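/- **Setting.** Let $\mathcal H$ be a complex Hilbert space and $\mathcal O\subseteq\mathbb C^n$ a domain with a base point $\alpha_0\in\mathcal O$. Let $\varrho(\alpha,\bar\alpha)$, $\alpha\in\mathcal O$, be density operators on $\mathcal H$, weakly continuously differentiable (i.e. $\mathrm{Tr}\,\varrho Z$ is $C^1$ on $\mathcal O$ for every bounded operator $Z$), with right logarithmic derivatives $h_k$, $\varrho h_k=\partial\varrho/\partial\bar\alpha^k$ (equivalently $h_k^*\varrho=\partial\varrho/\partial\alpha^k$), for which the Fisher information matrix $\mathsf H^{F}=[\mathrm{Tr}\,h_kh_l^*\varrho]$ is finite and nondegenerate. Let $\vartheta=(\vartheta_1,\dots,\vartheta_n):\mathcal O\to\mathbb C^n$ be $C^1$ and $\mathsf D=[\partial\vartheta_i/\partial\alpha^k]$. A quantum probability measure (QPM) is a normalized positive operator valued measure $M(d\lambda)$ on the Borel sets of $\mathbb C^n$; its results $\lambda$ have the law $\mathrm{Tr}\,\varrho M(d\lambda)$. They are *unbiased estimates* of $\vartheta$ if their mean is $\vartheta$ at every $\alpha\in\mathcal O$ and the error matrix $\mathsf R_M=\big[\int(\lambda_i-\vartheta_i)\overline{(\lambda_j-\vartheta_j)}\,\mathrm{Tr}\,\varrho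 M(d\lambda)\big]$ is finite and continuous on $\mathcal O$. The right quantum Cramér–Rao bound is $\mathsf R_M\ge \mathsf D(\mathsf H^{F})^{-1}\mathsf D^\dagger$. The estimates are *regular* if moreover $\mathsf R_M$ is nondegenerate on $\mathcal O$ and $\mathsf R_M^{-1}\mathsf D$ is differentiable with $$\frac{\partial}{\partial\alpha^i}(\mathsf R_M^{-1}\mathsf D)^j_k=\frac{\partial}{\partial\alpha^k}(\mathsf R_M^{-1}\mathsf D)^j_i,\qquad \frac{\partial}{\partial\bar\alpha^k}\,\mathsf R_M^{-1}\mathsf D=0 .$$ A *canonical system* consists of analytic functions $\beta=(\beta^1,\dots,\beta^n)$ on $\mathcal O$ with $\beta(\alpha_0)=0$ and nondegenerate Jacobian matrix, linearly independent, closed, densely defined operators $x_1,\dots,x_n$ in $\mathcal H$, a function $\chi$ and a QPM $\Pi(d\varkappa)$ on $\mathbb C^n$ such that, on $\mathcal O$, 1. $\varrho=\chi(\beta,\bar\beta)^{-1}e^{\beta^kx_k^*}\varrho_0\,e^{\bar\beta^kx_k}$ with $\varrho_0=\varrho(\alpha_0,\bar\alpha_0)$ and $\chi(\beta,\bar\beta)=\mathrm{Tr}\,\varrho_0e^{\bar\beta^kx_k}e^{\beta^kx_k^*}<\infty$.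 Here $e^{\beta^kx_k^*}\psi$ is the value at $t=1$ of a solution on $[0,1]$ of $\dot u=\beta^kx_k^*u$, $u(0)=\psi$; the operator $A_\beta=e^{\beta^kx_k^*}\varrho_0^{1/2}$ is everywhere defined and Hilbert–Schmidt, and $e^{\beta^kx_k^*}\varrho_0e^{\bar\beta^kx_k}$ means $A_\beta A_\beta^*$; 2. $x_k\Pi(d\varkappa)=\varkappa_k\Pi(d\varkappa)$ for all $k$ (that is, $x_k\Pi(B)=\int_B\varkappa_k\Pi(d\varkappa)$ for bounded Borel sets $B$); 3. $\ln\chi$ is differentiable at the points of $\beta(\mathcal O)$ and $\partial\ln\chi/\partial\bar\beta^k=\vartheta_k(\alpha,\bar\alpha)$ at $\beta=\beta(\alpha)$ for all $k$ and all $\alpha\in\mathcal O$. **Theorem.** (a) If the results of $M$ are regular estimates of $\vartheta$ and $\mathcal O$ is simply connected, then there are analytic functions $\beta^i$ on $\mathcal O$ with $\partial\beta^i/\partial\alpha^k=(\mathsf R_M^{-1}\mathsf D)^i_k$ and $\beta(\alpha_0)=0$. (b) Let the results of $M$ be regular estimates of $\vartheta$ and let $\beta$ be analytic functions on $\mathcal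 O$ (simply connected or not) with $\partial\beta^i/\partial\alpha^k=(\mathsf R_M^{-1}\mathsf D)^i_k$ and $\beta(\alpha_0)=0$. Then $\mathsf R_M=\mathsf D(\mathsf H^{F})^{-1}\mathsf D^\dagger$ on all of $\mathcal O$ if and only if there are $x_1,\dots,x_n,\chi,\Pi$ that form a canonical system together with $\beta$. (c) Let $\beta,x_1,\dots,x_n,\chi,\Pi$ be any canonical system. Then the results $\varkappa$ of $\Pi$ are regular estimates of $\vartheta$ with $\partial\beta^i/\partial\alpha^k=(\mathsf R_\Pi^{-1}\mathsf D)^i_k$; they attain the bound, $\mathsf R_\Pi=\mathsf D(\mathsf H^{F})^{-1}\mathsf D^\dagger$ on $\mathcal O$; their error matrix is the covariance matrix of the operators $x_k$, $$(\mathsf R_\Pi)_{ik}=\mathrm{Tr}\,\varrho\,(x_i-\vartheta_i)(x_k-\vartheta_k)^*;$$ and it is minimal: $\mathsf R_N\ge\mathsf R_\Pi$ on $\mathcal O$ for all unbiased estimates given by a QPM $N$. If $N$ also attains the bound on $\mathcal O$, then $\mathrm{Tr}\,\varrho N(d\varkappa)=\mathrm{Tr}\,\varrho\,\Pi(d\varkappa)$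 for all $\alpha\in\mathcal O$. -/

import Mathlib

open scoped ComplexConjugate ComplexOrder LinearPMap Matrix

noncomputable section

namespace QuantumCR

/-! ### Traces, Hilbert-Schmidt operators, density operators -/

section Trace

variable (H : Type*) [NormedAddCommGroup H] [InnerProductSpace ℂ H] [CompleteSpace H]

/-- Index set of a fixed orthonormal basis of the Hilbert space `H`. -/
def BasisIndex : Set H := Classical.choose (exists_hilbertBasis ℂ H)

/-- A fixed orthonormal (Hilbert) basis of `H`. The quantities below do not depend on it. -/
def onb : HilbertBasis (BasisIndex H) ℂ H :=
  Classical.choose (Classical.choose_spec (exists_hilbertBasis ℂ H))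

variable {H}

/-- The trace `Tr T = ∑ ⟨e, T e⟩` (meaningful for trace class operators, the only ones to which
it is applied). -/
def tr (T : H →L[ℂ] H) : ℂ := ∑' e, inner ℂ (onb H e) (T (onb H e))

/-- `T` is a Hilbert-Schmidt operator. -/
def IsHS (T : H →L[ℂ] H) : Prop := Summable fun e => ‖T (onb H e)‖ ^ 2

/-- The Hilbert-Schmidt inner product `Tr A* B`. -/
def hsInner (A B : H →L[ℂ] H) : ℂ := ∑' e, inner ℂ (A (onb H e)) (B (onb H e))

/-- Density operators: positive operators of trace one. -/
structure IsDensity (ρ : H →L[ℂ] H) : Prop where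
  nonneg : 0 ≤ ρ
  trace_one : HasSum (fun e => inner ℂ (onb H e) (ρ (onb H e))) 1

/-- `L` is a possibly unbounded operator, `A` and `S` are bounded: the product `L A` is everywhere
defined, is equal to `S`, and is Hilbert-Schmidt. -/
def HasHSProduct (L : H →ₗ.[ℂ] H) (A S : H →L[ℂ] H) : Prop :=
  (∀ ψ, ∃ h : A ψ ∈ L.domain, L ⟨A ψ, h⟩ = S ψ) ∧ IsHS S

end Trace

/-! ### Quantum probability measures -/

/-- A quantum probability measure (positive operator valued measure, quasimeasurement): a
normalized (weakly) countably additive map from the measurable sets to the positive operators. -/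
structure QPM (X : Type*) [MeasurableSpace X]
    (H : Type*) [NormedAddCommGroup H] [InnerProductSpace ℂ H] [CompleteSpace H] where
  /-- the operator of the event `B` -/
  op : Set X → H →L[ℂ] H
  nonneg : ∀ B, MeasurableSet B → 0 ≤ op B
  op_univ : op Set.univ = 1
  hasSum : ∀ f : ℕ → Set X, (∀ i, MeasurableSet (f i)) → Pairwise (Function.onFun Disjoint f) →
    ∀ ψ : H, HasSum (fun i => inner ℂ ψ (op (f i) ψ)) (inner ℂ ψ (op (⋃ i, f i) ψ))

namespace QPM

variable {X : Type*} [MeasurableSpace X]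
  {H : Type*} [NormedAddCommGroup H] [InnerProductSpace ℂ H] [CompleteSpace H]

theorem re_inner_nonneg (P : QPM X H) {B : Set X} (hB : MeasurableSet B) (ψ : H) :
    0 ≤ (inner ℂ ψ (P.op B ψ)).re := by
  have h := (ContinuousLinearMap.nonneg_iff_isPositive _).1 (P.nonneg B hB)
  exact h.re_inner_nonneg_right ψ

theorem inner_empty (P : QPM X H) (ψ : H) : inner ℂ ψ (P.op ∅ ψ) = 0 := by
  have h := P.hasSum (fun _ => ∅) (fun _ => MeasurableSet.empty)
    (fun i j _ => by simp [Function.onFun]) ψ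
  have h0 := h.summable.tendsto_atTop_zero
  exact tendsto_nhds_unique tendsto_const_nhds h0

/-- The measure `B ↦ ⟨ψ, Π(B) ψ⟩`. -/
def diag (P : QPM X H) (ψ : H) : MeasureTheory.Measure X :=
  MeasureTheory.Measure.ofMeasurable
    (fun B _ => ENNReal.ofReal (inner ℂ ψ (P.op B ψ)).re)
    (by simp [P.inner_empty ψ])
    (by
      intro f hf hd
      have h := P.hasSum f hf hd ψ
      have hre : HasSum (fun i => (inner ℂ ψ (P.op (f i) ψ)).re)
          (inner ℂ ψ (P.op (⋃ i, f i) ψ)).re := Complex.hasSum_re h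
      rw [← hre.tsum_eq]
      exact ENNReal.ofReal_tsum_of_nonneg (fun i => P.re_inner_nonneg (hf i) ψ) hre.summable)

/-- The probability distribution `B ↦ Tr ρ Π(B)` of the result in the state `ρ`, written in the
form `Tr ρ^{1/2} Π(B) ρ^{1/2} = ∑ ⟨ρ^{1/2} e, Π(B) ρ^{1/2} e⟩`. -/
def law (P : QPM X H) (ρ : H →L[ℂ] H) : MeasureTheory.Measure X :=
  MeasureTheory.Measure.sum fun e => P.diag (CFC.sqrt ρ (onb H e))

/-- `x_k Π(dκ) = κ_k Π(dκ)` for all `k`: for every bounded Borel set `B`, the operator `x_k` is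
defined on the range of `Π(B)` and `x_k Π(B) = ∫_B κ_k Π(dκ)`. The two sides are everywhere defined
linear operators, and their equality is expressed through their quadratic forms. -/
def IsRightEigen {n : ℕ} (P : QPM (Fin n → ℂ) H) (x : Fin n → H →ₗ.[ℂ] H) : Prop :=
  ∀ k, ∀ B : Set (Fin n → ℂ), MeasurableSet B → Bornology.IsBounded B → ∀ ψ : H,
    ∃ h : P.op B ψ ∈ (x k).domain,
      inner ℂ ψ (x k ⟨P.op B ψ, h⟩) = ∫ κ in B, κ k ∂(P.diag ψ)

end QPM

/-! ### Complex derivatives -/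

/-- The derivative `∂f/∂α^k = (∂/∂Re α^k - i ∂/∂Im α^k) f / 2`. -/
def dz {n : ℕ} (f : (Fin n → ℂ) → ℂ) (k : Fin n) (a : Fin n → ℂ) : ℂ :=
  (1 / 2) * (fderiv ℝ f a (Pi.single k 1) - Complex.I * fderiv ℝ f a (Pi.single k Complex.I))

/-- The derivative `∂f/∂ᾱ^k = (∂/∂Re α^k + i ∂/∂Im α^k) f / 2`. -/
def dzbar {n : ℕ} (f : (Fin n → ℂ) → ℂ) (k : Fin n) (a : Fin n → ℂ) : ℂ :=
  (1 / 2) * (fderiv ℝ f a (Pi.single k 1) + Complex.I * fderiv ℝ f a (Pi.single k Complex.I))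

/-- The matrix `∂f_i/∂α^k`. -/
def jac {n : ℕ} (f : (Fin n → ℂ) → Fin n → ℂ) (a : Fin n → ℂ) : Matrix (Fin n) (Fin n) ℂ :=
  Matrix.of fun i k => dz (fun b => f b i) k a

/-! ### Statistical models, the right bound, estimators -/

section Model

variable {H : Type*} [NormedAddCommGroup H] [InnerProductSpace ℂ H] [CompleteSpace H] {n : ℕ}

/-- The operators `g k = h_k*` are the left logarithmic derivatives at `a` of the family `ρ`, i.e.
`h_k* ρ = ∂ρ/∂α^k` (equivalently `ρ h_k = ∂ρ/∂ᾱ^k`), with finite second moments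
`Tr h_k h_k* ρ`; `S k` stands for the Hilbert-Schmidt operator `h_k* ρ^{1/2}`. The equation between
trace class operators is understood weakly, against all bounded operators. -/
def IsLogDeriv (ρ : (Fin n → ℂ) → H →L[ℂ] H) (a : Fin n → ℂ)
    (g : Fin n → H →ₗ.[ℂ] H) (S : Fin n → H →L[ℂ] H) : Prop :=
  ∀ k, HasHSProduct (g k) (CFC.sqrt (ρ a)) (S k) ∧
    ∀ Z : H →L[ℂ] H, dz (fun b => tr (ρ b ∘L Z)) k a = tr (S k ∘L CFC.sqrt (ρ a) ∘L Z)

/-- A statistical model on the set `O` of parameters: density operators `ρ(α)` that are (weakly)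
continuously differentiable on `O`, with right logarithmic derivatives `h_k(α)`, `g α k = h_k(α)*`,
and `S α k = h_k(α)* ρ(α)^{1/2}`. -/
structure IsModel (O : Set (Fin n → ℂ)) (ρ : (Fin n → ℂ) → H →L[ℂ] H)
    (g : (Fin n → ℂ) → Fin n → H →ₗ.[ℂ] H) (S : (Fin n → ℂ) → Fin n → H →L[ℂ] H) : Prop where
  density : ∀ a ∈ O, IsDensity (ρ a)
  smooth : ∀ Z : H →L[ℂ] H, ContDiffOn ℝ 1 (fun a => tr (ρ a ∘L Z)) O
  logDeriv : ∀ a ∈ O, IsLogDeriv ρ a (g a) (S a)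

/-- The right Fisher information `H_kl = Tr h_k h_l* ρ`, where `S k = h_k* ρ^{1/2}`. -/
def fisher (S : Fin n → H →L[ℂ] H) : Matrix (Fin n) (Fin n) ℂ :=
  Matrix.of fun k l => hsInner (S k) (S l)

/-- The right lower bound `D H⁻¹ D†` at `a`, with `D = [∂ϑ_i/∂α^k]`. -/
def rightBound (S : (Fin n → ℂ) → Fin n → H →L[ℂ] H) (ϑ : (Fin n → ℂ) → Fin n → ℂ)
    (a : Fin n → ℂ) : Matrix (Fin n) (Fin n) ℂ :=
  jac ϑ a * (fisher (S a))⁻¹ * (jac ϑ a)ᴴ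

/-- The matrix `R_ij = M[(λ_i - ϑ_i) conj(λ_j - ϑ_j)]` of mean quadratic errors at `a` of the
estimates `λ_i` that are the results of the measurement `M`. -/
def errMatrix (M : QPM (Fin n → ℂ) H) (ρ : (Fin n → ℂ) → H →L[ℂ] H)
    (ϑ : (Fin n → ℂ) → Fin n → ℂ) (a : Fin n → ℂ) : Matrix (Fin n) (Fin n) ℂ :=
  Matrix.of fun i j => ∫ l, (l i - ϑ a i) * conj (l j - ϑ a j) ∂(M.law (ρ a))

/-- The results of the measurement `M` are unbiased estimates of `ϑ` on `O`, with finite and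
continuous mean quadratic errors. -/
structure IsUnbiased (O : Set (Fin n → ℂ)) (ρ : (Fin n → ℂ) → H →L[ℂ] H)
    (ϑ : (Fin n → ℂ) → Fin n → ℂ) (M : QPM (Fin n → ℂ) H) : Prop where
  finite : ∀ a ∈ O, ∀ i, MeasureTheory.MemLp (fun l : Fin n → ℂ => l i) 2 (M.law (ρ a))
  mean : ∀ a ∈ O, ∀ i, ∫ l, l i ∂(M.law (ρ a)) = ϑ a i
  continuous : ∀ i j, ContinuousOn (fun a => errMatrix M ρ ϑ a i j) O

/-- The matrix `R⁻¹ D`. -/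
def invErrJac (M : QPM (Fin n → ℂ) H) (ρ : (Fin n → ℂ) → H →L[ℂ] H)
    (ϑ : (Fin n → ℂ) → Fin n → ℂ) (a : Fin n → ℂ) : Matrix (Fin n) (Fin n) ℂ :=
  (errMatrix M ρ ϑ a)⁻¹ * jac ϑ a

/-- Unbiased estimates that satisfy the regularity conditions: `R` is nondegenerate, and `R⁻¹ D` is
differentiable, curl-free, and independent of `ᾱ`. -/
structure IsRegularEstimate (O : Set (Fin n → ℂ)) (ρ : (Fin n → ℂ) → H →L[ℂ] H)
    (ϑ : (Fin n → ℂ) → Fin n → ℂ) (M : QPM (Fin n → ℂ) H) : Prop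
    extends IsUnbiased O ρ ϑ M where
  nondegenerate : ∀ a ∈ O, IsUnit (errMatrix M ρ ϑ a)
  differentiable : ∀ j k, DifferentiableOn ℝ (fun a => invErrJac M ρ ϑ a j k) O
  curl_free : ∀ a ∈ O, ∀ i j k,
    dz (fun b => invErrJac M ρ ϑ b j k) i a = dz (fun b => invErrJac M ρ ϑ b j i) k a
  analytic : ∀ a ∈ O, ∀ i j k, dzbar (fun b => invErrJac M ρ ϑ b i j) k a = 0

/-- `M` is right efficient on `O`: the right lower bound is attained at all points of `O`. -/
def AttainsRightBound (O : Set (Fin n → ℂ)) (ρ : (Fin n → ℂ) → H →L[ℂ] H)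
    (S : (Fin n → ℂ) → Fin n → H →L[ℂ] H) (ϑ : (Fin n → ℂ) → Fin n → ℂ)
    (M : QPM (Fin n → ℂ) H) : Prop :=
  ∀ a ∈ O, errMatrix M ρ ϑ a = rightBound S ϑ a

/-! ### Canonical families -/

/-- `φ = e^{y} ψ` for the operator `y = ∑ b^k x_k*` with domain `⋂ D(x_k*)`: the Cauchy problem
`u' = y u`, `u(0) = ψ` has a solution on `[0, 1]` with `u(1) = φ`. (For bounded `x_k` this is the
usual exponential.) -/
def IsExpAdj (x : Fin n → H →ₗ.[ℂ] H) (b : Fin n → ℂ) (ψ φ : H) : Prop :=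
  ∃ u : ℝ → H, u 0 = ψ ∧ u 1 = φ ∧ ∀ t ∈ Set.Icc (0 : ℝ) 1,
    ∃ h : ∀ k, u t ∈ ((x k)†).domain,
      HasDerivWithinAt u (∑ k, b k • (x k)† ⟨u t, h k⟩) (Set.Icc (0 : ℝ) 1) t

/-- The `x_k` are densely defined closed operators, linearly independent on their common domain. -/
structure IsAdmissible (x : Fin n → H →ₗ.[ℂ] H) : Prop where
  dense : ∀ k, Dense ((x k).domain : Set H)
  closed : ∀ k, (x k).IsClosed
  linearIndependent : ∀ c : Fin n → ℂ,
    (∀ (ψ : H) (h : ∀ k, ψ ∈ (x k).domain), ∑ k, c k • x k ⟨ψ, h k⟩ = 0) → c = 0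

/-- `β` is a system of analytic local coordinates on `O` that vanishes at `a₀`. -/
structure IsAnalyticCoord (O : Set (Fin n → ℂ)) (a₀ : Fin n → ℂ)
    (β : (Fin n → ℂ) → Fin n → ℂ) : Prop where
  analytic : DifferentiableOn ℂ β O
  base : β a₀ = 0
  nondegenerate : ∀ a ∈ O, IsUnit (jac β a)

/-- The family `ρ` has on `O` the canonical form
`ρ = χ(β, β̄)⁻¹ e^{β^k x_k*} ρ₀ e^{β̄^k x_k}` with `ρ₀ = ρ(a₀)`, `β = β(α)` and the generating function
`χ(β, β̄) = Tr ρ₀ e^{β̄^k x_k} e^{β^k x_k*}`. Here `A b = e^{b^k x_k*} ρ₀^{1/2}` is an everywhere defined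
Hilbert-Schmidt operator and `e^{b^k x_k*} ρ₀ e^{b̄^k x_k} = A b (A b)*`. -/
def IsCanonical (O : Set (Fin n → ℂ)) (a₀ : Fin n → ℂ) (ρ : (Fin n → ℂ) → H →L[ℂ] H)
    (x : Fin n → H →ₗ.[ℂ] H) (β : (Fin n → ℂ) → Fin n → ℂ) (χ : (Fin n → ℂ) → ℝ) : Prop :=
  ∃ A : (Fin n → ℂ) → H →L[ℂ] H,
    (∀ b ∈ β '' O, (∀ ψ, IsExpAdj x b (CFC.sqrt (ρ a₀) ψ) (A b ψ)) ∧
      HasSum (fun e => ‖A b (onb H e)‖ ^ 2) (χ b)) ∧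
    ∀ a ∈ O, ρ a = ((χ (β a))⁻¹ : ℂ) • (A (β a) ∘L ContinuousLinearMap.adjoint (A (β a)))

/-- The equations `∂ ln χ(β, β̄)/∂β̄^k = ϑ_k(α, ᾱ)` at `β = β(α)`, `α ∈ O`. -/
def CanonicalParameters (O : Set (Fin n → ℂ)) (ϑ : (Fin n → ℂ) → Fin n → ℂ)
    (β : (Fin n → ℂ) → Fin n → ℂ) (χ : (Fin n → ℂ) → ℝ) : Prop :=
  ∀ a ∈ O, DifferentiableAt ℝ (fun b => (Real.log (χ b) : ℂ)) (β a) ∧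
    ∀ k, dzbar (fun b => (Real.log (χ b) : ℂ)) k (β a) = ϑ a k

/-- The three conditions of efficiency: `x`, `β`, `χ` put the family in canonical form, `P` is a
joint right eigen QPM of the `x_k`, and `∂ ln χ/∂β̄^k = ϑ_k`. -/
structure IsCanonicalSystem (O : Set (Fin n → ℂ)) (a₀ : Fin n → ℂ) (ρ : (Fin n → ℂ) → H →L[ℂ] H)
    (ϑ : (Fin n → ℂ) → Fin n → ℂ) (β : (Fin n → ℂ) → Fin n → ℂ)
    (x : Fin n → H →ₗ.[ℂ] H) (χ : (Fin n → ℂ) → ℝ) (P : QPM (Fin n → ℂ) H) : Prop where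
  coord : IsAnalyticCoord O a₀ β
  admissible : IsAdmissible x
  canonical : IsCanonical O a₀ ρ x β χ
  rightEigen : P.IsRightEigen x
  parameters : CanonicalParameters O ϑ β χ

/-- The covariance matrix `H_ik = Tr ρ (x_i - m_i) (x_k - m_k)*` is defined (all second moments
`Tr ρ x_k x_k*` are finite) and equal to `C`; here `T k = x_k* ρ^{1/2}`. -/
def HasCovariance (ρ : H →L[ℂ] H) (x : Fin n → H →ₗ.[ℂ] H) (m : Fin n → ℂ)
    (C : Matrix (Fin n) (Fin n) ℂ) : Prop :=
  ∃ T : Fin n → H →L[ℂ] H, (∀ k, HasHSProduct ((x k)†) (CFC.sqrt ρ) (T k)) ∧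
    C = Matrix.of fun i k =>
      hsInner (T i - conj (m i) • CFC.sqrt ρ) (T k - conj (m k) • CFC.sqrt ρ)

end Model

end QuantumCR

end

open QuantumCR

/-! Everything happens in a minimal Naimark dilation `(Q, V)` of the measurement, where `Q` is
projection valued and the results `κ` become a commuting family. The products `f(Q) V ρ^{1/2}` with
`f` square integrable for the law `Tr ρ M(dκ)` form an isometric copy of that `L²` space inside the
Hilbert-Schmidt operators (`IsDilation.exists_isMul`, `IsDilation.hsIn_of_isMul`). There `R` is the
Gram matrix of the residuals `conj (κ_j - ϑ_j) V ρ^{1/2}`, the Fisher matrix is the Gram matrix of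
the scores `V h_k* ρ^{1/2}`, and differentiation of the unbiasedness relation identifies `D` with
the mixed Gram matrix (`IsUnbiased.jac_eq`). Projecting the residuals onto the span of the scores
gives the right Cramér-Rao inequality. When `R` is nondegenerate, equality forces each score to be
the combination of the residuals with coefficients `(R⁻¹ D)_{jk}`; this is the score condition
`IsScore`.

If `R⁻¹ D` is the Jacobian of an analytic `β`, the score condition is a linear differential equation
for `ρ`. Conjugated by truncations of `exp (-β κ*)`, where `β κ* = ∑ β^j conj κ_j`, the state
changes only by a scalar factor, so uniqueness on the connected set `O` gives `ρ = c e^{β κ*} ρ₀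
e^{β̄ κ}` in the dilation (`exists_expForm`). Conversely this form can be differentiated; because
the score is complex linear in the direction, the holomorphic and antiholomorphic parts separate and
the score condition returns (`isScore_of_isExpForm`). In this situation the laws are the tilts
`|e^{β κ*}|²` of the law at `α₀`, and `β(O)` is an open set on which the Laplace integral is finite.
Hence the error matrix is continuous, and with `J` the Jacobian of `β` the Fisher matrix is `J† R J`
and `D = R J`, so that the bound is attained (`efficient_of_isScore`).

From a canonical system to the exponential form: by minimality of the dilation, the relation `x_k Π
= κ_k Π` dualizes to `V x_k* φ = conj κ_k V φ` up to truncation, hence solutions of the Cauchy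
problem are carried by `V` to `e^{β κ*} V ψ` (`cut_adjoint_apply`, `IsExpAdj.cut_eq`). The equation
for `ln χ` is exactly the differential equation of the normalizing factor.

From an efficient measurement to a canonical system: the operators `e^{b κ*} V ρ₀^{1/2}` depend
holomorphically on `b`. For `b` near zero the exponential form shows that their ranges lie in the
range of `V`, and the identity theorem extends this to the whole interior of the Laplace domain. Let
`W` be the closed span of the corresponding vectors of `H`. Multiplication by `conj κ_k`, compressed
to `W` and extended by zero on the complement, is densely defined because `b`-derivatives of the
orbit stay in `W`; its adjoint is taken as `x_k`. The measurement `Π` is `M` compressed to `W`, plus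
a point mass at zero on the complement.

A second efficient measurement has the same `R`, hence the same `β` and the same normalizer; its law
at `α₀` has the same Laplace transform near zero and therefore is the same, and so are all the
tilts. Part (a) is the exactness of closed holomorphic forms on simply connected domains, obtained
by lifting the identity to the covering of germs of primitives. -/

noncomputable section

set_option linter.unusedSectionVars false

namespace QuantumCR

open MeasureTheory Filter
open scoped Topology ENNReal

section


/-! ### Bounded measurable functions -/

section BddMeas

variable {X : Type*} [MeasurableSpace X]

/-- Bounded measurable complex functions. -/
def BddMeas (f : X → ℂ) : Prop := Measurable f ∧ ∃ C, ∀ x, ‖f x‖ ≤ C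

theorem BddMeas.indicator_const {B : Set X} (hB : MeasurableSet B) (c : ℂ) :
    BddMeas (B.indicator fun _ => c) := by
  refine ⟨measurable_const.indicator hB, ‖c‖, fun x => ?_⟩
  exact norm_indicator_le_norm_self (s := B) (fun _ => c) x

theorem BddMeas.const (c : ℂ) : BddMeas (fun _ : X => c) := ⟨measurable_const, ‖c‖, fun _ => le_rfl⟩

theorem BddMeas.add {f g : X → ℂ} (hf : BddMeas f) (hg : BddMeas g) : BddMeas (f + g) := by
  obtain ⟨hf, C, hC⟩ := hf
  obtain ⟨hg, D, hD⟩ := hg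
  exact ⟨hf.add hg, C + D, fun x => (norm_add_le _ _).trans (add_le_add (hC x) (hD x))⟩

theorem BddMeas.mul {f g : X → ℂ} (hf : BddMeas f) (hg : BddMeas g) : BddMeas (f * g) := by
  obtain ⟨hf, C, hC⟩ := hf
  obtain ⟨hg, D, hD⟩ := hg
  refine ⟨hf.mul hg, C * D, fun x => ?_⟩
  rw [Pi.mul_apply, norm_mul]
  exact mul_le_mul (hC x) (hD x) (norm_nonneg _) ((norm_nonneg _).trans (hC x))

theorem BddMeas.const_smul {f : X → ℂ} (hf : BddMeas f) (c : ℂ) : BddMeas (c • f) := by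
  have := (BddMeas.const (X := X) c).mul hf
  exact this

theorem BddMeas.conj {f : X → ℂ} (hf : BddMeas f) : BddMeas (fun x => conj (f x)) := by
  obtain ⟨hf, C, hC⟩ := hf
  exact ⟨Complex.continuous_conj.measurable.comp hf, C, fun x => by simpa using hC x⟩

theorem BddMeas.integrable {f : X → ℂ} (hf : BddMeas f) (μ : Measure X) [IsFiniteMeasure μ] :
    Integrable f μ := by
  obtain ⟨hf, C, hC⟩ := hf
  exact Integrable.of_bound hf.aestronglyMeasurable C (Eventually.of_forall hC)

/-- Simple functions are sums of indicators, and a bounded measurable function is a uniformly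
bounded pointwise limit of simple functions. All algebraic identities for `∫ f dP` are reduced in
this way to sets. -/
theorem BddMeas.induction {p : ∀ f : X → ℂ, BddMeas f → Prop}
    (hind : ∀ B (hB : MeasurableSet B) c,
      p (B.indicator fun _ => c) (BddMeas.indicator_const hB c))
    (hadd : ∀ f g (hf : BddMeas f) (hg : BddMeas g), p f hf → p g hg → p (f + g) (hf.add hg))
    (hlim : ∀ (F : ℕ → X → ℂ) (f : X → ℂ) (C : ℝ) (hF : ∀ n, BddMeas (F n)) (hf : BddMeas f),
      (∀ n x, ‖F n x‖ ≤ C) →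
      (∀ x, Tendsto (fun n => F n x) atTop (𝓝 (f x))) → (∀ n, p (F n) (hF n)) → p f hf)
    {f : X → ℂ} (hf : BddMeas f) : p f hf := by
  have hs : ∀ g : SimpleFunc X ℂ, ∃ hg : BddMeas g, p g hg := by
    classical
    intro g
    induction g using SimpleFunc.induction with
    | const c hs =>
      rename_i B
      have : ⇑(SimpleFunc.piecewise B hs (SimpleFunc.const X c) (SimpleFunc.const X 0)) =
          B.indicator fun _ => c := by
        ext x
        by_cases hx : x ∈ B <;> simp [hx]
      rw [this]
      exact ⟨BddMeas.indicator_const hs c, hind B hs c⟩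
    | add _ hf hg => exact ⟨hf.1.add hg.1, hadd _ _ hf.1 hg.1 hf.2 hg.2⟩
  obtain ⟨hf', C, hC⟩ := id hf
  -- On an empty space the given bound may be negative, so it is replaced by its positive part.
  have hC0 : ∀ x, ‖f x‖ ≤ max C 0 := fun x => (hC x).trans (le_max_left _ _)
  exact hlim (fun n => hf'.stronglyMeasurable.approxBounded (max C 0) n) f (max C 0)
    (fun n => (hs _).1) hf
    (fun n x => StronglyMeasurable.norm_approxBounded_le _ (le_max_right _ _) n x)
    (fun x => StronglyMeasurable.tendsto_approxBounded_of_norm_le _ (hC0 x)) (fun n => (hs _).2)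

end BddMeas

/-! ### Operators defined by quadratic forms and integrals -/

section

variable {H : Type*} [NormedAddCommGroup H] [InnerProductSpace ℂ H]

theorem clm_ext_quad {S T : H →L[ℂ] H} (h : ∀ ψ, inner ℂ ψ (S ψ) = inner ℂ ψ (T ψ)) : S = T := by
  have := (ext_inner_map (S : H →ₗ[ℂ] H) (T : H →ₗ[ℂ] H)).1 (fun x => by
    rw [← inner_conj_symm, ← inner_conj_symm (𝕜 := ℂ) _ x]
    exact congrArg conj (h x))
  ext x
  exact LinearMap.congr_fun this x

/-- Only the diagonal measures of a QPM are available at the start; this identity dictates the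
definition of `form`. -/
theorem inner_polarization (T : H →L[ℂ] H) (ψ φ : H) :
    (1 / 4 : ℂ) * (inner ℂ (φ + ψ) (T (φ + ψ)) + Complex.I * inner ℂ (φ + Complex.I • ψ)
      (T (φ + Complex.I • ψ)) - inner ℂ (φ - ψ) (T (φ - ψ)) - Complex.I *
      inner ℂ (φ - Complex.I • ψ) (T (φ - Complex.I • ψ))) = inner ℂ ψ (T φ) := by
  simp only [map_add, map_sub, map_smul, inner_add_left, inner_add_right, inner_sub_left,
    inner_sub_right, inner_smul_left, inner_smul_right, Complex.conj_I]
  ring_nf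
  simp only [Complex.I_sq]
  ring

end

namespace QPM

variable {X : Type*} [MeasurableSpace X]
  {H : Type*} [NormedAddCommGroup H] [InnerProductSpace ℂ H] [CompleteSpace H]

theorem op_empty (P : QPM X H) : P.op ∅ = 0 :=
  clm_ext_quad fun ψ => by simpa using P.inner_empty ψ

theorem op_union (P : QPM X H) {A B : Set X} (hA : MeasurableSet A) (hB : MeasurableSet B)
    (hAB : Disjoint A B) : P.op (A ∪ B) = P.op A + P.op B := by
  refine clm_ext_quad fun ψ => ?_
  -- Additivity is postulated for sequences only, so the pair is continued by empty sets.
  set f : ℕ → Set X := fun i => if i = 0 then A else if i = 1 then B else ∅ with hf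
  have hU : ⋃ i, f i = A ∪ B := by
    ext x
    simp only [Set.mem_iUnion, Set.mem_union, hf]
    constructor
    · rintro ⟨i, hi⟩
      split_ifs at hi
      · exact Or.inl hi
      · exact Or.inr hi
      · exact hi.elim
    · rintro (h | h)
      · exact ⟨0, by simpa using h⟩
      · exact ⟨1, by simpa using h⟩
  have h := P.hasSum f (fun i => by simp only [hf]; split_ifs <;> simp [hA, hB])
    (fun i j hij => by
      simp only [Function.onFun, hf]
      split_ifs <;> simp_all [hAB.symm]) ψ
  rw [hU] at h
  have h2 := hasSum_sum_of_ne_finset_zero (L := .unconditional ℕ) (f := fun i => inner ℂ ψ (P.op (f i) ψ))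
    (s := {0, 1}) (fun i hi => by
      have h0 : i ≠ 0 := fun h => hi (by simp [h])
      have h1 : i ≠ 1 := fun h => hi (by simp [h])
      simp [hf, h0, h1, P.inner_empty])
  rw [h.unique h2]
  simp [hf]

theorem op_biUnion_finset (P : QPM X H) {ι : Type*} (s : Finset ι) (A : ι → Set X)
    (hA : ∀ i ∈ s, MeasurableSet (A i)) (hd : (s : Set ι).PairwiseDisjoint A) :
    P.op (⋃ i ∈ s, A i) = ∑ i ∈ s, P.op (A i) := by
  classical
  induction s using Finset.induction_on with
  | empty => simp [op_empty]
  | insert a s ha ih =>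
    rw [Finset.set_biUnion_insert, Finset.sum_insert ha, op_union, ih]
    · exact fun i hi => hA i (Finset.mem_insert_of_mem hi)
    · exact hd.subset (by simp)
    · exact hA a (Finset.mem_insert_self _ _)
    · exact Finset.measurableSet_biUnion _ fun i hi => hA i (Finset.mem_insert_of_mem hi)
    · rw [Set.disjoint_iUnion₂_right]
      intro i hi
      exact hd (by simp) (by simp [hi]) (fun h => ha (h ▸ hi))

theorem isPositive (P : QPM X H) {B : Set X} (hB : MeasurableSet B) : (P.op B).IsPositive :=
  (ContinuousLinearMap.nonneg_iff_isPositive _).1 (P.nonneg B hB)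

theorem diag_apply (P : QPM X H) (ψ : H) {B : Set X} (hB : MeasurableSet B) :
    P.diag ψ B = ENNReal.ofReal (inner ℂ ψ (P.op B ψ)).re :=
  Measure.ofMeasurable_apply B hB

instance (P : QPM X H) (ψ : H) : IsFiniteMeasure (P.diag ψ) :=
  ⟨by rw [P.diag_apply ψ MeasurableSet.univ]; exact ENNReal.ofReal_lt_top⟩

theorem diag_real (P : QPM X H) (ψ : H) {B : Set X} (hB : MeasurableSet B) :
    (((P.diag ψ).real B : ℝ) : ℂ) = inner ℂ ψ (P.op B ψ) := by
  rw [Measure.real, P.diag_apply ψ hB, ENNReal.toReal_ofReal (P.re_inner_nonneg hB ψ)]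
  have h := (P.isPositive hB).inner_nonneg_right ψ
  exact (Complex.ext (by simp) (by simpa using (Complex.nonneg_iff.1 h).2))

theorem diag_univ (P : QPM X H) (ψ : H) : (P.diag ψ).real Set.univ = ‖ψ‖ ^ 2 := by
  have := P.diag_real ψ MeasurableSet.univ
  rw [P.op_univ, one_apply_eq_self, inner_self_eq_norm_sq_to_K] at this
  exact Complex.ofReal_injective (this.trans (by norm_cast))

/-- The sesquilinear form of the operator `∫ f dP`. -/
def form (P : QPM X H) (f : X → ℂ) (ψ φ : H) : ℂ :=
  (1 / 4 : ℂ) * (∫ x, f x ∂P.diag (φ + ψ) + Complex.I * ∫ x, f x ∂P.diag (φ + Complex.I • ψ)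
    - ∫ x, f x ∂P.diag (φ - ψ) - Complex.I * ∫ x, f x ∂P.diag (φ - Complex.I • ψ))

theorem integral_indicator_const_diag (P : QPM X H) {B : Set X} (hB : MeasurableSet B) (c : ℂ)
    (ψ : H) : ∫ x, B.indicator (fun _ => c) x ∂P.diag ψ = c * inner ℂ ψ (P.op B ψ) := by
  rw [integral_indicator hB, setIntegral_const, ← P.diag_real ψ hB, Complex.real_smul, mul_comm]

theorem form_indicator (P : QPM X H) {B : Set X} (hB : MeasurableSet B) (c : ℂ) (ψ φ : H) :
    P.form (B.indicator fun _ => c) ψ φ = c * inner ℂ ψ (P.op B φ) := by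
  rw [form, ← inner_polarization (P.op B) ψ φ]
  simp only [integral_indicator_const_diag P hB]
  ring

theorem form_add_fun (P : QPM X H) {f g : X → ℂ} (hf : BddMeas f) (hg : BddMeas g) (ψ φ : H) :
    P.form (f + g) ψ φ = P.form f ψ φ + P.form g ψ φ := by
  simp only [form, Pi.add_apply]
  rw [integral_add (hf.integrable _) (hg.integrable _),
    integral_add (hf.integrable _) (hg.integrable _),
    integral_add (hf.integrable _) (hg.integrable _),
    integral_add (hf.integrable _) (hg.integrable _)]
  ring

theorem integral_tendsto_of_bdd (μ : Measure X) [IsFiniteMeasure μ] {F : ℕ → X → ℂ} {f : X → ℂ}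
    {C : ℝ} (hF : ∀ n, BddMeas (F n)) (hC : ∀ n x, ‖F n x‖ ≤ C)
    (hl : ∀ x, Tendsto (fun n => F n x) atTop (𝓝 (f x))) :
    Tendsto (fun n => ∫ x, F n x ∂μ) atTop (𝓝 (∫ x, f x ∂μ)) :=
  tendsto_integral_of_dominated_convergence (fun _ => C) (fun n => (hF n).1.aestronglyMeasurable)
    (integrable_const C) (fun n => Eventually.of_forall (hC n)) (Eventually.of_forall hl)

theorem form_tendsto (P : QPM X H) {F : ℕ → X → ℂ} {f : X → ℂ} {C : ℝ} (hF : ∀ n, BddMeas (F n))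
    (hC : ∀ n x, ‖F n x‖ ≤ C) (hl : ∀ x, Tendsto (fun n => F n x) atTop (𝓝 (f x))) (ψ φ : H) :
    Tendsto (fun n => P.form (F n) ψ φ) atTop (𝓝 (P.form f ψ φ)) := by
  have h := fun ξ : H => integral_tendsto_of_bdd (P.diag ξ) hF hC hl
  exact ((((h _).add ((h _).const_mul _)).sub (h _)).sub ((h _).const_mul _)).const_mul _

/-- Linearity is not visible in the polarized integrals. It holds for indicators because `P.op B` is
linear, and survives sums and bounded limits. -/
theorem form_add_right (P : QPM X H) {f : X → ℂ} (hf : BddMeas f) (ψ φ φ' : H) :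
    P.form f ψ (φ + φ') = P.form f ψ φ + P.form f ψ φ' := by
  induction hf using BddMeas.induction with
  | hind B hB c => simp only [form_indicator P hB, map_add, inner_add_right]; ring
  | hadd f g hf hg h1 h2 => simp only [form_add_fun P hf hg, h1, h2]; ring
  | hlim F f C hF hf hC hl h =>
    refine tendsto_nhds_unique (P.form_tendsto hF hC hl _ _) ?_
    simp only [h]
    exact (P.form_tendsto hF hC hl _ _).add (P.form_tendsto hF hC hl _ _)

theorem form_smul_right (P : QPM X H) {f : X → ℂ} (hf : BddMeas f) (ψ φ : H) (a : ℂ) :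
    P.form f ψ (a • φ) = a * P.form f ψ φ := by
  induction hf using BddMeas.induction with
  | hind B hB c => simp only [form_indicator P hB, map_smul, inner_smul_right]; ring
  | hadd f g hf hg h1 h2 => simp only [form_add_fun P hf hg, h1, h2]; ring
  | hlim F f C hF hf hC hl h =>
    refine tendsto_nhds_unique (P.form_tendsto hF hC hl _ _) ?_
    simp only [h]
    exact (P.form_tendsto hF hC hl _ _).const_mul _

theorem form_conj (P : QPM X H) {f : X → ℂ} (hf : BddMeas f) (ψ φ : H) :
    P.form (fun x => conj (f x)) ψ φ = conj (P.form f φ ψ) := by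
  induction hf using BddMeas.induction with
  | hind B hB c =>
    have : (fun x => conj (B.indicator (fun _ => c) x)) = B.indicator fun _ => conj c := by
      ext x; by_cases hx : x ∈ B <;> simp [hx]
    rw [this]
    simp only [form_indicator P hB, map_mul, inner_conj_symm]
    exact congrArg _ ((P.isPositive hB).isSelfAdjoint.isSymmetric ψ φ).symm
  | hadd f g hf hg h1 h2 =>
    have : (fun x => conj ((f + g) x)) = (fun x => conj (f x)) + fun x => conj (g x) := by
      ext x; simp
    rw [this, form_add_fun P hf.conj hg.conj, form_add_fun P hf hg, h1, h2, map_add]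
  | hlim F f C hF hf hC hl h =>
    refine tendsto_nhds_unique (P.form_tendsto (F := fun n x => conj (F n x)) (C := C)
      (fun n => (hF n).conj) (by simpa using hC)
      (fun x => (Complex.continuous_conj.tendsto _).comp (hl x)) _ _) ?_
    simp only [h]
    exact (Complex.continuous_conj.tendsto _).comp (P.form_tendsto hF hC hl _ _)

theorem form_self (P : QPM X H) {f : X → ℂ} (hf : BddMeas f) (ψ : H) :
    P.form f ψ ψ = ∫ x, f x ∂P.diag ψ := by
  induction hf using BddMeas.induction with
  | hind B hB c => simp only [form_indicator P hB, integral_indicator_const_diag P hB]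
  | hadd f g hf hg h1 h2 =>
    rw [form_add_fun P hf hg, h1, h2]
    exact (integral_add (hf.integrable _) (hg.integrable _)).symm
  | hlim F f C hF hf hC hl h =>
    refine tendsto_nhds_unique (P.form_tendsto hF hC hl _ _) ?_
    simp only [h]
    exact integral_tendsto_of_bdd _ hF hC hl

theorem norm_integral_diag_le (P : QPM X H) {f : X → ℂ} {C : ℝ} (hC : ∀ x, ‖f x‖ ≤ C) (ψ : H) :
    ‖∫ x, f x ∂P.diag ψ‖ ≤ C * ‖ψ‖ ^ 2 := by
  have := norm_integral_le_of_norm_le_const (μ := P.diag ψ) (Eventually.of_forall hC)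
  rwa [P.diag_univ] at this

/-- The parallelogram law bounds the four polarization terms by a multiple of `‖ψ‖² + ‖φ‖²`;
rescaling `φ` to the length of `ψ` turns the sum into a product. -/
theorem norm_form_le (P : QPM X H) {f : X → ℂ} (hf : BddMeas f) {C : ℝ} (hC : ∀ x, ‖f x‖ ≤ C)
    (ψ φ : H) : ‖P.form f ψ φ‖ ≤ 2 * max C 0 * ‖ψ‖ * ‖φ‖ := by
  have hC' : ∀ x, ‖f x‖ ≤ max C 0 := fun x => (hC x).trans (le_max_left _ _)
  have hD : 0 ≤ max C 0 := le_max_right _ _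
  set D := max C 0
  have key : ∀ ψ φ : H, ‖P.form f ψ φ‖ ≤ D * (‖ψ‖ ^ 2 + ‖φ‖ ^ 2) := by
    intro ψ φ
    have h := P.norm_integral_diag_le hC'
    rw [form, norm_mul]
    have h1 := parallelogram_law_with_norm ℂ φ ψ
    have h2 := parallelogram_law_with_norm ℂ φ (Complex.I • ψ)
    rw [norm_smul, Complex.norm_I, one_mul] at h2
    have e1 := h (φ + ψ)
    have e2 := h (φ - ψ)
    have e3 := h (φ + Complex.I • ψ)
    have e4 := h (φ - Complex.I • ψ)
    have e5 := norm_sub_le (∫ x, f x ∂P.diag (φ + ψ) + Complex.I *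
      ∫ x, f x ∂P.diag (φ + Complex.I • ψ) - ∫ x, f x ∂P.diag (φ - ψ))
      (Complex.I * ∫ x, f x ∂P.diag (φ - Complex.I • ψ))
    have e6 := norm_sub_le (∫ x, f x ∂P.diag (φ + ψ) + Complex.I *
      ∫ x, f x ∂P.diag (φ + Complex.I • ψ)) (∫ x, f x ∂P.diag (φ - ψ))
    have e7 := norm_add_le (∫ x, f x ∂P.diag (φ + ψ)) (Complex.I *
      ∫ x, f x ∂P.diag (φ + Complex.I • ψ))
    rw [norm_mul, Complex.norm_I, one_mul] at e5 e7
    have : ‖(1 / 4 : ℂ)‖ = 1 / 4 := by norm_num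
    rw [this]
    nlinarith [h1, h2]
  rcases eq_or_ne ψ 0 with rfl | hψ
  · have := P.form_conj hf φ 0
    have h0 := P.form_smul_right hf.conj φ 0 0
    rw [zero_smul, zero_mul, this] at h0
    simp [(map_eq_zero _).1 h0]
  rcases eq_or_ne φ 0 with rfl | hφ
  · have h0 := P.form_smul_right hf ψ 0 0
    rw [zero_smul, zero_mul] at h0
    simp [h0]
  have a : 0 < ‖ψ‖ := norm_pos_iff.2 hψ
  have b : 0 < ‖φ‖ := norm_pos_iff.2 hφ
  have h := key (φ := ((‖ψ‖ / ‖φ‖ : ℝ) : ℂ) • φ) ψ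
  rw [form_smul_right P hf, norm_mul, norm_smul, Complex.norm_real, Real.norm_eq_abs,
    abs_of_pos (div_pos a b), div_mul_cancel₀ _ b.ne'] at h
  have : ‖P.form f ψ φ‖ = ‖φ‖ / ‖ψ‖ * (‖ψ‖ / ‖φ‖ * ‖P.form f ψ φ‖) := by field_simp
  rw [this]
  calc _ ≤ ‖φ‖ / ‖ψ‖ * (D * (‖ψ‖ ^ 2 + ‖ψ‖ ^ 2)) := by gcongr
    _ = _ := by field_simp; ring

/-- The operator `∫ f dP` for a bounded measurable function `f`. -/
def int (P : QPM X H) (f : X → ℂ) : H →L[ℂ] H := by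
  classical
  exact if hf : BddMeas f then
    -- The operator representing a sesquilinear form acts on its first argument, while `∫ f dP` has
    -- to act on the second one; hence the adjoint.
    ContinuousLinearMap.adjoint (InnerProductSpace.continuousLinearMapOfBilin
      (LinearMap.mkContinuous₂ (LinearMap.mk₂'ₛₗ (starRingEnd ℂ) (RingHom.id ℂ) (P.form f)
        (fun ψ ψ' φ => by
          have h := P.form_conj hf.conj
          simp only [Complex.conj_conj] at h
          rw [h, h, h, form_add_right P hf.conj, map_add])
        (fun c ψ φ => by
          have h := P.form_conj hf.conj
          simp only [Complex.conj_conj] at h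
          rw [h, h, form_smul_right P hf.conj, map_mul, smul_eq_mul])
        (fun ψ φ φ' => form_add_right P hf ψ φ φ')
        (fun c ψ φ => form_smul_right P hf ψ φ c))
        (2 * max hf.2.choose 0) (fun ψ φ => P.norm_form_le hf hf.2.choose_spec ψ φ)))
  else 0

theorem inner_int (P : QPM X H) {f : X → ℂ} (hf : BddMeas f) (ψ φ : H) :
    inner ℂ ψ (P.int f φ) = P.form f ψ φ := by
  rw [int, dif_pos hf, ContinuousLinearMap.adjoint_inner_right,
    InnerProductSpace.continuousLinearMapOfBilin_apply]
  rfl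

theorem inner_int_self (P : QPM X H) {f : X → ℂ} (hf : BddMeas f) (ψ : H) :
    inner ℂ ψ (P.int f ψ) = ∫ x, f x ∂P.diag ψ := by
  rw [inner_int P hf, form_self P hf]

theorem int_indicator (P : QPM X H) {B : Set X} (hB : MeasurableSet B) (c : ℂ) :
    P.int (B.indicator fun _ => c) = c • P.op B := by
  refine clm_ext_quad fun ψ => ?_
  rw [inner_int P (BddMeas.indicator_const hB c), form_indicator P hB,
    _root_.smul_apply, inner_smul_right]

theorem int_add (P : QPM X H) {f g : X → ℂ} (hf : BddMeas f) (hg : BddMeas g) :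
    P.int (f + g) = P.int f + P.int g := by
  refine clm_ext_quad fun ψ => ?_
  rw [inner_int P (hf.add hg), form_add_fun P hf hg, _root_.add_apply,
    inner_add_right, inner_int P hf, inner_int P hg]

theorem int_smul (P : QPM X H) {f : X → ℂ} (hf : BddMeas f) (c : ℂ) :
    P.int (c • f) = c • P.int f := by
  refine clm_ext_quad fun ψ => ?_
  rw [inner_int_self P (hf.const_smul c), _root_.smul_apply,
    inner_smul_right, inner_int_self P hf]
  simp only [Pi.smul_apply, smul_eq_mul]
  exact integral_const_mul _ _

theorem int_conj (P : QPM X H) {f : X → ℂ} (hf : BddMeas f) :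
    P.int (fun x => conj (f x)) = ContinuousLinearMap.adjoint (P.int f) := by
  refine clm_ext_quad fun ψ => ?_
  rw [inner_int P hf.conj, form_conj P hf, ContinuousLinearMap.adjoint_inner_right,
    ← inner_int P hf, inner_conj_symm]

theorem inner_int_tendsto (P : QPM X H) {F : ℕ → X → ℂ} {f : X → ℂ} {C : ℝ}
    (hF : ∀ n, BddMeas (F n)) (hf : BddMeas f) (hC : ∀ n x, ‖F n x‖ ≤ C)
    (hl : ∀ x, Tendsto (fun n => F n x) atTop (𝓝 (f x))) (ψ φ : H) :
    Tendsto (fun n => inner ℂ ψ (P.int (F n) φ)) atTop (𝓝 (inner ℂ ψ (P.int f φ))) := by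
  simp only [inner_int P hf, fun n => inner_int P (hF n)]
  exact P.form_tendsto hF hC hl ψ φ

/-- Projection valued measures. -/
def IsProj (P : QPM X H) : Prop :=
  ∀ A B, MeasurableSet A → MeasurableSet B → P.op A ∘L P.op B = P.op (A ∩ B)

/-- For two indicators this is the definition of a projection valued measure. It extends first in
`g`, with `f` an indicator, and then in `f`. -/
theorem IsProj.int_mul {P : QPM X H} (hP : P.IsProj) {f g : X → ℂ} (hf : BddMeas f)
    (hg : BddMeas g) : P.int (f * g) = P.int f ∘L P.int g := by
  have lim : ∀ {F : ℕ → X → ℂ} {f g : X → ℂ} {C : ℝ}, (∀ n, BddMeas (F n)) → BddMeas f →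
      BddMeas g → (∀ n x, ‖F n x‖ ≤ C) → (∀ x, Tendsto (fun n => F n x) atTop (𝓝 (f x))) →
      ∀ ψ φ : H, Tendsto (fun n => inner ℂ ψ (P.int (F n * g) φ)) atTop
        (𝓝 (inner ℂ ψ (P.int (f * g) φ))) := by
    intro F f g C hF hf hg hC hl ψ φ
    obtain ⟨D, hD⟩ := hg.2
    refine P.inner_int_tendsto (C := C * D) (fun n => (hF n).mul hg) (hf.mul hg) ?_ ?_ ψ φ
    · intro n x
      rw [Pi.mul_apply, norm_mul]
      exact mul_le_mul (hC n x) (hD x) (norm_nonneg _) ((norm_nonneg _).trans (hC n x))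
    · intro x
      exact (hl x).mul_const _
  have key : ∀ {A : Set X}, MeasurableSet A → ∀ (c : ℂ) {g : X → ℂ}, BddMeas g →
      P.int (A.indicator (fun _ => c) * g) = P.int (A.indicator fun _ => c) ∘L P.int g := by
    intro A hA c g hg
    induction hg using BddMeas.induction with
    | hind B hB d =>
      have : A.indicator (fun _ => c) * B.indicator (fun _ => d) =
          (A ∩ B).indicator fun _ => c * d := by
        ext x
        by_cases ha : x ∈ A <;> by_cases hb : x ∈ B <;> simp [ha, hb]
      rw [this, int_indicator P (hA.inter hB), int_indicator P hA, int_indicator P hB,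
        ContinuousLinearMap.smul_comp, ContinuousLinearMap.comp_smul, hP A B hA hB, smul_smul]
    | hadd f g hf hg h1 h2 =>
      have hA' := BddMeas.indicator_const hA c
      rw [mul_add, int_add P (hA'.mul hf) (hA'.mul hg), h1, h2, int_add P hf hg,
        ContinuousLinearMap.comp_add]
    | hlim F f C hF hf hC hl h =>
      refine clm_ext_quad fun ψ => ?_
      have hA' := BddMeas.indicator_const hA c
      have h1 := lim hF hf hA' hC hl ψ ψ
      simp only [mul_comm _ (A.indicator fun _ => c), h] at h1
      refine tendsto_nhds_unique h1 ?_
      simp only [ContinuousLinearMap.comp_apply]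
      simp only [← ContinuousLinearMap.adjoint_inner_left (P.int (A.indicator fun _ => c))]
      exact P.inner_int_tendsto hF hf hC hl _ _
  induction hf using BddMeas.induction with
  | hind A hA c => exact key hA c hg
  | hadd f f' hf hf' h1 h2 =>
    rw [add_mul, int_add P (hf.mul hg) (hf'.mul hg), h1, h2, int_add P hf hf',
      ContinuousLinearMap.add_comp]
  | hlim F f C hF hf hC hl h =>
    refine clm_ext_quad fun ψ => ?_
    have h1 := lim hF hf hg hC hl ψ ψ
    simp only [h] at h1
    exact tendsto_nhds_unique h1 (P.inner_int_tendsto hF hf hC hl _ _)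

theorem IsProj.norm_int_sq {P : QPM X H} (hP : P.IsProj) {f : X → ℂ} (hf : BddMeas f) (ψ : H) :
    ‖P.int f ψ‖ ^ 2 = ∫ x, ‖f x‖ ^ 2 ∂P.diag ψ := by
  have h : (inner ℂ (P.int f ψ) (P.int f ψ) : ℂ) = ∫ x, ((‖f x‖ ^ 2 : ℝ) : ℂ) ∂P.diag ψ := by
    rw [← ContinuousLinearMap.adjoint_inner_right, ← int_conj P hf,
      ← ContinuousLinearMap.comp_apply, ← hP.int_mul hf.conj hf, inner_int_self P (hf.conj.mul hf)]
    refine integral_congr_ae (Eventually.of_forall fun x => ?_)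
    simp only [Pi.mul_apply, Complex.ofReal_pow]
    exact Complex.conj_mul' (f x)
  rw [inner_self_eq_norm_sq_to_K, integral_complex_ofReal] at h
  exact Complex.ofReal_injective (by rw [← h]; norm_cast)

theorem IsProj.norm_int_le {P : QPM X H} (hP : P.IsProj) {f : X → ℂ} (hf : BddMeas f) {C : ℝ}
    (hC : ∀ x, ‖f x‖ ≤ C) (hC0 : 0 ≤ C) : ‖P.int f‖ ≤ C := by
  refine ContinuousLinearMap.opNorm_le_bound _ hC0 fun ψ => ?_
  refine le_of_sq_le_sq ?_ (by positivity)
  rw [hP.norm_int_sq hf, mul_pow, ← P.diag_univ ψ]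
  have := integral_mono_of_nonneg (μ := P.diag ψ) (f := fun x => ‖f x‖ ^ 2) (g := fun _ => C ^ 2)
    (Eventually.of_forall fun x => by positivity) (integrable_const _)
    (Eventually.of_forall fun x => pow_le_pow_left₀ (norm_nonneg _) (hC x) 2)
  rwa [integral_const, smul_eq_mul, mul_comm] at this

end QPM

end

section


/-! ### The Naimark dilation -/

namespace QPM

variable {X : Type*} [MeasurableSpace X]
  {H : Type*} [NormedAddCommGroup H] [InnerProductSpace ℂ H] [CompleteSpace H]

/-- The kernel `(B, C) ↦ P(B ∩ C)` on the measurable sets. -/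
def ker (P : QPM X H) : Matrix {B : Set X // MeasurableSet B} {B : Set X // MeasurableSet B}
    (H →L[ℂ] H) := Matrix.of fun B C => P.op (B.1 ∩ C.1)

/-- The finite family `S` cuts the space into disjoint atoms, one for each subset `τ` of `S` (the
sets containing the atom). An intersection of two members is the union of the atoms with both
members in `τ`. -/
theorem op_inter_eq_sum_atoms (P : QPM X H) (S : Finset {B : Set X // MeasurableSet B})
    [DecidableEq {B : Set X // MeasurableSet B}] {B C : {B : Set X // MeasurableSet B}}
    (hB : B ∈ S) (hC : C ∈ S) :
    P.op (C.1 ∩ B.1) = ∑ τ ∈ S.powerset, if B ∈ τ ∧ C ∈ τ then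
      P.op (⋂ D ∈ S, if D ∈ τ then D.1 else D.1ᶜ) else 0 := by
  classical
  set A : Finset {B : Set X // MeasurableSet B} → Set X :=
    fun τ => ⋂ D ∈ S, if D ∈ τ then D.1 else D.1ᶜ with hA
  have hmem : ∀ τ x, x ∈ A τ ↔ ∀ D ∈ S, (D ∈ τ ↔ x ∈ D.1) := by
    intro τ x
    simp only [hA, Set.mem_iInter]
    refine forall₂_congr fun D _ => ?_
    by_cases h : D ∈ τ <;> simp [h]
  have hm : ∀ τ, MeasurableSet (A τ) := fun τ =>
    Finset.measurableSet_biInter _ fun D _ => by split_ifs; exacts [D.2, D.2.compl]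
  rw [← Finset.sum_filter, ← P.op_biUnion_finset _ A (fun τ _ => hm τ)]
  · congr 1
    ext x
    simp only [Set.mem_inter_iff, Set.mem_iUnion, Finset.mem_filter, Finset.mem_powerset,
      exists_prop, hmem]
    constructor
    · rintro ⟨hx, hx'⟩
      refine ⟨S.filter fun D => x ∈ D.1, ⟨Finset.filter_subset _ _, ?_, ?_⟩, ?_⟩
      · exact Finset.mem_filter.2 ⟨hB, hx'⟩
      · exact Finset.mem_filter.2 ⟨hC, hx⟩
      · intro D hD
        simp [hD]
    · rintro ⟨τ, ⟨_, h1, h2⟩, h⟩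
      exact ⟨(h C hC).1 h2, (h B hB).1 h1⟩
  · intro τ hτ τ' hτ' hne
    simp only [Finset.coe_filter, Finset.mem_powerset, Set.mem_ofPred_eq] at hτ hτ'
    refine Set.disjoint_left.2 fun x hx hx' => hne ?_
    rw [hmem] at hx hx'
    ext D
    constructor
    · intro h
      exact (hx' D (hτ.1 h)).2 ((hx D (hτ.1 h)).1 h)
    · intro h
      exact (hx D (hτ'.1 h)).2 ((hx' D (hτ'.1 h)).1 h)

/-- On the atoms the double sum becomes `∑_τ ⟨P(A_τ) u_τ, u_τ⟩`, where `u_τ` is the sum of the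
vectors attached to the members of `τ`; every term is nonnegative. -/
theorem ker_posSemidef (P : QPM X H) : P.ker.PosSemidef := by
  classical
  refine (RKHS.posSemidef_tfae.out 0 2).2 ?_
  refine ⟨?_, fun vv => ?_⟩
  · ext1 B C
    simp only [ker, Matrix.conjTranspose_apply, Matrix.of_apply, Set.inter_comm C.1]
    exact (P.isPositive (B.2.inter C.2)).isSelfAdjoint
  · set S := vv.support with hS
    set A : Finset {B : Set X // MeasurableSet B} → Set X :=
      fun τ => ⋂ D ∈ S, if D ∈ τ then D.1 else D.1ᶜ with hA
    have hm : ∀ τ, MeasurableSet (A τ) := fun τ =>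
      Finset.measurableSet_biInter _ fun D _ => by split_ifs; exacts [D.2, D.2.compl]
    have key : (vv.sum fun B w => vv.sum fun C w' => inner ℂ (P.ker C B w) w') =
        ∑ τ ∈ S.powerset, inner ℂ (P.op (A τ) (∑ B ∈ S, if B ∈ τ then vv B else 0))
          (∑ C ∈ S, if C ∈ τ then vv C else 0) := by
      have hexp : ∀ τ, inner ℂ (P.op (A τ) (∑ B ∈ S, if B ∈ τ then vv B else 0))
          (∑ C ∈ S, if C ∈ τ then vv C else 0) = ∑ B ∈ S, ∑ C ∈ S,
          inner ℂ (P.op (A τ) (if B ∈ τ then vv B else 0)) (if C ∈ τ then vv C else 0) := by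
        intro τ
        rw [map_sum, sum_inner]
        exact Finset.sum_congr rfl fun B _ => inner_sum _ _ _
      simp only [hexp]
      rw [Finset.sum_comm, Finsupp.sum]
      refine Finset.sum_congr rfl fun B hB => ?_
      rw [Finset.sum_comm, Finsupp.sum]
      refine Finset.sum_congr rfl fun C hC => ?_
      rw [ker, Matrix.of_apply, P.op_inter_eq_sum_atoms S hB hC, _root_.sum_apply,
        sum_inner]
      refine Finset.sum_congr rfl fun τ _ => ?_
      by_cases h1 : B ∈ τ <;> by_cases h2 : C ∈ τ <;> simp [h1, h2, A]
    rw [key, map_sum]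
    refine Finset.sum_nonneg fun τ _ => ?_
    exact (P.isPositive (hm τ)).re_inner_nonneg_left _

/-- `(Q, V)` is a minimal projection valued dilation of `P`. -/
structure IsDilation (P : QPM X H) {K : Type*} [NormedAddCommGroup K] [InnerProductSpace ℂ K]
    [CompleteSpace K] (Q : QPM X K) (V : H →L[ℂ] K) : Prop where
  proj : Q.IsProj
  isometry : ContinuousLinearMap.adjoint V ∘L V = 1
  compress : ∀ B, MeasurableSet B → P.op B = ContinuousLinearMap.adjoint V ∘L Q.op B ∘L V
  minimal : ∀ ζ, (∀ B, MeasurableSet B → ∀ ψ, inner ℂ (Q.op B (V ψ)) ζ = 0) → ζ = 0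

section

variable {K : Type*} [NormedAddCommGroup K] [InnerProductSpace ℂ K] [CompleteSpace K]

/-- The closed subspace spanned by the vectors of the measurable subsets of `B`. -/
def spanOn (v : {B : Set X // MeasurableSet B} → H →L[ℂ] K) (B : Set X) : Submodule ℂ K :=
  (Submodule.span ℂ {ζ | ∃ C : {B : Set X // MeasurableSet B}, ∃ ψ, C.1 ⊆ B ∧ v C ψ = ζ}).topologicalClosure

variable {v : {B : Set X // MeasurableSet B} → H →L[ℂ] K}

instance (B : Set X) : (spanOn v B).HasOrthogonalProjection := by
  unfold spanOn; infer_instance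

theorem mem_spanOn (B : Set X) (C : {B : Set X // MeasurableSet B}) (ψ : H) (h : C.1 ⊆ B) :
    v C ψ ∈ spanOn v B :=
  Submodule.le_topologicalClosure _ (Submodule.subset_span ⟨C, ψ, h, rfl⟩)

theorem spanOn_mono : Monotone (spanOn v) := fun _ _ h =>
  Submodule.topologicalClosure_mono (Submodule.span_mono fun _ ⟨C, ψ, hC, e⟩ =>
    ⟨C, ψ, hC.trans h, e⟩)

theorem spanOn_le {B : Set X} {U : Submodule ℂ K} (hU : IsClosed (U : Set K))
    (h : ∀ C ψ, C.1 ⊆ B → v C ψ ∈ U) : spanOn v B ≤ U :=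
  Submodule.topologicalClosure_minimal _ (Submodule.span_le.2 fun _ ⟨C, ψ, hC, e⟩ => e ▸ h C ψ hC) hU

variable {P : QPM X H}

/-- The difference of the two sides is orthogonal to every vector `v D φ`, and is itself a
combination of such vectors. -/
theorem vec_union
    (hv : ∀ B C ψ φ, inner ℂ (v B ψ) (v C φ) = inner ℂ ψ (P.op (B.1 ∩ C.1) φ))
    {A B C : {B : Set X // MeasurableSet B}} (hAB : Disjoint A.1 B.1)
    (hC : A.1 ∪ B.1 = C.1) (ψ : H) : v C ψ = v A ψ + v B ψ := by
  rw [← sub_eq_zero, ← inner_self_eq_zero (𝕜 := ℂ)]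
  have hd : ∀ D : {B : Set X // MeasurableSet B}, P.op (D.1 ∩ C.1) =
      P.op (D.1 ∩ A.1) + P.op (D.1 ∩ B.1) := fun D => by
    rw [← hC, Set.inter_union_distrib_left, P.op_union (D.2.inter A.2) (D.2.inter B.2)]
    exact hAB.mono Set.inter_subset_right Set.inter_subset_right
  have h0 : ∀ D : {B : Set X // MeasurableSet B}, ∀ φ,
      inner ℂ (v D φ) (v C ψ - (v A ψ + v B ψ)) = 0 := by
    intro D φ
    rw [inner_sub_right, inner_add_right, hv, hv, hv, hd, _root_.add_apply, inner_add_right,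
      sub_self]
  rw [inner_sub_left, inner_add_left, h0, h0, h0]
  simp

/-- `v C ψ` splits into its parts over `B ∩ C` and `C \ B`, the second being orthogonal to
everything supported in `B`. Thus projections act by intersection of sets, which makes them
multiplicative. -/
theorem starProjection_spanOn
    (hv : ∀ B C ψ φ, inner ℂ (v B ψ) (v C φ) = inner ℂ ψ (P.op (B.1 ∩ C.1) φ))
    {B : Set X} (hB : MeasurableSet B)
    (C : {B : Set X // MeasurableSet B}) (ψ : H) :
    (spanOn v B).starProjection (v C ψ) = v ⟨B ∩ C.1, hB.inter C.2⟩ ψ := by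
  refine Submodule.eq_starProjection_of_mem_orthogonal (mem_spanOn _ _ _ Set.inter_subset_left) ?_
  rw [vec_union hv (A := ⟨B ∩ C.1, hB.inter C.2⟩) (B := ⟨C.1 \ B, C.2.diff hB⟩) (C := C),
    add_sub_cancel_left]
  · have : spanOn v B ≤ (Submodule.span ℂ {v ⟨C.1 \ B, C.2.diff hB⟩ ψ})ᗮ := by
      refine spanOn_le (Submodule.isClosed_orthogonal _) fun D φ hD => ?_
      rw [Submodule.mem_orthogonal_singleton_iff_inner_right, hv]
      have : (C.1 \ B) ∩ D.1 = ∅ := by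
        ext x; simp only [Set.mem_inter_iff, Set.mem_sdiff, Set.mem_empty_iff_false, iff_false]
        exact fun h => h.1.2 (hD h.2)
      simp [this, op_empty]
    rw [Submodule.mem_orthogonal]
    intro u hu
    exact (Submodule.mem_orthogonal_singleton_iff_inner_left).1 (this hu)
  · exact Set.disjoint_left.2 fun x hx hx' => hx'.2 hx.1
  · simp only [Set.inter_comm B, Set.inter_union_sdiff]

theorem clm_ext_vec (hd : ∀ ζ : K, (∀ B ψ, inner ℂ (v B ψ) ζ = 0) → ζ = 0) {S T : K →L[ℂ] K}
    (h : ∀ B ψ, S (v B ψ) = T (v B ψ)) : S = T := by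
  have h' : ContinuousLinearMap.adjoint S = ContinuousLinearMap.adjoint T := by
    ext ζ
    rw [← sub_eq_zero]
    refine hd _ fun B ψ => ?_
    rw [inner_sub_right, ContinuousLinearMap.adjoint_inner_right,
      ContinuousLinearMap.adjoint_inner_right, h, sub_self]
  simpa using congrArg ContinuousLinearMap.adjoint h'

/-- The squared distance from `v (A m ∩ C) ψ` to `v C ψ` is a difference of measures `⟨ψ, P(·) ψ⟩`,
which tends to zero by continuity from below; hence the spans over `A m` are dense in the span over
the union. -/
theorem starProjection_spanOn_tendsto
    (hv : ∀ B C ψ φ, inner ℂ (v B ψ) (v C φ) = inner ℂ ψ (P.op (B.1 ∩ C.1) φ))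
    {A : ℕ → Set X} (hA : ∀ m, MeasurableSet (A m))
    (hmono : Monotone A) (ζ : K) : Tendsto (fun m => (spanOn v (A m)).starProjection ζ) atTop
      (𝓝 ((spanOn v (⋃ m, A m)).starProjection ζ)) := by
  have hcl : (⨆ m, spanOn v (A m)).topologicalClosure = spanOn v (⋃ m, A m) := by
    refine le_antisymm ?_ ?_
    · refine Submodule.topologicalClosure_minimal _ (iSup_le fun m =>
        spanOn_mono (Set.subset_iUnion _ _)) ?_
      exact Submodule.isClosed_topologicalClosure _
    · refine spanOn_le (Submodule.isClosed_topologicalClosure _) fun C ψ hC => ?_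
      have hlim : Tendsto (fun m => v ⟨A m ∩ C.1, (hA m).inter C.2⟩ ψ) atTop (𝓝 (v C ψ)) := by
        rw [tendsto_iff_norm_sub_tendsto_zero]
        have hsq : Tendsto (fun m => (P.diag ψ).real C.1 - (P.diag ψ).real (A m ∩ C.1)) atTop
            (𝓝 0) := by
          have : C.1 = ⋃ m, A m ∩ C.1 := by
            rw [← Set.iUnion_inter, Set.inter_eq_self_of_subset_right hC]
          have h1 := tendsto_measure_iUnion_atTop (μ := P.diag ψ) (s := fun m => A m ∩ C.1)
            (fun i j h => Set.inter_subset_inter_left _ (hmono h))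
          rw [← this] at h1
          have h2 := (ENNReal.tendsto_toReal (measure_ne_top (P.diag ψ) C.1)).comp h1
          have h3 := (tendsto_const_nhds (x := (P.diag ψ).real C.1)).sub h2
          rwa [Measure.real, sub_self] at h3
        have heq : ∀ m, ‖v ⟨A m ∩ C.1, (hA m).inter C.2⟩ ψ - v C ψ‖ ^ 2 =
            (P.diag ψ).real C.1 - (P.diag ψ).real (A m ∩ C.1) := by
          intro m
          have := inner_self_eq_norm_sq_to_K (𝕜 := ℂ)
            (v ⟨A m ∩ C.1, (hA m).inter C.2⟩ ψ - v C ψ)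
          simp only [inner_sub_left, inner_sub_right, hv, Set.inter_self,
            Set.inter_eq_self_of_subset_left (Set.inter_subset_right (s := A m) (t := C.1)),
            Set.inter_eq_self_of_subset_right (Set.inter_subset_right (s := A m) (t := C.1)),
            ← P.diag_real ψ C.2, ← P.diag_real ψ ((hA m).inter C.2)] at this
          refine Complex.ofReal_injective ?_
          rw [Complex.ofReal_pow]
          refine this.symm.trans ?_
          push_cast
          ring
        have h4 : Tendsto (fun m => √(‖v ⟨A m ∩ C.1, (hA m).inter C.2⟩ ψ - v C ψ‖ ^ 2)) atTop
            (𝓝 0) := by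
          simp only [heq]
          simpa using hsq.sqrt
        simpa [Real.sqrt_sq] using h4
      refine mem_closure_of_tendsto hlim (Eventually.of_forall fun m => ?_)
      exact Submodule.mem_iSup_of_mem m (mem_spanOn _ _ _ Set.inter_subset_left)
  have := Submodule.starProjection_tendsto_closure_iSup (fun m => spanOn v (A m))
    (fun i j h => spanOn_mono (hmono h)) ζ
  simpa only [hcl] using this

/-- The projection valued measure on the space spanned by the vectors `v B ψ`. -/
def spanQPM
    (hv : ∀ B C ψ φ, inner ℂ (v B ψ) (v C φ) = inner ℂ ψ (P.op (B.1 ∩ C.1) φ))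
    (hd : ∀ ζ : K, (∀ B ψ, inner ℂ (v B ψ) ζ = 0) → ζ = 0) : QPM X K where
  op B := (spanOn v B).starProjection
  nonneg B _ := by
    rw [ContinuousLinearMap.nonneg_iff_isPositive]
    refine ⟨Submodule.starProjection_isSymmetric _, fun x => ?_⟩
    exact Submodule.re_inner_starProjection_nonneg _ x
  op_univ := by
    refine clm_ext_vec hd fun B ψ => ?_
    rw [starProjection_spanOn hv MeasurableSet.univ]
    simp
  hasSum f hf hdis ζ := by
    -- Countable additivity is split into finite additivity and continuity along the increasing
    -- finite unions.
    have hadd : ∀ m, ∑ i ∈ Finset.range m, (spanOn v (f i)).starProjection =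
        (spanOn v (⋃ i ∈ Finset.range m, f i)).starProjection := by
      intro m
      refine clm_ext_vec hd fun B ψ => ?_
      have hmm : ∀ m, MeasurableSet (⋃ i ∈ Finset.range m, f i) := fun m =>
        Finset.measurableSet_biUnion _ fun i _ => hf i
      rw [_root_.sum_apply]
      simp only [starProjection_spanOn hv (hf _), starProjection_spanOn hv (hmm m)]
      induction m with
      | zero =>
        rw [Finset.sum_range_zero, eq_comm, ← inner_self_eq_zero (𝕜 := ℂ), hv]
        simp [op_empty]
      | succ m ih =>
        rw [Finset.sum_range_succ, ih]
        refine (vec_union hv ?_ ?_ ψ).symm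
        · refine Set.disjoint_left.2 fun x hx hx' => ?_
          simp only [Set.mem_inter_iff, Set.mem_iUnion, Finset.mem_range, exists_prop] at hx
          obtain ⟨⟨i, hi, hxi⟩, _⟩ := hx
          exact Set.disjoint_left.1 (hdis hi.ne) hxi hx'.1
        · simp only [Finset.range_add_one, Finset.set_biUnion_insert]
          rw [Set.union_inter_distrib_right, Set.union_comm]
    have hre : ∀ B, inner ℂ ζ ((spanOn v B).starProjection ζ) =
        ((‖(spanOn v B).starProjection ζ‖ ^ 2 : ℝ) : ℂ) := by
      intro B
      have := Submodule.inner_starProjection_left_eq_right (spanOn v B) ζ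
        ((spanOn v B).starProjection ζ)
      rw [Submodule.starProjection_eq_self_iff.2 (Submodule.starProjection_apply_mem _ _)] at this
      rw [← this, inner_self_eq_norm_sq_to_K]
      norm_cast
    simp only [hre]
    rw [Complex.hasSum_ofReal, hasSum_iff_tendsto_nat_of_nonneg (fun _ => by positivity)]
    have hlim := starProjection_spanOn_tendsto hv (A := fun m => ⋃ i ∈ Finset.range m, f i)
      (fun m => Finset.measurableSet_biUnion _ fun i _ => hf i)
      (fun i j h => Set.biUnion_subset_biUnion_left (by simpa using h)) ζ
    have hU : ⋃ m, ⋃ i ∈ Finset.range m, f i = ⋃ i, f i := by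
      ext x
      simp only [Set.mem_iUnion, Finset.mem_range, exists_prop]
      exact ⟨fun ⟨_, i, _, h⟩ => ⟨i, h⟩, fun ⟨i, h⟩ => ⟨i + 1, i, Nat.lt_succ_self i, h⟩⟩
    rw [hU] at hlim
    have := (hlim.norm.pow 2)
    refine this.congr fun m => Complex.ofReal_injective ?_
    rw [← hre, ← hadd, Complex.ofReal_sum, _root_.sum_apply, inner_sum]
    exact Finset.sum_congr rfl fun i _ => hre _

end

/-- The dilation space is the reproducing kernel space of `(B, C) ↦ P(B ∩ C)`. `V ψ` is the kernel
vector of the whole space, and `Q(B)` projects onto the span of the kernel vectors of subsets of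
`B`. Since `Q(B) V ψ` is the kernel vector of `B`, the dilation is minimal. -/
theorem exists_dilation.{u, w} {X : Type u} [MeasurableSpace X]
    {H : Type w} [NormedAddCommGroup H] [InnerProductSpace ℂ H] [CompleteSpace H] (P : QPM X H) :
    ∃ (K : Type (max u w)) (_ : NormedAddCommGroup K) (_ : InnerProductSpace ℂ K)
      (_ : CompleteSpace K) (Q : QPM X K) (V : H →L[ℂ] K), P.IsDilation Q V := by
  have : Fact P.ker.PosSemidef := ⟨P.ker_posSemidef⟩
  have hv : ∀ B C ψ φ, inner ℂ (RKHS.kerFun (RKHS.OfKernel P.ker) B ψ)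
      (RKHS.kerFun (RKHS.OfKernel P.ker) C φ) = inner ℂ ψ (P.op (B.1 ∩ C.1) φ) := by
    intro B C ψ φ
    rw [RKHS.kerFun_inner, RKHS.kerFun_apply, RKHS.OfKernel.kernel_ofKernel]
    rfl
  have hd : ∀ ζ : RKHS.OfKernel P.ker,
      (∀ B ψ, inner ℂ (RKHS.kerFun (RKHS.OfKernel P.ker) B ψ) ζ = 0) → ζ = 0 := by
    intro ζ h
    refine RKHS.ext fun B => ext_inner_left ℂ fun ψ => ?_
    rw [← RKHS.kerFun_inner, h, RKHS.coe_zero]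
    simp
  have hQ : ∀ (B) (hB : MeasurableSet B) (C ψ), (spanQPM hv hd).op B
      (RKHS.kerFun (RKHS.OfKernel P.ker) C ψ) = RKHS.kerFun (RKHS.OfKernel P.ker)
        ⟨B ∩ C.1, hB.inter C.2⟩ ψ :=
    fun B hB C ψ => starProjection_spanOn hv hB C ψ
  refine ⟨RKHS.OfKernel P.ker, inferInstance, inferInstance, inferInstance, spanQPM hv hd,
    RKHS.kerFun (RKHS.OfKernel P.ker) ⟨Set.univ, MeasurableSet.univ⟩, ?_, ?_, ?_, ?_⟩
  · intro A B hA hB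
    refine clm_ext_vec hd fun C ψ => ?_
    rw [ContinuousLinearMap.comp_apply, hQ B hB, hQ A hA, hQ _ (hA.inter hB)]
    congr 2
    simp only [Set.inter_assoc]
  · refine clm_ext_quad fun ψ => ?_
    rw [ContinuousLinearMap.comp_apply, ContinuousLinearMap.adjoint_inner_right, hv]
    simp [P.op_univ]
  · intro B hB
    refine clm_ext_quad fun ψ => ?_
    rw [ContinuousLinearMap.comp_apply, ContinuousLinearMap.adjoint_inner_right,
      ContinuousLinearMap.comp_apply, hQ B hB, hv]
    simp
  · intro ζ h
    refine hd ζ fun B ψ => ?_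
    have := h B.1 B.2 ψ
    rw [hQ B.1 B.2] at this
    simpa using this

end QPM

end

section


/-! ### Hilbert-Schmidt operators between Hilbert spaces -/

section HS

variable {H : Type*} [NormedAddCommGroup H] [InnerProductSpace ℂ H] [CompleteSpace H]
variable {K : Type*} [NormedAddCommGroup K] [InnerProductSpace ℂ K] [CompleteSpace K]
variable {K' : Type*} [NormedAddCommGroup K'] [InnerProductSpace ℂ K'] [CompleteSpace K']

theorem enorm_sq_eq_tsum {ι : Type*} (b : HilbertBasis ι ℂ H) (x : H) :
    ‖x‖ₑ ^ 2 = ∑' i, ‖(inner ℂ (b i) x : ℂ)‖ₑ ^ 2 := by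
  have h := b.hasSum_inner_mul_inner x x
  have h2 : HasSum (fun i => ‖(inner ℂ (b i) x : ℂ)‖ ^ 2) (‖x‖ ^ 2) := by
    rw [← Complex.hasSum_ofReal]
    rw [inner_self_eq_norm_sq_to_K] at h
    convert! h using 1
    · ext i
      rw [← inner_conj_symm x, Complex.conj_mul']
      norm_cast
    · norm_cast
  have h3 := ENNReal.ofReal_tsum_of_nonneg (fun i => by positivity) h2.summable
  rw [h2.tsum_eq] at h3
  simpa only [ENNReal.ofReal_pow (norm_nonneg _), ofReal_norm] using h3

/-- Parseval's identity on both sides and interchange of a double sum, which in `ℝ≥0∞` needs no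
summability. -/
theorem tsum_enorm_adjoint {ι ι' : Type*} (b : HilbertBasis ι ℂ H) (b' : HilbertBasis ι' ℂ K)
    (T : H →L[ℂ] K) : ∑' i, ‖T (b i)‖ₑ ^ 2 = ∑' j, ‖ContinuousLinearMap.adjoint T (b' j)‖ₑ ^ 2 := by
  simp only [enorm_sq_eq_tsum b', enorm_sq_eq_tsum b]
  rw [ENNReal.tsum_comm]
  refine tsum_congr fun j => tsum_congr fun i => ?_
  rw [ContinuousLinearMap.adjoint_inner_right, ← inner_conj_symm (b' j)]
  simp only [← ofReal_norm, RCLike.norm_conj]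

/-- The square of the Hilbert-Schmidt norm. -/
def hsSq (T : H →L[ℂ] K) : ℝ≥0∞ := ∑' e, ‖T (onb H e)‖ₑ ^ 2

theorem hsSq_adjoint (T : H →L[ℂ] K) : hsSq (ContinuousLinearMap.adjoint T) = hsSq T :=
  (tsum_enorm_adjoint (onb H) (onb K) T).symm

theorem hsSq_comp_le (Z : K →L[ℂ] K') (T : H →L[ℂ] K) : hsSq (Z ∘L T) ≤ ‖Z‖ₑ ^ 2 * hsSq T := by
  rw [hsSq, hsSq, ← ENNReal.tsum_mul_left]
  refine ENNReal.tsum_le_tsum fun e => ?_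
  rw [← mul_pow]
  exact pow_le_pow_left' (Z.le_opENorm _) 2

theorem hsSq_comp_le' (T : K →L[ℂ] K') (Z : H →L[ℂ] K) : hsSq (T ∘L Z) ≤ ‖Z‖ₑ ^ 2 * hsSq T := by
  rw [← hsSq_adjoint, ContinuousLinearMap.adjoint_comp, ← hsSq_adjoint T]
  refine (hsSq_comp_le _ _).trans_eq ?_
  simp only [← ofReal_norm, LinearIsometryEquiv.norm_map]

theorem enorm_apply_sq_le (T : H →L[ℂ] K) (ψ : H) : ‖T ψ‖ₑ ^ 2 ≤ hsSq T * ‖ψ‖ₑ ^ 2 := by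
  rw [← hsSq_adjoint, enorm_sq_eq_tsum (onb K), hsSq, ← ENNReal.tsum_mul_right]
  refine ENNReal.tsum_le_tsum fun j => ?_
  rw [← ContinuousLinearMap.adjoint_inner_left, ← mul_pow]
  refine pow_le_pow_left' ?_ 2
  simp only [← ofReal_norm]
  rw [← ENNReal.ofReal_mul (norm_nonneg _)]
  exact ENNReal.ofReal_le_ofReal (norm_inner_le_norm _ _)

theorem isHS_iff {T : H →L[ℂ] H} : IsHS T ↔ hsSq T ≠ ∞ := by
  have : ∀ e, ‖T (onb H e)‖ₑ ^ 2 = ((‖T (onb H e)‖₊ ^ 2 : NNReal) : ℝ≥0∞) := fun e => by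
    rw [ENNReal.coe_pow]; rfl
  simp only [hsSq, this]
  rw [ENNReal.tsum_coe_ne_top_iff_summable, ← NNReal.summable_coe]
  simp [IsHS]

/-- The vector of the values of a Hilbert-Schmidt operator on the basis. -/
def hsVec (T : H →L[ℂ] K) (hT : hsSq T ≠ ∞) : lp (fun _ : BasisIndex H => K) 2 :=
  ⟨fun e => T (onb H e), by
    refine memℓp_gen ?_
    have : ∀ e, ‖T (onb H e)‖ₑ ^ 2 = ((‖T (onb H e)‖₊ ^ 2 : NNReal) : ℝ≥0∞) := fun e => by
      rw [ENNReal.coe_pow]; rfl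
    simp only [hsSq, this] at hT
    rw [ENNReal.tsum_coe_ne_top_iff_summable, ← NNReal.summable_coe] at hT
    simpa using hT⟩

@[simp]
theorem hsVec_apply (T : H →L[ℂ] K) (hT : hsSq T ≠ ∞) (e) : hsVec T hT e = T (onb H e) := rfl

/-- The Hilbert-Schmidt inner product of operators into another space. -/
def hsIn (A B : H →L[ℂ] K) : ℂ := ∑' e, inner ℂ (A (onb H e)) (B (onb H e))

theorem hsIn_eq_hsInner (A B : H →L[ℂ] H) : hsIn A B = hsInner A B := rfl

theorem inner_hsVec {A B : H →L[ℂ] K} (hA : hsSq A ≠ ∞) (hB : hsSq B ≠ ∞) :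
    inner ℂ (hsVec A hA) (hsVec B hB) = hsIn A B := by
  rw [lp.inner_eq_tsum]; rfl

theorem hasSum_hsIn {A B : H →L[ℂ] K} (hA : hsSq A ≠ ∞) (hB : hsSq B ≠ ∞) :
    HasSum (fun e => inner ℂ (A (onb H e)) (B (onb H e))) (hsIn A B) := by
  rw [← inner_hsVec hA hB]
  exact lp.hasSum_inner (hsVec A hA) (hsVec B hB)

theorem norm_hsVec_sq {A : H →L[ℂ] K} (hA : hsSq A ≠ ∞) : ‖hsVec A hA‖ ^ 2 = (hsSq A).toReal := by
  have h := hasSum_hsIn hA hA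
  rw [← inner_hsVec hA hA, inner_self_eq_norm_sq_to_K] at h
  have h2 : HasSum (fun e => ‖A (onb H e)‖ ^ 2) (‖hsVec A hA‖ ^ 2) := by
    rw [← Complex.hasSum_ofReal]
    convert! h using 1
    · ext e
      rw [inner_self_eq_norm_sq_to_K]
      norm_cast
    · norm_cast
  have h3 := ENNReal.ofReal_tsum_of_nonneg (fun i => by positivity) h2.summable
  rw [h2.tsum_eq] at h3
  simp only [ENNReal.ofReal_pow (norm_nonneg _), ofReal_norm] at h3
  rw [hsSq, ← h3, ENNReal.toReal_pow, toReal_enorm]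

theorem hsVec_add {A B : H →L[ℂ] K} (hA : hsSq A ≠ ∞) (hB : hsSq B ≠ ∞)
    (hAB : hsSq (A + B) ≠ ∞) : hsVec (A + B) hAB = hsVec A hA + hsVec B hB := rfl

theorem hsVec_smul {A : H →L[ℂ] K} (hA : hsSq A ≠ ∞) (c : ℂ) (hc : hsSq (c • A) ≠ ∞) :
    hsVec (c • A) hc = c • hsVec A hA := rfl

theorem hsSq_add_ne_top {A B : H →L[ℂ] K} (hA : hsSq A ≠ ∞) (hB : hsSq B ≠ ∞) :
    hsSq (A + B) ≠ ∞ := by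
  have h : hsSq (A + B) ≤ 2 * (hsSq A + hsSq B) := by
    rw [hsSq, hsSq, hsSq, ← ENNReal.tsum_add, ← ENNReal.tsum_mul_left]
    refine ENNReal.tsum_le_tsum fun e => ?_
    refine (pow_le_pow_left' (enorm_add_le _ _) 2).trans ?_
    have := ENNReal.rpow_add_le_mul_rpow_add_rpow ‖A (onb H e)‖ₑ ‖B (onb H e)‖ₑ (p := 2) (by norm_num)
    norm_num at this
    exact this
  exact ne_top_of_le_ne_top (ENNReal.mul_ne_top (by simp) (ENNReal.add_ne_top.2 ⟨hA, hB⟩)) h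

theorem hsSq_comp_ne_top (Z : K →L[ℂ] K') {T : H →L[ℂ] K} (hT : hsSq T ≠ ∞) :
    hsSq (Z ∘L T) ≠ ∞ :=
  ne_top_of_le_ne_top (ENNReal.mul_ne_top (by simp) hT) (hsSq_comp_le Z T)

theorem hsSq_comp_ne_top' {T : K →L[ℂ] K'} (hT : hsSq T ≠ ∞) (Z : H →L[ℂ] K) :
    hsSq (T ∘L Z) ≠ ∞ :=
  ne_top_of_le_ne_top (ENNReal.mul_ne_top (by simp) hT) (hsSq_comp_le' T Z)

theorem hsSq_smul_ne_top {A : H →L[ℂ] K} (hA : hsSq A ≠ ∞) (c : ℂ) : hsSq (c • A) ≠ ∞ := by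
  have : c • A = (c • ContinuousLinearMap.id ℂ K) ∘L A := by ext; simp
  rw [this]
  exact hsSq_comp_ne_top _ hA

theorem hsSq_sum_ne_top {ι : Type*} (s : Finset ι) {A : ι → H →L[ℂ] K}
    (hA : ∀ i ∈ s, hsSq (A i) ≠ ∞) : hsSq (∑ i ∈ s, A i) ≠ ∞ := by
  classical
  induction s using Finset.induction_on with
  | empty => simp [hsSq]
  | insert a s ha ih =>
    rw [Finset.sum_insert ha]
    exact hsSq_add_ne_top (hA a (by simp)) (ih fun i hi => hA i (by simp [hi]))

/-- Taking adjoints is conjugate linear and preserves Hilbert-Schmidt norms of all combinations of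
`A` and `B`, so polarization applies. -/
theorem hsIn_adjoint {A B : H →L[ℂ] K} (hA : hsSq A ≠ ∞) (hB : hsSq B ≠ ∞) :
    hsIn (ContinuousLinearMap.adjoint B) (ContinuousLinearMap.adjoint A) = hsIn A B := by
  have hA' : hsSq (ContinuousLinearMap.adjoint A) ≠ ∞ := by rwa [hsSq_adjoint]
  have hB' : hsSq (ContinuousLinearMap.adjoint B) ≠ ∞ := by rwa [hsSq_adjoint]
  have key : ∀ c d : ℂ, ‖c • hsVec A hA + d • hsVec B hB‖ ^ 2 =
      ‖conj c • hsVec _ hA' + conj d • hsVec _ hB'‖ ^ 2 := by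
    intro c d
    have h1 := hsSq_add_ne_top (hsSq_smul_ne_top hA c) (hsSq_smul_ne_top hB d)
    have h2 := hsSq_add_ne_top (hsSq_smul_ne_top hA' (conj c)) (hsSq_smul_ne_top hB' (conj d))
    have e1 : hsVec _ h1 = c • hsVec A hA + d • hsVec B hB := rfl
    have e2 : hsVec _ h2 = conj c • hsVec _ hA' + conj d • hsVec _ hB' := rfl
    rw [← e1, ← e2, norm_hsVec_sq, norm_hsVec_sq, ← hsSq_adjoint (c • A + d • B)]
    congr 2
    rw [map_add, map_smulₛₗ, map_smulₛₗ]
  rw [← inner_hsVec hA hB, ← inner_hsVec hB' hA']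
  have k1 := key 1 1
  have k2 := key 1 (-1)
  have k3 := key 1 (-Complex.I)
  have k4 := key 1 Complex.I
  simp only [one_smul, map_one, map_neg, neg_smul, ← sub_eq_add_neg, Complex.conj_I, neg_neg] at k1 k2 k3 k4
  rw [inner_eq_sum_norm_sq_div_four, inner_eq_sum_norm_sq_div_four (hsVec A hA)]
  -- The two imaginary terms of the polarization formula with the arguments exchanged differ from
  -- the original ones by unimodular factors.
  have m1 : ‖hsVec _ hB' - Complex.I • hsVec _ hA'‖ = ‖hsVec _ hA' + Complex.I • hsVec _ hB'‖ := by
    have : hsVec _ hA' + Complex.I • hsVec _ hB' = Complex.I • (hsVec _ hB' - Complex.I • hsVec _ hA') := by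
      rw [smul_sub, smul_smul, Complex.I_mul_I, neg_one_smul, sub_neg_eq_add, add_comm]
    rw [this, norm_smul, Complex.norm_I, one_mul]
  have m2 : ‖hsVec _ hB' + Complex.I • hsVec _ hA'‖ = ‖hsVec _ hA' - Complex.I • hsVec _ hB'‖ := by
    have : hsVec _ hA' - Complex.I • hsVec _ hB' = -(Complex.I • (hsVec _ hB' + Complex.I • hsVec _ hA')) := by
      rw [smul_add, smul_smul, Complex.I_mul_I, neg_one_smul]; abel
    rw [this, norm_neg, norm_smul, Complex.norm_I, one_mul]
  have hI : ∀ z : lp (fun _ : BasisIndex H => K) 2, (RCLike.I : ℂ) • z = Complex.I • z := fun _ => rfl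
  have hI' : ∀ z : lp (fun _ : BasisIndex K => H) 2, (RCLike.I : ℂ) • z = Complex.I • z := fun _ => rfl
  simp only [hI, hI'] 
  rw [m1, m2, add_comm (hsVec _ hB'), norm_sub_rev (hsVec _ hB')]
  have c : ∀ {a b : ℝ}, a ^ 2 = b ^ 2 → (a : ℂ) ^ 2 = (b : ℂ) ^ 2 := fun h => by exact_mod_cast h
  simp only [RCLike.ofReal_eq_complex_ofReal, c k1, c k2, c k3, c k4]

/-! ### The trace -/

theorem tr_comp_rankOne (T : H →L[ℂ] H) (x y : H) :
    tr (T ∘L (innerSL ℂ y).smulRight x) = inner ℂ y (T x) := by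
  rw [tr, ← (onb H).tsum_inner_mul_inner y (T x)]
  refine tsum_congr fun e => ?_
  simp

/-- Cyclicity of the trace for products of two Hilbert-Schmidt operators. It turns the weak equation
for the logarithmic derivatives into inner products with the scores. -/
theorem tr_comp_eq_hsIn {S s Z : H →L[ℂ] H} (hS : hsSq S ≠ ∞) (hs : hsSq s ≠ ∞)
    (hsa : ContinuousLinearMap.adjoint s = s) : tr (S ∘L s ∘L Z) = hsIn s (Z ∘L S) := by
  have h1 : tr (S ∘L s ∘L Z) = hsIn (ContinuousLinearMap.adjoint S) (s ∘L Z) := by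
    refine tsum_congr fun e => ?_
    rw [ContinuousLinearMap.adjoint_inner_left]
    rfl
  have h2 := hsIn_adjoint (A := ContinuousLinearMap.adjoint S) (B := s ∘L Z)
    (by rwa [hsSq_adjoint]) (hsSq_comp_ne_top' hs Z)
  rw [h1, ← h2, ContinuousLinearMap.adjoint_adjoint, ContinuousLinearMap.adjoint_comp, hsa]
  refine tsum_congr fun e => ?_
  rw [ContinuousLinearMap.comp_apply, ContinuousLinearMap.adjoint_inner_left]
  rfl

variable {ρ : H →L[ℂ] H}

theorem adjoint_sqrt (ρ : H →L[ℂ] H) : ContinuousLinearMap.adjoint (CFC.sqrt ρ) = CFC.sqrt ρ :=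
  (IsSelfAdjoint.of_nonneg (CFC.sqrt_nonneg ρ) : _)

theorem IsDensity.sqrt_comp (h : IsDensity ρ) : CFC.sqrt ρ ∘L CFC.sqrt ρ = ρ :=
  CFC.sqrt_mul_sqrt_self ρ h.nonneg

theorem IsDensity.inner_sqrt (h : IsDensity ρ) (x y : H) :
    inner ℂ (CFC.sqrt ρ x) (CFC.sqrt ρ y) = inner ℂ x (ρ y) := by
  rw [← ContinuousLinearMap.adjoint_inner_right, adjoint_sqrt, ← ContinuousLinearMap.comp_apply,
    h.sqrt_comp]

theorem IsDensity.hsSq_sqrt (h : IsDensity ρ) : hsSq (CFC.sqrt ρ) = 1 := by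
  have h1 := h.trace_one
  have h2 : HasSum (fun e => ‖CFC.sqrt ρ (onb H e)‖ ^ 2) 1 := by
    rw [← Complex.hasSum_ofReal, Complex.ofReal_one]
    convert! h1 using 1
    ext e
    rw [← h.inner_sqrt, inner_self_eq_norm_sq_to_K]
    norm_cast
  have h3 := ENNReal.ofReal_tsum_of_nonneg (fun i => by positivity) h2.summable
  rw [h2.tsum_eq] at h3
  simp only [ENNReal.ofReal_pow (norm_nonneg _), ofReal_norm] at h3
  rw [hsSq, ← h3, ENNReal.ofReal_one]

theorem IsDensity.hsSq_sqrt_ne_top (h : IsDensity ρ) : hsSq (CFC.sqrt ρ) ≠ ∞ := by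
  rw [h.hsSq_sqrt]; simp

theorem IsDensity.tr_comp (h : IsDensity ρ) (Z : H →L[ℂ] H) :
    tr (ρ ∘L Z) = hsIn (CFC.sqrt ρ) (Z ∘L CFC.sqrt ρ) := by
  rw [← tr_comp_eq_hsIn h.hsSq_sqrt_ne_top h.hsSq_sqrt_ne_top (adjoint_sqrt ρ),
    ← ContinuousLinearMap.comp_assoc, h.sqrt_comp]

theorem hsIn_conj (A B : H →L[ℂ] K) : conj (hsIn A B) = hsIn B A := by
  rw [hsIn, Complex.conj_tsum]
  exact tsum_congr fun e => inner_conj_symm _ _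

theorem hsIn_comp_left (Z : K →L[ℂ] K') (A : H →L[ℂ] K) (B : H →L[ℂ] K') :
    hsIn (Z ∘L A) B = hsIn A (ContinuousLinearMap.adjoint Z ∘L B) :=
  tsum_congr fun e => by
    rw [ContinuousLinearMap.comp_apply, ContinuousLinearMap.comp_apply,
      ContinuousLinearMap.adjoint_inner_right]

theorem IsDensity.tr_comp_conj (h : IsDensity ρ) (Z : H →L[ℂ] H) :
    tr (ρ ∘L ContinuousLinearMap.adjoint Z) = conj (tr (ρ ∘L Z)) := by
  rw [h.tr_comp, h.tr_comp, hsIn_conj, hsIn_comp_left]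

end HS

/-! ### The law of the results -/

namespace QPM

variable {X : Type*} [MeasurableSpace X]
  {H : Type*} [NormedAddCommGroup H] [InnerProductSpace ℂ H] [CompleteSpace H]
  {K : Type*} [NormedAddCommGroup K] [InnerProductSpace ℂ K] [CompleteSpace K]
  {P : QPM X H} {Q : QPM X K} {V : H →L[ℂ] K} {ρ : H →L[ℂ] H}

theorem IsDilation.diag (hd : P.IsDilation Q V) (ψ : H) : Q.diag (V ψ) = P.diag ψ := by
  ext B hB
  rw [diag_apply _ _ hB, diag_apply _ _ hB, hd.compress B hB, ContinuousLinearMap.comp_apply,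
    ContinuousLinearMap.adjoint_inner_right]
  rfl

theorem IsDilation.inner_map (hd : P.IsDilation Q V) (ψ φ : H) :
    inner ℂ (V ψ) (V φ) = inner ℂ ψ φ := by
  rw [← ContinuousLinearMap.adjoint_inner_right, ← ContinuousLinearMap.comp_apply, hd.isometry]
  rfl

theorem IsDilation.adjoint_apply (hd : P.IsDilation Q V) (ψ : H) :
    ContinuousLinearMap.adjoint V (V ψ) = ψ := by
  rw [← ContinuousLinearMap.comp_apply, hd.isometry]
  rfl

theorem IsDilation.norm_map (hd : P.IsDilation Q V) (ψ : H) : ‖V ψ‖ = ‖ψ‖ := by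
  have := hd.inner_map ψ ψ
  rw [inner_self_eq_norm_sq_to_K, inner_self_eq_norm_sq_to_K] at this
  have h2 : ‖V ψ‖ ^ 2 = ‖ψ‖ ^ 2 := by exact_mod_cast this
  exact (sq_eq_sq₀ (norm_nonneg _) (norm_nonneg _)).1 h2

theorem IsProj.diag_eq_enorm (hQ : Q.IsProj) {B : Set X} (hB : MeasurableSet B) (ζ : K) :
    Q.diag ζ B = ‖Q.op B ζ‖ₑ ^ 2 := by
  have h : inner ℂ ζ (Q.op B ζ) = ((‖Q.op B ζ‖ ^ 2 : ℝ) : ℂ) := by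
    have h1 := (Q.isPositive hB).isSelfAdjoint.isSymmetric ζ (Q.op B ζ)
    have h2 : Q.op B (Q.op B ζ) = Q.op B ζ := by
      rw [← ContinuousLinearMap.comp_apply, hQ B B hB hB, Set.inter_self]
    change inner ℂ (Q.op B ζ) (Q.op B ζ) = inner ℂ ζ (Q.op B (Q.op B ζ)) at h1
    rw [h2, inner_self_eq_norm_sq_to_K] at h1
    rw [← h1]; norm_cast
  rw [diag_apply _ _ hB, h, Complex.ofReal_re, ENNReal.ofReal_pow (norm_nonneg _), ofReal_norm]

theorem IsDilation.law_apply (hd : P.IsDilation Q V) (ρ : H →L[ℂ] H) {B : Set X}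
    (hB : MeasurableSet B) : P.law ρ B = hsSq (Q.op B ∘L V ∘L CFC.sqrt ρ) := by
  rw [law, Measure.sum_apply _ hB, hsSq]
  refine tsum_congr fun e => ?_
  rw [← hd.diag, hd.proj.diag_eq_enorm hB]
  rfl

theorem law_univ (P : QPM X H) (h : IsDensity ρ) : P.law ρ Set.univ = 1 := by
  rw [law, Measure.sum_apply _ MeasurableSet.univ, ← h.hsSq_sqrt, hsSq]
  refine tsum_congr fun e => ?_
  rw [diag_apply _ _ MeasurableSet.univ, P.op_univ, one_apply_eq_self,
    inner_self_eq_norm_sq_to_K, ← ofReal_norm, ← ENNReal.ofReal_pow (norm_nonneg _)]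
  norm_cast

theorem isProbabilityMeasure_law (P : QPM X H) (h : IsDensity ρ) : IsProbabilityMeasure (P.law ρ) :=
  ⟨P.law_univ h⟩

/-- Each single vector distribution is dominated by the law. Hence a function square integrable for
the law can be multiplied onto `V ρ^{1/2} ψ` for every `ψ`, not only for basis vectors. -/
theorem IsDilation.diag_le_law (hd : P.IsDilation Q V) (ρ : H →L[ℂ] H) (ψ : H) :
    P.diag (CFC.sqrt ρ ψ) ≤ (‖ψ‖₊ ^ 2) • P.law ρ := by
  refine Measure.le_iff.2 fun B hB => ?_
  rw [Measure.smul_apply, hd.law_apply ρ hB, ← hd.diag, hd.proj.diag_eq_enorm hB]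
  refine (enorm_apply_sq_le (Q.op B ∘L V ∘L CFC.sqrt ρ) ψ).trans_eq ?_
  rw [ENNReal.smul_def, smul_eq_mul, mul_comm, ENNReal.coe_pow]
  rfl

theorem IsProj.enorm_int_sq (hQ : Q.IsProj) {f : X → ℂ} (hf : BddMeas f) (ζ : K) :
    ‖Q.int f ζ‖ₑ ^ 2 = ∫⁻ x, ‖f x‖ₑ ^ 2 ∂Q.diag ζ := by
  have h := hQ.norm_int_sq hf ζ
  have hi : Integrable (fun x => ‖f x‖ ^ 2) (Q.diag ζ) := by
    obtain ⟨C, hC⟩ := hf.2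
    refine Integrable.of_bound (hf.1.norm.pow_const 2).aestronglyMeasurable (C ^ 2)
      (Eventually.of_forall fun x => ?_)
    rw [Real.norm_of_nonneg (by positivity)]
    exact pow_le_pow_left₀ (norm_nonneg _) (hC x) 2
  have h2 := ofReal_integral_eq_lintegral_ofReal hi (Eventually.of_forall fun x => by positivity)
  rw [← h] at h2
  simpa only [ENNReal.ofReal_pow (norm_nonneg _), ofReal_norm] using h2

theorem IsDilation.hsSq_int (hd : P.IsDilation Q V) {f : X → ℂ} (hf : BddMeas f) (ρ : H →L[ℂ] H) :
    hsSq (Q.int f ∘L V ∘L CFC.sqrt ρ) = ∫⁻ x, ‖f x‖ₑ ^ 2 ∂P.law ρ := by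
  rw [law, lintegral_sum_measure, hsSq]
  refine tsum_congr fun e => ?_
  rw [← hd.diag, ← hd.proj.enorm_int_sq hf]
  rfl

theorem IsDilation.integral_law (hd : P.IsDilation Q V) (h : IsDensity ρ) {f : X → ℂ}
    (hf : BddMeas f) : ∫ x, f x ∂P.law ρ = hsIn (V ∘L CFC.sqrt ρ) (Q.int f ∘L V ∘L CFC.sqrt ρ) := by
  have := P.isProbabilityMeasure_law h
  have hi := hf.integrable (P.law ρ)
  rw [law] at hi
  rw [law, ← (hasSum_integral_measure hi).tsum_eq]
  refine tsum_congr fun e => ?_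
  rw [← hd.diag, ← Q.inner_int_self hf]
  rfl

theorem IsDilation.tr_comp_int (hd : P.IsDilation Q V) (h : IsDensity ρ) {f : X → ℂ}
    (hf : BddMeas f) : tr (ρ ∘L ContinuousLinearMap.adjoint V ∘L Q.int f ∘L V) =
      ∫ x, f x ∂P.law ρ := by
  rw [h.tr_comp, hd.integral_law h hf, hsIn_comp_left]
  rfl

end QPM

end

section


/-! ### Truncated functional calculus -/

section Cut

variable {n : ℕ}

/-- The restriction of a continuous function to the ball of radius `N`, extended by zero. -/
def cutFun (N : ℕ) (f : C(Fin n → ℂ, ℂ)) : (Fin n → ℂ) → ℂ :=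
  (Metric.closedBall (0 : Fin n → ℂ) N).indicator f

theorem measurableSet_ball (N : ℕ) : MeasurableSet (Metric.closedBall (0 : Fin n → ℂ) N) :=
  Metric.isClosed_closedBall.measurableSet

theorem cutFun_bddMeas (N : ℕ) (f : C(Fin n → ℂ, ℂ)) : BddMeas (cutFun N f) := by
  refine ⟨f.continuous.measurable.indicator (measurableSet_ball N), ?_⟩
  obtain ⟨C, hC⟩ := (isCompact_closedBall (0 : Fin n → ℂ) (N : ℝ)).exists_bound_of_continuousOn
    f.continuous.continuousOn
  refine ⟨max C 0, fun x => ?_⟩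
  by_cases hx : x ∈ Metric.closedBall (0 : Fin n → ℂ) N
  · simpa [cutFun, hx] using Or.inl (hC x hx)
  · simp [cutFun, hx]

theorem cutFun_mul_of_le {N M : ℕ} (h : N ≤ M) (f g : C(Fin n → ℂ, ℂ)) :
    cutFun N f * cutFun M g = cutFun N (f * g) := by
  ext x
  by_cases hx : x ∈ Metric.closedBall (0 : Fin n → ℂ) N
  · have hx' : x ∈ Metric.closedBall (0 : Fin n → ℂ) M :=
      Metric.closedBall_subset_closedBall (by exact_mod_cast h) hx
    simp only [cutFun, Pi.mul_apply, Set.indicator_of_mem hx, Set.indicator_of_mem hx',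
      ContinuousMap.mul_apply]
  · simp only [cutFun, Pi.mul_apply, Set.indicator_of_notMem hx, zero_mul]

theorem iUnion_ball : ⋃ N : ℕ, Metric.closedBall (0 : Fin n → ℂ) N = Set.univ := by
  refine Set.eq_univ_of_forall fun x => ?_
  obtain ⟨N, hN⟩ := exists_nat_ge ‖x‖
  exact Set.mem_iUnion.2 ⟨N, by simpa using hN⟩

theorem ball_mono : Monotone fun N : ℕ => Metric.closedBall (0 : Fin n → ℂ) N :=
  fun _ _ h => Metric.closedBall_subset_closedBall (by exact_mod_cast h)

theorem tendsto_measure_compl_ball (μ : Measure (Fin n → ℂ)) [IsFiniteMeasure μ] :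
    Tendsto (fun N : ℕ => μ (Metric.closedBall (0 : Fin n → ℂ) N)ᶜ) atTop (𝓝 0) := by
  have := tendsto_measure_iInter_atTop (μ := μ)
    (s := fun N : ℕ => (Metric.closedBall (0 : Fin n → ℂ) N)ᶜ)
    (fun N => (measurableSet_ball N).compl.nullMeasurableSet)
    (fun _ _ h => Set.compl_subset_compl.2 (ball_mono h)) ⟨0, measure_ne_top _ _⟩
  rwa [← Set.compl_iUnion, iUnion_ball, Set.compl_univ, measure_empty] at this

variable {K : Type*} [NormedAddCommGroup K] [InnerProductSpace ℂ K] [CompleteSpace K]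

/-- The operator `∫_{|κ| ≤ N} f dQ`. -/
def QPM.cut (Q : QPM (Fin n → ℂ) K) (N : ℕ) (f : C(Fin n → ℂ, ℂ)) : K →L[ℂ] K := Q.int (cutFun N f)

namespace QPM

variable {Q : QPM (Fin n → ℂ) K}

theorem cut_add (Q : QPM (Fin n → ℂ) K) (N : ℕ) (f g : C(Fin n → ℂ, ℂ)) :
    Q.cut N (f + g) = Q.cut N f + Q.cut N g := by
  rw [cut, cut, cut, ← Q.int_add (cutFun_bddMeas N f) (cutFun_bddMeas N g)]
  congr 1
  exact Set.indicator_add _ _ _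

theorem cut_smul (Q : QPM (Fin n → ℂ) K) (N : ℕ) (c : ℂ) (f : C(Fin n → ℂ, ℂ)) :
    Q.cut N (c • f) = c • Q.cut N f := by
  rw [cut, cut, ← Q.int_smul (cutFun_bddMeas N f)]
  congr 1
  ext x
  by_cases hx : x ∈ Metric.closedBall (0 : Fin n → ℂ) N <;> simp [cutFun, hx]

/-- The truncated functional calculus as a linear map. -/
def cutₗ (Q : QPM (Fin n → ℂ) K) (N : ℕ) : C(Fin n → ℂ, ℂ) →ₗ[ℂ] K →L[ℂ] K where
  toFun := Q.cut N
  map_add' := Q.cut_add N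
  map_smul' := Q.cut_smul N

theorem cut_sub (Q : QPM (Fin n → ℂ) K) (N : ℕ) (f g : C(Fin n → ℂ, ℂ)) :
    Q.cut N (f - g) = Q.cut N f - Q.cut N g := map_sub (Q.cutₗ N) f g

theorem cut_neg (Q : QPM (Fin n → ℂ) K) (N : ℕ) (f : C(Fin n → ℂ, ℂ)) :
    Q.cut N (-f) = -Q.cut N f := map_neg (Q.cutₗ N) f

theorem cut_sum (Q : QPM (Fin n → ℂ) K) (N : ℕ) {ι : Type*} (s : Finset ι)
    (f : ι → C(Fin n → ℂ, ℂ)) : Q.cut N (∑ i ∈ s, f i) = ∑ i ∈ s, Q.cut N (f i) :=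
  map_sum (Q.cutₗ N) f s

theorem adjoint_cut (Q : QPM (Fin n → ℂ) K) (N : ℕ) (f : C(Fin n → ℂ, ℂ)) :
    ContinuousLinearMap.adjoint (Q.cut N f) = Q.cut N (star f) := by
  rw [cut, cut, ← Q.int_conj (cutFun_bddMeas N f)]
  congr 1
  ext x
  by_cases hx : x ∈ Metric.closedBall (0 : Fin n → ℂ) N <;> simp [cutFun, hx]

theorem IsProj.cut_mul_of_le (hQ : Q.IsProj) {N M : ℕ} (h : N ≤ M) (f g : C(Fin n → ℂ, ℂ)) :
    Q.cut N (f * g) = Q.cut N f ∘L Q.cut M g := by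
  rw [cut, cut, cut, ← hQ.int_mul (cutFun_bddMeas N f) (cutFun_bddMeas M g), cutFun_mul_of_le h]

theorem IsProj.cut_mul (hQ : Q.IsProj) (N : ℕ) (f g : C(Fin n → ℂ, ℂ)) :
    Q.cut N (f * g) = Q.cut N f ∘L Q.cut N g := hQ.cut_mul_of_le le_rfl f g

theorem IsProj.cut_comp_apply (hQ : Q.IsProj) (N : ℕ) (f g : C(Fin n → ℂ, ℂ)) (ζ : K) :
    Q.cut N f (Q.cut N g ζ) = Q.cut N (f * g) ζ := by
  rw [hQ.cut_mul]; rfl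

theorem cut_one (Q : QPM (Fin n → ℂ) K) (N : ℕ) :
    Q.cut N 1 = Q.op (Metric.closedBall (0 : Fin n → ℂ) N) := by
  have := Q.int_indicator (measurableSet_ball (n := n) N) 1
  rw [one_smul] at this
  exact this

theorem IsProj.enorm_cut_sq (hQ : Q.IsProj) (N : ℕ) (f : C(Fin n → ℂ, ℂ)) (ζ : K) :
    ‖Q.cut N f ζ‖ₑ ^ 2 = ∫⁻ x in Metric.closedBall 0 N, ‖f x‖ₑ ^ 2 ∂Q.diag ζ := by
  rw [cut, hQ.enorm_int_sq (cutFun_bddMeas N f), ← lintegral_indicator (measurableSet_ball N)]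
  refine lintegral_congr fun x => ?_
  by_cases hx : x ∈ Metric.closedBall (0 : Fin n → ℂ) N <;> simp [cutFun, hx]

theorem IsProj.enorm_cut_sub_sq_le (hQ : Q.IsProj) {N M : ℕ} (h : N ≤ M) (f : C(Fin n → ℂ, ℂ))
    (ζ : K) : ‖Q.cut M f ζ - Q.cut N f ζ‖ₑ ^ 2 ≤
      ∫⁻ x in (Metric.closedBall 0 N)ᶜ, ‖f x‖ₑ ^ 2 ∂Q.diag ζ := by
  have hb : BddMeas (cutFun M f + (-1 : ℂ) • cutFun N f) :=
    (cutFun_bddMeas M f).add ((cutFun_bddMeas N f).const_smul _)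
  have : Q.cut M f ζ - Q.cut N f ζ = Q.int (cutFun M f + (-1 : ℂ) • cutFun N f) ζ := by
    rw [Q.int_add (cutFun_bddMeas M f) ((cutFun_bddMeas N f).const_smul _),
      Q.int_smul (cutFun_bddMeas N f), neg_one_smul, ← sub_eq_add_neg]
    rfl
  rw [this, hQ.enorm_int_sq hb, ← lintegral_indicator (measurableSet_ball N).compl]
  refine lintegral_mono fun x => ?_
  by_cases hx : x ∈ Metric.closedBall (0 : Fin n → ℂ) N
  · have hx' : x ∈ Metric.closedBall (0 : Fin n → ℂ) M := ball_mono h hx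
    simp only [cutFun, Pi.add_apply, Pi.smul_apply, Set.indicator_of_mem hx,
      Set.indicator_of_mem hx', smul_eq_mul, neg_one_mul, add_neg_cancel]
    simp
  · have hx2 : x ∈ (Metric.closedBall (0 : Fin n → ℂ) N)ᶜ := hx
    simp only [cutFun, Pi.add_apply, Pi.smul_apply, Set.indicator_of_notMem hx, smul_zero,
      add_zero, Set.indicator_of_mem hx2]
    by_cases hx' : x ∈ Metric.closedBall (0 : Fin n → ℂ) M <;> simp [hx']

theorem IsProj.tendsto_cut_one (hQ : Q.IsProj) (ζ : K) :
    Tendsto (fun N => Q.cut N 1 ζ) atTop (𝓝 ζ) := by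
  rw [tendsto_iff_edist_tendsto_0]
  have h : ∀ N, ‖Q.cut N 1 ζ - ζ‖ₑ ^ 2 = Q.diag ζ (Metric.closedBall (0 : Fin n → ℂ) N)ᶜ := by
    intro N
    rw [hQ.diag_eq_enorm (measurableSet_ball N).compl, cut_one]
    have : Q.op (Metric.closedBall (0 : Fin n → ℂ) N) + Q.op (Metric.closedBall (0 : Fin n → ℂ) N)ᶜ = 1 := by
      rw [← Q.op_union (measurableSet_ball N) (measurableSet_ball N).compl disjoint_compl_right,
        Set.union_compl_self, Q.op_univ]
    rw [← eq_sub_iff_add_eq'] at this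
    rw [this, _root_.sub_apply, one_apply_eq_self, ← enorm_neg, neg_sub]
  have h2 := tendsto_measure_compl_ball (Q.diag ζ)
  simp only [← h] at h2
  have h3 := (ENNReal.continuous_rpow_const (y := 2⁻¹)).tendsto _ |>.comp h2
  rw [ENNReal.zero_rpow_of_pos (by norm_num)] at h3
  refine h3.congr fun N => ?_
  rw [Function.comp, edist_eq_enorm_sub, ← ENNReal.rpow_natCast, ← ENNReal.rpow_mul]
  norm_num

theorem IsProj.eq_of_cut_one (hQ : Q.IsProj) {ζ η : K} (h : ∀ N, Q.cut N 1 ζ = Q.cut N 1 η) :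
    ζ = η :=
  tendsto_nhds_unique (hQ.tendsto_cut_one ζ) (by simpa only [h] using hQ.tendsto_cut_one η)

/-- The vector `f(Q) ζ` is the limit of its truncations, which form a Cauchy sequence because the
tails of the integral of `|f|²` vanish. -/
theorem IsProj.exists_mul (hQ : Q.IsProj) {f : C(Fin n → ℂ, ℂ)} {ζ : K}
    (hf : ∫⁻ x, ‖f x‖ₑ ^ 2 ∂Q.diag ζ ≠ ∞) :
    ∃ η, (∀ N, Q.cut N 1 η = Q.cut N f ζ) ∧ Tendsto (fun N => Q.cut N f ζ) atTop (𝓝 η) := by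
  have hc : CauchySeq fun N => Q.cut N f ζ := by
    have h0 := tendsto_setLIntegral_zero hf (tendsto_measure_compl_ball (Q.diag ζ))
    have h3 := (ENNReal.continuous_rpow_const (y := 2⁻¹)).tendsto _ |>.comp h0
    rw [ENNReal.zero_rpow_of_pos (by norm_num)] at h3
    rw [EMetric.cauchySeq_iff']
    intro ε hε
    obtain ⟨N, hN⟩ := (h3.eventually (gt_mem_nhds hε)).exists
    refine ⟨N, fun M hM => lt_of_le_of_lt ?_ hN⟩
    have := ENNReal.rpow_le_rpow (hQ.enorm_cut_sub_sq_le hM f ζ) (z := 2⁻¹) (by norm_num)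
    rw [← ENNReal.rpow_natCast, ← ENNReal.rpow_mul] at this
    norm_num at this
    rw [edist_eq_enorm_sub]
    simpa using this
  obtain ⟨η, hη⟩ := cauchySeq_tendsto_of_complete hc
  refine ⟨η, fun N => ?_, hη⟩
  refine tendsto_nhds_unique (((Q.cut N 1).continuous.tendsto η).comp hη) ?_
  refine tendsto_const_nhds.congr' ?_
  filter_upwards [eventually_ge_atTop N] with M hM
  rw [Function.comp, ← ContinuousLinearMap.comp_apply, ← hQ.cut_mul_of_le hM, one_mul]

theorem IsProj.enorm_sq_of_mul (hQ : Q.IsProj) {f : C(Fin n → ℂ, ℂ)} {ζ η : K}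
    (h : ∀ N, Q.cut N 1 η = Q.cut N f ζ) : ‖η‖ₑ ^ 2 = ∫⁻ x, ‖f x‖ₑ ^ 2 ∂Q.diag ζ := by
  have h1 : Tendsto (fun N => ‖Q.cut N f ζ‖ₑ ^ 2) atTop (𝓝 (‖η‖ₑ ^ 2)) := by
    simp only [← h]
    exact ((ENNReal.continuous_pow 2).tendsto _).comp
      ((continuous_enorm.tendsto _).comp (hQ.tendsto_cut_one η))
  simp only [hQ.enorm_cut_sq] at h1
  refine tendsto_nhds_unique h1 ?_
  have h2 := tendsto_measure_iUnion_atTop (μ := (Q.diag ζ).withDensity fun x => ‖f x‖ₑ ^ 2)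
    (ball_mono (n := n))
  rw [iUnion_ball, withDensity_apply _ MeasurableSet.univ, setLIntegral_univ] at h2
  refine h2.congr fun N => ?_
  rw [Function.comp, withDensity_apply _ (measurableSet_ball N)]

end QPM

/-- The function `κ ↦ conj κ_j`. -/
def coordC (j : Fin n) : C(Fin n → ℂ, ℂ) := ⟨fun κ => conj (κ j), by fun_prop⟩

/-- The linear function `κ ↦ ∑ b_j conj κ_j`. -/
def linC (b : Fin n → ℂ) : C(Fin n → ℂ, ℂ) := ∑ j, b j • coordC j

/-- The function `κ ↦ exp (∑ b_j conj κ_j)`. -/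
def expC (b : Fin n → ℂ) : C(Fin n → ℂ, ℂ) := ⟨fun κ => Complex.exp (linC b κ), by fun_prop⟩

@[simp]
theorem coordC_apply (j : Fin n) (κ : Fin n → ℂ) : coordC j κ = conj (κ j) := rfl

theorem linC_apply (b κ : Fin n → ℂ) : linC b κ = ∑ j, b j * conj (κ j) := by
  simp [linC, ContinuousMap.sum_apply]

theorem expC_apply (b κ : Fin n → ℂ) : expC b κ = Complex.exp (linC b κ) := rfl

theorem linC_add (b c : Fin n → ℂ) : linC (b + c) = linC b + linC c := by
  ext κ
  simp [linC_apply, add_mul, Finset.sum_add_distrib]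

theorem linC_smul (z : ℂ) (b : Fin n → ℂ) : linC (z • b) = z • linC b := by
  ext κ
  simp [linC_apply, Finset.mul_sum, mul_assoc]

theorem expC_add (b c : Fin n → ℂ) : expC (b + c) = expC b * expC c := by
  ext κ
  simp [expC_apply, linC_add, Complex.exp_add]

theorem expC_zero : expC (0 : Fin n → ℂ) = 1 := by
  ext κ
  simp [expC_apply, linC_apply]

theorem expC_mul_neg (b : Fin n → ℂ) : expC b * expC (-b) = 1 := by
  rw [← expC_add, add_neg_cancel, expC_zero]

theorem norm_linC_le (b κ : Fin n → ℂ) : ‖linC b κ‖ ≤ n * ‖b‖ * ‖κ‖ := by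
  rw [linC_apply]
  refine (norm_sum_le _ _).trans ?_
  have : ∀ j ∈ Finset.univ, ‖b j * conj (κ j)‖ ≤ ‖b‖ * ‖κ‖ := fun j _ => by
    rw [norm_mul, RCLike.norm_conj]
    exact mul_le_mul (norm_le_pi_norm b j) (norm_le_pi_norm κ j) (norm_nonneg _) (norm_nonneg _)
  refine (Finset.sum_le_sum this).trans_eq ?_
  simp [mul_assoc]

end Cut

end

section


/-! ### Calculus on `ℂⁿ` -/

section Calculus

variable {n : ℕ}

theorem eq_sum_single_re_im (v : Fin n → ℂ) :
    v = ∑ k, ((v k).re • (Pi.single k 1 : Fin n → ℂ) + (v k).im • (Pi.single k Complex.I : Fin n → ℂ)) := by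
  ext i
  rw [Finset.sum_apply, Finset.sum_eq_single i]
  · simp
  · intro k _ hk
    simp [Pi.single_eq_of_ne hk.symm]
  · simp

theorem fderiv_eq_sum_dz (f : (Fin n → ℂ) → ℂ) (a v : Fin n → ℂ) :
    fderiv ℝ f a v = ∑ k, (dz f k a * v k + dzbar f k a * conj (v k)) := by
  conv_lhs => rw [eq_sum_single_re_im v]
  rw [map_sum]
  refine Finset.sum_congr rfl fun k _ => ?_
  rw [map_add, map_smul, map_smul, dz, dzbar, Complex.real_smul, Complex.real_smul]
  have h1 : v k = (v k).re + (v k).im * Complex.I := (Complex.re_add_im _).symm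
  have h2 : conj (v k) = (v k).re - (v k).im * Complex.I := by
    apply Complex.ext <;> simp
  generalize fderiv ℝ f a (Pi.single k 1) = x
  generalize fderiv ℝ f a (Pi.single k Complex.I) = y
  rw [h2]
  nth_rw 3 [h1]
  ring_nf
  rw [Complex.I_sq]
  ring

theorem dz_eq_of_hasFDerivAt {f : (Fin n → ℂ) → ℂ} {f' : (Fin n → ℂ) →L[ℂ] ℂ} {a : Fin n → ℂ}
    (h : HasFDerivAt f f' a) (k : Fin n) : dz f k a = f' (Pi.single k 1) := by
  have h1 : fderiv ℝ f a = f'.restrictScalars ℝ := (h.restrictScalars ℝ).fderiv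
  have h2 : (Pi.single k Complex.I : Fin n → ℂ) = Complex.I • Pi.single k 1 := by
    rw [← Pi.single_smul, smul_eq_mul, mul_one]
  rw [dz, h1, ContinuousLinearMap.coe_restrictScalars', h2, map_smul, smul_eq_mul, ← mul_assoc,
    Complex.I_mul_I]
  ring

theorem dzbar_eq_of_hasFDerivAt {f : (Fin n → ℂ) → ℂ} {f' : (Fin n → ℂ) →L[ℂ] ℂ} {a : Fin n → ℂ}
    (h : HasFDerivAt f f' a) (k : Fin n) : dzbar f k a = 0 := by
  have h1 : fderiv ℝ f a = f'.restrictScalars ℝ := (h.restrictScalars ℝ).fderiv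
  have h2 : (Pi.single k Complex.I : Fin n → ℂ) = Complex.I • Pi.single k 1 := by
    rw [← Pi.single_smul, smul_eq_mul, mul_one]
  rw [dzbar, h1, ContinuousLinearMap.coe_restrictScalars', h2, map_smul, smul_eq_mul, ← mul_assoc,
    Complex.I_mul_I]
  ring

/-- The complex linear map with prescribed values on the standard basis. -/
def coordForm (c : Fin n → ℂ) : (Fin n → ℂ) →L[ℂ] ℂ := ∑ k, c k • ContinuousLinearMap.proj k

theorem coordForm_apply (c v : Fin n → ℂ) : coordForm c v = ∑ k, c k * v k := by
  simp [coordForm]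

theorem coordForm_single (c : Fin n → ℂ) (k : Fin n) : coordForm c (Pi.single k 1) = c k := by
  simp [coordForm_apply, Pi.single_apply]

theorem eq_coordForm (L : (Fin n → ℂ) →L[ℂ] ℂ) : L = coordForm fun k => L (Pi.single k 1) := by
  ext v
  conv_lhs => rw [pi_eq_sum_univ' v]
  rw [map_sum, coordForm_apply]
  refine Finset.sum_congr rfl fun k _ => ?_
  rw [map_smul, smul_eq_mul, mul_comm]

/-- The Cauchy-Riemann equations. -/
theorem hasFDerivAt_of_dzbar_eq_zero {f : (Fin n → ℂ) → ℂ} {a : Fin n → ℂ}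
    (hf : DifferentiableAt ℝ f a) (h : ∀ k, dzbar f k a = 0) :
    HasFDerivAt f (coordForm fun k => dz f k a) a := by
  refine hasFDerivAt_of_restrictScalars ℝ hf.hasFDerivAt ?_
  ext v
  rw [ContinuousLinearMap.coe_restrictScalars', coordForm_apply, fderiv_eq_sum_dz]
  simp [h]

theorem dzbar_conj (f : (Fin n → ℂ) → ℂ) (k : Fin n) (a : Fin n → ℂ) :
    dzbar (fun b => conj (f b)) k a = conj (dz f k a) := by
  have h : ∀ v, fderiv ℝ (fun b => conj (f b)) a v = conj (fderiv ℝ f a v) := by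
    intro v
    have := Complex.conjCLE.comp_fderiv (f := f) (x := a)
    have h2 : (Complex.conjCLE ∘ f) = fun b => conj (f b) := by ext; simp
    rw [h2] at this
    rw [this]
    simp
  rw [dzbar, dz, h, h, map_mul, map_sub, map_mul, Complex.conj_I, map_div₀, map_one, map_ofNat]
  ring

theorem dz_congr {f g : (Fin n → ℂ) → ℂ} {a : Fin n → ℂ} (h : f =ᶠ[𝓝 a] g) (k : Fin n) :
    dz f k a = dz g k a := by
  rw [dz, dz, h.fderiv_eq]

theorem dzbar_congr {f g : (Fin n → ℂ) → ℂ} {a : Fin n → ℂ} (h : f =ᶠ[𝓝 a] g) (k : Fin n) :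
    dzbar f k a = dzbar g k a := by
  rw [dzbar, dzbar, h.fderiv_eq]

/-- A solution on a connected set of a homogeneous linear differential equation with locally
bounded coefficients that vanishes at one point vanishes everywhere. -/
theorem eqOn_zero_of_hasDerivAt {E : Type*} [NormedAddCommGroup E] [NormedSpace ℝ E] {O : Set E}
    (hO : IsOpen O) (hOc : IsPreconnected O) {W : E → ℂ} {Λ : E → E → ℂ}
    (hΛ : ∀ a ∈ O, ∃ C, ∀ᶠ b in 𝓝 a, ∀ v, ‖Λ b v‖ ≤ C * ‖v‖)
    (hW : ∀ a ∈ O, ∀ v, HasDerivAt (fun t : ℝ => W (a + t • v)) (Λ a v * W a) 0)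
    {a₀ : E} (ha₀ : a₀ ∈ O) (h0 : W a₀ = 0) : ∀ a ∈ O, W a = 0 := by
  intro a ha
  refine hOc.induction₂' (fun x y => W x = 0 → W y = 0) ?_ (fun x y z _ _ _ h1 h2 h => h2 (h1 h))
    ha₀ ha h0
  intro x hx
  obtain ⟨C, hC⟩ := hΛ x hx
  obtain ⟨r, hr, hball⟩ := Metric.eventually_nhds_iff_ball.1 (hC.and (hO.mem_nhds hx))
  -- Inside a ball, Grönwall's inequality along the segment carries a zero of `W` from any point to
  -- any other; the relation is transitive and thus propagates over the connected set.
  have key : ∀ y ∈ Metric.ball x r, ∀ z ∈ Metric.ball x r, W y = 0 → W z = 0 := by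
    intro y hy z hz hy0
    have hseg : ∀ t ∈ Set.Icc (0 : ℝ) 1, y + t • (z - y) ∈ Metric.ball x r := fun t ht =>
      (convex_ball x r).add_smul_sub_mem hy hz ht
    have hd : ∀ t ∈ Set.Icc (0 : ℝ) 1, HasDerivAt (fun t : ℝ => W (y + t • (z - y)))
        (Λ (y + t • (z - y)) (z - y) * W (y + t • (z - y))) t := by
      intro t ht
      have h1 := hW _ (hball _ (hseg t ht)).2 (z - y)
      have h2 := HasDerivAt.comp_sub_const t t (f := fun s : ℝ => W (y + t • (z - y) + s • (z - y)))
        (f' := Λ (y + t • (z - y)) (z - y) * W (y + t • (z - y))) (by simpa using h1)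
      refine h2.congr_of_eventuallyEq (Eventually.of_forall fun s => ?_)
      simp only [add_assoc, ← add_smul]
      congr 3
      ring_nf
    have := eq_zero_of_abs_deriv_le_mul_abs_self_of_eq_zero_right
      (f := fun t : ℝ => W (y + t • (z - y)))
      (f' := fun t => Λ (y + t • (z - y)) (z - y) * W (y + t • (z - y))) (K := C * ‖z - y‖)
      (a := 0) (b := 1)
      (fun t ht => (hd t ht).continuousAt.continuousWithinAt)
      (fun t ht => (hd t (Set.Ico_subset_Icc_self ht)).hasDerivWithinAt) (by simpa using hy0)
      (fun t ht => by
        rw [norm_mul]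
        gcongr
        exact (hball _ (hseg t (Set.Ico_subset_Icc_self ht))).1 _) 1 (by simp)
    simpa using this
  filter_upwards [mem_nhdsWithin_of_mem_nhds (Metric.ball_mem_nhds x hr)] with y hy
  exact ⟨key x (Metric.mem_ball_self hr) y hy, key y hy x (Metric.mem_ball_self hr)⟩

/-! ### Holomorphic functions of several variables -/

section Holomorphic

variable {O : Set (Fin n → ℂ)} {f : (Fin n → ℂ) → ℂ}

theorem hasDerivAt_line {a v : Fin n → ℂ} {z : ℂ} {f' : (Fin n → ℂ) →L[ℂ] ℂ}
    (h : HasFDerivAt f f' (a + z • v)) : HasDerivAt (fun z : ℂ => f (a + z • v)) (f' v) z := by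
  have h1 : HasDerivAt (fun z : ℂ => a + z • v) v z := by
    simpa using ((hasDerivAt_id z).smul_const v).const_add a
  exact h.comp_hasDerivAt z h1

/-- Cauchy's estimate on complex lines: near `a` the function is bounded by `‖f a‖ + 1`, and the
discs in direction `v` of radius less than `(r / 2) / ‖v‖` stay in that neighbourhood. No continuity
of the derivative is presupposed. -/
theorem exists_bound_fderiv (hO : IsOpen O) (hf : DifferentiableOn ℂ f O) {a : Fin n → ℂ}
    (ha : a ∈ O) : ∃ r > 0, ∃ C, ∀ b ∈ Metric.ball a r, b ∈ O ∧ ‖fderiv ℂ f b‖ ≤ C := by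
  obtain ⟨r, hr, hball⟩ := Metric.eventually_nhds_iff_ball.1 ((hO.eventually_mem ha).and
    ((hf.differentiableAt (hO.mem_nhds ha)).continuousAt.norm.eventually_lt_const
      (lt_add_one ‖f a‖)))
  have hC : 0 ≤ ‖f a‖ + 1 := by positivity
  refine ⟨r / 2, half_pos hr, (‖f a‖ + 1) / (r / 2), fun b hb => ?_⟩
  have hbr : ∀ c, ‖c - b‖ < r / 2 → c ∈ Metric.ball a r := by
    intro c hc
    rw [mem_ball_iff_norm] at hb ⊢
    calc ‖c - a‖ = ‖(c - b) + (b - a)‖ := by rw [sub_add_sub_cancel]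
      _ < r := (norm_add_le _ _).trans_lt (by linarith)
  refine ⟨(hball b (hbr b (by simpa using half_pos hr))).1, ?_⟩
  refine ContinuousLinearMap.opNorm_le_bound _ (by positivity) fun v => ?_
  rcases eq_or_ne v 0 with rfl | hv
  · simp
  have hv' : 0 < ‖v‖ := norm_pos_iff.2 hv
  refine le_of_forall_pos_lt_add fun ε hε => ?_
  have hmem : ∀ ρ < r / 2 / ‖v‖, ∀ z : ℂ, ‖z‖ ≤ ρ → b + z • v ∈ Metric.ball a r := by
    intro ρ hρ z hz
    refine hbr _ ?_
    rw [add_sub_cancel_left, norm_smul]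
    exact (lt_div_iff₀ hv').1 (hz.trans_lt hρ)
  -- The closed disc must stay inside the open ball, so `ρ` is strictly smaller than the critical
  -- radius; the limit is taken afterwards.
  have hle : ∀ ρ, 0 < ρ → ρ < r / 2 / ‖v‖ → ‖fderiv ℂ f b v‖ ≤ (‖f a‖ + 1) / ρ := by
    intro ρ hρ0 hρ
    have hd : ∀ z ∈ Metric.closedBall (0 : ℂ) ρ,
        HasDerivAt (fun z : ℂ => f (b + z • v)) (fderiv ℂ f (b + z • v) v) z := fun z hz =>
      hasDerivAt_line (hf.differentiableAt (hO.mem_nhds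
        (hball _ (hmem ρ hρ z (by simpa using hz))).1)).hasFDerivAt
    have h1 := Complex.norm_deriv_le_of_forall_mem_sphere_norm_le hρ0 (c := 0)
      (f := fun z : ℂ => f (b + z • v)) (C := ‖f a‖ + 1)
      (DifferentiableOn.diffContOnCl_ball (U := Metric.closedBall 0 ρ)
        (fun z hz => (hd z hz).differentiableAt.differentiableWithinAt) subset_rfl)
      (fun z hz => (hball _ (hmem ρ hρ z (by simpa using hz.le))).2.le)
    have h2 := hd 0 (by simp [hρ0.le])
    rw [h2.deriv] at h1
    simpa using h1
  have hlim : Tendsto (fun ρ => (‖f a‖ + 1) / ρ) (𝓝[<] (r / 2 / ‖v‖))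
      (𝓝 ((‖f a‖ + 1) / (r / 2 / ‖v‖))) :=
    (tendsto_const_nhds.div tendsto_id (by positivity)).mono_left nhdsWithin_le_nhds
  have h3 := ge_of_tendsto hlim (b := ‖fderiv ℂ f b v‖) (by
    filter_upwards [self_mem_nhdsWithin, mem_nhdsWithin_of_mem_nhds
      (lt_mem_nhds (show 0 < r / 2 / ‖v‖ by positivity))] with ρ h1 h2
    exact hle ρ h2 h1)
  have h4 : (‖f a‖ + 1) / (r / 2 / ‖v‖) = (‖f a‖ + 1) / (r / 2) * ‖v‖ := by field_simp
  linarith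

/-- Cauchy's formula writes the directional derivative as a circle integral of `f`. Differentiation
under the integral in the base point is justified by the local bound on `fderiv ℂ f`. -/
theorem differentiableOn_fderiv_apply (hO : IsOpen O) (hf : DifferentiableOn ℂ f O)
    {v : Fin n → ℂ} (hv : ‖v‖ ≤ 1) : DifferentiableOn ℂ (fun a => fderiv ℂ f a v) O := by
  intro a ha
  obtain ⟨r, hr, C, hball⟩ := exists_bound_fderiv hO hf ha
  -- Base points range over the ball of radius `r / 2`, and `‖v‖ ≤ 1`, so circles of radius `r / 4`
  -- remain in the ball of radius `r`.
  set ρ := r / 4 with hρ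
  have hρ0 : 0 < ρ := by positivity
  have hmem : ∀ b ∈ Metric.ball a (r / 2), ∀ z : ℂ, ‖z‖ ≤ ρ → b + z • v ∈ Metric.ball a r := by
    intro b hb z hz
    rw [mem_ball_iff_norm] at hb ⊢
    have h1 : ‖z • v‖ ≤ ρ := by
      rw [norm_smul]
      exact (mul_le_of_le_one_right (norm_nonneg _) hv).trans hz
    calc ‖b + z • v - a‖ = ‖(b - a) + z • v‖ := by rw [add_sub_right_comm]
      _ < r := (norm_add_le _ _).trans_lt (by linarith)
  have hdiff : ∀ b ∈ Metric.ball a (r / 2), ∀ z : ℂ, ‖z‖ ≤ ρ →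
      HasFDerivAt f (fderiv ℂ f (b + z • v)) (b + z • v) := fun b hb z hz =>
    (hf.differentiableAt (hO.mem_nhds (hball _ (hmem b hb z hz)).1)).hasFDerivAt
  have hcirc : ∀ θ, ‖circleMap 0 ρ θ‖ ≤ ρ := fun θ => by simp [abs_of_pos hρ0]
  set k : ℝ → ℂ := fun θ => deriv (circleMap 0 ρ) θ * ((circleMap 0 ρ θ) ^ 2)⁻¹ with hk
  have hkc : Continuous k := by
    simp only [hk, deriv_circleMap]
    refine ((continuous_circleMap 0 ρ).mul continuous_const).mul
      (((continuous_circleMap 0 ρ).pow 2).inv₀ fun θ => ?_)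
    simp [hρ0.ne']
  have hline : ∀ b ∈ Metric.ball a (r / 2), Continuous fun θ => f (b + circleMap 0 ρ θ • v) := by
    intro b hb
    refine continuous_iff_continuousAt.2 fun θ => ?_
    refine ContinuousAt.comp (g := f) (hdiff b hb _ (hcirc θ)).continuousAt ?_
    exact (continuous_const.add ((continuous_circleMap 0 ρ).smul continuous_const)).continuousAt
  have heq : ∀ b ∈ Metric.ball a (r / 2), fderiv ℂ f b v =
      (2 * Real.pi * Complex.I : ℂ)⁻¹ • ∫ θ in (0)..(2 * Real.pi), k θ * f (b + circleMap 0 ρ θ • v) := by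
    intro b hb
    have hU : IsOpen ((fun z : ℂ => b + z • v) ⁻¹' O) := hO.preimage (by fun_prop)
    have h1 := Complex.two_pi_I_inv_smul_circleIntegral_sub_sq_inv_smul_of_differentiable
      (c := 0) (w₀ := 0) (R := ρ) (f := fun z : ℂ => f (b + z • v)) hU
      (fun z hz => (hball _ (hmem b hb z (by simpa using hz))).1)
      (hf.comp (by fun_prop) fun z hz => hz) (by simpa using hρ0)
    have h2 := hasDerivAt_line (z := 0) (hdiff b hb 0 (by simpa using hρ0.le))
    rw [h2.deriv] at h1
    simp only [zero_smul, add_zero] at h1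
    rw [← h1, circleIntegral]
    simp only [hk, sub_zero, smul_eq_mul, mul_assoc]
  have hmain : HasFDerivAt (fun b => ∫ θ in (0)..(2 * Real.pi), k θ * f (b + circleMap 0 ρ θ • v))
      (∫ θ in (0)..(2 * Real.pi), k θ • fderiv ℂ f (a + circleMap 0 ρ θ • v)) a := by
    have hs : Metric.ball a (r / 2) ∈ 𝓝 a := Metric.ball_mem_nhds a (half_pos hr)
    have haB : a ∈ Metric.ball a (r / 2) := Metric.mem_ball_self (half_pos hr)
    refine intervalIntegral.hasFDerivAt_integral_of_dominated_of_fderiv_le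
      (F := fun b θ => k θ * f (b + circleMap 0 ρ θ • v))
      (F' := fun b θ => k θ • fderiv ℂ f (b + circleMap 0 ρ θ • v))
      (bound := fun θ => ‖k θ‖ * C) hs ?_ ?_ ?_ ?_ ?_ ?_
    · filter_upwards [hs] with b hb
      exact (hkc.mul (hline b hb)).aestronglyMeasurable
    · exact (hkc.mul (hline a haB)).intervalIntegrable _ _
    · have : SecondCountableTopology ((Fin n → ℂ) →L[ℂ] ℂ) := by
        have := FiniteDimensional.proper ℂ ((Fin n → ℂ) →L[ℂ] ℂ)
        infer_instance
      refine (hkc.stronglyMeasurable.smul ?_).aestronglyMeasurable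
      refine ((measurable_fderiv ℂ f).comp ?_).stronglyMeasurable
      exact (continuous_const.add
        ((continuous_circleMap 0 ρ).smul continuous_const)).measurable
    · refine Eventually.of_forall fun θ _ b hb => ?_
      rw [norm_smul]
      exact mul_le_mul_of_nonneg_left (hball _ (hmem b hb _ (hcirc θ))).2 (norm_nonneg _)
    · exact (hkc.norm.mul continuous_const).intervalIntegrable _ _
    · refine Eventually.of_forall fun θ _ b hb => ?_
      have h1 := (hdiff b hb _ (hcirc θ)).comp b
        ((hasFDerivAt_id b).add_const (circleMap 0 ρ θ • v))
      exact h1.const_mul (k θ)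
  refine ((hmain.const_smul ((2 * Real.pi * Complex.I : ℂ)⁻¹)).differentiableAt.congr_of_eventuallyEq
    ?_).differentiableWithinAt
  filter_upwards [Metric.ball_mem_nhds a (half_pos hr)] with b hb
  exact heq b hb

theorem norm_single_one_le (k : Fin n) : ‖(Pi.single k 1 : Fin n → ℂ)‖ ≤ 1 := by
  refine (pi_norm_le_iff_of_nonneg zero_le_one).2 fun i => ?_
  by_cases h : i = k
  · subst h; simp
  · simp [h]

theorem differentiableOn_dz (hO : IsOpen O) (hf : DifferentiableOn ℂ f O) (k : Fin n) :
    DifferentiableOn ℂ (fun a => dz f k a) O :=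
  (differentiableOn_fderiv_apply hO hf (norm_single_one_le k)).congr fun _ ha =>
    dz_eq_of_hasFDerivAt (hf.differentiableAt (hO.mem_nhds ha)).hasFDerivAt k

theorem dz_dz_comm (hO : IsOpen O) (hf : DifferentiableOn ℂ f O) (i k : Fin n)
    {a : Fin n → ℂ} (ha : a ∈ O) : dz (fun b => dz f k b) i a = dz (fun b => dz f i b) k a := by
  have hd : ∀ k, HasFDerivAt (fun b => dz f k b) (fderiv ℂ (fun b => dz f k b) a) a := fun k =>
    ((differentiableOn_dz hO hf k).differentiableAt (hO.mem_nhds ha)).hasFDerivAt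
  have h1 : ∀ᶠ b in 𝓝 a, HasFDerivAt f (coordForm fun k => dz f k b) b := by
    filter_upwards [hO.mem_nhds ha] with b hb
    have h := (hf.differentiableAt (hO.mem_nhds hb)).hasFDerivAt
    have h2 := eq_coordForm (fderiv ℂ f b)
    simp only [← dz_eq_of_hasFDerivAt h] at h2
    rwa [← h2]
  have h2 : HasFDerivAt (fun b => coordForm fun k => dz f k b)
      (∑ k, (fderiv ℂ (fun b => dz f k b) a).smulRight
        (ContinuousLinearMap.proj k : (Fin n → ℂ) →L[ℂ] ℂ)) a := by
    unfold coordForm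
    exact HasFDerivAt.fun_sum fun k _ => (hd k).smul_const (ContinuousLinearMap.proj k : (Fin n → ℂ) →L[ℂ] ℂ)
  have h3 := second_derivative_symmetric_of_eventually h1 h2 (Pi.single i 1) (Pi.single k 1)
  simp only [_root_.sum_apply, ContinuousLinearMap.smulRight_apply, _root_.smul_apply,
    ContinuousLinearMap.proj_apply, smul_eq_mul, Pi.single_apply, mul_ite, mul_one, mul_zero,
    Finset.sum_ite_eq', Finset.mem_univ, if_true] at h3
  rw [dz_eq_of_hasFDerivAt (hd k), dz_eq_of_hasFDerivAt (hd i)]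
  exact h3

end Holomorphic

end Calculus

end

section


/-! ### Closed forms on simply connected sets -/

section Primitive

/-- A copy of a type with the discrete topology. -/
def Discrete (F : Type*) := F

instance (F : Type*) : TopologicalSpace (Discrete F) := ⊥

instance (F : Type*) : DiscreteTopology (Discrete F) := ⟨rfl⟩

/-- The identification of a type with its discrete copy. -/
def Discrete.of {F : Type*} (x : F) : Discrete F := x

/-- The identification of the discrete copy of a type with the type. -/
def Discrete.val {F : Type*} (x : Discrete F) : F := x

theorem Discrete.val_of {F : Type*} (x : F) : (Discrete.of x).val = x := rfl

theorem Discrete.of_val {F : Type*} (x : Discrete F) : Discrete.of x.val = x := rfl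

variable {E F : Type*} [NormedAddCommGroup E] [NormedSpace ℝ E] [NormedAddCommGroup F]
  [NormedSpace ℝ F]

/-- The germs of local primitives form a covering of `O` with discrete fibre `F`. Over a simply
connected and locally path connected base the identity lifts to this covering, and the lift selects
a global primitive. -/
theorem exists_primitive_of_local {O : Set E} (hO : IsOpen O) (hs : IsSimplyConnected O)
    {ω : E → E →L[ℝ] F} (h : ∀ a ∈ O, ∃ r > 0, Metric.ball a r ⊆ O ∧
      ∃ f : E → F, ∀ b ∈ Metric.ball a r, HasFDerivAt f (ω b) b) :
    ∃ f : E → F, ∀ a ∈ O, HasFDerivAt f (ω a) a := by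
  classical
  choose! r hr hrO f hf using h
  -- The intersection of two balls is convex, so two primitives differ there by a constant even if
  -- `O` is not convex.
  have hconst : ∀ i ∈ O, ∀ j ∈ O, ∀ x ∈ Metric.ball i (r i) ∩ Metric.ball j (r j),
      ∀ y ∈ Metric.ball i (r i) ∩ Metric.ball j (r j), f i x - f j x = f i y - f j y := by
    intro i hi j hj x hx y hy
    have hopen : IsOpen (Metric.ball i (r i) ∩ Metric.ball j (r j)) :=
      Metric.isOpen_ball.inter Metric.isOpen_ball
    have hd : ∀ b ∈ Metric.ball i (r i) ∩ Metric.ball j (r j),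
        HasFDerivAt (fun b => f i b - f j b) (0 : E →L[ℝ] F) b := by
      intro b hb
      have := (hf i hi b hb.1).fun_sub (hf j hj b hb.2)
      rwa [sub_self] at this
    exact ((convex_ball i (r i)).inter (convex_ball j (r j))).is_const_of_fderivWithin_eq_zero
      (𝕜 := ℝ) (f := fun b => f i b - f j b)
      (fun b hb => (hd b hb).differentiableAt.differentiableWithinAt)
      (fun b hb => (hd b hb).hasFDerivWithinAt.fderivWithin (hopen.uniqueDiffWithinAt hb)) hx hy
  -- The coordinate `v` over `x` in the chart `i` stands for the germ of `f i + v`; the transition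
  -- functions are locally constant by `hconst`, hence continuous for the discrete fibre.
  let Z : FiberBundleCore O O (Discrete F) :=
    { baseSet := fun i => Subtype.val ⁻¹' Metric.ball i.1 (r i.1)
      isOpen_baseSet := fun i => Metric.isOpen_ball.preimage continuous_subtype_val
      indexAt := id
      mem_baseSet_at := fun x => Metric.mem_ball_self (hr x.1 x.2)
      coordChange := fun i j x v => .of (v.val + f i.1 x.1 - f j.1 x.1)
      coordChange_self := fun i x _ v => by rw [add_sub_cancel_right, Discrete.of_val]
      continuousOn_coordChange := by
        intro i j
        rintro ⟨x, v⟩ ⟨hx, -⟩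
        have hopen : IsOpen ((Subtype.val ⁻¹' Metric.ball i.1 (r i.1) ∩
            Subtype.val ⁻¹' Metric.ball j.1 (r j.1)) ×ˢ (Set.univ : Set (Discrete F)) :
              Set (O × Discrete F)) :=
          ((Metric.isOpen_ball.preimage continuous_subtype_val).inter
            (Metric.isOpen_ball.preimage continuous_subtype_val)).prod isOpen_univ
        have h1 : ContinuousAt (fun p : O × Discrete F =>
            Discrete.of (p.2.val + (f i.1 x.1 - f j.1 x.1))) (x, v) :=
          ((continuous_of_discreteTopology (f := fun v : Discrete F =>
            Discrete.of (v.val + (f i.1 x.1 - f j.1 x.1)))).comp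
              continuous_snd).continuousAt
        refine (h1.congr ?_).continuousWithinAt
        filter_upwards [hopen.mem_nhds ⟨hx, trivial⟩] with p hp
        have := hconst i.1 i.2 j.1 j.2 x.1 hx p.1.1 hp.1
        rw [this, add_sub_assoc]
      coordChange_comp := by
        intro i j k x _ v
        rw [Discrete.val_of, sub_add_cancel] }
  have hcov : IsCoveringMap Z.proj :=
    IsFiberBundle.isCoveringMap fun x => ⟨Z.localTriv x, Z.mem_baseSet_at x⟩
  have := hs.simplyConnectedSpace
  have := hO.locallyPathConnectedSpace
  obtain ⟨a₀, ha₀⟩ := hs.nonempty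
  obtain ⟨σ, ⟨-, hσ⟩, -⟩ := hcov.existsUnique_continuousMap_lifts
    (ContinuousMap.id O) (a₀ := ⟨a₀, ha₀⟩) (e₀ := ⟨⟨a₀, ha₀⟩, Discrete.of 0⟩) rfl
  have hσ1 : ∀ x, (σ x).1 = x := fun x => congr_fun hσ x
  let w : O → O → F := fun i x => Discrete.val (F := F) (Z.localTriv i (σ x)).2
  have hw : ∀ i x, w i x = Discrete.val (F := F) (σ x).2 + f x.1 x.1 - f i.1 x.1 := by
    intro i x
    change Discrete.val (F := F) (Z.localTriv i (σ x)).2 = _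
    rw [Z.localTriv_apply]
    change Discrete.val (F := F) (σ x).2 + f (σ x).1.1 (σ x).1.1 - f i.1 (σ x).1.1 = _
    rw [hσ1]
  -- The fibre coordinate of the lift is continuous with discrete values, hence locally constant:
  -- near `i` the section is `f i` plus a constant.
  have hwc : ∀ i : O, ∀ᶠ x in 𝓝 i, w i x = w i i := by
    intro i
    have h1 : ContinuousAt (Z.localTriv i) (σ i) := by
      refine (Z.localTriv i).continuousAt ?_
      rw [Z.mem_localTriv_source]
      change (σ i).1 ∈ Z.baseSet i
      rw [hσ1]
      exact Z.mem_baseSet_at i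
    have h2 : ContinuousAt (fun x => (Z.localTriv i (σ x)).2) i :=
      continuousAt_snd.comp (ContinuousAt.comp (f := σ) (g := Z.localTriv i) h1
        σ.continuous.continuousAt)
    have h3 := h2.eventually (mem_nhds_discrete.2 (Set.mem_singleton (Z.localTriv i (σ i)).2))
    filter_upwards [h3] with x hx
    exact congrArg (Discrete.val (F := F)) hx
  refine ⟨fun x => if hx : x ∈ O then Discrete.val (F := F) (σ ⟨x, hx⟩).2 + f x x else 0, fun a ha => ?_⟩
  have h1 := hwc ⟨a, ha⟩
  rw [nhds_subtype, eventually_comap] at h1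
  refine ((hf a ha a (Metric.mem_ball_self (hr a ha))).add_const (w ⟨a, ha⟩ ⟨a, ha⟩)
    ).congr_of_eventuallyEq ?_
  filter_upwards [h1, hO.mem_nhds ha] with x hx hxO
  have h2 := hx ⟨x, hxO⟩ rfl
  rw [dif_pos hxO, ← h2, hw]
  rw [add_sub_cancel]

end Primitive

variable {n : ℕ}

/-- A holomorphic closed form on a simply connected domain is exact. -/
theorem exists_primitive_of_curl_free {O : Set (Fin n → ℂ)} (hO : IsOpen O)
    (hs : IsSimplyConnected O) {c : (Fin n → ℂ) → Fin n → ℂ}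
    (hc : ∀ k, DifferentiableOn ℝ (fun a => c a k) O)
    (hbar : ∀ a ∈ O, ∀ i k, dzbar (fun b => c b i) k a = 0)
    (hcurl : ∀ a ∈ O, ∀ i k, dz (fun b => c b k) i a = dz (fun b => c b i) k a) :
    ∃ f : (Fin n → ℂ) → ℂ, ∀ a ∈ O, HasFDerivAt f (coordForm (c a)) a := by
  have hd : ∀ a ∈ O, ∀ k, HasFDerivAt (fun b => c b k) (coordForm fun i => dz (fun b => c b k) i a) a :=
    fun a ha k => hasFDerivAt_of_dzbar_eq_zero ((hc k).differentiableAt (hO.mem_nhds ha)) (hbar a ha k)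
  set ω : (Fin n → ℂ) → (Fin n → ℂ) →L[ℝ] ℂ := fun a => (coordForm (c a)).restrictScalars ℝ with hω
  have hωd : ∀ a ∈ O, HasFDerivAt ω (∑ k, ((coordForm fun i => dz (fun b => c b k) i a).restrictScalars
      ℝ).smulRight ((ContinuousLinearMap.proj k : (Fin n → ℂ) →L[ℂ] ℂ).restrictScalars ℝ)) a := by
    intro a ha
    have h1 : ∀ b, ω b = ∑ k, c b k • ((ContinuousLinearMap.proj k : (Fin n → ℂ) →L[ℂ] ℂ).restrictScalars ℝ) := by
      intro b
      ext v
      simp [hω, coordForm_apply]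
    simp only [funext h1]
    exact HasFDerivAt.fun_sum fun k _ => ((hd a ha k).restrictScalars ℝ).smul_const
      ((ContinuousLinearMap.proj k : (Fin n → ℂ) →L[ℂ] ℂ).restrictScalars ℝ)
  suffices h : ∃ f : (Fin n → ℂ) → ℂ, ∀ a ∈ O, HasFDerivAt f (ω a) a by
    obtain ⟨f, hf⟩ := h
    exact ⟨f, fun a ha => hasFDerivAt_of_restrictScalars ℝ (hf a ha) rfl⟩
  refine exists_primitive_of_local hO hs fun a ha => ?_
  obtain ⟨r, hr, hball⟩ := Metric.isOpen_iff.1 hO a ha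
  refine ⟨r, hr, hball, ?_⟩
  refine (convex_ball a r).exists_forall_hasFDerivAt_of_fderiv_symmetric Metric.isOpen_ball
    (fun b hb => (hωd b (hball hb)).differentiableAt.differentiableWithinAt) fun b hb x y => ?_
  rw [(hωd b (hball hb)).fderiv]
  simp only [_root_.sum_apply, ContinuousLinearMap.smulRight_apply, _root_.smul_apply,
    ContinuousLinearMap.coe_restrictScalars', ContinuousLinearMap.proj_apply, smul_eq_mul,
    coordForm_apply, Finset.sum_mul]
  rw [Finset.sum_comm]
  refine Finset.sum_congr rfl fun i _ => Finset.sum_congr rfl fun k _ => ?_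
  rw [hcurl b (hball hb) i k]
  ring

end

section


variable {n : ℕ}

/-! ### Multiplication by unbounded functions -/

theorem tendsto_cutFun (f : C(Fin n → ℂ, ℂ)) (x : Fin n → ℂ) :
    Tendsto (fun N => cutFun N f x) atTop (𝓝 (f x)) := by
  obtain ⟨N, hN⟩ := exists_nat_ge ‖x‖
  refine tendsto_const_nhds.congr' ?_
  filter_upwards [eventually_ge_atTop N] with M hM
  rw [cutFun, Set.indicator_of_mem]
  simpa using hN.trans (by exact_mod_cast hM)

theorem norm_cutFun_le (N : ℕ) (f : C(Fin n → ℂ, ℂ)) (x : Fin n → ℂ) : ‖cutFun N f x‖ ≤ ‖f x‖ :=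
  norm_indicator_le_norm_self _ _

theorem tendsto_integral_cutFun {μ : Measure (Fin n → ℂ)} {f : C(Fin n → ℂ, ℂ)}
    (hf : Integrable f μ) : Tendsto (fun N => ∫ x, cutFun N f x ∂μ) atTop (𝓝 (∫ x, f x ∂μ)) :=
  tendsto_integral_of_dominated_convergence (fun x => ‖f x‖)
    (fun N => (cutFun_bddMeas N f).1.aestronglyMeasurable) hf.norm
    (fun N => Eventually.of_forall fun x => norm_cutFun_le N f x)
    (Eventually.of_forall fun x => tendsto_cutFun f x)

theorem memLp_two_of_lintegral {μ : Measure (Fin n → ℂ)} {f : C(Fin n → ℂ, ℂ)}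
    (hf : ∫⁻ x, ‖f x‖ₑ ^ 2 ∂μ ≠ ∞) : MemLp f 2 μ := by
  refine ⟨f.continuous.aestronglyMeasurable, ?_⟩
  rw [eLpNorm_lt_top_iff_lintegral_rpow_enorm_lt_top (by norm_num) (by norm_num)]
  simpa using lt_top_iff_ne_top.2 hf

theorem lintegral_of_memLp_two {μ : Measure (Fin n → ℂ)} {f : (Fin n → ℂ) → ℂ}
    (hf : MemLp f 2 μ) : ∫⁻ x, ‖f x‖ₑ ^ 2 ∂μ ≠ ∞ := by
  have := hf.2
  rw [eLpNorm_lt_top_iff_lintegral_rpow_enorm_lt_top (by norm_num) (by norm_num)] at this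
  simpa using this.ne

theorem integrable_conj_mul {μ : Measure (Fin n → ℂ)} {f g : (Fin n → ℂ) → ℂ}
    (hf : MemLp f 2 μ) (hg : MemLp g 2 μ) : Integrable (fun x => conj (f x) * g x) μ :=
  (hf.star).integrable_mul hg

namespace QPM

variable {H : Type*} [NormedAddCommGroup H] [InnerProductSpace ℂ H] [CompleteSpace H]
  {K : Type*} [NormedAddCommGroup K] [InnerProductSpace ℂ K] [CompleteSpace K]
  {P : QPM (Fin n → ℂ) H} {Q : QPM (Fin n → ℂ) K} {V : H →L[ℂ] K} {ρ : H →L[ℂ] H}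

theorem IsProj.inner_of_mul (hQ : Q.IsProj) {f g : C(Fin n → ℂ, ℂ)} {ζ η ξ : K}
    (hf : ∀ N, Q.cut N 1 η = Q.cut N f ζ) (hg : ∀ N, Q.cut N 1 ξ = Q.cut N g ζ) :
    inner ℂ η ξ = ∫ x, conj (f x) * g x ∂Q.diag ζ := by
  have hlim : ∀ {f : C(Fin n → ℂ, ℂ)} {η : K}, (∀ N, Q.cut N 1 η = Q.cut N f ζ) →
      MemLp f 2 (Q.diag ζ) := fun h => memLp_two_of_lintegral (by
    rw [← hQ.enorm_sq_of_mul h]; simp)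
  have h1 : Tendsto (fun N => inner ℂ (Q.cut N f ζ) (Q.cut N g ζ)) atTop (𝓝 (inner ℂ η ξ)) := by
    simp only [← hf, ← hg]
    exact (hQ.tendsto_cut_one η).inner (hQ.tendsto_cut_one ξ)
  have h2 : ∀ N, inner ℂ (Q.cut N f ζ) (Q.cut N g ζ) = ∫ x, cutFun N (star f * g) x ∂Q.diag ζ := by
    intro N
    rw [← ContinuousLinearMap.adjoint_inner_right, adjoint_cut, hQ.cut_comp_apply, cut,
      Q.inner_int_self (cutFun_bddMeas N _)]
  simp only [h2] at h1
  exact tendsto_nhds_unique h1 (tendsto_integral_cutFun (f := star f * g)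
    (integrable_conj_mul (hlim hf) (hlim hg)))

/-- `L` is the product `f(Q) T`, where `f(Q) = ∫ f dQ`. -/
def IsMul (Q : QPM (Fin n → ℂ) K) (f : C(Fin n → ℂ, ℂ)) (T L : H →L[ℂ] K) : Prop :=
  ∀ N, Q.cut N 1 ∘L L = Q.cut N f ∘L T

theorem IsMul.apply {f : C(Fin n → ℂ, ℂ)} {T L : H →L[ℂ] K} (h : Q.IsMul f T L) (N : ℕ) (ψ : H) :
    Q.cut N 1 (L ψ) = Q.cut N f (T ψ) := congr($(h N) ψ)

theorem IsProj.isMul_unique (hQ : Q.IsProj) {f : C(Fin n → ℂ, ℂ)} {T L L' : H →L[ℂ] K}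
    (h : Q.IsMul f T L) (h' : Q.IsMul f T L') : L = L' :=
  ContinuousLinearMap.ext fun ψ => hQ.eq_of_cut_one fun N => by rw [h.apply, h'.apply]

theorem isMul_one (T : H →L[ℂ] K) : Q.IsMul 1 T T := fun _ => rfl

theorem IsMul.add {f g : C(Fin n → ℂ, ℂ)} {T L L' : H →L[ℂ] K} (h : Q.IsMul f T L)
    (h' : Q.IsMul g T L') : Q.IsMul (f + g) T (L + L') := fun N => by
  rw [ContinuousLinearMap.comp_add, h, h', cut_add, ContinuousLinearMap.add_comp]

theorem IsMul.smul {f : C(Fin n → ℂ, ℂ)} {T L : H →L[ℂ] K} (h : Q.IsMul f T L) (c : ℂ) :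
    Q.IsMul (c • f) T (c • L) := fun N => by
  rw [ContinuousLinearMap.comp_smul, h, cut_smul, ContinuousLinearMap.smul_comp]

theorem IsMul.sum {ι : Type*} {s : Finset ι} {f : ι → C(Fin n → ℂ, ℂ)} {T : H →L[ℂ] K}
    {L : ι → H →L[ℂ] K} (h : ∀ i ∈ s, Q.IsMul (f i) T (L i)) :
    Q.IsMul (∑ i ∈ s, f i) T (∑ i ∈ s, L i) := fun N => by
  rw [cut_sum, ContinuousLinearMap.finsetSum_comp, ContinuousLinearMap.comp_finsetSum]
  exact Finset.sum_congr rfl fun i hi => h i hi N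

theorem IsMul.mul {f g : C(Fin n → ℂ, ℂ)} {T L : H →L[ℂ] K} (hQ : Q.IsProj) (h : Q.IsMul f T L)
    (N : ℕ) : Q.cut N g ∘L L = Q.cut N (g * f) ∘L T := by
  have := congrArg (fun Z => Q.cut N g ∘L Z) (h N)
  rwa [← ContinuousLinearMap.comp_assoc, ← ContinuousLinearMap.comp_assoc, ← hQ.cut_mul,
    ← hQ.cut_mul, mul_one] at this

theorem IsDilation.hsSq_of_isMul (hd : P.IsDilation Q V) {f : C(Fin n → ℂ, ℂ)} {L : H →L[ℂ] K}
    (h : Q.IsMul f (V ∘L CFC.sqrt ρ) L) : hsSq L = ∫⁻ x, ‖f x‖ₑ ^ 2 ∂P.law ρ := by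
  rw [law, lintegral_sum_measure, hsSq]
  refine tsum_congr fun e => ?_
  rw [← hd.diag]
  exact hd.proj.enorm_sq_of_mul fun N => h.apply N _

theorem IsDilation.memLp_of_isMul (hd : P.IsDilation Q V) {f : C(Fin n → ℂ, ℂ)} {L : H →L[ℂ] K}
    (h : Q.IsMul f (V ∘L CFC.sqrt ρ) L) (hL : hsSq L ≠ ∞) : MemLp f 2 (P.law ρ) :=
  memLp_two_of_lintegral (by rwa [← hd.hsSq_of_isMul h])

theorem IsDilation.hsIn_of_isMul (hd : P.IsDilation Q V) {f g : C(Fin n → ℂ, ℂ)} {L L' : H →L[ℂ] K}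
    (h : Q.IsMul f (V ∘L CFC.sqrt ρ) L) (h' : Q.IsMul g (V ∘L CFC.sqrt ρ) L')
    (hL : hsSq L ≠ ∞) (hL' : hsSq L' ≠ ∞) :
    hsIn L L' = ∫ x, conj (f x) * g x ∂P.law ρ := by
  have hi := integrable_conj_mul (hd.memLp_of_isMul h hL) (hd.memLp_of_isMul h' hL')
  rw [law] at hi
  rw [law, ← (hasSum_integral_measure hi).tsum_eq]
  refine tsum_congr fun e => ?_
  rw [← hd.diag]
  exact hd.proj.inner_of_mul (fun N => h.apply N _) (fun N => h'.apply N _)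

/-- The domination of the vector distributions by the law yields the value and a bound for every
`ψ`; linearity follows because a vector is determined by its truncations. -/
theorem IsDilation.exists_isMul (hd : P.IsDilation Q V) {f : C(Fin n → ℂ, ℂ)}
    (hf : ∫⁻ x, ‖f x‖ₑ ^ 2 ∂P.law ρ ≠ ∞) :
    ∃ L : H →L[ℂ] K, Q.IsMul f (V ∘L CFC.sqrt ρ) L ∧ hsSq L ≠ ∞ := by
  have hle : ∀ ψ, ∫⁻ x, ‖f x‖ₑ ^ 2 ∂Q.diag (V (CFC.sqrt ρ ψ)) ≤
      ‖ψ‖ₑ ^ 2 * ∫⁻ x, ‖f x‖ₑ ^ 2 ∂P.law ρ := by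
    intro ψ
    rw [hd.diag]
    refine (lintegral_mono' (hd.diag_le_law ρ ψ) le_rfl).trans_eq ?_
    rw [lintegral_smul_measure, ENNReal.smul_def, ENNReal.coe_pow, smul_eq_mul]
    rfl
  choose η hη _ using fun ψ => hd.proj.exists_mul (f := f) (ζ := V (CFC.sqrt ρ ψ))
    (ne_top_of_le_ne_top (ENNReal.mul_ne_top (by simp) hf) (hle ψ))
  let L : H →ₗ[ℂ] K :=
    { toFun := η
      map_add' := fun x y => hd.proj.eq_of_cut_one fun N => by simp only [map_add, hη]
      map_smul' := fun c x => hd.proj.eq_of_cut_one fun N => by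
        simp only [map_smul, hη, RingHom.id_apply] }
  have hb : ∀ ψ, ‖L ψ‖ ≤ √(∫⁻ x, ‖f x‖ₑ ^ 2 ∂P.law ρ).toReal * ‖ψ‖ := by
    intro ψ
    refine le_of_sq_le_sq ?_ (by positivity)
    rw [mul_pow, Real.sq_sqrt ENNReal.toReal_nonneg]
    have h1 := (hd.proj.enorm_sq_of_mul (hη ψ)).trans_le (hle ψ)
    have h2 := ENNReal.toReal_mono (ENNReal.mul_ne_top (by simp) hf) h1
    rw [ENNReal.toReal_mul, ENNReal.toReal_pow, ENNReal.toReal_pow, toReal_enorm, toReal_enorm,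
      mul_comm] at h2
    exact h2
  have hL : Q.IsMul f (V ∘L CFC.sqrt ρ) (L.mkContinuous _ hb) := fun N => by
    ext ψ
    exact hη ψ N
  exact ⟨_, hL, by rwa [hd.hsSq_of_isMul hL]⟩

theorem IsProj.adjoint_cut_one (Q : QPM (Fin n → ℂ) K) (N : ℕ) :
    ContinuousLinearMap.adjoint (Q.cut N 1) = Q.cut N 1 := by
  rw [adjoint_cut, star_one]

/-- Pythagoras: a truncation is an orthogonal projection, so the error is the loss of squared norm.
-/
theorem IsProj.norm_hsVec_sub_sq (hQ : Q.IsProj) {L : H →L[ℂ] K} (hL : hsSq L ≠ ∞) (N : ℕ) :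
    ‖hsVec L hL - hsVec (Q.cut N 1 ∘L L) (hsSq_comp_ne_top _ hL)‖ ^ 2 =
      (hsSq L).toReal - (hsSq (Q.cut N 1 ∘L L)).toReal := by
  have h1 : hsIn (Q.cut N 1 ∘L L) L = hsIn (Q.cut N 1 ∘L L) (Q.cut N 1 ∘L L) := by
    rw [hsIn_comp_left, hsIn_comp_left, IsProj.adjoint_cut_one, ← ContinuousLinearMap.comp_assoc,
      ← hQ.cut_mul, one_mul]
  rw [← norm_hsVec_sq hL, ← norm_hsVec_sq (hsSq_comp_ne_top _ hL), @norm_sub_sq ℂ,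
    ← inner_conj_symm, inner_hsVec, h1, ← inner_hsVec (hsSq_comp_ne_top _ hL)
    (hsSq_comp_ne_top _ hL), inner_self_eq_norm_sq_to_K]
  have : RCLike.re (conj (((‖hsVec (Q.cut N 1 ∘L L) (hsSq_comp_ne_top _ hL)‖ : ℝ) : ℂ) ^ 2)) =
      ‖hsVec (Q.cut N 1 ∘L L) (hsSq_comp_ne_top _ hL)‖ ^ 2 := by
    rw [← Complex.ofReal_pow, Complex.conj_ofReal]
    exact Complex.ofReal_re _
  refine Eq.trans (congrArg (fun z => _ - 2 * z + _) this) ?_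
  ring

end QPM

/-! ### Gram matrices -/

section Gram

variable {E : Type*} [NormedAddCommGroup E] [InnerProductSpace ℂ E]

/-- The coefficients `G⁻¹ D†` are those of the orthogonal projection of `ξ i` onto the span of the
`w k`. The Schur complement is therefore the Gram matrix of what remains. -/
theorem gram_sub_eq (ξ w : Fin n → E) {R D G : Matrix (Fin n) (Fin n) ℂ}
    (hR : ∀ i j, R i j = inner ℂ (ξ i) (ξ j)) (hD : ∀ i j, D i j = inner ℂ (ξ i) (w j))
    (hG : ∀ i j, G i j = inner ℂ (w i) (w j)) (hu : IsUnit G) :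
    R - D * G⁻¹ * Dᴴ = Matrix.gram ℂ fun i => ξ i - ∑ k, (G⁻¹ * Dᴴ) k i • w k := by
  have hdet := (Matrix.isUnit_iff_isUnit_det _).1 hu
  set c := G⁻¹ * Dᴴ with hc
  have hGc : G * c = Dᴴ := by rw [hc, Matrix.mul_nonsing_inv_cancel_left _ _ hdet]
  have hGH : Gᴴ = G := by
    ext i j
    rw [Matrix.conjTranspose_apply, hG, hG, RCLike.star_def, inner_conj_symm]
  have hcH : cᴴ * Dᴴ = D * c := by
    rw [hc, Matrix.conjTranspose_mul, Matrix.conjTranspose_conjTranspose,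
      Matrix.conjTranspose_nonsing_inv, hGH, Matrix.mul_assoc]
  ext i j
  have e1 : ∑ k, c k j * D i k = (D * c) i j := by
    rw [Matrix.mul_apply]; exact Finset.sum_congr rfl fun k _ => mul_comm _ _
  have e2 : ∑ k, conj (c k i) * inner ℂ (w k) (ξ j) = (D * c) i j := by
    rw [← hcH, Matrix.mul_apply]
    refine Finset.sum_congr rfl fun k _ => ?_
    rw [Matrix.conjTranspose_apply, Matrix.conjTranspose_apply, hD, RCLike.star_def,
      inner_conj_symm]
  have e3 : ∑ k, conj (c k i) * ∑ l, c l j * inner ℂ (w k) (w l) = (D * c) i j := by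
    rw [← hcH, ← hGc, Matrix.mul_apply]
    refine Finset.sum_congr rfl fun k _ => ?_
    rw [Matrix.conjTranspose_apply, RCLike.star_def, Matrix.mul_apply]
    congr 1
    exact Finset.sum_congr rfl fun l _ => by rw [hG, mul_comm]
  rw [Matrix.gram_apply, inner_sub_left, inner_sub_right, inner_sub_right]
  simp only [inner_sum, sum_inner, inner_smul_left, inner_smul_right]
  simp only [← hD, ← hR]
  have e3' : ∑ x, c x j * ∑ y, conj (c y i) * inner ℂ (w y) (w x) = (D * c) i j := by
    rw [← e3]
    simp only [Finset.mul_sum]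
    rw [Finset.sum_comm]
    exact Finset.sum_congr rfl fun k _ => Finset.sum_congr rfl fun l _ => by ring
  rw [e1, e2, e3']
  rw [Matrix.sub_apply, Matrix.mul_assoc]
  ring

theorem posSemidef_gram_sub (ξ w : Fin n → E) {R D G : Matrix (Fin n) (Fin n) ℂ}
    (hR : ∀ i j, R i j = inner ℂ (ξ i) (ξ j)) (hD : ∀ i j, D i j = inner ℂ (ξ i) (w j))
    (hG : ∀ i j, G i j = inner ℂ (w i) (w j)) (hu : IsUnit G) :
    (R - D * G⁻¹ * Dᴴ).PosSemidef := by
  rw [gram_sub_eq ξ w hR hD hG hu]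
  exact Matrix.posSemidef_gram ℂ _

/-- A vanishing Gram matrix makes the remainders vanish, so `ξ` is the combination of `w` with
coefficients `c = G⁻¹ D†`. Since `R⁻¹ D c = R⁻¹ R = 1` for square matrices, the relation can be
inverted. -/
theorem eq_sum_of_gram_eq (ξ w : Fin n → E) {R D G : Matrix (Fin n) (Fin n) ℂ}
    (hR : ∀ i j, R i j = inner ℂ (ξ i) (ξ j)) (hD : ∀ i j, D i j = inner ℂ (ξ i) (w j))
    (hG : ∀ i j, G i j = inner ℂ (w i) (w j)) (hu : IsUnit G) (hRu : IsUnit R)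
    (heq : R = D * G⁻¹ * Dᴴ) (k : Fin n) : w k = ∑ j, (R⁻¹ * D) j k • ξ j := by
  have h0 := gram_sub_eq ξ w hR hD hG hu
  rw [← heq, sub_self] at h0
  have h1 : ∀ i, ξ i = ∑ k, (G⁻¹ * Dᴴ) k i • w k := by
    intro i
    have := congrFun (congrFun h0 i) i
    rw [Matrix.gram_apply, Matrix.zero_apply] at this
    exact sub_eq_zero.1 (inner_self_eq_zero.1 this.symm)
  set c := G⁻¹ * Dᴴ with hc
  have hRdet := (Matrix.isUnit_iff_isUnit_det _).1 hRu
  have hcJ : c * (R⁻¹ * D) = 1 := by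
    have h2 : R⁻¹ * D * c = 1 := by
      rw [Matrix.mul_assoc, hc, ← Matrix.mul_assoc D, ← heq, Matrix.nonsing_inv_mul _ hRdet]
    exact mul_eq_one_comm.1 h2
  have h3 : ∑ j, (R⁻¹ * D) j k • ξ j = ∑ l, (c * (R⁻¹ * D)) l k • w l := by
    have h4 : ∀ l, (c * (R⁻¹ * D)) l k = ∑ j, c l j * (R⁻¹ * D) j k := fun l => Matrix.mul_apply
    simp only [h4, Finset.sum_smul]
    rw [Finset.sum_comm]
    refine Finset.sum_congr rfl fun j _ => ?_
    rw [h1 j, Finset.smul_sum]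
    exact Finset.sum_congr rfl fun l _ => by rw [smul_smul, mul_comm]
  rw [h3, hcJ]
  simp [Matrix.one_apply]

end Gram

end

section


/-! ### Derivatives of a model -/

section Model

variable {n : ℕ} {H : Type*} [NormedAddCommGroup H] [InnerProductSpace ℂ H] [CompleteSpace H]
  {K : Type*} [NormedAddCommGroup K] [InnerProductSpace ℂ K] [CompleteSpace K]
  {O : Set (Fin n → ℂ)} {ρ : (Fin n → ℂ) → H →L[ℂ] H}
  {g : (Fin n → ℂ) → Fin n → H →ₗ.[ℂ] H} {S : (Fin n → ℂ) → Fin n → H →L[ℂ] H}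
  {a : Fin n → ℂ}

/-- The operator `∑ v_k S_k`. -/
def dirOp (S : Fin n → H →L[ℂ] K) (v : Fin n → ℂ) : H →L[ℂ] K := ∑ k, v k • S k

theorem IsModel.hsSq_ne_top (hρ : IsModel O ρ g S) (ha : a ∈ O) (k : Fin n) : hsSq (S a k) ≠ ∞ :=
  isHS_iff.1 ((hρ.logDeriv a ha k).1.2)

theorem hsSq_dirOp_ne_top {S : Fin n → H →L[ℂ] K} (hS : ∀ k, hsSq (S k) ≠ ∞) (v : Fin n → ℂ) :
    hsSq (dirOp S v) ≠ ∞ :=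
  hsSq_sum_ne_top _ fun k _ => hsSq_smul_ne_top (hS k) _

theorem hsIn_add_right {A B C : H →L[ℂ] K} (hA : hsSq A ≠ ∞) (hB : hsSq B ≠ ∞) (hC : hsSq C ≠ ∞) :
    hsIn A (B + C) = hsIn A B + hsIn A C := by
  rw [← inner_hsVec hA (hsSq_add_ne_top hB hC), hsVec_add hB hC, inner_add_right, inner_hsVec,
    inner_hsVec]

theorem hsIn_smul_right {A B : H →L[ℂ] K} (hA : hsSq A ≠ ∞) (hB : hsSq B ≠ ∞) (c : ℂ) :
    hsIn A (c • B) = c * hsIn A B := by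
  rw [← inner_hsVec hA (hsSq_smul_ne_top hB c), hsVec_smul hB, inner_smul_right, inner_hsVec]

theorem hsIn_sum_right {ι : Type*} {A : H →L[ℂ] K} (hA : hsSq A ≠ ∞) (s : Finset ι)
    {B : ι → H →L[ℂ] K} (hB : ∀ i ∈ s, hsSq (B i) ≠ ∞) :
    hsIn A (∑ i ∈ s, B i) = ∑ i ∈ s, hsIn A (B i) := by
  classical
  induction s using Finset.induction_on with
  | empty => simp [hsIn]
  | insert i s hi ih =>
    have h1 : ∀ j ∈ s, hsSq (B j) ≠ ∞ := fun j hj => hB j (Finset.mem_insert_of_mem hj)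
    rw [Finset.sum_insert hi, Finset.sum_insert hi,
      hsIn_add_right hA (hB i (Finset.mem_insert_self i s)) (hsSq_sum_ne_top s h1), ih h1]

theorem hsIn_dirOp {A : H →L[ℂ] K} (hA : hsSq A ≠ ∞) {S : Fin n → H →L[ℂ] K}
    (hS : ∀ k, hsSq (S k) ≠ ∞) (v : Fin n → ℂ) : hsIn A (dirOp S v) = ∑ k, v k * hsIn A (S k) := by
  rw [dirOp, hsIn_sum_right hA _ fun k _ => hsSq_smul_ne_top (hS k) _]
  exact Finset.sum_congr rfl fun k _ => hsIn_smul_right hA (hS k) _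

theorem comp_dirOp (Z : H →L[ℂ] K) (S : Fin n → H →L[ℂ] H) (v : Fin n → ℂ) :
    Z ∘L dirOp S v = dirOp (fun k => Z ∘L S k) v := by
  simp only [dirOp, ContinuousLinearMap.comp_finsetSum, ContinuousLinearMap.comp_smul]

theorem norm_hsVec_dirOp_le {S : Fin n → H →L[ℂ] K} (hS : ∀ k, hsSq (S k) ≠ ∞) (v : Fin n → ℂ) :
    ‖hsVec (dirOp S v) (hsSq_dirOp_ne_top hS v)‖ ≤ ‖v‖ * ∑ k, ‖hsVec (S k) (hS k)‖ := by
  have h : hsVec (dirOp S v) (hsSq_dirOp_ne_top hS v) = ∑ k, v k • hsVec (S k) (hS k) := by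
    ext e
    rw [hsVec_apply, dirOp, _root_.sum_apply, lp.coeFn_sum, Finset.sum_apply]
    rfl
  rw [h, Finset.mul_sum]
  refine (norm_sum_le _ _).trans (Finset.sum_le_sum fun k _ => ?_)
  rw [norm_smul]
  exact mul_le_mul_of_nonneg_right (norm_le_pi_norm v k) (norm_nonneg _)

theorem IsModel.dz_tr (hρ : IsModel O ρ g S) (ha : a ∈ O) (k : Fin n) (Z : H →L[ℂ] H) :
    dz (fun b => tr (ρ b ∘L Z)) k a = hsIn (CFC.sqrt (ρ a)) (Z ∘L S a k) := by
  rw [(hρ.logDeriv a ha k).2 Z, tr_comp_eq_hsIn (hρ.hsSq_ne_top ha k)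
    (hρ.density a ha).hsSq_sqrt_ne_top (adjoint_sqrt _)]

theorem IsModel.dzbar_tr (hO : IsOpen O) (hρ : IsModel O ρ g S) (ha : a ∈ O) (k : Fin n)
    (Z : H →L[ℂ] H) : dzbar (fun b => tr (ρ b ∘L Z)) k a =
      conj (hsIn (CFC.sqrt (ρ a)) (ContinuousLinearMap.adjoint Z ∘L S a k)) := by
  rw [← hρ.dz_tr ha k, ← dzbar_conj]
  refine dzbar_congr ?_ k
  filter_upwards [hO.mem_nhds ha] with b hb
  rw [← (hρ.density b hb).tr_comp_conj, ContinuousLinearMap.adjoint_adjoint]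

theorem IsModel.hasFDerivAt (hO : IsOpen O) (hρ : IsModel O ρ g S) (ha : a ∈ O) (Z : H →L[ℂ] H) :
    HasFDerivAt (fun b => tr (ρ b ∘L Z)) (fderiv ℝ (fun b => tr (ρ b ∘L Z)) a) a :=
  (((hρ.smooth Z).contDiffAt (hO.mem_nhds ha)).differentiableAt one_ne_zero).hasFDerivAt

theorem IsModel.fderiv_apply (hO : IsOpen O) (hρ : IsModel O ρ g S) (ha : a ∈ O) (Z : H →L[ℂ] H)
    (v : Fin n → ℂ) : fderiv ℝ (fun b => tr (ρ b ∘L Z)) a v =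
      hsIn (CFC.sqrt (ρ a)) (Z ∘L dirOp (S a) v) +
        conj (hsIn (CFC.sqrt (ρ a)) (ContinuousLinearMap.adjoint Z ∘L dirOp (S a) v)) := by
  have hs := (hρ.density a ha).hsSq_sqrt_ne_top
  have hS : ∀ Z : H →L[ℂ] H, ∀ k, hsSq (Z ∘L S a k) ≠ ∞ := fun Z k =>
    hsSq_comp_ne_top Z (hρ.hsSq_ne_top ha k)
  rw [fderiv_eq_sum_dz, comp_dirOp, comp_dirOp, hsIn_dirOp hs (hS _), hsIn_dirOp hs (hS _), map_sum,
    ← Finset.sum_add_distrib]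
  refine Finset.sum_congr rfl fun k _ => ?_
  rw [hρ.dz_tr ha, hρ.dzbar_tr hO ha, map_mul]
  ring

/-- The derivative along a line of a real differentiable function. -/
theorem hasDerivAt_real_line {E : Type*} [NormedAddCommGroup E] [NormedSpace ℝ E] {f : E → ℂ}
    {f' : E →L[ℝ] ℂ} {a v : E} {t : ℝ} (h : HasFDerivAt f f' (a + t • v)) :
    HasDerivAt (fun s : ℝ => f (a + s • v)) (f' v) t := by
  have h1 : HasDerivAt (fun s : ℝ => a + s • v) v t := by
    simpa using ((hasDerivAt_id t).smul_const v).const_add a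
  exact h.comp_hasDerivAt t h1

theorem tr_comp_one (h : IsDensity (ρ a)) : tr (ρ a ∘L (1 : H →L[ℂ] H)) = 1 := by
  rw [tr, ← h.trace_one.tsum_eq]
  rfl

/-- `Tr h_k* ρ = 0`. -/
theorem IsModel.hsIn_sqrt (hO : IsOpen O) (hρ : IsModel O ρ g S) (ha : a ∈ O) (k : Fin n) :
    hsIn (CFC.sqrt (ρ a)) (S a k) = 0 := by
  have h := hρ.dz_tr ha k 1
  have h1 : dz (fun b => tr (ρ b ∘L (1 : H →L[ℂ] H))) k a = dz (fun _ => 1) k a := by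
    refine dz_congr ?_ k
    filter_upwards [hO.mem_nhds ha] with b hb
    exact tr_comp_one (hρ.density b hb)
  rw [h1] at h
  have h2 : dz (fun _ : Fin n → ℂ => (1 : ℂ)) k a = 0 := by simp [dz]
  rw [h2] at h
  rw [h]
  rfl

variable {M : QPM (Fin n → ℂ) H} {Q : QPM (Fin n → ℂ) K} {V : H →L[ℂ] K}
  {ϑ : (Fin n → ℂ) → Fin n → ℂ}

/-- The function `κ ↦ conj (κ_j - m_j)`. -/
def resC (m : Fin n → ℂ) (j : Fin n) : C(Fin n → ℂ, ℂ) := coordC j - (conj (m j)) • (1 : C(Fin n → ℂ, ℂ))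

theorem resC_apply (m : Fin n → ℂ) (j : Fin n) (κ : Fin n → ℂ) : resC m j κ = conj (κ j - m j) := by
  simp [resC]

/-- The compression to `H` of the truncated integrals. -/
def QPM.comp (Q : QPM (Fin n → ℂ) K) (V : H →L[ℂ] K) (N : ℕ) (f : C(Fin n → ℂ, ℂ)) : H →L[ℂ] H :=
  ContinuousLinearMap.adjoint V ∘L Q.cut N f ∘L V

theorem QPM.adjoint_comp (Q : QPM (Fin n → ℂ) K) (V : H →L[ℂ] K) (N : ℕ) (f : C(Fin n → ℂ, ℂ)) :
    ContinuousLinearMap.adjoint (Q.comp V N f) = Q.comp V N (star f) := by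
  rw [QPM.comp, QPM.comp, ContinuousLinearMap.adjoint_comp, ContinuousLinearMap.adjoint_comp,
    QPM.adjoint_cut, ContinuousLinearMap.adjoint_adjoint, ContinuousLinearMap.comp_assoc]

theorem QPM.hsIn_comp (Q : QPM (Fin n → ℂ) K) (V : H →L[ℂ] K) (N : ℕ) (f : C(Fin n → ℂ, ℂ))
    (s T : H →L[ℂ] H) : hsIn s (Q.comp V N f ∘L T) = hsIn (Q.cut N (star f) ∘L V ∘L s) (V ∘L T) := by
  rw [← QPM.adjoint_cut, hsIn_comp_left, ContinuousLinearMap.adjoint_adjoint, hsIn_comp_left]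
  rfl

/-- The tails of the second moments of unbiased estimates are locally uniformly small. -/
theorem IsUnbiased.tendstoLocallyUniformlyOn (hρ : IsModel O ρ g S)
    (hϑ : ContinuousOn ϑ O) (hM : IsUnbiased O ρ ϑ M) (hd : M.IsDilation Q V) (i : Fin n) :
    TendstoLocallyUniformlyOn
      (fun (N : ℕ) a => ∫ κ in Metric.closedBall 0 N, ‖κ i‖ ^ 2 ∂(M.law (ρ a)))
      (fun a => ∫ κ, ‖κ i‖ ^ 2 ∂(M.law (ρ a))) atTop O := by
  have hint : ∀ a ∈ O, Integrable (fun κ : Fin n → ℂ => ‖κ i‖ ^ 2) (M.law (ρ a)) := fun a ha =>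
    (hM.finite a ha i).integrable_norm_pow two_ne_zero
  have hF : ∀ (N : ℕ), ∀ a ∈ O, ((∫ κ in Metric.closedBall 0 N, ‖κ i‖ ^ 2 ∂(M.law (ρ a)) : ℝ) : ℂ) =
      tr (ρ a ∘L Q.comp V N (star (coordC i) * coordC i)) := by
    intro N a ha
    rw [QPM.comp, QPM.cut, hd.tr_comp_int (hρ.density a ha) (cutFun_bddMeas N _),
      ← integral_indicator (measurableSet_ball N), ← integral_complex_ofReal]
    refine integral_congr_ae (Eventually.of_forall fun κ => ?_)
    by_cases hκ : κ ∈ Metric.closedBall (0 : Fin n → ℂ) N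
    · simp only [cutFun, Set.indicator_of_mem hκ, ContinuousMap.mul_apply, ContinuousMap.star_apply,
        coordC_apply, RCLike.star_def, Complex.conj_conj, Complex.mul_conj, Complex.normSq_eq_norm_sq]
    · simp only [cutFun, Set.indicator_of_notMem hκ, Complex.ofReal_zero]
  -- The full second moment is `R_ii + |ϑ_i|²`; here the assumed continuity of the error matrix
  -- makes the limit continuous.
  have hm : ∀ a ∈ O, ((∫ κ, ‖κ i‖ ^ 2 ∂(M.law (ρ a)) : ℝ) : ℂ) =
      errMatrix M ρ ϑ a i i + ϑ a i * conj (ϑ a i) := by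
    intro a ha
    have := M.isProbabilityMeasure_law (hρ.density a ha)
    have h1 : Integrable (fun κ : Fin n → ℂ => κ i) (M.law (ρ a)) :=
      (hM.finite a ha i).integrable one_le_two
    have h2 : Integrable (fun κ : Fin n → ℂ => conj (κ i)) (M.law (ρ a)) :=
      ((hM.finite a ha i).star).integrable one_le_two
    have e : ∀ κ : Fin n → ℂ, (κ i - ϑ a i) * conj (κ i - ϑ a i) = ((‖κ i‖ ^ 2 : ℝ) : ℂ) -
        conj (ϑ a i) * κ i - ϑ a i * conj (κ i) + ϑ a i * conj (ϑ a i) := by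
      intro κ
      rw [← Complex.normSq_eq_norm_sq, ← Complex.mul_conj, map_sub]
      ring
    simp only [errMatrix, Matrix.of_apply, e]
    rw [integral_add, integral_sub, integral_sub, integral_const_mul, integral_const_mul,
      integral_conj, hM.mean a ha i, integral_const, probReal_univ, integral_complex_ofReal]
    · simp only [one_smul]
      ring
    · exact (hint a ha).ofReal
    · exact h1.const_mul _
    · exact (hint a ha).ofReal.sub (h1.const_mul _)
    · exact h2.const_mul _
    · exact ((hint a ha).ofReal.sub (h1.const_mul _)).sub (h2.const_mul _)
    · exact integrable_const _
  -- Dini's theorem: truncated second moments are continuous and increase to a continuous limit.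
  refine Monotone.tendstoLocallyUniformlyOn_of_forall_tendsto ?_ ?_ ?_ ?_
  · intro N
    have h1 : ContinuousOn (fun a => (tr (ρ a ∘L Q.comp V N (star (coordC i) * coordC i))).re) O :=
      Complex.continuous_re.comp_continuousOn (hρ.smooth _).continuousOn
    refine h1.congr fun a ha => ?_
    simp only [← hF N a ha, Complex.ofReal_re]
  · intro a ha N N' h
    exact setIntegral_mono_set (hint a ha).integrableOn
      (Eventually.of_forall fun κ => by positivity) (ball_mono h).eventuallyLE
  · have h0 : ContinuousOn (fun a => ϑ a i) O := (continuous_apply i).comp_continuousOn hϑ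
    have h1 : ContinuousOn (fun a => (errMatrix M ρ ϑ a i i + ϑ a i * conj (ϑ a i)).re) O :=
      Complex.continuous_re.comp_continuousOn ((hM.continuous i i).add
        (h0.mul (Complex.continuous_conj.comp_continuousOn h0)))
    refine h1.congr fun a ha => ?_
    simp only [← hm a ha, Complex.ofReal_re]
  · intro a ha
    have := tendsto_setIntegral_of_monotone (μ := M.law (ρ a)) (f := fun κ => ‖κ i‖ ^ 2)
      (fun N => measurableSet_ball (n := n) N) ball_mono (by
        rw [iUnion_ball]; exact (hint a ha).integrableOn)
    rwa [iUnion_ball, setIntegral_univ] at this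

theorem lintegral_enorm_sq {μ : Measure (Fin n → ℂ)} {s : Set (Fin n → ℂ)} {f : (Fin n → ℂ) → ℂ}
    (hf : Integrable (fun κ => ‖f κ‖ ^ 2) μ) :
    (∫⁻ κ in s, ‖f κ‖ₑ ^ 2 ∂μ).toReal = ∫ κ in s, ‖f κ‖ ^ 2 ∂μ := by
  rw [integral_eq_lintegral_of_nonneg_ae (Eventually.of_forall fun κ => by positivity)
    hf.integrableOn.aestronglyMeasurable]
  congr 1
  refine lintegral_congr fun κ => ?_
  rw [ENNReal.ofReal_pow (norm_nonneg _), ofReal_norm]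

theorem QPM.IsDilation.norm_hsVec_sub_sq (hd : M.IsDilation Q V) {ρ : H →L[ℂ] H}
    {f : C(Fin n → ℂ, ℂ)}
    {L : H →L[ℂ] K} (h : Q.IsMul f (V ∘L CFC.sqrt ρ) L) (hL : hsSq L ≠ ∞) (N : ℕ) :
    ‖hsVec L hL - hsVec (Q.cut N 1 ∘L L) (hsSq_comp_ne_top _ hL)‖ ^ 2 =
      ∫ κ, ‖f κ‖ ^ 2 ∂M.law ρ - ∫ κ in Metric.closedBall 0 N, ‖f κ‖ ^ 2 ∂M.law ρ := by
  have hi : Integrable (fun κ => ‖f κ‖ ^ 2) (M.law ρ) :=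
    (hd.memLp_of_isMul h hL).integrable_norm_pow two_ne_zero
  have h2 : hsSq (Q.cut N 1 ∘L L) = ∫⁻ κ in Metric.closedBall 0 N, ‖f κ‖ₑ ^ 2 ∂M.law ρ := by
    rw [h N, QPM.cut, hd.hsSq_int (cutFun_bddMeas N f), ← lintegral_indicator (measurableSet_ball N)]
    refine lintegral_congr fun κ => ?_
    by_cases hκ : κ ∈ Metric.closedBall (0 : Fin n → ℂ) N <;> simp [cutFun, hκ]
  rw [hd.proj.norm_hsVec_sub_sq hL, hd.hsSq_of_isMul h, h2, lintegral_enorm_sq hi,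
    ← setLIntegral_univ, lintegral_enorm_sq hi, setIntegral_univ]

theorem norm_hsIn_sub_le {A B C : H →L[ℂ] K} (hA : hsSq A ≠ ∞) (hB : hsSq B ≠ ∞) (hC : hsSq C ≠ ∞) :
    ‖hsIn A C - hsIn B C‖ ≤ ‖hsVec A hA - hsVec B hB‖ * ‖hsVec C hC‖ := by
  rw [← inner_hsVec hA hC, ← inner_hsVec hB hC, ← inner_sub_left]
  exact norm_inner_le_norm _ _

theorem norm_hsVec_comp (hd : M.IsDilation Q V) {T : H →L[ℂ] H} (hT : hsSq T ≠ ∞) :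
    ‖hsVec (V ∘L T) (hsSq_comp_ne_top _ hT)‖ = ‖hsVec T hT‖ := by
  rw [← sq_eq_sq₀ (norm_nonneg _) (norm_nonneg _), norm_hsVec_sq, norm_hsVec_sq]
  congr 1
  refine tsum_congr fun e => ?_
  rw [ContinuousLinearMap.comp_apply, ← ofReal_norm, hd.norm_map, ofReal_norm]

/-- The derivatives of the mean values of unbiased estimates. -/
theorem IsUnbiased.jac_eq (hO : IsOpen O) (hρ : IsModel O ρ g S)
    (hϑ : ContDiffOn ℝ 1 ϑ O) (hM : IsUnbiased O ρ ϑ M) (hd : M.IsDilation Q V)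
    (hF : ∀ k, ContinuousOn (fun a => fisher (S a) k k) O) (ha : a ∈ O) (i : Fin n)
    {L : H →L[ℂ] K} (hL : Q.IsMul (coordC i) (V ∘L CFC.sqrt (ρ a)) L)
    (k : Fin n) : hsIn L (V ∘L S a k) = jac ϑ a i k := by
  have hnorm : ∀ a ∈ O, ∫⁻ κ, ‖coordC i κ‖ₑ ^ 2 ∂M.law (ρ a) ≠ ∞ := by
    intro a ha
    have := lintegral_of_memLp_two (hM.finite a ha i)
    convert! this using 3 with κ
    simp [← ofReal_norm]
  have hnorm' : ∀ a ∈ O, ∫⁻ κ, ‖(star (coordC i) : C(Fin n → ℂ, ℂ)) κ‖ₑ ^ 2 ∂M.law (ρ a) ≠ ∞ := by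
    intro a ha
    have := lintegral_of_memLp_two (hM.finite a ha i)
    convert! this using 3 with κ
    simp [← ofReal_norm]
  -- `A` is multiplication by `conj κ_i` and `B` by `κ_i`. Both occur because a real directional
  -- derivative of the mean contains the scores and their adjoints.
  choose! A hA hAt using fun a ha => hd.exists_isMul (hnorm a ha)
  choose! B hB hBt using fun a ha => hd.exists_isMul (hnorm' a ha)
  have hSv : ∀ b ∈ O, ∀ v, hsSq (V ∘L dirOp (S b) v) ≠ ∞ := fun b hb v =>
    hsSq_comp_ne_top _ (hsSq_dirOp_ne_top (hρ.hsSq_ne_top hb) v)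
  -- The truncated means are differentiable by the weak smoothness of the model. Local uniform
  -- convergence of their derivatives permits differentiation of the limit, which is `ϑ_i`.
  have hunif : ∀ v, TendstoLocallyUniformlyOn
      (fun (N : ℕ) b => fderiv ℝ (fun b => tr (ρ b ∘L Q.comp V N (star (coordC i)))) b v)
      (fun b => hsIn (A b) (V ∘L dirOp (S b) v) + conj (hsIn (B b) (V ∘L dirOp (S b) v))) atTop O := by
    intro v
    rw [Metric.tendstoLocallyUniformlyOn_iff]
    intro ε hε x hx
    -- `C` bounds the Hilbert-Schmidt norm of the score in direction `v` near `x`, by continuity of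
    -- the Fisher matrix. Each of the two error terms is at most `ε / (2 C + 1) * C` by
    -- Cauchy-Schwarz, and their sum stays below `ε` even if `C = 0`.
    set C := ‖v‖ * ∑ k, √(‖fisher (S x) k k‖ + 1) with hC
    have hC0 : 0 ≤ C := by positivity
    have hbd : ∀ᶠ b in 𝓝[O] x, ∀ k, ‖fisher (S b) k k‖ < ‖fisher (S x) k k‖ + 1 :=
      eventually_all.2 fun k => (hF k x hx).norm.eventually_lt_const (lt_add_one _)
    obtain ⟨t, ht, htail⟩ := Metric.tendstoLocallyUniformlyOn_iff.1
      (hM.tendstoLocallyUniformlyOn hρ hϑ.continuousOn hd i) ((ε / (2 * C + 1)) ^ 2)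
      (by positivity) x hx
    refine ⟨_, inter_mem (inter_mem ht hbd) self_mem_nhdsWithin, ?_⟩
    filter_upwards [htail] with N hN b hb
    obtain ⟨⟨hbt, hbd⟩, hbO⟩ := hb
    have htN := hN b hbt
    rw [Real.dist_eq] at htN
    have hSb : ‖hsVec (V ∘L dirOp (S b) v) (hSv b hbO v)‖ ≤ C := by
      rw [norm_hsVec_comp hd (hsSq_dirOp_ne_top (hρ.hsSq_ne_top hbO) v)]
      refine (norm_hsVec_dirOp_le (hρ.hsSq_ne_top hbO) v).trans ?_
      refine mul_le_mul_of_nonneg_left (Finset.sum_le_sum fun k _ => ?_) (norm_nonneg _)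
      refine Real.le_sqrt_of_sq_le ?_
      have h1 : fisher (S b) k k = ((‖hsVec (S b k) (hρ.hsSq_ne_top hbO k)‖ ^ 2 : ℝ) : ℂ) := by
        rw [fisher, Matrix.of_apply, ← hsIn_eq_hsInner, ← inner_hsVec (hρ.hsSq_ne_top hbO k)
          (hρ.hsSq_ne_top hbO k), inner_self_eq_norm_sq_to_K]
        norm_cast
      have h2 := (hbd k).le
      rw [h1, Complex.norm_real, Real.norm_of_nonneg (by positivity)] at h2
      exact h2
    have hdist : ∀ {f : C(Fin n → ℂ, ℂ)} {L : H →L[ℂ] K} (_ : Q.IsMul f (V ∘L CFC.sqrt (ρ b)) L)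
        (_ : hsSq L ≠ ∞) (_ : ∀ κ, ‖f κ‖ = ‖κ i‖),
        ‖hsIn L (V ∘L dirOp (S b) v) - hsIn (Q.cut N f ∘L V ∘L CFC.sqrt (ρ b)) (V ∘L dirOp (S b) v)‖
          ≤ ε / (2 * C + 1) * C := by
      intro f L hL hLt hf
      rw [← hL N]
      refine (norm_hsIn_sub_le hLt (hsSq_comp_ne_top _ hLt) (hSv b hbO v)).trans ?_
      refine mul_le_mul ?_ hSb (norm_nonneg _) (by positivity)
      refine le_of_sq_le_sq ?_ (by positivity)
      rw [hd.norm_hsVec_sub_sq hL hLt]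
      simp only [hf]
      exact (le_abs_self _).trans htN.le
    rw [hρ.fderiv_apply hO hbO, QPM.adjoint_comp, star_star, QPM.hsIn_comp, QPM.hsIn_comp, star_star,
      dist_eq_norm, add_sub_add_comm, ← map_sub]
    have h1 := hdist (hA b hbO) (hAt b hbO) fun κ => by simp
    have h2 := hdist (hB b hbO) (hBt b hbO) fun κ => by simp
    refine (norm_add_le _ _).trans_lt ?_
    rw [RCLike.norm_conj]
    have h3 : ε / (2 * C + 1) * C + ε / (2 * C + 1) * C < ε := by
      rw [← two_mul, ← mul_assoc, mul_comm 2, mul_assoc, div_mul_eq_mul_div, div_lt_iff₀ (by positivity)]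
      nlinarith
    linarith
  have hder : ∀ v, fderiv ℝ (fun b => ϑ b i) a v =
      hsIn (A a) (V ∘L dirOp (S a) v) + conj (hsIn (B a) (V ∘L dirOp (S a) v)) := by
    intro v
    have hT : IsOpen ((fun t : ℝ => a + t • v) ⁻¹' O) := hO.preimage (by fun_prop)
    have h1 : HasDerivAt (fun t : ℝ => ϑ (a + t • v) i)
        (hsIn (A (a + (0 : ℝ) • v)) (V ∘L dirOp (S (a + (0 : ℝ) • v)) v) +
          conj (hsIn (B (a + (0 : ℝ) • v)) (V ∘L dirOp (S (a + (0 : ℝ) • v)) v))) 0 := by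
      refine hasDerivAt_of_tendstoLocallyUniformlyOn hT ((hunif v).comp (fun t : ℝ => a + t • v)
        (fun t ht => ht) (by fun_prop)) (Eventually.of_forall fun N t ht =>
          hasDerivAt_real_line (hρ.hasFDerivAt hO ht _)) ?_ (by simpa using ha)
      intro t ht
      have hi : Integrable (fun κ : Fin n → ℂ => (star (coordC i) : C(Fin n → ℂ, ℂ)) κ)
          (M.law (ρ (a + t • v))) := by
        have := M.isProbabilityMeasure_law (hρ.density _ ht)
        simpa using (hM.finite _ ht i).integrable one_le_two
      have h2 := tendsto_integral_cutFun hi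
      have h3 := hM.mean _ ht i
      simp only [ContinuousMap.star_apply, coordC_apply, RCLike.star_def, Complex.conj_conj, h3] at h2
      refine h2.congr fun N => ?_
      rw [QPM.comp, QPM.cut, hd.tr_comp_int (hρ.density _ ht) (cutFun_bddMeas N _)]
    have h2 : DifferentiableAt ℝ (fun b => ϑ b i) a :=
      ((contDiffOn_pi.1 hϑ i).contDiffAt (hO.mem_nhds ha)).differentiableAt one_ne_zero
    have h3 : HasDerivAt (fun t : ℝ => ϑ (a + t • v) i) (fderiv ℝ (fun b => ϑ b i) a v) 0 :=
      hasDerivAt_real_line (f := fun b => ϑ b i) (by simpa using h2.hasFDerivAt)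
    have h4 := h3.unique h1
    simpa using h4
  have hone : ∀ z : ℂ, dirOp (S a) (Pi.single k z) = z • S a k := by
    intro z
    rw [dirOp, Finset.sum_eq_single k]
    · simp
    · intro j _ hj
      simp [hj]
    · simp
  have hSk := hsSq_comp_ne_top V (hρ.hsSq_ne_top ha k)
  -- The term with `B` is conjugate linear in the direction, so it drops out of the derivative `dz`.
  rw [hd.proj.isMul_unique hL (hA a ha), jac, Matrix.of_apply, dz, hder, hder, hone, hone]
  simp only [ContinuousLinearMap.comp_smul, one_smul]
  rw [hsIn_smul_right (hAt a ha) hSk, hsIn_smul_right (hBt a ha) hSk, map_mul, Complex.conj_I]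
  ring_nf
  rw [Complex.I_sq]
  ring

/-- The operators `(conj (κ_i) - conj (m_i)) V ρ^{1/2}`. -/
theorem IsUnbiased.exists_residuals (hO : IsOpen O) (hρ : IsModel O ρ g S)
    (hϑ : ContDiffOn ℝ 1 ϑ O) (hM : IsUnbiased O ρ ϑ M) (hd : M.IsDilation Q V)
    (hF : ∀ k, ContinuousOn (fun a => fisher (S a) k k) O) (ha : a ∈ O) :
    ∃ L : Fin n → H →L[ℂ] K, (∀ i, Q.IsMul (resC (ϑ a) i) (V ∘L CFC.sqrt (ρ a)) (L i)) ∧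
      (∀ i, hsSq (L i) ≠ ∞) ∧ ∀ i k, hsIn (L i) (V ∘L S a k) = jac ϑ a i k := by
  have hnorm : ∀ i, ∫⁻ κ, ‖coordC i κ‖ₑ ^ 2 ∂M.law (ρ a) ≠ ∞ := by
    intro i
    have := lintegral_of_memLp_two (hM.finite a ha i)
    convert! this using 3 with κ
    simp [← ofReal_norm]
  choose A hA hAt using fun i => hd.exists_isMul (hnorm i)
  have hs := hsSq_comp_ne_top V (hρ.density a ha).hsSq_sqrt_ne_top
  refine ⟨fun i => A i + (-conj (ϑ a i)) • (V ∘L CFC.sqrt (ρ a)), fun i => ?_, fun i =>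
    hsSq_add_ne_top (hAt i) (hsSq_smul_ne_top hs _), fun i k => ?_⟩
  · have := (hA i).add ((QPM.isMul_one (Q := Q) (V ∘L CFC.sqrt (ρ a))).smul (-conj (ϑ a i)))
    have e : coordC i + (-conj (ϑ a i)) • (1 : C(Fin n → ℂ, ℂ)) = resC (ϑ a) i := by
      ext κ
      simp [resC, sub_eq_add_neg]
    rwa [e] at this
  · have hSk := hsSq_comp_ne_top V (hρ.hsSq_ne_top ha k)
    rw [← hsIn_conj, hsIn_add_right hSk (hAt i) (hsSq_smul_ne_top hs _), hsIn_smul_right hSk hs,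
      map_add, map_mul, hsIn_conj, hsIn_conj, hM.jac_eq hO hρ hϑ hd hF ha i (hA i)]
    have : hsIn (V ∘L CFC.sqrt (ρ a)) (V ∘L S a k) = 0 := by
      rw [hsIn_comp_left, ← ContinuousLinearMap.comp_assoc, hd.isometry, ← hρ.hsIn_sqrt hO ha k]
      rfl
    rw [this, mul_zero, add_zero]

theorem errMatrix_eq_hsIn (hd : M.IsDilation Q V) {L : Fin n → H →L[ℂ] K}
    (hL : ∀ i, Q.IsMul (resC (ϑ a) i) (V ∘L CFC.sqrt (ρ a)) (L i)) (hLt : ∀ i, hsSq (L i) ≠ ∞)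
    (i j : Fin n) : errMatrix M ρ ϑ a i j = hsIn (L i) (L j) := by
  rw [hd.hsIn_of_isMul (hL i) (hL j) (hLt i) (hLt j), errMatrix, Matrix.of_apply]
  simp only [resC_apply, Complex.conj_conj]

theorem fisher_eq_hsIn (hd : M.IsDilation Q V) (i j : Fin n) :
    fisher (S a) i j = hsIn (V ∘L S a i) (V ∘L S a j) := by
  rw [hsIn_comp_left, ← ContinuousLinearMap.comp_assoc, hd.isometry]
  rfl

/-- The right Cramér-Rao inequality. -/
theorem IsUnbiased.posSemidef_sub (hO : IsOpen O) (hρ : IsModel O ρ g S)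
    (hϑ : ContDiffOn ℝ 1 ϑ O) (hM : IsUnbiased O ρ ϑ M)
    (hF : ∀ k, ContinuousOn (fun a => fisher (S a) k k) O) (ha : a ∈ O)
    (hS : IsUnit (fisher (S a))) : (errMatrix M ρ ϑ a - rightBound S ϑ a).PosSemidef := by
  obtain ⟨K, _, _, _, Q, V, hd⟩ := QPM.exists_dilation M
  obtain ⟨L, hL, hLt, hLS⟩ := hM.exists_residuals hO hρ hϑ hd hF ha
  have hSt : ∀ k, hsSq (V ∘L S a k) ≠ ∞ := fun k => hsSq_comp_ne_top V (hρ.hsSq_ne_top ha k)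
  exact posSemidef_gram_sub (fun i => hsVec (L i) (hLt i)) (fun k => hsVec (V ∘L S a k) (hSt k))
    (fun i j => by rw [errMatrix_eq_hsIn hd hL hLt, inner_hsVec])
    (fun i k => by rw [← hLS, inner_hsVec]) (fun i j => by rw [fisher_eq_hsIn hd, inner_hsVec]) hS

theorem clm_ext_onb {A B : H →L[ℂ] K} (h : ∀ e, A (onb H e) = B (onb H e)) : A = B := by
  refine ContinuousLinearMap.ext_on
    ((Submodule.dense_iff_topologicalClosure_eq_top).2 (onb H).dense_span) ?_
  rintro _ ⟨e, rfl⟩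
  exact h e

/-- The condition of equality in the right Cramér-Rao inequality. -/
theorem IsUnbiased.comp_eq_of_eq (hO : IsOpen O) (hρ : IsModel O ρ g S)
    (hϑ : ContDiffOn ℝ 1 ϑ O) (hM : IsUnbiased O ρ ϑ M) (hd : M.IsDilation Q V)
    (hF : ∀ k, ContinuousOn (fun a => fisher (S a) k k) O) (ha : a ∈ O)
    (hS : IsUnit (fisher (S a))) (hR : IsUnit (errMatrix M ρ ϑ a))
    (heq : errMatrix M ρ ϑ a = rightBound S ϑ a) (k : Fin n) :
    Q.IsMul (∑ j, invErrJac M ρ ϑ a j k • resC (ϑ a) j) (V ∘L CFC.sqrt (ρ a)) (V ∘L S a k) := by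
  obtain ⟨L, hL, hLt, hLS⟩ := hM.exists_residuals hO hρ hϑ hd hF ha
  have hSt : ∀ k, hsSq (V ∘L S a k) ≠ ∞ := fun k => hsSq_comp_ne_top V (hρ.hsSq_ne_top ha k)
  have h := eq_sum_of_gram_eq (fun i => hsVec (L i) (hLt i)) (fun k => hsVec (V ∘L S a k) (hSt k))
    (fun i j => by rw [errMatrix_eq_hsIn hd hL hLt, inner_hsVec])
    (fun i k => by rw [← hLS, inner_hsVec]) (fun i j => by rw [fisher_eq_hsIn hd, inner_hsVec])
    hS hR heq k
  have h2 : V ∘L S a k = ∑ j, invErrJac M ρ ϑ a j k • L j := by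
    refine clm_ext_onb fun e => ?_
    have := congrArg (fun x : lp (fun _ : BasisIndex H => K) 2 => x e) h
    simp only [lp.coeFn_sum, Finset.sum_apply, lp.coeFn_smul, Pi.smul_apply, hsVec_apply] at this
    rw [this, _root_.sum_apply]
    rfl
  rw [h2]
  exact QPM.IsMul.sum fun j _ => (hL j).smul _

end Model

end

section


/-! ### The exponential form of an efficient family -/

section Tools

variable {H : Type*} [NormedAddCommGroup H] [InnerProductSpace ℂ H] [CompleteSpace H]

/-- The states are differentiable only in the weak sense. Convergence of the vectors in norm and a
uniform bound on the operators compensate for this and give the product rule below. -/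
theorem tendsto_inner_weak {ι : Type*} {l : Filter ι} {x y : ι → H} {x₀ y₀ : H} {T : ι → H →L[ℂ] H}
    {T₀ : H →L[ℂ] H} {C : ℝ} (hx : Tendsto x l (𝓝 x₀)) (hy : Tendsto y l (𝓝 y₀))
    (hT : ∀ x y, Tendsto (fun i => (inner ℂ x (T i y) : ℂ)) l (𝓝 (inner ℂ x (T₀ y))))
    (hC : ∀ᶠ i in l, ‖T i‖ ≤ C) :
    Tendsto (fun i => (inner ℂ (x i) (T i (y i)) : ℂ)) l (𝓝 (inner ℂ x₀ (T₀ y₀))) := by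
  have h1 : Tendsto (fun i => (inner ℂ (x i - x₀) (T i (y i)) : ℂ)) l (𝓝 0) := by
    refine squeeze_zero_norm' (a := fun i => ‖x i - x₀‖ * (C * ‖y i‖)) ?_ ?_
    · filter_upwards [hC] with i hi
      exact (norm_inner_le_norm _ _).trans (mul_le_mul_of_nonneg_left
        ((T i).le_of_opNorm_le hi _) (norm_nonneg _))
    · have h2 : Tendsto (fun i => ‖x i - x₀‖) l (𝓝 0) := by
        simpa using (hx.sub_const x₀).norm
      simpa using h2.mul ((hy.norm).const_mul C)
  have h2 : Tendsto (fun i => (inner ℂ x₀ (T i (y i - y₀)) : ℂ)) l (𝓝 0) := by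
    refine squeeze_zero_norm' (a := fun i => ‖x₀‖ * (C * ‖y i - y₀‖)) ?_ ?_
    · filter_upwards [hC] with i hi
      exact (norm_inner_le_norm _ _).trans (mul_le_mul_of_nonneg_left
        ((T i).le_of_opNorm_le hi _) (norm_nonneg _))
    · have h2 : Tendsto (fun i => ‖y i - y₀‖) l (𝓝 0) := by
        simpa using (hy.sub_const y₀).norm
      simpa using (h2.const_mul C).const_mul ‖x₀‖
  have h3 := (h1.add h2).add (hT x₀ y₀)
  rw [zero_add, zero_add] at h3
  refine h3.congr fun i => ?_
  rw [map_sub, inner_sub_left, inner_sub_right]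
  ring

/-- The product rule for a weakly differentiable bounded family of operators. -/
theorem hasDerivAt_inner_weak {p q : ℝ → H} {p' q' : H} {T : ℝ → H →L[ℂ] H} {B : H → H → ℂ} {C : ℝ}
    (hp : HasDerivAt p p' 0) (hq : HasDerivAt q q' 0)
    (hT : ∀ x y, HasDerivAt (fun t => (inner ℂ x (T t y) : ℂ)) (B x y) 0)
    (hC : ∀ᶠ t in 𝓝 0, ‖T t‖ ≤ C) :
    HasDerivAt (fun t => (inner ℂ (p t) (T t (q t)) : ℂ))
      (inner ℂ p' (T 0 (q 0)) + inner ℂ (p 0) (T 0 q') + B (p 0) (q 0)) 0 := by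
  rw [hasDerivAt_iff_tendsto_slope] at hp hq ⊢
  have hC' : ∀ᶠ t in 𝓝[≠] (0 : ℝ), ‖T t‖ ≤ C := hC.filter_mono nhdsWithin_le_nhds
  have hw : ∀ x y, Tendsto (fun t => (inner ℂ x (T t y) : ℂ)) (𝓝[≠] 0) (𝓝 (inner ℂ x (T 0 y))) :=
    fun x y => (hT x y).continuousAt.tendsto.mono_left nhdsWithin_le_nhds
  have hqc : Tendsto q (𝓝[≠] 0) (𝓝 (q 0)) :=
    (hasDerivAt_iff_tendsto_slope.2 hq).continuousAt.tendsto.mono_left nhdsWithin_le_nhds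
  have h1 := tendsto_inner_weak hp hqc hw hC'
  have h2 := tendsto_inner_weak (tendsto_const_nhds (x := p 0)) hq hw hC'
  have h3 := hasDerivAt_iff_tendsto_slope.1 (hT (p 0) (q 0))
  refine ((h1.add h2).add h3).congr fun t => ?_
  have e1 : ∀ x z : H, (inner ℂ (t⁻¹ • x) z : ℂ) = t⁻¹ * inner ℂ x z := fun x z => by
    rw [← Complex.coe_smul, inner_smul_left, Complex.conj_ofReal, Complex.ofReal_inv]
  have e2 : ∀ x z : H, (inner ℂ x (T t (t⁻¹ • z)) : ℂ) = t⁻¹ * inner ℂ x (T t z) := fun x z => by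
    rw [← Complex.coe_smul, map_smul, inner_smul_right, Complex.ofReal_inv]
  simp only [slope_def_module, sub_zero, e1, e2, Complex.real_smul, Complex.ofReal_inv, map_sub,
    inner_sub_left, inner_sub_right]
  ring

theorem hasFDerivAt_of_norm_le_sq {𝕜 E F : Type*} [NontriviallyNormedField 𝕜] [NormedAddCommGroup E]
    [NormedSpace 𝕜 E] [NormedAddCommGroup F] [NormedSpace 𝕜 F] {f : E → F} {L : E →L[𝕜] F} {c : E}
    {δ C : ℝ} (hδ : 0 < δ) (h : ∀ h, ‖h‖ ≤ δ → ‖f (c + h) - f c - L h‖ ≤ C * ‖h‖ ^ 2) :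
    HasFDerivAt f L c := by
  rw [hasFDerivAt_iff_isLittleO_nhds_zero]
  have h1 : (fun h => f (c + h) - f c - L h) =O[𝓝 0] fun h : E => ‖h‖ ^ 2 := by
    refine Asymptotics.IsBigO.of_bound C ?_
    filter_upwards [Metric.closedBall_mem_nhds (0 : E) hδ] with x hx
    rw [Real.norm_of_nonneg (by positivity)]
    exact h x (by simpa using hx)
  refine h1.trans_isLittleO ?_
  exact (Asymptotics.isLittleO_norm_pow_id one_lt_two)

theorem IsDensity.norm_sqrt_le {ρ : H →L[ℂ] H} (h : IsDensity ρ) : ‖CFC.sqrt ρ‖ ≤ 1 := by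
  refine ContinuousLinearMap.opNorm_le_bound _ zero_le_one fun ψ => ?_
  have h1 := enorm_apply_sq_le (CFC.sqrt ρ) ψ
  rw [h.hsSq_sqrt, one_mul] at h1
  have h2 := ENNReal.toReal_mono (by simp) h1
  simp only [ENNReal.toReal_pow, toReal_enorm] at h2
  rw [one_mul]
  exact le_of_sq_le_sq h2 (norm_nonneg _)

theorem IsDensity.norm_le {ρ : H →L[ℂ] H} (h : IsDensity ρ) : ‖ρ‖ ≤ 1 := by
  rw [← h.sqrt_comp]
  exact (ContinuousLinearMap.opNorm_comp_le _ _).trans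
    (mul_le_one₀ h.norm_sqrt_le (norm_nonneg _) h.norm_sqrt_le)

/-- The Hilbert-Schmidt norm of `Z ρ^{1/2}` is the trace of `Z ρ Z*`; passing to the adjoint
expresses it through the quadratic form of `ρ` on the vectors `Z* ζ`. -/
theorem hsSq_comp_eq {K : Type*} [NormedAddCommGroup K] [InnerProductSpace ℂ K] [CompleteSpace K]
    {ρ ρ₀ : H →L[ℂ] H} (h : IsDensity ρ) (h₀ : IsDensity ρ₀) {Z Z₀ : H →L[ℂ] K} {c : ℝ}
    (hc : 0 ≤ c) (hZ : ∀ ζ, inner ℂ (ContinuousLinearMap.adjoint Z ζ)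
      (ρ (ContinuousLinearMap.adjoint Z ζ)) = c * inner ℂ (ContinuousLinearMap.adjoint Z₀ ζ)
      (ρ₀ (ContinuousLinearMap.adjoint Z₀ ζ))) :
    hsSq (Z ∘L CFC.sqrt ρ) = ENNReal.ofReal c * hsSq (Z₀ ∘L CFC.sqrt ρ₀) := by
  rw [← hsSq_adjoint, ← hsSq_adjoint (Z₀ ∘L _), hsSq, hsSq, ← ENNReal.tsum_mul_left]
  refine tsum_congr fun e => ?_
  have h1 := hZ (onb K e)
  rw [← h.inner_sqrt, ← h₀.inner_sqrt, inner_self_eq_norm_sq_to_K, inner_self_eq_norm_sq_to_K] at h1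
  have h2 : ‖CFC.sqrt ρ (ContinuousLinearMap.adjoint Z (onb K e))‖ ^ 2 =
      c * ‖CFC.sqrt ρ₀ (ContinuousLinearMap.adjoint Z₀ (onb K e))‖ ^ 2 := by
    refine Complex.ofReal_injective ?_
    push_cast
    exact h1
  rw [ContinuousLinearMap.adjoint_comp, ContinuousLinearMap.adjoint_comp, adjoint_sqrt, adjoint_sqrt,
    ContinuousLinearMap.comp_apply, ContinuousLinearMap.comp_apply, ← ofReal_norm, ← ofReal_norm,
    ← ENNReal.ofReal_pow (norm_nonneg _), ← ENNReal.ofReal_pow (norm_nonneg _), h2,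
    ENNReal.ofReal_mul hc]

end Tools

section Exp

variable {n : ℕ} {H : Type*} [NormedAddCommGroup H] [InnerProductSpace ℂ H] [CompleteSpace H]
  {K : Type*} [NormedAddCommGroup K] [InnerProductSpace ℂ K] [CompleteSpace K]
  {M : QPM (Fin n → ℂ) H} {Q : QPM (Fin n → ℂ) K} {V : H →L[ℂ] K}

theorem norm_expC_le (b κ : Fin n → ℂ) : ‖expC b κ‖ ≤ Real.exp (n * ‖b‖ * ‖κ‖) := by
  rw [expC_apply, Complex.norm_exp]
  exact Real.exp_le_exp.2 ((Complex.re_le_norm _).trans (norm_linC_le b κ))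

theorem expC_ne_zero (b κ : Fin n → ℂ) : expC b κ ≠ 0 := Complex.exp_ne_zero _

theorem QPM.IsProj.norm_cut_le (hQ : Q.IsProj) {N : ℕ} {f : C(Fin n → ℂ, ℂ)} {C : ℝ} (hC0 : 0 ≤ C)
    (hC : ∀ x, ‖x‖ ≤ N → ‖f x‖ ≤ C) : ‖Q.cut N f‖ ≤ C := by
  refine hQ.norm_int_le (cutFun_bddMeas N f) (fun x => ?_) hC0
  by_cases hx : x ∈ Metric.closedBall (0 : Fin n → ℂ) N
  · rw [cutFun, Set.indicator_of_mem hx]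
    exact hC x (by simpa using hx)
  · rw [cutFun, Set.indicator_of_notMem hx, norm_zero]
    exact hC0

/-- `h ↦ ∫_{|κ| ≤ N} (∑ h_j conj κ_j) f dQ`. -/
def QPM.cutLin (Q : QPM (Fin n → ℂ) K) (N : ℕ) (f : C(Fin n → ℂ, ℂ)) :
    (Fin n → ℂ) →L[ℂ] K →L[ℂ] K :=
  LinearMap.toContinuousLinearMap
    { toFun := fun h => Q.cut N (linC h * f)
      map_add' := fun x y => by rw [linC_add, add_mul, Q.cut_add]
      map_smul' := fun c x => by rw [linC_smul, smul_mul_assoc, Q.cut_smul, RingHom.id_apply] }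

/-- On the ball of radius `N` the exponent has modulus at most `n N ‖h‖`; for `‖h‖ ≤ 1 / (n N + 1)`
this is at most one, where the second order remainder of `exp` is at most the square of the
exponent. -/
theorem QPM.IsProj.hasFDerivAt_cut_expC (hQ : Q.IsProj) (N : ℕ) (b : Fin n → ℂ) :
    HasFDerivAt (fun b => Q.cut N (expC b)) (Q.cutLin N (expC b)) b := by
  refine hasFDerivAt_of_norm_le_sq (δ := 1 / (n * N + 1))
    (C := Real.exp (n * ‖b‖ * N) * (n * N) ^ 2) (by positivity) fun h hh => ?_
  have e : Q.cut N (expC (b + h)) - Q.cut N (expC b) - Q.cutLin N (expC b) h =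
      Q.cut N (expC b * (expC h - 1 - linC h)) := by
    have : Q.cutLin N (expC b) h = Q.cut N (linC h * expC b) := rfl
    rw [this, expC_add, mul_sub, mul_sub, mul_one, Q.cut_sub, Q.cut_sub, mul_comm (linC h)]
  rw [e]
  refine hQ.norm_cut_le (by positivity) fun x hx => ?_
  have h1 : ‖linC h x‖ ≤ n * N * ‖h‖ := by
    refine (norm_linC_le h x).trans ?_
    calc n * ‖h‖ * ‖x‖ ≤ n * ‖h‖ * N := by gcongr
      _ = n * N * ‖h‖ := by ring
  have h2 : n * N * ‖h‖ ≤ 1 := by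
    rw [le_div_iff₀ (by positivity)] at hh
    nlinarith [norm_nonneg h]
  have h3 := Complex.norm_exp_sub_one_sub_id_le (h1.trans h2)
  rw [ContinuousMap.mul_apply, norm_mul, mul_assoc]
  refine mul_le_mul ((norm_expC_le b x).trans (Real.exp_le_exp.2 (by gcongr))) ?_ (norm_nonneg _)
    (by positivity)
  rw [← mul_pow]
  exact h3.trans (pow_le_pow_left₀ (norm_nonneg _) h1 2)

theorem QPM.IsProj.hasDerivAt_cut_expC (hQ : Q.IsProj) (N : ℕ) {c : ℝ → Fin n → ℂ} {c' : Fin n → ℂ}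
    {t : ℝ} (hc : HasDerivAt c c' t) :
    HasDerivAt (fun s => Q.cut N (expC (c s))) (Q.cut N (linC c' * expC (c t))) t :=
  ((hQ.hasFDerivAt_cut_expC N (c t)).restrictScalars ℝ).comp_hasDerivAt t hc

theorem hasDerivAt_comp_line {O : Set (Fin n → ℂ)} (hO : IsOpen O) {β : (Fin n → ℂ) → Fin n → ℂ}
    (hβ : DifferentiableOn ℂ β O) {a : Fin n → ℂ} (ha : a ∈ O) (v : Fin n → ℂ) :
    HasDerivAt (fun t : ℝ => β (a + t • v)) (jac β a *ᵥ v) 0 := by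
  rw [hasDerivAt_pi]
  intro i
  have h1 : HasFDerivAt (fun b => β b i) (fderiv ℂ (fun b => β b i) a) a :=
    ((differentiableOn_pi.1 hβ i).differentiableAt (hO.mem_nhds ha)).hasFDerivAt
  have h2 := hasDerivAt_real_line (a := a) (v := v) (t := 0) (f := fun b => β b i)
    (f' := (fderiv ℂ (fun b => β b i) a).restrictScalars ℝ) (by simpa using h1.restrictScalars ℝ)
  convert! h2 using 1
  rw [ContinuousLinearMap.coe_restrictScalars', eq_coordForm (fderiv ℂ (fun b => β b i) a),
    coordForm_apply, Matrix.mulVec, dotProduct]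
  refine Finset.sum_congr rfl fun k _ => ?_
  rw [jac, Matrix.of_apply, dz_eq_of_hasFDerivAt h1]

/-- The score condition: the left logarithmic derivatives `S_k = h_k* ρ^{1/2}` act in the dilation
space as the multiplication operators by `∑_j J_jk conj (κ_j - m_j)`. -/
def IsScore (Q : QPM (Fin n → ℂ) K) (V : H →L[ℂ] K) (ρ : H →L[ℂ] H) (S : Fin n → H →L[ℂ] H)
    (J : Matrix (Fin n) (Fin n) ℂ) (m : Fin n → ℂ) : Prop :=
  ∀ k, Q.IsMul (∑ j, J j k • resC m j) (V ∘L CFC.sqrt ρ) (V ∘L S k)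

theorem sum_smul_resC (J : Matrix (Fin n) (Fin n) ℂ) (m v : Fin n → ℂ) :
    ∑ k, v k • ∑ j, J j k • resC m j = linC (J *ᵥ v) - (linC (J *ᵥ v) m) • 1 := by
  ext κ
  simp only [ContinuousMap.sum_apply, ContinuousMap.smul_apply, resC_apply, smul_eq_mul,
    ContinuousMap.sub_apply, linC_apply, ContinuousMap.one_apply, mul_one, ← Finset.sum_sub_distrib,
    Matrix.mulVec, dotProduct, Finset.sum_mul, Finset.mul_sum, map_sub]
  rw [Finset.sum_comm]
  refine Finset.sum_congr rfl fun j _ => ?_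
  refine Finset.sum_congr rfl fun k _ => ?_
  ring

theorem IsScore.dir {ρ : H →L[ℂ] H} {S : Fin n → H →L[ℂ] H} {J : Matrix (Fin n) (Fin n) ℂ}
    {m : Fin n → ℂ} (h : IsScore Q V ρ S J m) (v : Fin n → ℂ) :
    Q.IsMul (linC (J *ᵥ v) - (linC (J *ᵥ v) m) • 1) (V ∘L CFC.sqrt ρ) (V ∘L dirOp S v) := by
  rw [← sum_smul_resC, comp_dirOp]
  exact QPM.IsMul.sum fun k _ => (h k).smul (v k)

/-- The trace of the state against a rank one operator is a matrix element, so the weak derivative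
of the model applies to it. -/
theorem IsModel.hasDerivAt_inner {O : Set (Fin n → ℂ)} {ρ : (Fin n → ℂ) → H →L[ℂ] H}
    {g : (Fin n → ℂ) → Fin n → H →ₗ.[ℂ] H} {S : (Fin n → ℂ) → Fin n → H →L[ℂ] H} {a : Fin n → ℂ}
    (hO : IsOpen O) (hρ : IsModel O ρ g S) (ha : a ∈ O) (v : Fin n → ℂ) (x y : H) :
    HasDerivAt (fun t : ℝ => (inner ℂ x (ρ (a + t • v) y) : ℂ))
      (inner ℂ x (dirOp (S a) v (CFC.sqrt (ρ a) y)) +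
        conj (inner ℂ y (dirOp (S a) v (CFC.sqrt (ρ a) x)) : ℂ)) 0 := by
  have h := hasDerivAt_real_line (a := a) (v := v) (t := 0)
    (f := fun b => tr (ρ b ∘L (innerSL ℂ x).smulRight y)) (by
      simpa using hρ.hasFDerivAt hO ha ((innerSL ℂ x).smulRight y))
  have hS := hsSq_dirOp_ne_top (hρ.hsSq_ne_top ha) v
  have hs := (hρ.density a ha).hsSq_sqrt_ne_top
  have hadj : ContinuousLinearMap.adjoint ((innerSL ℂ x).smulRight y) =
      ((innerSL ℂ y).smulRight x : H →L[ℂ] H) := by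
    symm
    rw [ContinuousLinearMap.eq_adjoint_iff]
    intro u w
    simp [inner_smul_left, inner_smul_right, mul_comm]
  rw [hρ.fderiv_apply hO ha, hadj, ← tr_comp_eq_hsIn hS hs (adjoint_sqrt _),
    ← tr_comp_eq_hsIn hS hs (adjoint_sqrt _)] at h
  simp only [← ContinuousLinearMap.comp_assoc, tr_comp_rankOne] at h
  exact h

variable {O : Set (Fin n → ℂ)} {a₀ : Fin n → ℂ} {ρ : (Fin n → ℂ) → H →L[ℂ] H}
  {g : (Fin n → ℂ) → Fin n → H →ₗ.[ℂ] H} {S : (Fin n → ℂ) → Fin n → H →L[ℂ] H}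
  {ϑ β : (Fin n → ℂ) → Fin n → ℂ} {a : Fin n → ℂ}

/-- The vector `V* (∫_{|κ| ≤ N} exp (b κ*) dQ)* ζ`. -/
def cutVec (Q : QPM (Fin n → ℂ) K) (V : H →L[ℂ] K) (N : ℕ) (ζ : K) (b : Fin n → ℂ) : H :=
  ContinuousLinearMap.adjoint V (ContinuousLinearMap.adjoint (Q.cut N (expC b)) ζ)

theorem inner_cutVec (N : ℕ) (ζ : K) (b : Fin n → ℂ) (x : H) :
    inner ℂ (cutVec Q V N ζ b) x = inner ℂ ζ (Q.cut N (expC b) (V x)) := by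
  rw [cutVec, ContinuousLinearMap.adjoint_inner_left, ContinuousLinearMap.adjoint_inner_left]

/-- The exponential contributes `-∑ (J v)_j conj κ_j` and the score `∑ (J v)_j conj (κ_j - ϑ_j)`.
The operator parts cancel, leaving a scalar and its conjugate times the form itself. -/
theorem hasDerivAt_cutForm (hO : IsOpen O) (hρ : IsModel O ρ g S) (hQ : Q.IsProj)
    (hβ : DifferentiableOn ℂ β O) (ha : a ∈ O) (hsc : IsScore Q V (ρ a) (S a) (jac β a) (ϑ a))
    (N : ℕ) (ζ ξ : K) (v : Fin n → ℂ) :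
    HasDerivAt (fun t : ℝ => (inner ℂ (cutVec Q V N ζ (-β (a + t • v)))
      (ρ (a + t • v) (cutVec Q V N ξ (-β (a + t • v)))) : ℂ))
      (-(linC (jac β a *ᵥ v) (ϑ a) + conj (linC (jac β a *ᵥ v) (ϑ a))) *
        inner ℂ (cutVec Q V N ζ (-β a)) (ρ a (cutVec Q V N ξ (-β a)))) 0 := by
  set J := jac β a
  set ω := linC (J *ᵥ v) (ϑ a)
  set E := Q.cut N (expC (-β a)) with hE
  set F := Q.cut N (linC (J *ᵥ v) * expC (-β a)) with hF
  have hE' : HasDerivAt (fun t : ℝ => Q.cut N (expC (-β (a + t • v)))) (-F) 0 := by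
    have h1 := hQ.hasDerivAt_cut_expC N (hasDerivAt_comp_line hO hβ ha v).neg
    have e : ∀ f, linC (-(J *ᵥ v)) * f = -(linC (J *ᵥ v) * f) := by
      intro f
      ext κ
      simp [linC_apply]
    rw [e, Q.cut_neg] at h1
    simpa using h1
  have hp : ∀ ζ : K, HasDerivAt (fun t : ℝ => cutVec Q V N ζ (-β (a + t • v)))
      (-ContinuousLinearMap.adjoint V (ContinuousLinearMap.adjoint F ζ)) 0 := by
    intro ζ
    have h1 := ((ContinuousLinearMap.apply ℂ K ζ).restrictScalars ℝ).hasFDerivAt.comp_hasDerivAt 0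
      hE'.star
    have h2 := ((ContinuousLinearMap.adjoint V).restrictScalars ℝ).hasFDerivAt.comp_hasDerivAt 0 h1
    convert! h2 using 1
    simp [ContinuousLinearMap.star_eq_adjoint]
  have hC : ∀ᶠ t : ℝ in 𝓝 0, ‖ρ (a + t • v)‖ ≤ 1 := by
    have hc : ContinuousAt (fun t : ℝ => a + t • v) 0 := by fun_prop
    have := hc.eventually (p := fun b => b ∈ O) (hO.mem_nhds (by simpa using ha))
    filter_upwards [this] with t ht
    exact (hρ.density _ ht).norm_le
  have h := hasDerivAt_inner_weak (hp ζ) (hp ξ) (fun x y => hρ.hasDerivAt_inner hO ha v x y) hC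
  simp only [zero_smul, add_zero] at h
  convert! h using 1
  -- This is the cancellation on the left factor; the right factor follows by conjugation and
  -- symmetry of `ρ`.
  have hkey : ∀ ζ x, inner ℂ (-ContinuousLinearMap.adjoint V (ContinuousLinearMap.adjoint F ζ)) (ρ a x) +
      inner ℂ (cutVec Q V N ζ (-β a)) (dirOp (S a) v (CFC.sqrt (ρ a) x)) =
      -ω * inner ℂ (cutVec Q V N ζ (-β a)) (ρ a x) := by
    intro ζ x
    have h1 := congr($((hsc.dir v).mul (g := expC (-β a)) hQ N) (CFC.sqrt (ρ a) x))
    simp only [ContinuousLinearMap.comp_apply] at h1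
    have h2 : CFC.sqrt (ρ a) (CFC.sqrt (ρ a) x) = ρ a x := congr($((hρ.density a ha).sqrt_comp) x)
    rw [inner_cutVec, inner_cutVec, h1, h2, inner_neg_left, ContinuousLinearMap.adjoint_inner_left,
      ContinuousLinearMap.adjoint_inner_left, mul_sub, Q.cut_sub, mul_smul_comm, mul_one, Q.cut_smul,
      _root_.sub_apply, inner_sub_right, _root_.smul_apply, inner_smul_right, hF,
      mul_comm (expC (-β a))]
    ring
  have hsym : ∀ x y : H, inner ℂ x (ρ a y) = conj (inner ℂ y (ρ a x) : ℂ) := by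
    intro x y
    rw [← (hρ.density a ha).inner_sqrt, ← (hρ.density a ha).inner_sqrt, inner_conj_symm]
  have h1 := hkey ζ (cutVec Q V N ξ (-β a))
  have h2 := congrArg conj (hkey ξ (cutVec Q V N ζ (-β a)))
  rw [map_add, map_mul, ← hsym, ← hsym, map_neg (starRingEnd ℂ) ω] at h2
  linear_combination -h1 - h2

end Exp

end

section


/-! ### Integration of the score equation, and tilting of the law -/

section Exp

variable {n : ℕ} {H : Type*} [NormedAddCommGroup H] [InnerProductSpace ℂ H] [CompleteSpace H]
  {K : Type*} [NormedAddCommGroup K] [InnerProductSpace ℂ K] [CompleteSpace K]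
  {M : QPM (Fin n → ℂ) H} {Q : QPM (Fin n → ℂ) K} {V : H →L[ℂ] K}
  {O : Set (Fin n → ℂ)} {a₀ : Fin n → ℂ} {ρ : (Fin n → ℂ) → H →L[ℂ] H}
  {g : (Fin n → ℂ) → Fin n → H →ₗ.[ℂ] H} {S : (Fin n → ℂ) → Fin n → H →L[ℂ] H}
  {ϑ β : (Fin n → ℂ) → Fin n → ℂ} {a : Fin n → ℂ}

/-- The exponential form `ρ = c e^{b κ*} ρ₀ e^{b* κ}` in the dilation space. -/
def IsExpForm (Q : QPM (Fin n → ℂ) K) (V : H →L[ℂ] K) (ρ₀ ρ : H →L[ℂ] H) (b : Fin n → ℂ) (c : ℝ) :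
    Prop :=
  ∀ N ζ ξ, inner ℂ (cutVec Q V N ζ (-b)) (ρ (cutVec Q V N ξ (-b))) =
    c * inner ℂ (cutVec Q V N ζ 0) (ρ₀ (cutVec Q V N ξ 0))

/-- The normalizing factor satisfies the differential equation `d ln c = - 2 Re ∑ ϑ̄_j dβ^j`. -/
def IsNormalizer (O : Set (Fin n → ℂ)) (a₀ : Fin n → ℂ) (ϑ β : (Fin n → ℂ) → Fin n → ℂ)
    (c : (Fin n → ℂ) → ℝ) : Prop :=
  c a₀ = 1 ∧ ∀ a ∈ O, ∀ v, HasDerivAt (fun t : ℝ => (c (a + t • v) : ℂ))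
    (-(linC (jac β a *ᵥ v) (ϑ a) + conj (linC (jac β a *ᵥ v) (ϑ a))) * c a) 0

theorem exists_bound_normalizer (hO : IsOpen O) (hβ : DifferentiableOn ℂ β O) (hϑ : ContinuousOn ϑ O)
    (ha : a ∈ O) : ∃ C, ∀ᶠ b in 𝓝 a, ∀ v,
      ‖-(linC (jac β b *ᵥ v) (ϑ b) + conj (linC (jac β b *ᵥ v) (ϑ b)))‖ ≤ C * ‖v‖ := by
  have hJ : ∀ i k, ContinuousOn (fun b => jac β b i k) O := fun i k =>
    (differentiableOn_dz hO (differentiableOn_pi.1 hβ i) k).continuousOn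
  set f : (Fin n → ℂ) → ℝ := fun b => 2 * (n * (∑ i, ∑ k, ‖jac β b i k‖) * ‖ϑ b‖) with hf
  have hfc : ContinuousAt f a := by
    refine ContinuousOn.continuousAt (s := O) ?_ (hO.mem_nhds ha)
    exact continuousOn_const.mul ((continuousOn_const.mul (continuousOn_finsetSum _ fun i _ =>
      continuousOn_finsetSum _ fun k _ => (hJ i k).norm)).mul hϑ.norm)
  refine ⟨f a + 1, ?_⟩
  filter_upwards [hfc.eventually_lt_const (lt_add_one (f a))] with b hb v
  have h1 : ‖jac β b *ᵥ v‖ ≤ (∑ i, ∑ k, ‖jac β b i k‖) * ‖v‖ := by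
    refine (pi_norm_le_iff_of_nonneg (by positivity)).2 fun i => ?_
    have h2 : ‖(jac β b *ᵥ v) i‖ ≤ (∑ k, ‖jac β b i k‖) * ‖v‖ := by
      rw [Matrix.mulVec, dotProduct, Finset.sum_mul]
      refine (norm_sum_le _ _).trans (Finset.sum_le_sum fun k _ => ?_)
      rw [norm_mul]
      exact mul_le_mul_of_nonneg_left (norm_le_pi_norm v k) (norm_nonneg _)
    refine h2.trans (mul_le_mul_of_nonneg_right ?_ (norm_nonneg _))
    exact Finset.single_le_sum (f := fun i => ∑ k, ‖jac β b i k‖)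
      (fun i _ => by positivity) (Finset.mem_univ i)
  have h3 := norm_linC_le (jac β b *ᵥ v) (ϑ b)
  rw [norm_neg]
  refine (norm_add_le _ _).trans ?_
  rw [RCLike.norm_conj]
  have h4 : n * ‖jac β b *ᵥ v‖ * ‖ϑ b‖ ≤ n * ((∑ i, ∑ k, ‖jac β b i k‖) * ‖v‖) * ‖ϑ b‖ := by
    gcongr
  have h5 : f b * ‖v‖ ≤ (f a + 1) * ‖v‖ := mul_le_mul_of_nonneg_right hb.le (norm_nonneg _)
  have h6 : f b * ‖v‖ = 2 * (n * ((∑ i, ∑ k, ‖jac β b i k‖) * ‖v‖) * ‖ϑ b‖) := by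
    simp only [hf]; ring
  linarith

theorem eqOn_of_isNormalizer (hO : IsOpen O) (hOc : IsPreconnected O) (ha₀ : a₀ ∈ O)
    (hβ : DifferentiableOn ℂ β O) (hϑ : ContinuousOn ϑ O) {c c' : (Fin n → ℂ) → ℝ}
    (hc : IsNormalizer O a₀ ϑ β c) (hc' : IsNormalizer O a₀ ϑ β c') : ∀ a ∈ O, c a = c' a := by
  intro a ha
  have := eqOn_zero_of_hasDerivAt hO hOc (W := fun a => (c a : ℂ) - c' a)
    (Λ := fun a v => -(linC (jac β a *ᵥ v) (ϑ a) + conj (linC (jac β a *ᵥ v) (ϑ a))))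
    (fun a ha => exists_bound_normalizer hO hβ hϑ ha)
    (fun a ha v => by
      have := (hc.2 a ha v).sub (hc'.2 a ha v)
      rw [← mul_sub] at this
      exact this) ha₀ (by simp [hc.1, hc'.1]) a ha
  exact Complex.ofReal_injective (sub_eq_zero.1 this)

theorem inner_self_real (h : IsDensity (ρ a)) (x : H) :
    inner ℂ x (ρ a x) = ((‖CFC.sqrt (ρ a) x‖ ^ 2 : ℝ) : ℂ) := by
  rw [← h.inner_sqrt, inner_self_eq_norm_sq_to_K]
  push_cast
  rfl

/-- These vectors are dense in `H`, as truncations converge to the identity; if `ρ^{1/2}`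
annihilated them all, its trace norm could not be one. The vector found serves to read off the
normalizing factor. -/
theorem exists_cutVec_ne_zero {ρ : H →L[ℂ] H} (h : IsDensity ρ) (hd : M.IsDilation Q V) :
    ∃ N ζ, CFC.sqrt ρ (cutVec Q V N ζ 0) ≠ 0 := by
  by_contra! h0
  have h1 : ∀ ψ, CFC.sqrt ρ ψ = 0 := by
    intro ψ
    have h2 : Tendsto (fun N => CFC.sqrt ρ (ContinuousLinearMap.adjoint V (Q.cut N 1 (V ψ)))) atTop
        (𝓝 (CFC.sqrt ρ (ContinuousLinearMap.adjoint V (V ψ)))) :=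
      ((CFC.sqrt ρ ∘L ContinuousLinearMap.adjoint V).continuous.tendsto _).comp
        (hd.proj.tendsto_cut_one (V ψ))
    rw [hd.adjoint_apply] at h2
    refine tendsto_nhds_unique h2 (tendsto_const_nhds.congr fun N => ?_)
    have := h0 N (V ψ)
    rw [cutVec, expC_zero, QPM.IsProj.adjoint_cut_one] at this
    exact this.symm
  have h2 := h.hsSq_sqrt
  simp [hsSq, h1] at h2

/-- The score condition implies the exponential form. -/
theorem exists_expForm (hO : IsOpen O) (hOc : IsPreconnected O) (ha₀ : a₀ ∈ O)
    (hρ : IsModel O ρ g S) (hd : M.IsDilation Q V) (hϑ : ContinuousOn ϑ O)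
    (hβ : DifferentiableOn ℂ β O) (hβ0 : β a₀ = 0)
    (hsc : ∀ a ∈ O, IsScore Q V (ρ a) (S a) (jac β a) (ϑ a)) :
    ∃ c : (Fin n → ℂ) → ℝ, (∀ a ∈ O, 0 < c a) ∧ IsNormalizer O a₀ ϑ β c ∧
      ∀ a ∈ O, IsExpForm Q V (ρ a₀) (ρ a) (β a) (c a) := by
  obtain ⟨N₀, ζ₀, h₀⟩ := exists_cutVec_ne_zero (hρ.density a₀ ha₀) hd
  set r := ‖CFC.sqrt (ρ a₀) (cutVec Q V N₀ ζ₀ 0)‖ ^ 2 with hr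
  have hr0 : 0 < r := by
    have := norm_pos_iff.2 h₀
    positivity
  -- The factor is the value of the conjugated form on one fixed vector, divided by its value at
  -- `a₀`; it inherits the scalar equation.
  set c : (Fin n → ℂ) → ℝ := fun b => r⁻¹ * ‖CFC.sqrt (ρ b) (cutVec Q V N₀ ζ₀ (-β b))‖ ^ 2 with hc
  have hcG : ∀ b ∈ O, (c b : ℂ) = (r : ℂ)⁻¹ *
      inner ℂ (cutVec Q V N₀ ζ₀ (-β b)) (ρ b (cutVec Q V N₀ ζ₀ (-β b))) := by
    intro b hb
    rw [inner_self_real (hρ.density b hb), hc]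
    push_cast
    rfl
  have hnorm : IsNormalizer O a₀ ϑ β c := by
    refine ⟨?_, fun a ha v => ?_⟩
    · simp only [hc, hβ0, neg_zero]
      rw [← hr]
      exact inv_mul_cancel₀ hr0.ne'
    · have h1 := (hasDerivAt_cutForm hO hρ hd.proj hβ ha (hsc a ha) N₀ ζ₀ ζ₀ v).const_mul (r : ℂ)⁻¹
      rw [mul_left_comm, ← hcG a ha] at h1
      refine h1.congr_of_eventuallyEq ?_
      have hc : ContinuousAt (fun t : ℝ => a + t • v) 0 := by fun_prop
      filter_upwards [hc.eventually (p := fun b => b ∈ O) (hO.mem_nhds (by simpa using ha))] with t ht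
      exact hcG _ ht
  have hbound := fun a (ha : a ∈ O) => exists_bound_normalizer hO hβ hϑ ha
  refine ⟨c, fun a ha => ?_, hnorm, fun a ha N ζ ξ => ?_⟩
  -- A zero of `c` anywhere would propagate to `a₀`, where `c = 1`.
  · refine lt_of_le_of_ne (by positivity) fun h => ?_
    have := eqOn_zero_of_hasDerivAt hO hOc (W := fun a => (c a : ℂ)) hbound hnorm.2 ha
      (by simp [← h]) a₀ ha₀
    rw [hnorm.1] at this
    simp at this
  · have := eqOn_zero_of_hasDerivAt hO hOc (W := fun a => inner ℂ (cutVec Q V N ζ (-β a))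
      (ρ a (cutVec Q V N ξ (-β a))) - c a * inner ℂ (cutVec Q V N ζ 0) (ρ a₀ (cutVec Q V N ξ 0)))
      hbound (fun a ha v => by
        have h1 := (hasDerivAt_cutForm hO hρ hd.proj hβ ha (hsc a ha) N ζ ξ v).sub
          ((hnorm.2 a ha v).mul_const (inner ℂ (cutVec Q V N ζ 0) (ρ a₀ (cutVec Q V N ξ 0))))
        rw [mul_assoc, ← mul_sub] at h1
        exact h1) ha₀ (by simp [hnorm.1, hβ0]) a ha
    exact sub_eq_zero.1 this

theorem cutVec_cut (hQ : Q.IsProj) (N : ℕ) (f : C(Fin n → ℂ, ℂ)) (ζ : K) (b : Fin n → ℂ) :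
    cutVec Q V N (ContinuousLinearMap.adjoint (Q.cut N f) ζ) b =
      ContinuousLinearMap.adjoint V (ContinuousLinearMap.adjoint (Q.cut N (f * expC b)) ζ) := by
  rw [cutVec, hQ.cut_mul, ContinuousLinearMap.adjoint_comp]
  rfl

/-- The exponential form, with the factors on the other side. -/
theorem IsExpForm.symm (hQ : Q.IsProj) {ρ₀ ρ : H →L[ℂ] H} {b : Fin n → ℂ} {c : ℝ}
    (h : IsExpForm Q V ρ₀ ρ b c) (N : ℕ) (ζ ξ : K) :
    inner ℂ (cutVec Q V N ζ 0) (ρ (cutVec Q V N ξ 0)) =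
      c * inner ℂ (cutVec Q V N ζ b) (ρ₀ (cutVec Q V N ξ b)) := by
  have h1 := h N (ContinuousLinearMap.adjoint (Q.cut N (expC b)) ζ)
    (ContinuousLinearMap.adjoint (Q.cut N (expC b)) ξ)
  simp only [cutVec_cut hQ, expC_mul_neg, expC_zero, mul_one] at h1
  simpa only [cutVec, expC_zero] using h1

/-- Testing the exponential form on `Q(B) ζ` and summing over a basis gives the density `c |e^{b
κ*}|²` on bounded sets; the balls then exhaust the space. -/
theorem IsExpForm.law_eq (hd : M.IsDilation Q V) {ρ₀ ρ : H →L[ℂ] H} (hρ₀ : IsDensity ρ₀)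
    (hρ : IsDensity ρ) {b : Fin n → ℂ} {c : ℝ} (hc : 0 ≤ c) (h : IsExpForm Q V ρ₀ ρ b c) :
    M.law ρ = ENNReal.ofReal c • (M.law ρ₀).withDensity fun κ => ‖expC b κ‖ₑ ^ 2 := by
  have hball : ∀ N : ℕ, ∀ B, MeasurableSet B → M.law ρ (B ∩ Metric.closedBall 0 N) =
      (ENNReal.ofReal c • (M.law ρ₀).withDensity fun κ => ‖expC b κ‖ₑ ^ 2)
        (B ∩ Metric.closedBall 0 N) := by
    intro N B hB
    have hBN := hB.inter (measurableSet_ball (n := n) N)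
    have hadj : ContinuousLinearMap.adjoint (Q.op B) = Q.op B :=
      (Q.isPositive hB).isSelfAdjoint.adjoint_eq
    have hop : Q.op (B ∩ Metric.closedBall 0 N) = Q.op B ∘L Q.cut N 1 := by
      rw [QPM.cut_one, hd.proj B _ hB (measurableSet_ball N)]
    have hint : Q.op B ∘L Q.cut N (expC b) =
        Q.int ((B.indicator fun _ => 1) * cutFun N (expC b)) := by
      rw [hd.proj.int_mul (BddMeas.indicator_const hB 1) (cutFun_bddMeas N _), Q.int_indicator hB,
        one_smul]
      rfl
    rw [hd.law_apply ρ hBN, hop, ← ContinuousLinearMap.comp_assoc,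
      hsSq_comp_eq (Z₀ := Q.op B ∘L Q.cut N (expC b) ∘L V) hρ hρ₀ hc ?_,
      ContinuousLinearMap.comp_assoc, ContinuousLinearMap.comp_assoc,
      ← ContinuousLinearMap.comp_assoc (Q.op B), hint,
      hd.hsSq_int ((BddMeas.indicator_const hB 1).mul (cutFun_bddMeas N _)),
      Measure.smul_apply, withDensity_apply _ hBN, smul_eq_mul, ← lintegral_indicator hBN]
    · congr 1
      refine lintegral_congr fun κ => ?_
      by_cases h1 : κ ∈ B <;> by_cases h2 : κ ∈ Metric.closedBall (0 : Fin n → ℂ) N <;>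
        simp [cutFun, h1, h2]
    · intro ζ
      have := h.symm hd.proj N (Q.op B ζ) (Q.op B ζ)
      simpa only [ContinuousLinearMap.adjoint_comp, hadj, cutVec, expC_zero,
        ContinuousLinearMap.comp_apply] using this
  ext B hB
  have h1 : ∀ μ : Measure (Fin n → ℂ),
      Tendsto (fun N : ℕ => μ (B ∩ Metric.closedBall 0 N)) atTop (𝓝 (μ B)) := by
    intro μ
    have := tendsto_measure_iUnion_atTop (μ := μ)
      (s := fun N : ℕ => B ∩ Metric.closedBall (0 : Fin n → ℂ) N)
      (fun _ _ h => Set.inter_subset_inter_right _ (ball_mono h))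
    rwa [← Set.inter_iUnion, iUnion_ball, Set.inter_univ] at this
  refine tendsto_nhds_unique (h1 _) ?_
  simp only [fun N => hball N B hB]
  exact h1 _

end Exp

end

section


/-! ### From the exponential form to the scores, and efficiency -/

section Score

variable {n : ℕ} {H : Type*} [NormedAddCommGroup H] [InnerProductSpace ℂ H] [CompleteSpace H]
  {K : Type*} [NormedAddCommGroup K] [InnerProductSpace ℂ K] [CompleteSpace K]
  {M : QPM (Fin n → ℂ) H} {Q : QPM (Fin n → ℂ) K} {V : H →L[ℂ] K}
  {O : Set (Fin n → ℂ)} {a₀ : Fin n → ℂ} {ρ : (Fin n → ℂ) → H →L[ℂ] H}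
  {g : (Fin n → ℂ) → Fin n → H →ₗ.[ℂ] H} {S : (Fin n → ℂ) → Fin n → H →L[ℂ] H}
  {ϑ β : (Fin n → ℂ) → Fin n → ℂ} {a : Fin n → ℂ}

/-- Operators that vanish on the kernel of a self-adjoint `s` are determined by their values on its
range. -/
theorem eq_of_comp_eq {s : H →L[ℂ] H} (hs : ContinuousLinearMap.adjoint s = s) {X Y : H →L[ℂ] K}
    (h : X ∘L s = Y ∘L s) (hX : ∀ ψ, s ψ = 0 → X ψ = 0) (hY : ∀ ψ, s ψ = 0 → Y ψ = 0) : X = Y := by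
  set D := X - Y with hD
  have h1 : ∀ ζ, s (ContinuousLinearMap.adjoint D ζ) = 0 := by
    intro ζ
    have : ContinuousLinearMap.adjoint (D ∘L s) = 0 := by
      rw [hD, ContinuousLinearMap.sub_comp, h, sub_self, map_zero]
    rw [ContinuousLinearMap.adjoint_comp, hs] at this
    exact congr($this ζ)
  have h2 : ContinuousLinearMap.adjoint D = 0 := by
    ext ζ
    rw [_root_.zero_apply, ← inner_self_eq_zero (𝕜 := ℂ), ContinuousLinearMap.adjoint_inner_left, hD,
      _root_.sub_apply, hX _ (h1 ζ), hY _ (h1 ζ), sub_zero, inner_zero_right]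
  have h3 : D = 0 := by
    rw [← ContinuousLinearMap.adjoint_adjoint D, h2, map_zero]
  exact sub_eq_zero.1 h3

theorem IsModel.apply_eq_zero (hρ : IsModel O ρ g S) (ha : a ∈ O) (k : Fin n) {ψ : H}
    (h : CFC.sqrt (ρ a) ψ = 0) : S a k ψ = 0 := by
  obtain ⟨hm, h1⟩ := (hρ.logDeriv a ha k).1.1 ψ
  rw [← h1]
  have : (⟨CFC.sqrt (ρ a) ψ, hm⟩ : (g a k).domain) = 0 := Subtype.ext h
  rw [this, LinearPMap.map_zero]

theorem hasDerivAt_cutVec (hO : IsOpen O) (hQ : Q.IsProj) (hβ : DifferentiableOn ℂ β O) (ha : a ∈ O)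
    (N : ℕ) (ζ : K) (v : Fin n → ℂ) :
    HasDerivAt (fun t : ℝ => cutVec Q V N ζ (β (a + t • v)))
      (ContinuousLinearMap.adjoint V (ContinuousLinearMap.adjoint
        (Q.cut N (linC (jac β a *ᵥ v) * expC (β a))) ζ)) 0 := by
  have h0 := hQ.hasDerivAt_cut_expC N (hasDerivAt_comp_line hO hβ ha v)
  have h1 := ((ContinuousLinearMap.apply ℂ K ζ).restrictScalars ℝ).hasFDerivAt.comp_hasDerivAt 0
    h0.star
  have h2 := ((ContinuousLinearMap.adjoint V).restrictScalars ℝ).hasFDerivAt.comp_hasDerivAt 0 h1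
  convert! h2 using 1
  simp [ContinuousLinearMap.star_eq_adjoint]

/-- The exponential form implies the score condition. -/
theorem isScore_of_isExpForm (hO : IsOpen O) (hρ : IsModel O ρ g S) (hd : M.IsDilation Q V)
    (hβ : DifferentiableOn ℂ β O) {ρ₀ : H →L[ℂ] H} {c : (Fin n → ℂ) → ℝ}
    (hc : IsNormalizer O a₀ ϑ β c) (hE : ∀ a ∈ O, IsExpForm Q V ρ₀ (ρ a) (β a) (c a)) (ha : a ∈ O) :
    IsScore Q V (ρ a) (S a) (jac β a) (ϑ a) := by
  set J := jac β a with hJ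
  set s := CFC.sqrt (ρ a) with hs
  have hss : ∀ x, s (s x) = ρ a x := fun x => congr($((hρ.density a ha).sqrt_comp) x)
  set f : (Fin n → ℂ) → C(Fin n → ℂ, ℂ) := fun v => linC (J *ᵥ v) - (linC (J *ᵥ v) (ϑ a)) • 1 with hf
  -- `A` is the defect of the score condition in direction `v`, tested on truncated vectors.
  -- Differentiating the exponential form only yields the vanishing of `A` plus its adjoint form.
  set A : ℕ → (Fin n → ℂ) → K → K → ℂ := fun N v ζ ξ =>
    inner ℂ ζ (Q.cut N 1 (V (dirOp (S a) v (s (cutVec Q V N ξ 0))))) -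
      inner ℂ ζ (Q.cut N (f v) (V (s (s (cutVec Q V N ξ 0))))) with hA
  have hsum : ∀ N v ζ ξ, A N v ζ ξ + conj (A N v ξ ζ) = 0 := by
    intro N v ζ ξ
    have hC : ∀ᶠ t : ℝ in 𝓝 0, a + t • v ∈ O := by
      have hc : ContinuousAt (fun t : ℝ => a + t • v) 0 := by fun_prop
      exact hc.eventually (p := fun b => b ∈ O) (hO.mem_nhds (by simpa using ha))
    have h1 := hρ.hasDerivAt_inner hO ha v (cutVec Q V N ζ 0) (cutVec Q V N ξ 0)
    have h2 := (hc.2 a ha v).mul (hasDerivAt_inner_weak (B := 0) (C := ‖ρ₀‖) (T := fun _ => ρ₀)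
      (hasDerivAt_cutVec (V := V) hO hd.proj hβ ha N ζ v)
      (hasDerivAt_cutVec (V := V) hO hd.proj hβ ha N ξ v)
      (fun x y => hasDerivAt_const _ _) (Eventually.of_forall fun _ => le_rfl))
    have h3 := h1.unique (h2.congr_of_eventuallyEq (hC.mono fun t ht =>
      (hE _ ht).symm hd.proj N ζ ξ))
    have h4 : ∀ ζ ξ : K, (c a : ℂ) * inner ℂ (cutVec Q V N ζ (β a)) (ρ₀ (cutVec Q V N ξ (β a))) =
        inner ℂ (cutVec Q V N ζ 0) (ρ a (cutVec Q V N ξ 0)) := fun ζ ξ =>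
      ((hE a ha).symm hd.proj N ζ ξ).symm
    have h5 : ∀ ζ : K, ContinuousLinearMap.adjoint V (ContinuousLinearMap.adjoint
        (Q.cut N (linC (J *ᵥ v) * expC (β a))) ζ) =
        cutVec Q V N (ContinuousLinearMap.adjoint (Q.cut N (linC (J *ᵥ v))) ζ) (β a) := fun ζ =>
      (cutVec_cut hd.proj N (linC (J *ᵥ v)) ζ (β a)).symm
    have h6 : ∀ ζ : K, cutVec Q V N (ContinuousLinearMap.adjoint (Q.cut N (linC (J *ᵥ v))) ζ) 0 =
        ContinuousLinearMap.adjoint V (ContinuousLinearMap.adjoint (Q.cut N (linC (J *ᵥ v))) ζ) := by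
      intro ζ
      rw [cutVec_cut hd.proj, expC_zero, mul_one]
    simp only [zero_smul, add_zero, Pi.zero_apply] at h3
    rw [← hJ, h5, h5, mul_add, h4, h4, mul_assoc, h4] at h3
    have hsym : ∀ x y : H, inner ℂ x (ρ a y) = conj (inner ℂ y (ρ a x) : ℂ) := by
      intro x y
      rw [← (hρ.density a ha).inner_sqrt, ← (hρ.density a ha).inner_sqrt, inner_conj_symm]
    have h7 : ∀ ζ ξ : K, A N v ζ ξ = inner ℂ (cutVec Q V N ζ 0)
        (dirOp (S a) v (s (cutVec Q V N ξ 0))) -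
        (inner ℂ (cutVec Q V N (ContinuousLinearMap.adjoint (Q.cut N (linC (J *ᵥ v))) ζ) 0)
          (ρ a (cutVec Q V N ξ 0)) - linC (J *ᵥ v) (ϑ a) *
            inner ℂ (cutVec Q V N ζ 0) (ρ a (cutVec Q V N ξ 0))) := by
      intro ζ ξ
      simp only [hA, hf]
      rw [inner_cutVec, inner_cutVec N ζ, h6, hss, Q.cut_sub, Q.cut_smul, expC_zero,
        ContinuousLinearMap.adjoint_inner_left, ContinuousLinearMap.adjoint_inner_left,
        _root_.sub_apply, _root_.smul_apply, inner_sub_right, inner_smul_right]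
    rw [h7, h7]
    simp only [map_sub, map_mul]
    rw [← hsym, ← hsym]
    linear_combination h3
  have hI : ∀ N v ζ ξ, A N (Complex.I • v) ζ ξ = Complex.I * A N v ζ ξ := by
    intro N v ζ ξ
    have e1 : dirOp (S a) (Complex.I • v) = Complex.I • dirOp (S a) v := by
      simp only [dirOp, Finset.smul_sum, smul_smul, Pi.smul_apply, smul_eq_mul]
    have e2 : f (Complex.I • v) = Complex.I • f v := by
      ext κ
      simp only [hf, Matrix.mulVec_smul, linC_smul, ContinuousMap.sub_apply, ContinuousMap.smul_apply,
        smul_eq_mul, ContinuousMap.one_apply]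
      ring
    simp only [hA, e1, e2, Q.cut_smul, _root_.smul_apply, map_smul, inner_smul_right]
    ring
  -- Since `A` is complex linear in `v`, the relations for `v` and `i v` separate `A` from its
  -- adjoint form.
  have hA0 : ∀ N v ζ ξ, A N v ζ ξ = 0 := by
    intro N v ζ ξ
    have h1 := hsum N v ζ ξ
    have h2 := hsum N (Complex.I • v) ζ ξ
    rw [hI, hI, map_mul, Complex.conj_I] at h2
    have h3 : Complex.I * (A N v ζ ξ - conj (A N v ξ ζ)) = 0 := by linear_combination h2
    have h4 := (mul_eq_zero.1 h3).resolve_left Complex.I_ne_zero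
    linear_combination (1 / 2 : ℂ) * h1 + (1 / 2 : ℂ) * h4
  intro k N
  have hk : f (Pi.single k 1) = ∑ j, J j k • resC (ϑ a) j := by
    simp only [hf]
    rw [← sum_smul_resC, Finset.sum_eq_single k (fun b _ hb => by ext κ; simp [hb]) (by simp)]
    ext κ
    simp
  have hdk : dirOp (S a) (Pi.single k 1) = S a k := by
    rw [dirOp, Finset.sum_eq_single k (fun b _ hb => by simp [hb]) (by simp)]
    simp
  rw [← hk]
  -- The defect has been tested only on the range of `ρ^{1/2}`; on its kernel both sides vanish,
  -- which settles the remaining directions.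
  refine eq_of_comp_eq (adjoint_sqrt (ρ a)) ?_ (fun ψ hψ => ?_) (fun ψ hψ => ?_)
  · ext φ
    simp only [ContinuousLinearMap.comp_apply]
    -- The test vectors carry the same truncation as the identity. Taking it at level `N + m`,
    -- restricting to level `N` and letting `m` grow removes it from the vectors alone.
    have hcut : ∀ (m : ℕ) (g : C(Fin n → ℂ, ℂ)) (x : K), Q.cut N 1 (Q.cut (N + m) g x) =
        Q.cut N g x := by
      intro m g x
      have := hd.proj.cut_mul_of_le (f := 1) (g := g) (Nat.le_add_right N m)
      rw [one_mul] at this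
      exact congr($this x).symm
    have hlim : Tendsto (fun m : ℕ => cutVec Q V (N + m) (V φ) 0) atTop (𝓝 φ) := by
      have h1 := ((ContinuousLinearMap.adjoint V).continuous.tendsto _).comp
        ((hd.proj.tendsto_cut_one (V φ)).comp (tendsto_atTop_mono (fun m => Nat.le_add_left m N)
          tendsto_id))
      rw [hd.adjoint_apply] at h1
      refine h1.congr fun m => ?_
      simp [cutVec, expC_zero, QPM.IsProj.adjoint_cut_one]
    have heq : ∀ m : ℕ, Q.cut N 1 (V (S a k (s (cutVec Q V (N + m) (V φ) 0)))) =
        Q.cut N (f (Pi.single k 1)) (V (s (s (cutVec Q V (N + m) (V φ) 0)))) := by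
      intro m
      have h1 : Q.cut (N + m) 1 (V (S a k (s (cutVec Q V (N + m) (V φ) 0)))) =
          Q.cut (N + m) (f (Pi.single k 1)) (V (s (s (cutVec Q V (N + m) (V φ) 0)))) := by
        refine ext_inner_left ℂ fun ζ => ?_
        have := hA0 (N + m) (Pi.single k 1) ζ (V φ)
        simp only [hA, hdk] at this
        exact sub_eq_zero.1 this
      rw [← hcut m (f (Pi.single k 1)), ← h1, hcut m]
    refine tendsto_nhds_unique
      (((Q.cut N 1 ∘L V ∘L S a k ∘L s).continuous.tendsto _).comp hlim) ?_
    refine (((Q.cut N (f (Pi.single k 1)) ∘L V ∘L s ∘L s).continuous.tendsto _).comp hlim).congr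
      fun m => ?_
    exact (heq m).symm
  · simp [hρ.apply_eq_zero ha k hψ]
  · rw [ContinuousLinearMap.comp_apply, ContinuousLinearMap.comp_apply, hψ, map_zero, map_zero]

/-! ### Consequences of the score condition -/

/-- The operators `κ̄_j - m̄_j` applied to `V ρ^{1/2}`. -/
def scoreRes (V : H →L[ℂ] K) (S : Fin n → H →L[ℂ] H) (J : Matrix (Fin n) (Fin n) ℂ) (j : Fin n) :
    H →L[ℂ] K := dirOp (fun k => V ∘L S k) fun k => J⁻¹ k j

variable {T : H →L[ℂ] H} {Sa : Fin n → H →L[ℂ] H} {J : Matrix (Fin n) (Fin n) ℂ} {m : Fin n → ℂ}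

theorem IsScore.isMul (h : IsScore Q V T Sa J m) (hJ : IsUnit J) (j : Fin n) :
    Q.IsMul (resC m j) (V ∘L CFC.sqrt T) (scoreRes V Sa J j) := by
  have h1 : ∑ k, J⁻¹ k j • ∑ i, J i k • resC m i = resC m j := by
    ext κ
    have h2 : ∀ i, ∑ k, J⁻¹ k j * (J i k * resC m i κ) =
        (1 : Matrix (Fin n) (Fin n) ℂ) i j * resC m i κ := by
      intro i
      rw [← Matrix.mul_nonsing_inv J ((Matrix.isUnit_iff_isUnit_det _).1 hJ), Matrix.mul_apply,
        Finset.sum_mul]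
      exact Finset.sum_congr rfl fun k _ => by ring
    simp only [ContinuousMap.sum_apply, ContinuousMap.smul_apply, smul_eq_mul, Finset.mul_sum]
    rw [Finset.sum_comm]
    simp only [h2, Matrix.one_apply, ite_mul, one_mul, zero_mul, Finset.sum_ite_eq',
      Finset.mem_univ, if_true]
  rw [← h1]
  exact QPM.IsMul.sum fun k _ => (h k).smul _

theorem hsSq_scoreRes_ne_top (hS : ∀ k, hsSq (Sa k) ≠ ∞) (j : Fin n) :
    hsSq (scoreRes V Sa J j) ≠ ∞ :=
  hsSq_dirOp_ne_top (fun k => hsSq_comp_ne_top V (hS k)) _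

theorem comp_eq_sum_scoreRes (hJ : IsUnit J) (k : Fin n) :
    V ∘L Sa k = ∑ j, J j k • scoreRes V Sa J j := by
  simp only [scoreRes, dirOp, Finset.smul_sum]
  rw [Finset.sum_comm]
  have h2 : ∀ i, ∑ j, J j k • J⁻¹ i j • (V ∘L Sa i) =
      (1 : Matrix (Fin n) (Fin n) ℂ) i k • (V ∘L Sa i) := by
    intro i
    rw [← Matrix.nonsing_inv_mul J ((Matrix.isUnit_iff_isUnit_det _).1 hJ), Matrix.mul_apply,
      Finset.sum_smul]
    exact Finset.sum_congr rfl fun k _ => by rw [smul_smul, mul_comm]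
  simp only [h2, Matrix.one_apply, ite_smul, one_smul, zero_smul, Finset.sum_ite_eq',
    Finset.mem_univ, if_true]

theorem memLp_eval_of_resC {μ : Measure (Fin n → ℂ)} [IsFiniteMeasure μ] {j : Fin n}
    (h : MemLp (resC m j) 2 μ) : MemLp (fun κ : Fin n → ℂ => κ j) 2 μ := by
  have h1 := h.star.add (memLp_const (m j))
  refine h1.ae_eq (Eventually.of_forall fun κ => ?_)
  simp [resC_apply]

theorem IsScore.memLp (hd : M.IsDilation Q V) (hT : IsDensity T) (hS : ∀ k, hsSq (Sa k) ≠ ∞)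
    (h : IsScore Q V T Sa J m) (hJ : IsUnit J) (j : Fin n) :
    MemLp (fun κ : Fin n → ℂ => κ j) 2 (M.law T) := by
  have := QPM.isProbabilityMeasure_law M hT
  exact memLp_eval_of_resC (m := m) (hd.memLp_of_isMul (h.isMul hJ j) (hsSq_scoreRes_ne_top hS j))

/-- The residuals are combinations of the scores, which are orthogonal to `V ρ^{1/2}` because `Tr
h_k* ρ = 0`; so the residuals have mean zero. -/
theorem IsScore.mean (hd : M.IsDilation Q V) (hT : IsDensity T) (hS : ∀ k, hsSq (Sa k) ≠ ∞)
    (h0 : ∀ k, hsIn (CFC.sqrt T) (Sa k) = 0)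
    (h : IsScore Q V T Sa J m) (hJ : IsUnit J) (j : Fin n) :
    ∫ κ, κ j ∂(M.law T) = m j := by
  have := QPM.isProbabilityMeasure_law M hT
  have hs : hsSq (V ∘L CFC.sqrt T) ≠ ∞ := hsSq_comp_ne_top _ hT.hsSq_sqrt_ne_top
  have h1 := hd.hsIn_of_isMul (QPM.isMul_one _) (h.isMul hJ j) hs (hsSq_scoreRes_ne_top hS j)
  have h2 : hsIn (V ∘L CFC.sqrt T) (scoreRes V Sa J j) = 0 := by
    rw [scoreRes, hsIn_dirOp hs (fun k => hsSq_comp_ne_top V (hS k))]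
    refine Finset.sum_eq_zero fun k _ => ?_
    rw [hsIn_comp_left, ← ContinuousLinearMap.comp_assoc, hd.isometry,
      ContinuousLinearMap.one_def, ContinuousLinearMap.id_comp, h0, mul_zero]
  rw [h2] at h1
  have hi : Integrable (fun κ : Fin n → ℂ => κ j) (M.law T) :=
    (h.memLp hd hT hS hJ j).integrable (by norm_num)
  have h3 : ∫ κ, (κ j - m j) ∂(M.law T) = 0 := by
    have h4 : conj (∫ κ, (κ j - m j) ∂(M.law T)) = 0 := by
      rw [← integral_conj, h1]
      refine integral_congr_ae (Eventually.of_forall fun κ => ?_)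
      simp [resC_apply]
    simpa using h4
  rw [integral_sub hi (integrable_const _)] at h3
  simp only [integral_const, probReal_univ, one_smul] at h3
  exact sub_eq_zero.1 h3

theorem IsScore.fisher_eq (hd : M.IsDilation Q V) (hS : ∀ k, hsSq (S a k) ≠ ∞)
    (h : IsScore Q V (ρ a) (S a) J (ϑ a)) (hJ : IsUnit J) :
    fisher (S a) = Jᴴ * errMatrix M ρ ϑ a * J := by
  have hL := fun j => hsSq_scoreRes_ne_top (V := V) (J := J) hS j
  ext k l
  rw [fisher_eq_hsIn hd, comp_eq_sum_scoreRes hJ l, hsIn_sum_right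
    (hsSq_comp_ne_top V (hS k)) _ (fun j _ => hsSq_smul_ne_top (hL j) _), Matrix.mul_apply]
  refine Finset.sum_congr rfl fun j _ => ?_
  rw [hsIn_smul_right (hsSq_comp_ne_top V (hS k)) (hL j), mul_comm]
  congr 1
  rw [← hsIn_conj, comp_eq_sum_scoreRes hJ k, hsIn_sum_right (hL j) _
    (fun j _ => hsSq_smul_ne_top (hL j) _), map_sum, Matrix.mul_apply]
  refine Finset.sum_congr rfl fun i _ => ?_
  rw [hsIn_smul_right (hL j) (hL i), map_mul, hsIn_conj,
    errMatrix_eq_hsIn hd (fun j => h.isMul hJ j) hL]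
  rfl

theorem IsScore.hsIn_eq (hd : M.IsDilation Q V) (hS : ∀ k, hsSq (S a k) ≠ ∞)
    (h : IsScore Q V (ρ a) (S a) J (ϑ a)) (hJ : IsUnit J) (i k : Fin n) :
    hsIn (scoreRes V (S a) J i) (V ∘L S a k) = (errMatrix M ρ ϑ a * J) i k := by
  have hL := fun j => hsSq_scoreRes_ne_top (V := V) (J := J) hS j
  rw [comp_eq_sum_scoreRes hJ k, hsIn_sum_right (hL i) _ (fun j _ => hsSq_smul_ne_top (hL j) _),
    Matrix.mul_apply]
  refine Finset.sum_congr rfl fun j _ => ?_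
  rw [hsIn_smul_right (hL i) (hL j), errMatrix_eq_hsIn hd (fun j => h.isMul hJ j) hL, mul_comm]

/-- Efficient estimation from the score condition and the continuity of the error matrix. -/
theorem efficient_of_isScore (hO : IsOpen O) (hρ : IsModel O ρ g S) (hd : M.IsDilation Q V)
    (hS : ∀ a ∈ O, IsUnit (fisher (S a))) (hϑ : ContDiffOn ℝ 1 ϑ O) (hβ : DifferentiableOn ℂ β O)
    (hJ : ∀ a ∈ O, IsUnit (jac β a)) (hsc : ∀ a ∈ O, IsScore Q V (ρ a) (S a) (jac β a) (ϑ a))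
    (hcont : ∀ i j, ContinuousOn (fun a => errMatrix M ρ ϑ a i j) O) :
    (∀ k, ContinuousOn (fun a => fisher (S a) k k) O) ∧ IsRegularEstimate O ρ ϑ M ∧
      (∀ a ∈ O, jac β a = invErrJac M ρ ϑ a) ∧ AttainsRightBound O ρ S ϑ M := by
  have hHS := fun a (ha : a ∈ O) => hρ.hsSq_ne_top ha
  have hJc : ∀ i k, ContinuousOn (fun b => jac β b i k) O := fun i k =>
    (differentiableOn_dz hO (differentiableOn_pi.1 hβ i) k).continuousOn
  -- Continuity of the Fisher information is not part of the model. It follows from `J† R J`, and is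
  -- needed before the means can be differentiated.
  have hF : ∀ k, ContinuousOn (fun a => fisher (S a) k k) O := by
    intro k
    have : ContinuousOn (fun a => ∑ j, (∑ i, conj (jac β a i k) * errMatrix M ρ ϑ a i j) *
        jac β a j k) O :=
      continuousOn_finsetSum _ fun j _ => (continuousOn_finsetSum _ fun i _ =>
        (Complex.continuous_conj.comp_continuousOn (hJc i k)).mul (hcont i j)).mul (hJc j k)
    refine this.congr fun a ha => ?_
    simp only [(hsc a ha).fisher_eq hd (hHS a ha) (hJ a ha), Matrix.mul_apply,
      Matrix.conjTranspose_apply, RCLike.star_def]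
  have hub : IsUnbiased O ρ ϑ M :=
    ⟨fun a ha i => (hsc a ha).memLp hd (hρ.density a ha) (hHS a ha) (hJ a ha) i,
      fun a ha i => (hsc a ha).mean hd (hρ.density a ha) (hHS a ha)
        (fun k => hρ.hsIn_sqrt hO ha k) (hJ a ha) i, hcont⟩
  have hD : ∀ a ∈ O, jac ϑ a = errMatrix M ρ ϑ a * jac β a := by
    intro a ha
    ext i k
    obtain ⟨L, hL, hLt, hLS⟩ := hub.exists_residuals hO hρ hϑ hd hF ha
    rw [← hLS, ← (hsc a ha).hsIn_eq hd (hHS a ha) (hJ a ha),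
      hd.proj.isMul_unique (hL i) ((hsc a ha).isMul (hJ a ha) i)]
  -- `R` is a factor of the nondegenerate Fisher matrix `J† R J`.
  have hR : ∀ a ∈ O, IsUnit (errMatrix M ρ ϑ a) := by
    intro a ha
    have h1 := hS a ha
    rw [(hsc a ha).fisher_eq hd (hHS a ha) (hJ a ha), Matrix.isUnit_iff_isUnit_det,
      Matrix.det_mul, Matrix.det_mul] at h1
    exact (Matrix.isUnit_iff_isUnit_det _).2
      (isUnit_of_mul_isUnit_right (isUnit_of_mul_isUnit_left h1))
  have hinv : ∀ a ∈ O, jac β a = invErrJac M ρ ϑ a := by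
    intro a ha
    rw [invErrJac, hD a ha, ← mul_assoc, Matrix.nonsing_inv_mul _
      ((Matrix.isUnit_iff_isUnit_det _).1 (hR a ha)), one_mul]
  have hev : ∀ a ∈ O, ∀ j k, (fun b => invErrJac M ρ ϑ b j k) =ᶠ[𝓝 a]
      fun b => dz (fun b => β b j) k b := by
    intro a ha j k
    filter_upwards [hO.mem_nhds ha] with b hb
    rw [← hinv b hb]
    rfl
  have hdz := fun j k => differentiableOn_dz hO (differentiableOn_pi.1 hβ j) k
  refine ⟨hF, ⟨hub, hR, fun j k a ha => ?_, fun a ha i j k => ?_, fun a ha i j k => ?_⟩, hinv,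
    fun a ha => ?_⟩
  · have := ((hdz j k a ha).differentiableAt (hO.mem_nhds ha)).restrictScalars ℝ
    exact (this.congr_of_eventuallyEq (hev a ha j k)).differentiableWithinAt
  · rw [dz_congr (hev a ha j k), dz_congr (hev a ha j i)]
    exact dz_dz_comm hO (differentiableOn_pi.1 hβ j) i k ha
  · rw [dzbar_congr (hev a ha i j)]
    exact dzbar_eq_of_hasFDerivAt
      ((hdz i j a ha).differentiableAt (hO.mem_nhds ha)).hasFDerivAt k
  · have hRh : (errMatrix M ρ ϑ a)ᴴ = errMatrix M ρ ϑ a := by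
      have hL := fun j => hsSq_scoreRes_ne_top (V := V) (J := jac β a) (hHS a ha) j
      ext i j
      rw [Matrix.conjTranspose_apply, errMatrix_eq_hsIn hd (fun j => (hsc a ha).isMul (hJ a ha) j) hL,
        errMatrix_eq_hsIn hd (fun j => (hsc a ha).isMul (hJ a ha) j) hL, RCLike.star_def, hsIn_conj]
    have hRd := (Matrix.isUnit_iff_isUnit_det _).1 (hR a ha)
    have hJd := (Matrix.isUnit_iff_isUnit_det _).1 (hJ a ha)
    have hJhd : IsUnit ((jac β a)ᴴ).det := by
      rw [Matrix.det_conjTranspose]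
      exact hJd.star
    rw [rightBound, (hsc a ha).fisher_eq hd (hHS a ha) (hJ a ha), hD a ha, Matrix.mul_inv_rev,
      Matrix.mul_inv_rev, Matrix.conjTranspose_mul, hRh]
    have e : ∀ R J Ri Ji Jhi Jh : Matrix (Fin n) (Fin n) ℂ, J * Ji = 1 → R * Ri = 1 → Jhi * Jh = 1 →
        R = R * J * (Ji * (Ri * Jhi)) * (Jh * R) := by
      intro R J Ri Ji Jhi Jh h1 h2 h3
      calc R = R * (1 : Matrix (Fin n) (Fin n) ℂ) * Ri * 1 * R := by rw [mul_one, mul_one, h2, one_mul]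
        _ = R * (J * Ji) * Ri * (Jhi * Jh) * R := by rw [h1, h3]
        _ = _ := by simp only [mul_assoc]
    exact e _ _ _ _ _ _ (Matrix.mul_nonsing_inv _ hJd) (Matrix.mul_nonsing_inv _ hRd)
      (Matrix.nonsing_inv_mul _ hJhd)

end Score

end

section


/-! ### Laplace transforms -/

section Laplace

variable {n : ℕ} {μ : Measure (Fin n → ℂ)} {b : Fin n → ℂ}

theorem norm_expC (b κ : Fin n → ℂ) : ‖expC b κ‖ = Real.exp (linC b κ).re := by
  rw [expC_apply, Complex.norm_exp]

theorem norm_expC_sq (b κ : Fin n → ℂ) : ‖expC b κ‖ ^ 2 = Real.exp (2 * (linC b κ).re) := by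
  rw [norm_expC, ← Real.exp_nat_mul]
  norm_num

/-- The interior of the domain of convergence of the Laplace transform `∫ |exp (b κ*)|² dμ`. -/
def expDomain (μ : Measure (Fin n → ℂ)) : Set (Fin n → ℂ) :=
  interior {b | Integrable (fun κ => ‖expC b κ‖ ^ 2) μ}

theorem isOpen_expDomain : IsOpen (expDomain μ) := isOpen_interior

theorem integrable_of_mem_expDomain (h : b ∈ expDomain μ) :
    Integrable (fun κ => ‖expC b κ‖ ^ 2) μ := by
  have h1 : b ∈ {b | Integrable (fun κ => ‖expC b κ‖ ^ 2) μ} := interior_subset h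
  exact h1

theorem convex_expDomain : Convex ℝ (expDomain μ) := by
  refine Convex.interior fun b hb c hc s t hs ht hst => ?_
  refine ((hb.const_mul s).add (hc.const_mul t)).mono' (by fun_prop) (Eventually.of_forall fun κ => ?_)
  have h1 := convexOn_exp.2 (Set.mem_univ (2 * (linC b κ).re)) (Set.mem_univ (2 * (linC c κ).re))
    hs ht hst
  rw [Real.norm_of_nonneg (by positivity)]
  simp only [Pi.add_apply, norm_expC_sq]
  refine le_trans (le_of_eq ?_) h1
  rw [linC_add, ← Complex.coe_smul, ← Complex.coe_smul, linC_smul, linC_smul]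
  simp only [ContinuousMap.add_apply, ContinuousMap.smul_apply, smul_eq_mul, Complex.add_re,
    Complex.re_ofReal_mul]
  congr 1
  ring

theorem linC_single (j : Fin n) (w : ℂ) (κ : Fin n → ℂ) : linC (Pi.single j w) κ = w * conj (κ j) := by
  rw [linC_apply, Finset.sum_eq_single j (fun i _ hi => by simp [hi]) (by simp), Pi.single_eq_same]

/-- `|κ_j| ≤ |Re κ_j| + |Im κ_j|`, and for a suitable choice of the two signs the right side is `±
Re κ_j ± Im κ_j`. The factor `δ / 2` is due to the square of the modulus of the exponential. -/
theorem exp_norm_le {δ : ℝ} (hδ : 0 < δ) (κ : Fin n → ℂ) :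
    Real.exp (δ * ‖κ‖) ≤ 1 + ∑ j, ∑ u : Bool × Bool, ‖expC (Pi.single j
      (((δ / 2 : ℝ) : ℂ) * ((if u.1 then 1 else -1) + (if u.2 then 1 else -1) * Complex.I))) κ‖ ^ 2 := by
  set R := 1 + ∑ j, ∑ u : Bool × Bool, ‖expC (Pi.single j
      (((δ / 2 : ℝ) : ℂ) * ((if u.1 then 1 else -1) + (if u.2 then 1 else -1) * Complex.I))) κ‖ ^ 2
    with hR
  have hR1 : 1 ≤ R := le_add_of_nonneg_right (by positivity)
  have hR0 : 0 < R := lt_of_lt_of_le one_pos hR1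
  have h1 : ∀ j, ‖κ j‖ ≤ Real.log R / δ := by
    intro j
    rw [le_div_iff₀ hδ, Real.le_log_iff_exp_le hR0]
    have h2 : ∑ u : Bool × Bool, ‖expC (Pi.single j (((δ / 2 : ℝ) : ℂ) *
        ((if u.1 then 1 else -1) + (if u.2 then 1 else -1) * Complex.I))) κ‖ ^ 2 ≤ R := by
      have := Finset.single_le_sum (f := fun j => ∑ u : Bool × Bool, ‖expC (Pi.single j
        (((δ / 2 : ℝ) : ℂ) * ((if u.1 then 1 else -1) + (if u.2 then 1 else -1) * Complex.I))) κ‖ ^ 2)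
        (fun i _ => by positivity) (Finset.mem_univ j)
      linarith
    refine le_trans ?_ h2
    have h3 : ∀ u : Bool × Bool, ‖expC (Pi.single j (((δ / 2 : ℝ) : ℂ) *
        ((if u.1 then 1 else -1) + (if u.2 then 1 else -1) * Complex.I))) κ‖ ^ 2 =
        Real.exp (δ * ((if u.1 then 1 else -1) * (κ j).re + (if u.2 then 1 else -1) * (κ j).im)) := by
      intro u
      rw [norm_expC_sq, linC_single, mul_assoc, Complex.re_ofReal_mul]
      congr 1
      rcases u with ⟨_ | _, _ | _⟩ <;> simp <;> ring
    have h4 : ∀ u : Bool × Bool, ‖κ j‖ ≤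
        (if u.1 then 1 else -1) * (κ j).re + (if u.2 then 1 else -1) * (κ j).im →
        Real.exp (‖κ j‖ * δ) ≤ ∑ u : Bool × Bool, ‖expC (Pi.single j (((δ / 2 : ℝ) : ℂ) *
        ((if u.1 then 1 else -1) + (if u.2 then 1 else -1) * Complex.I))) κ‖ ^ 2 := by
      intro u hu
      refine le_trans ?_ (Finset.single_le_sum (f := fun u : Bool × Bool => ‖expC (Pi.single j
        (((δ / 2 : ℝ) : ℂ) * ((if u.1 then 1 else -1) + (if u.2 then 1 else -1) * Complex.I))) κ‖ ^ 2)
        (fun i _ => by positivity) (Finset.mem_univ u))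
      simp only [h3]
      refine Real.exp_le_exp.2 ?_
      rw [mul_comm]
      exact mul_le_mul_of_nonneg_left hu hδ.le
    have h5 := Complex.norm_le_abs_re_add_abs_im (κ j)
    rcases le_total 0 (κ j).re with hr | hr <;> rcases le_total 0 (κ j).im with hi | hi
    · exact h4 (true, true) (by simpa [abs_of_nonneg hr, abs_of_nonneg hi] using h5)
    · exact h4 (true, false) (by simpa [abs_of_nonneg hr, abs_of_nonpos hi] using h5)
    · exact h4 (false, true) (by simpa [abs_of_nonpos hr, abs_of_nonneg hi] using h5)
    · exact h4 (false, false) (by simpa [abs_of_nonpos hr, abs_of_nonpos hi] using h5)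
  have h2 : ‖κ‖ ≤ Real.log R / δ :=
    (pi_norm_le_iff_of_nonneg (div_nonneg (Real.log_nonneg hR1) hδ.le)).2 h1
  rw [le_div_iff₀ hδ, mul_comm] at h2
  exact (Real.le_log_iff_exp_le hR0).1 h2

/-- In the interior of the domain there is room to shift `b` in finitely many directions, which buys
a factor `e^{δ ‖κ‖}`. This factor absorbs all polynomial terms in later dominated convergence
arguments. -/
theorem exists_integrable_exp (h : b ∈ expDomain μ) :
    ∃ δ > 0, Integrable (fun κ => Real.exp (δ * ‖κ‖) * ‖expC b κ‖ ^ 2) μ := by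
  obtain ⟨δ, hδ, hb⟩ := Metric.mem_nhds_iff.1 (mem_interior_iff_mem_nhds.1 h)
  refine ⟨δ / 2, by positivity, ?_⟩
  have hδ' : 0 < δ / 2 := by positivity
  have hmem : ∀ (j : Fin n) (u : Bool × Bool), Integrable (fun κ => ‖expC (b + Pi.single j
      (((δ / 2 / 2 : ℝ) : ℂ) * ((if u.1 then 1 else -1) + (if u.2 then 1 else -1) * Complex.I))) κ‖ ^ 2)
      μ := by
    intro j u
    refine hb ?_
    rw [mem_ball_iff_norm, add_sub_cancel_left]
    have h1 : ∀ w : ℂ, ‖(Pi.single j w : Fin n → ℂ)‖ ≤ ‖w‖ := fun w => by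
      refine (pi_norm_le_iff_of_nonneg (norm_nonneg _)).2 fun i => ?_
      by_cases hi : i = j
      · subst hi
        simp
      · simp [hi]
    refine lt_of_le_of_lt (h1 _) ?_
    have h2 : ‖((if u.1 then 1 else -1) + (if u.2 then 1 else -1) * Complex.I : ℂ)‖ ≤ 2 := by
      refine (norm_add_le _ _).trans ?_
      rcases u with ⟨_ | _, _ | _⟩ <;> norm_num
    rw [norm_mul, Complex.norm_real, Real.norm_of_nonneg (by positivity)]
    nlinarith
  refine ((integrable_of_mem_expDomain h).add (integrable_finsetSum Finset.univ fun j _ =>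
    integrable_finsetSum Finset.univ fun u _ => hmem j u)).mono' (by fun_prop)
      (Eventually.of_forall fun κ => ?_)
  rw [Real.norm_of_nonneg (by positivity)]
  refine (mul_le_mul_of_nonneg_right (exp_norm_le hδ' κ) (by positivity)).trans (le_of_eq ?_)
  simp only [Pi.add_apply, add_mul, one_mul, Finset.sum_mul, expC_add, ContinuousMap.mul_apply,
    norm_mul, mul_pow]
  congr 1
  exact Finset.sum_congr rfl fun j _ => Finset.sum_congr rfl fun u _ => mul_comm _ _

theorem norm_expC_sq_le {ε : ℝ} (b h κ : Fin n → ℂ) (hε : 2 * (n * ‖h‖) ≤ ε) :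
    ‖expC (b + h) κ‖ ^ 2 ≤ Real.exp (ε * ‖κ‖) * ‖expC b κ‖ ^ 2 := by
  rw [expC_add, ContinuousMap.mul_apply, norm_mul, mul_pow, mul_comm]
  refine mul_le_mul_of_nonneg_right ?_ (by positivity)
  refine (pow_le_pow_left₀ (norm_nonneg _) (norm_expC_le h κ) 2).trans ?_
  rw [← Real.exp_nat_mul]
  refine Real.exp_le_exp.2 ?_
  calc ((2 : ℕ) : ℝ) * (n * ‖h‖ * ‖κ‖) = (2 * (n * ‖h‖)) * ‖κ‖ := by push_cast; ring
    _ ≤ _ := mul_le_mul_of_nonneg_right hε (norm_nonneg _)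

theorem add_le_exp {ε x R : ℝ} (hε : 0 < ε) (hx : 0 ≤ x) (hR : 0 ≤ R) :
    x + R ≤ (1 / ε + R) * Real.exp (ε * x) := by
  have h1 := Real.add_one_le_exp (ε * x)
  have h2 : 1 ≤ Real.exp (ε * x) := Real.one_le_exp (by positivity)
  have h3 : x ≤ 1 / ε * Real.exp (ε * x) := by
    rw [div_mul_eq_mul_div, one_mul, le_div_iff₀ hε]
    linarith
  nlinarith

/-- The generating function `∫ |exp (b κ*)|² dμ`. -/
def genFun (μ : Measure (Fin n → ℂ)) (b : Fin n → ℂ) : ℝ := ∫ κ, ‖expC b κ‖ ^ 2 ∂μ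

/-- The real-linear form `b ↦ 2 Re ∑ b_j conj κ_j`. -/
def reForm (κ : Fin n → ℂ) : (Fin n → ℂ) →L[ℝ] ℝ :=
  (2 : ℝ) • Complex.reCLM ∘L (coordForm fun j => conj (κ j)).restrictScalars ℝ

theorem reForm_apply (κ b : Fin n → ℂ) : reForm κ b = 2 * (linC b κ).re := by
  simp only [reForm, _root_.smul_apply, ContinuousLinearMap.comp_apply,
    ContinuousLinearMap.coe_restrictScalars', coordForm_apply, linC_apply, smul_eq_mul,
    Complex.reCLM_apply, mul_comm]

theorem continuous_reForm : Continuous (reForm : (Fin n → ℂ) → (Fin n → ℂ) →L[ℝ] ℝ) := by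
  rw [continuous_clm_apply]
  intro b
  simp only [reForm_apply]
  have : ∀ κ, linC b κ = ∑ j, b j * conj (κ j) := linC_apply b
  simp only [this]
  fun_prop

theorem norm_reForm_le (κ : Fin n → ℂ) : ‖reForm κ‖ ≤ 2 * n * ‖κ‖ := by
  refine ContinuousLinearMap.opNorm_le_bound _ (by positivity) fun b => ?_
  rw [reForm_apply, Real.norm_eq_abs, abs_mul, abs_of_nonneg (by norm_num : (0:ℝ) ≤ 2)]
  have := (Complex.abs_re_le_norm _).trans (norm_linC_le b κ)
  linarith

/-- Half of the exponential reserve is spent on the linear factor `‖κ‖`. -/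
theorem exists_integrable_reForm (h : b ∈ expDomain μ) : ∃ δ > 0,
    Integrable (fun κ => 2 * n * ‖κ‖ * (Real.exp (δ * ‖κ‖) * ‖expC b κ‖ ^ 2)) μ := by
  obtain ⟨δ, hδ, hint⟩ := exists_integrable_exp h
  refine ⟨δ / 2, by positivity, ?_⟩
  refine (hint.const_mul (2 * n * (1 / (δ / 2) + 0))).mono' (by fun_prop)
    (Eventually.of_forall fun κ => ?_)
  rw [Real.norm_of_nonneg (by positivity)]
  have h1 := add_le_exp (ε := δ / 2) (x := ‖κ‖) (R := 0) (by positivity) (norm_nonneg _) le_rfl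
  rw [add_zero] at h1
  have h2 : Real.exp (δ * ‖κ‖) = Real.exp (δ / 2 * ‖κ‖) * Real.exp (δ / 2 * ‖κ‖) := by
    rw [← Real.exp_add]; congr 1; ring
  rw [h2]
  calc 2 * n * ‖κ‖ * (Real.exp (δ / 2 * ‖κ‖) * ‖expC b κ‖ ^ 2)
      ≤ 2 * n * ((1 / (δ / 2) + 0) * Real.exp (δ / 2 * ‖κ‖)) *
        (Real.exp (δ / 2 * ‖κ‖) * ‖expC b κ‖ ^ 2) := by gcongr
    _ = _ := by ring

theorem integrable_smul_reForm (h : b ∈ expDomain μ) :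
    Integrable (fun κ => ‖expC b κ‖ ^ 2 • reForm κ) μ := by
  obtain ⟨δ, hδ, hint⟩ := exists_integrable_reForm h
  refine hint.mono' ?_ (Eventually.of_forall fun κ => ?_)
  · exact (((expC b).continuous.norm.pow 2).smul continuous_reForm).aestronglyMeasurable
  · rw [norm_smul, Real.norm_of_nonneg (by positivity)]
    have h1 : 1 ≤ Real.exp (δ * ‖κ‖) := Real.one_le_exp (by positivity)
    have h2 := norm_reForm_le κ
    calc ‖expC b κ‖ ^ 2 * ‖reForm κ‖ ≤ ‖expC b κ‖ ^ 2 * (2 * n * ‖κ‖) := by gcongr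
      _ = 2 * n * ‖κ‖ * (1 * ‖expC b κ‖ ^ 2) := by ring
      _ ≤ _ := by gcongr

theorem hasFDerivAt_genFun (h : b ∈ expDomain μ) :
    HasFDerivAt (genFun μ) (∫ κ, ‖expC b κ‖ ^ 2 • reForm κ ∂μ) b := by
  obtain ⟨δ, hδ, hint⟩ := exists_integrable_reForm h
  have hr : 0 < δ / (2 * n + 1) := by positivity
  refine hasFDerivAt_integral_of_dominated_of_fderiv_le (𝕜 := ℝ)
    (F' := fun b κ => ‖expC b κ‖ ^ 2 • reForm κ) (Metric.ball_mem_nhds b hr)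
    (Eventually.of_forall fun c => by fun_prop) (integrable_of_mem_expDomain h)
    (integrable_smul_reForm h).aestronglyMeasurable (Eventually.of_forall fun κ c hc => ?_) hint
    (Eventually.of_forall fun κ c _ => ?_)
  · rw [mem_ball_iff_norm] at hc
    have h1 : 2 * (n * ‖c - b‖) ≤ δ := by
      rw [lt_div_iff₀ (by positivity)] at hc
      nlinarith [norm_nonneg (c - b)]
    have h2 := norm_expC_sq_le b (c - b) κ h1
    rw [add_sub_cancel] at h2
    rw [norm_smul, Real.norm_of_nonneg (by positivity), mul_comm]
    exact mul_le_mul (norm_reForm_le κ) h2 (by positivity) (by positivity)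
  · have h1 : (fun b => ‖expC b κ‖ ^ 2) = fun b => Real.exp (reForm κ b) := by
      ext b
      rw [norm_expC_sq, reForm_apply]
    have h2 := ((reForm κ).hasFDerivAt (x := c)).exp
    rw [norm_expC_sq, ← reForm_apply, h1]
    exact h2

theorem integrable_smul_eval (h : b ∈ expDomain μ) (k : Fin n) :
    Integrable (fun κ => ((‖expC b κ‖ ^ 2 : ℝ) : ℂ) * κ k) μ := by
  obtain ⟨δ, hδ, hint⟩ := exists_integrable_reForm h
  have hn : (1 : ℝ) ≤ n := by
    have := k.pos
    exact_mod_cast this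
  refine hint.mono' (by fun_prop) (Eventually.of_forall fun κ => ?_)
  rw [norm_mul, Complex.norm_real, Real.norm_of_nonneg (by positivity)]
  have h1 : 1 ≤ Real.exp (δ * ‖κ‖) := Real.one_le_exp (by positivity)
  have h2 := norm_le_pi_norm κ k
  calc ‖expC b κ‖ ^ 2 * ‖κ k‖ ≤ ‖expC b κ‖ ^ 2 * ‖κ‖ := by gcongr
    _ = 1 * ‖κ‖ * (1 * ‖expC b κ‖ ^ 2) := by ring
    _ ≤ 2 * n * ‖κ‖ * (Real.exp (δ * ‖κ‖) * ‖expC b κ‖ ^ 2) := by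
      gcongr
      linarith

/-- The derivative of `|e^{b κ*}|²` in `b̄_k` brings down `κ_k`, so the logarithmic derivative is
the mean of `κ_k` under the normalized tilt. -/
theorem dzbar_log_genFun (h : b ∈ expDomain μ) (h0 : genFun μ b ≠ 0) :
    DifferentiableAt ℝ (fun b => (Real.log (genFun μ b) : ℂ)) b ∧
    ∀ k, dzbar (fun b => (Real.log (genFun μ b) : ℂ)) k b =
      ((genFun μ b)⁻¹ : ℝ) * ∫ κ, ((‖expC b κ‖ ^ 2 : ℝ) : ℂ) * κ k ∂μ := by
  have h1 := (hasFDerivAt_genFun h).log h0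
  have h2 := Complex.ofRealCLM.hasFDerivAt.comp b h1
  refine ⟨h2.differentiableAt, fun k => ?_⟩
  have h3 : fderiv ℝ (fun b => (Real.log (genFun μ b) : ℂ)) b = _ := h2.fderiv
  have h4 : ∀ v, (∫ κ, ‖expC b κ‖ ^ 2 • reForm κ ∂μ) v =
      ∫ κ, ‖expC b κ‖ ^ 2 * (2 * (linC v κ).re) ∂μ := by
    intro v
    rw [ContinuousLinearMap.integral_apply (integrable_smul_reForm h)]
    refine integral_congr_ae (Eventually.of_forall fun κ => ?_)
    simp only [_root_.smul_apply, reForm_apply, smul_eq_mul]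
  have hi := integrable_smul_eval h k
  have hre : ∫ κ, ‖expC b κ‖ ^ 2 * (2 * (linC (Pi.single k 1) κ).re) ∂μ =
      2 * (∫ κ, ((‖expC b κ‖ ^ 2 : ℝ) : ℂ) * κ k ∂μ).re := by
    rw [← RCLike.re_eq_complex_re, ← integral_re hi, ← integral_const_mul]
    refine integral_congr_ae (Eventually.of_forall fun κ => ?_)
    simp only [linC_single, one_mul, Complex.conj_re, RCLike.re_eq_complex_re, Complex.re_ofReal_mul]
    ring
  have him : ∫ κ, ‖expC b κ‖ ^ 2 * (2 * (linC (Pi.single k Complex.I) κ).re) ∂μ =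
      2 * (∫ κ, ((‖expC b κ‖ ^ 2 : ℝ) : ℂ) * κ k ∂μ).im := by
    rw [← RCLike.im_eq_complex_im, ← integral_im hi, ← integral_const_mul]
    refine integral_congr_ae (Eventually.of_forall fun κ => ?_)
    simp only [linC_single, RCLike.im_eq_complex_im, Complex.im_ofReal_mul, Complex.I_mul_re,
      Complex.conj_im, neg_neg]
    ring
  rw [dzbar, h3]
  simp only [ContinuousLinearMap.comp_apply, _root_.smul_apply, h4, hre, him,
    Complex.ofRealCLM_apply, smul_eq_mul]
  push_cast
  have := Complex.re_add_im (∫ κ, ((‖expC b κ‖ ^ 2 : ℝ) : ℂ) * κ k ∂μ)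
  push_cast at this
  linear_combination (genFun μ b : ℂ)⁻¹ * this

end Laplace

end

section


/-! ### Tilted measures and uniqueness of Laplace transforms -/

section Laplace

variable {n : ℕ} {μ : Measure (Fin n → ℂ)} {b : Fin n → ℂ}

theorem continuous_expC (κ : Fin n → ℂ) : Continuous fun b => expC b κ := by
  simp only [expC_apply, linC_apply]
  fun_prop

/-- The measure with the density `c |exp (b κ*)|²`. -/
def tilt (μ : Measure (Fin n → ℂ)) (b : Fin n → ℂ) (c : ℝ) : Measure (Fin n → ℂ) :=
  ENNReal.ofReal c • μ.withDensity fun κ => ‖expC b κ‖ₑ ^ 2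

theorem integral_tilt {c : ℝ} (hc : 0 ≤ c) (f : (Fin n → ℂ) → ℂ) :
    ∫ κ, f κ ∂(tilt μ b c) = c * ∫ κ, ((‖expC b κ‖ ^ 2 : ℝ) : ℂ) * f κ ∂μ := by
  rw [tilt, integral_smul_measure, integral_withDensity_eq_integral_toReal_smul
    (by fun_prop) (Eventually.of_forall fun κ => by simp), ENNReal.toReal_ofReal hc,
    Complex.real_smul]
  simp [Complex.real_smul]

/-- Total mass one with `c > 0` forces the Laplace integral to be finite and equal to `1 / c`.
Finiteness on all of `β(O)` is obtained in this way. -/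
theorem of_isProbabilityMeasure_tilt {c : ℝ} (hc : 0 < c) (h : IsProbabilityMeasure (tilt μ b c)) :
    Integrable (fun κ => ‖expC b κ‖ ^ 2) μ ∧ c = (genFun μ b)⁻¹ := by
  have h1 : ENNReal.ofReal c * ∫⁻ κ, ‖expC b κ‖ₑ ^ 2 ∂μ = 1 := by
    have := h.measure_univ
    rwa [tilt, Measure.smul_apply, withDensity_apply _ MeasurableSet.univ, setLIntegral_univ,
      smul_eq_mul] at this
  have h2 : ∫⁻ κ, ‖expC b κ‖ₑ ^ 2 ∂μ ≠ ∞ := by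
    intro h3
    rw [h3, ENNReal.mul_top (by simpa using hc)] at h1
    exact ENNReal.top_ne_one h1
  have h3 : Integrable (fun κ => ‖expC b κ‖ ^ 2) μ := (memLp_two_of_lintegral h2).norm.integrable_sq
  refine ⟨h3, ?_⟩
  have h4 : genFun μ b = (∫⁻ κ, ‖expC b κ‖ₑ ^ 2 ∂μ).toReal := by
    have := lintegral_enorm_sq (s := Set.univ) h3
    rw [setLIntegral_univ, setIntegral_univ] at this
    exact this.symm
  have h5 := congrArg ENNReal.toReal h1
  rw [ENNReal.toReal_mul, ENNReal.toReal_ofReal hc.le, ← h4, ENNReal.toReal_one] at h5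
  exact eq_inv_of_mul_eq_one_left h5

theorem genFun_pos [NeZero μ] (h : Integrable (fun κ => ‖expC b κ‖ ^ 2) μ) : 0 < genFun μ b := by
  refine (integral_pos_iff_support_of_nonneg (fun κ => by positivity) h).2 ?_
  have : Function.support (fun κ => ‖expC b κ‖ ^ 2) = Set.univ := by
    ext κ
    simp [expC_ne_zero]
  rw [this]
  exact (Measure.measure_univ_pos).2 (NeZero.ne μ)

theorem linC_surjective (L : StrongDual ℝ (Fin n → ℂ)) :
    ∃ b : Fin n → ℂ, ∀ κ, L κ = 2 * (linC b κ).re := by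
  refine ⟨fun j => (1 / 2 : ℂ) * (L (Pi.single j 1) + L (Pi.single j Complex.I) * Complex.I),
    fun κ => ?_⟩
  have h1 : κ = ∑ j, ((κ j).re • (Pi.single j 1 : Fin n → ℂ) + (κ j).im • (Pi.single j Complex.I : Fin n → ℂ)) := by
    ext i
    rw [Finset.sum_apply, Finset.sum_eq_single i (fun j _ hj => by simp [hj.symm]) (by simp)]
    simp
  conv_lhs => rw [h1]
  rw [map_sum, linC_apply, Complex.re_sum, Finset.mul_sum]
  refine Finset.sum_congr rfl fun j _ => ?_
  rw [map_add, map_smul, map_smul, smul_eq_mul, smul_eq_mul]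
  simp [Complex.mul_re, Complex.mul_im]
  ring

open ProbabilityTheory in
/-- A finite measure is determined by its Laplace transform near zero. -/
theorem ext_of_genFun {μ ν : Measure (Fin n → ℂ)} [IsFiniteMeasure μ] [IsFiniteMeasure ν]
    (hμ : 0 ∈ expDomain μ) (hν : 0 ∈ expDomain ν) (h : ∀ᶠ b in 𝓝 0, genFun μ b = genFun ν b) :
    μ = ν := by
  refine Measure.ext_of_charFunDual ?_
  ext L
  obtain ⟨b, hb⟩ := linC_surjective L
  have hc : Tendsto (fun t : ℝ => t • b) (𝓝 0) (𝓝 0) := by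
    have : Continuous fun t : ℝ => t • b := by fun_prop
    simpa using this.tendsto 0
  have hexp : ∀ (t : ℝ) κ, Real.exp (t * L κ) = ‖expC (t • b) κ‖ ^ 2 := by
    intro t κ
    rw [norm_expC_sq, hb, ← Complex.coe_smul, linC_smul]
    simp only [ContinuousMap.smul_apply, smul_eq_mul, Complex.re_ofReal_mul]
    congr 1
    ring
  obtain ⟨ε, hε, hall⟩ := Metric.eventually_nhds_iff_ball.1
    ((hc.eventually (isOpen_expDomain.mem_nhds hμ)).and
      ((hc.eventually (isOpen_expDomain.mem_nhds hν)).and (hc.eventually h)))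
  -- The moment generating functions of `L` extend analytically to the strip `|Re z| < ε` and agree
  -- on its real points, hence also at `z = i`, which is the characteristic function.
  set U : Set ℂ := Complex.re ⁻¹' Metric.ball 0 ε with hU
  have hUo : IsOpen U := Metric.isOpen_ball.preimage Complex.continuous_re
  have hUc : Convex ℝ U := (convex_ball 0 ε).linear_preimage Complex.reLm
  have hsub : ∀ ξ : Measure (Fin n → ℂ), (∀ t ∈ Metric.ball (0 : ℝ) ε, t • b ∈ expDomain ξ) →
      ∀ z ∈ U, z.re ∈ interior (integrableExpSet L ξ) := by
    intro ξ hξ z hz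
    refine mem_interior.2 ⟨Metric.ball 0 ε, fun t ht => ?_, Metric.isOpen_ball, hz⟩
    have := integrable_of_mem_expDomain (hξ t ht)
    simp only [← hexp] at this
    exact this
  have h1 : AnalyticOnNhd ℂ (complexMGF L μ) U := fun z hz =>
    analyticAt_complexMGF (hsub μ (fun t ht => (hall t ht).1) z hz)
  have h2 : AnalyticOnNhd ℂ (complexMGF L ν) U := fun z hz =>
    analyticAt_complexMGF (hsub ν (fun t ht => (hall t ht).2.1) z hz)
  have h0 : (0 : ℂ) ∈ U := by simpa [hU] using hε
  have hreal : ∀ t ∈ Metric.ball (0 : ℝ) ε, complexMGF L μ (t : ℂ) = complexMGF L ν (t : ℂ) := by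
    intro t ht
    rw [complexMGF_ofReal, complexMGF_ofReal, mgf, mgf]
    have := (hall t ht).2.2
    simp only [genFun, ← hexp] at this
    rw [this]
  have hfreq : ∃ᶠ z in 𝓝[≠] (0 : ℂ), complexMGF L μ z = complexMGF L ν z := by
    have ht : Tendsto (fun t : ℝ => (t : ℂ)) (𝓝[≠] 0) (𝓝[≠] 0) := by
      refine tendsto_nhdsWithin_of_tendsto_nhds_of_eventually_within _ ?_ ?_
      · have : Tendsto (fun t : ℝ => (t : ℂ)) (𝓝 0) (𝓝 ((0 : ℝ) : ℂ)) :=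
          Complex.continuous_ofReal.tendsto 0
        rw [Complex.ofReal_zero] at this
        exact this.mono_left nhdsWithin_le_nhds
      · filter_upwards [self_mem_nhdsWithin] with t ht
        simpa using ht
    refine ht.frequently (Eventually.frequently ?_)
    filter_upwards [nhdsWithin_le_nhds (Metric.ball_mem_nhds (0 : ℝ) hε)] with t ht
    exact hreal t ht
  have h3 := h1.eqOn_of_preconnected_of_frequently_eq h2 hUc.isPreconnected h0 hfreq
  have hI : Complex.I ∈ U := by simpa [hU] using hε
  have h4 := h3 hI
  simp only [complexMGF] at h4
  simp only [charFunDual_apply]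
  simpa only [mul_comm] using h4

end Laplace

/-! ### Openness of `β(O)` and continuity of the error matrix -/

section Estimates

variable {n : ℕ} {H : Type*} [NormedAddCommGroup H] [InnerProductSpace ℂ H] [CompleteSpace H]
  {K : Type*} [NormedAddCommGroup K] [InnerProductSpace ℂ K] [CompleteSpace K]
  {M : QPM (Fin n → ℂ) H} {Q : QPM (Fin n → ℂ) K} {V : H →L[ℂ] K}
  {O : Set (Fin n → ℂ)} {ρ : (Fin n → ℂ) → H →L[ℂ] H}
  {ϑ β : (Fin n → ℂ) → Fin n → ℂ} {a : Fin n → ℂ}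

/-- A holomorphic map is strictly differentiable, its partial derivatives being continuous; an
invertible Jacobian makes it open. Thus `β(a)` is interior to any set containing `β(O)`. -/
theorem image_mem_nhds (hO : IsOpen O) (hβ : DifferentiableOn ℂ β O) (ha : a ∈ O)
    (hJ : IsUnit (jac β a)) : β '' O ∈ 𝓝 (β a) := by
  have hJc : ∀ i k, ContinuousOn (fun b => jac β b i k) O := fun i k =>
    (differentiableOn_dz hO (differentiableOn_pi.1 hβ i) k).continuousOn
  set F : (Fin n → ℂ) → (Fin n → ℂ) →L[ℂ] (Fin n → ℂ) := fun b =>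
    ContinuousLinearMap.pi fun i => coordForm fun k => jac β b i k with hF
  have h1 : ∀ᶠ b in 𝓝 a, HasFDerivAt β (F b) b := by
    filter_upwards [hO.mem_nhds ha] with b hb
    rw [hasFDerivAt_pi']
    intro i
    have h1 : HasFDerivAt (fun b => β b i) (fderiv ℂ (fun b => β b i) b) b :=
      ((differentiableOn_pi.1 hβ i).differentiableAt (hO.mem_nhds hb)).hasFDerivAt
    convert! h1 using 1
    rw [eq_coordForm (fderiv ℂ (fun b => β b i) b)]
    ext v
    simp only [hF, ContinuousLinearMap.comp_apply, ContinuousLinearMap.proj_apply,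
      ContinuousLinearMap.coe_pi', jac, Matrix.of_apply, dz_eq_of_hasFDerivAt h1]
  have h2 : ContinuousAt F a := by
    rw [continuousAt_clm_apply]
    intro v
    rw [continuousAt_pi]
    intro i
    simp only [hF, ContinuousLinearMap.coe_pi', coordForm_apply]
    refine ContinuousOn.continuousAt (s := O) ?_ (hO.mem_nhds ha)
    exact continuousOn_finsetSum _ fun k _ => (hJc i k).mul continuousOn_const
  have h3 := hasStrictFDerivAt_of_hasFDerivAt_of_continuousAt h1 h2
  have h4 : (F a).range = ⊤ := by
    rw [LinearMap.range_eq_top]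
    intro w
    refine ⟨(jac β a)⁻¹ *ᵥ w, ?_⟩
    have : ∀ v, F a v = jac β a *ᵥ v := by
      intro v
      ext i
      simp only [hF, ContinuousLinearMap.coe_pi', coordForm_apply, Matrix.mulVec, dotProduct]
    rw [ContinuousLinearMap.coe_coe, this, Matrix.mulVec_mulVec, Matrix.mul_nonsing_inv _
      ((Matrix.isUnit_iff_isUnit_det _).1 hJ), Matrix.one_mulVec]
  rw [← h3.map_nhds_eq_of_surj h4]
  exact image_mem_map (hO.mem_nhds ha)

theorem integral_errMatrix {μ : Measure (Fin n → ℂ)} {b : Fin n → ℂ} {c : ℝ} (hc : 0 ≤ c)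
    (h : M.law (ρ a) = tilt μ b c) (i j : Fin n) : errMatrix M ρ ϑ a i j =
      c * ∫ κ, ((‖expC b κ‖ ^ 2 : ℝ) : ℂ) * ((κ i - ϑ a i) * conj (κ j - ϑ a j)) ∂μ := by
  rw [errMatrix, Matrix.of_apply, h, integral_tilt hc]

/-- The mean quadratic errors are continuous on an exponential family. -/
theorem continuousOn_errMatrix (hO : IsOpen O) (hβ : ContinuousOn β O) (hϑ : ContinuousOn ϑ O)
    {μ : Measure (Fin n → ℂ)} [NeZero μ] (hdom : ∀ a ∈ O, β a ∈ expDomain μ)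
    (hlaw : ∀ a ∈ O, M.law (ρ a) = tilt μ (β a) (genFun μ (β a))⁻¹) (i j : Fin n) :
    ContinuousOn (fun a => errMatrix M ρ ϑ a i j) O := by
  have hpos : ∀ a ∈ O, 0 < genFun μ (β a) := fun a ha =>
    genFun_pos (integrable_of_mem_expDomain (hdom a ha))
  refine ContinuousOn.congr (f := fun a => (((genFun μ (β a))⁻¹ : ℝ) : ℂ) *
    ∫ κ, ((‖expC (β a) κ‖ ^ 2 : ℝ) : ℂ) * ((κ i - ϑ a i) * conj (κ j - ϑ a j)) ∂μ) ?_
    fun a ha => integral_errMatrix (inv_nonneg.2 (hpos a ha).le) (hlaw a ha) i j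
  intro a ha
  refine ContinuousAt.continuousWithinAt ?_
  have hβa := hβ.continuousAt (hO.mem_nhds ha)
  have hϑa := hϑ.continuousAt (hO.mem_nhds ha)
  have hg : ContinuousAt (fun a => genFun μ (β a)) a :=
    ContinuousAt.comp (g := genFun μ) (hasFDerivAt_genFun (hdom a ha)).continuousAt hβa
  refine ContinuousAt.mul (Complex.continuous_ofReal.continuousAt.comp
    (hg.inv₀ (hpos a ha).ne')) ?_
  -- The reserve `e^{δ ‖κ‖}` is divided: `δ / 2` pays for the shift of the exponent from `β a` to `β
  -- x`, and `δ / 4` for each of the two linear factors.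
  obtain ⟨δ, hδ, hint⟩ := exists_integrable_exp (hdom a ha)
  set R := ‖ϑ a‖ + 1 with hR
  set C := 1 / (δ / 4) + R with hC
  have hR0 : 0 ≤ R := by positivity
  refine continuousAt_of_dominated (bound := fun κ => C ^ 2 * (Real.exp (δ * ‖κ‖) *
    ‖expC (β a) κ‖ ^ 2)) (Eventually.of_forall fun x => by fun_prop) ?_ (hint.const_mul _)
    (Eventually.of_forall fun κ => ?_)
  · have h1 : ∀ᶠ x in 𝓝 a, 2 * (n * ‖β x - β a‖) < δ / 2 := by
      have : ContinuousAt (fun x => 2 * (n * ‖β x - β a‖)) a := by fun_prop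
      refine this.eventually_lt_const ?_
      simp [hδ]
    have h2 : ∀ᶠ x in 𝓝 a, ‖ϑ x‖ < R := hϑa.norm.eventually_lt_const (lt_add_one _)
    filter_upwards [h1, h2] with x hx1 hx2
    refine Eventually.of_forall fun κ => ?_
    have h3 := norm_expC_sq_le (β a) (β x - β a) κ hx1.le
    rw [add_sub_cancel] at h3
    have h4 : ∀ i, ‖κ i - ϑ x i‖ ≤ C * Real.exp (δ / 4 * ‖κ‖) := by
      intro i
      refine (norm_sub_le _ _).trans (le_trans ?_
        (add_le_exp (ε := δ / 4) (x := ‖κ‖) (R := R) (by positivity) (norm_nonneg _) hR0))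
      exact add_le_add (norm_le_pi_norm κ i) ((norm_le_pi_norm (ϑ x) i).trans hx2.le)
    rw [norm_mul, norm_mul, RCLike.norm_conj, Complex.norm_real, Real.norm_of_nonneg (by positivity)]
    have e : Real.exp (δ * ‖κ‖) = Real.exp (δ / 2 * ‖κ‖) * (Real.exp (δ / 4 * ‖κ‖) *
        Real.exp (δ / 4 * ‖κ‖)) := by
      rw [← Real.exp_add, ← Real.exp_add]; congr 1; ring
    calc ‖expC (β x) κ‖ ^ 2 * (‖κ i - ϑ x i‖ * ‖κ j - ϑ x j‖)
        ≤ (Real.exp (δ / 2 * ‖κ‖) * ‖expC (β a) κ‖ ^ 2) *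
          ((C * Real.exp (δ / 4 * ‖κ‖)) * (C * Real.exp (δ / 4 * ‖κ‖))) := by
          refine mul_le_mul h3 (mul_le_mul (h4 i) (h4 j) (norm_nonneg _) ?_) (by positivity)
            (by positivity)
          exact (norm_nonneg _).trans (h4 i)
      _ = _ := by rw [e]; ring
  · have h1 : ContinuousAt (fun x => expC (β x) κ) a := (continuous_expC κ).continuousAt.comp hβa
    have h2 : ∀ i, ContinuousAt (fun x => ϑ x i) a := fun i => (continuousAt_pi.1 hϑa) i
    have h3 := h2 i
    have h4 := h2 j
    refine ContinuousAt.mul (Complex.continuous_ofReal.continuousAt.comp (h1.norm.pow 2)) ?_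
    exact (continuousAt_const.sub h3).mul
      (Complex.continuous_conj.continuousAt.comp (continuousAt_const.sub h4))

theorem law_eq_tilt {c : ℝ} {ρ₀ : H →L[ℂ] H} {b : Fin n → ℂ} (hd : M.IsDilation Q V)
    (hρ₀ : IsDensity ρ₀) {ρ : H →L[ℂ] H} (hρ : IsDensity ρ) (hc : 0 < c)
    (h : IsExpForm Q V ρ₀ ρ b c) : M.law ρ = tilt (M.law ρ₀) b (genFun (M.law ρ₀) b)⁻¹ ∧
      c = (genFun (M.law ρ₀) b)⁻¹ ∧ Integrable (fun κ => ‖expC b κ‖ ^ 2) (M.law ρ₀) := by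
  have h1 : M.law ρ = tilt (M.law ρ₀) b c := h.law_eq hd hρ₀ hρ hc.le
  have h2 := of_isProbabilityMeasure_tilt hc (h1 ▸ QPM.isProbabilityMeasure_law M hρ)
  exact ⟨by rw [← h2.2]; exact h1, h2.2, h2.1⟩

end Estimates

end

section


/-! ### Holomorphic dependence of the exponential operators on their parameter -/

section Holomorphic

variable {n : ℕ} {H : Type*} [NormedAddCommGroup H] [InnerProductSpace ℂ H] [CompleteSpace H]
  {K : Type*} [NormedAddCommGroup K] [InnerProductSpace ℂ K] [CompleteSpace K]
  {M : QPM (Fin n → ℂ) H} {Q : QPM (Fin n → ℂ) K} {V : H →L[ℂ] K} {T : H →L[ℂ] H}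

theorem norm_sq_le_hsSq {X : H →L[ℂ] K} (hX : hsSq X ≠ ∞) : ‖X‖ ^ 2 ≤ (hsSq X).toReal := by
  have h1 : ‖X‖ ≤ Real.sqrt (hsSq X).toReal := by
    refine ContinuousLinearMap.opNorm_le_bound _ (Real.sqrt_nonneg _) fun ψ => ?_
    have h2 := ENNReal.toReal_mono (ENNReal.mul_ne_top hX (by simp)) (enorm_apply_sq_le X ψ)
    rw [ENNReal.toReal_mul] at h2
    simp only [ENNReal.toReal_pow, toReal_enorm] at h2
    refine le_of_sq_le_sq ?_ (by positivity)
    rwa [mul_pow, Real.sq_sqrt ENNReal.toReal_nonneg]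
  calc ‖X‖ ^ 2 ≤ Real.sqrt (hsSq X).toReal ^ 2 := pow_le_pow_left₀ (norm_nonneg _) h1 2
    _ = _ := Real.sq_sqrt ENNReal.toReal_nonneg

theorem QPM.IsDilation.norm_sq_le_of_isMul (hd : M.IsDilation Q V) {f : C(Fin n → ℂ, ℂ)}
    {X : H →L[ℂ] K} (h : Q.IsMul f (V ∘L CFC.sqrt T) X) {F : (Fin n → ℂ) → ℝ}
    (hF : Integrable F (M.law T)) (hf : ∀ κ, ‖f κ‖ ^ 2 ≤ F κ) :
    hsSq X ≠ ∞ ∧ ‖X‖ ^ 2 ≤ ∫ κ, F κ ∂(M.law T) := by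
  have h1 : Integrable (fun κ => ‖f κ‖ ^ 2) (M.law T) :=
    hF.mono' (by fun_prop) (Eventually.of_forall fun κ => by
      rw [Real.norm_of_nonneg (by positivity)]; exact hf κ)
  have h2 : MemLp f 2 (M.law T) :=
    (memLp_two_iff_integrable_sq_norm (by fun_prop)).2 h1
  have h3 := lintegral_of_memLp_two h2
  rw [← hd.hsSq_of_isMul h] at h3
  refine ⟨h3, (norm_sq_le_hsSq h3).trans ?_⟩
  rw [hd.hsSq_of_isMul h, ← setLIntegral_univ, lintegral_enorm_sq h1, setIntegral_univ]
  exact integral_mono h1 hF hf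

theorem exists_isMul_of_integrable (hd : M.IsDilation Q V) {f : C(Fin n → ℂ, ℂ)}
    {F : (Fin n → ℂ) → ℝ} (hF : Integrable F (M.law T)) (hf : ∀ κ, ‖f κ‖ ^ 2 ≤ F κ) :
    ∃ L : H →L[ℂ] K, Q.IsMul f (V ∘L CFC.sqrt T) L ∧ hsSq L ≠ ∞ := by
  refine hd.exists_isMul (lintegral_of_memLp_two
    ((memLp_two_iff_integrable_sq_norm (by fun_prop)).2 ?_))
  exact hF.mono' (by fun_prop) (Eventually.of_forall fun κ => by
      rw [Real.norm_of_nonneg (by positivity)]; exact hf κ)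

/-- The operators `exp (b κ*) V T^{1/2}` depend holomorphically on `b`. -/
theorem exists_hasDerivAt_isMul_expC (hd : M.IsDilation Q V) {Lf : (Fin n → ℂ) → H →L[ℂ] K}
    (hL : ∀ b ∈ expDomain (M.law T), Q.IsMul (expC b) (V ∘L CFC.sqrt T) (Lf b)) {b : Fin n → ℂ}
    (hb : b ∈ expDomain (M.law T)) (v : Fin n → ℂ) :
    ∃ G : H →L[ℂ] K, Q.IsMul (linC v * expC b) (V ∘L CFC.sqrt T) G ∧ hsSq G ≠ ∞ ∧
      HasDerivAt (fun z : ℂ => Lf (b + z • v)) G 0 := by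
  obtain ⟨δ, hδ, hint⟩ := exists_integrable_exp hb
  set A : ℝ := n * ‖v‖ with hA
  have hA0 : 0 ≤ A := by positivity
  have hlin : ∀ κ, ‖linC v κ‖ ≤ A * ‖κ‖ := norm_linC_le v
  set C : ℝ := A * (1 / (δ / 8)) with hC
  have hC0 : 0 ≤ C := by positivity
  have hexp : ∀ κ, ‖linC v κ‖ ≤ C * Real.exp (δ / 8 * ‖κ‖) := by
    intro κ
    refine (hlin κ).trans ?_
    have h1 := add_le_exp (ε := δ / 8) (x := ‖κ‖) (R := 0) (by positivity) (norm_nonneg _) le_rfl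
    rw [add_zero, add_zero] at h1
    refine (mul_le_mul_of_nonneg_left h1 hA0).trans (le_of_eq ?_)
    rw [hC]
    ring
  -- The remainder `e^w - 1 - w` with `w = z ∑ v_j conj κ_j` is at most `|w|² e^{|w|}`. Squared, it
  -- costs four linear factors, each absorbed by `e^{δ ‖κ‖ / 8}`, and an exponential that gets the
  -- other `δ / 2`.
  have e2 : ∀ κ : Fin n → ℂ, (Real.exp (δ / 8 * ‖κ‖)) ^ 4 * Real.exp (δ / 2 * ‖κ‖) =
      Real.exp (δ * ‖κ‖) := fun κ => by
    rw [← Real.exp_nat_mul, ← Real.exp_add]; congr 1; push_cast; ring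
  have hone : ∀ (c : ℝ) (κ : Fin n → ℂ), 0 ≤ c → 1 ≤ Real.exp (c * ‖κ‖) := fun c κ hc =>
    Real.one_le_exp (by positivity)
  obtain ⟨G, hG, hGt⟩ := exists_isMul_of_integrable (f := linC v * expC b) hd
    (hint.const_mul (C ^ 2)) (fun κ => by
      rw [ContinuousMap.mul_apply, norm_mul, mul_pow, ← mul_assoc]
      refine mul_le_mul_of_nonneg_right ?_ (by positivity)
      refine (pow_le_pow_left₀ (norm_nonneg _) (hexp κ) 2).trans ?_
      rw [mul_pow, ← Real.exp_nat_mul]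
      refine mul_le_mul_of_nonneg_left (Real.exp_le_exp.2 ?_) (by positivity)
      push_cast
      nlinarith [norm_nonneg κ])
  refine ⟨G, hG, hGt, ?_⟩
  have hcont : Tendsto (fun z : ℂ => b + z • v) (𝓝 0) (𝓝 b) := by
    have : Continuous fun z : ℂ => b + z • v := by fun_prop
    simpa using this.tendsto 0
  obtain ⟨r, hr, hball⟩ := Metric.eventually_nhds_iff_ball.1
    (hcont.eventually (isOpen_expDomain.mem_nhds hb))
  set I : ℝ := ∫ κ, Real.exp (δ * ‖κ‖) * ‖expC b κ‖ ^ 2 ∂(M.law T) with hI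
  -- The first bound keeps `b + z v` in the domain; the second makes `2 |w| ≤ δ ‖κ‖ / 2`.
  set r' : ℝ := min (r / 2) (δ / (4 * (A + 1))) with hr'
  have hr'0 : 0 < r' := lt_min (by positivity) (by positivity)
  have hmain : HasFDerivAt (fun z : ℂ => Lf (b + z • v))
      (ContinuousLinearMap.toSpanSingleton ℂ G) 0 := by
    refine hasFDerivAt_of_norm_le_sq (δ := r') (C := C ^ 2 * Real.sqrt I) hr'0 fun z hz => ?_
    rw [zero_add, zero_smul, add_zero, ContinuousLinearMap.toSpanSingleton_apply]
    have hzr : z ∈ Metric.ball (0 : ℂ) r := by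
      rw [mem_ball_zero_iff]
      have := hz.trans (min_le_left _ _)
      linarith
    have hzδ : 2 * (‖z‖ * A) ≤ δ / 2 := by
      have h1 := hz.trans (min_le_right _ _)
      rw [le_div_iff₀ (by positivity)] at h1
      nlinarith [norm_nonneg z]
    have hX : Q.IsMul (expC (b + z • v) + ((-1 : ℂ) • expC b + (-z) • (linC v * expC b)))
        (V ∘L CFC.sqrt T) (Lf (b + z • v) + ((-1 : ℂ) • Lf b + (-z) • G)) :=
      (hL _ (hball z hzr)).add (((hL b hb).smul _).add (hG.smul _))
    have eX : Lf (b + z • v) - Lf b - z • G = Lf (b + z • v) + ((-1 : ℂ) • Lf b + (-z) • G) := by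
      ext ψ
      simp only [_root_.sub_apply, _root_.add_apply, _root_.smul_apply]
      module
    rw [eX]
    have hbound := (hd.norm_sq_le_of_isMul hX (hint.const_mul ((C ^ 2 * ‖z‖ ^ 2) ^ 2)) (fun κ => by
      have h1 : (expC (b + z • v) + ((-1 : ℂ) • expC b + (-z) • (linC v * expC b))) κ =
          expC b κ * (Complex.exp (z * linC v κ) -
            ∑ m ∈ Finset.range 2, (z * linC v κ) ^ m / m.factorial) := by
        rw [expC_add]
        simp only [ContinuousMap.add_apply, ContinuousMap.mul_apply, ContinuousMap.smul_apply,
          smul_eq_mul, Finset.sum_range_succ, Finset.sum_range_zero, pow_zero, pow_one,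
          Nat.factorial, expC_apply (z • v), linC_smul]
        push_cast
        ring
      have h2 := Complex.norm_exp_sub_sum_le_norm_mul_exp (z * linC v κ) 2
      have h3 : Real.exp ‖z * linC v κ‖ ^ 2 ≤ Real.exp (δ / 2 * ‖κ‖) := by
        rw [← Real.exp_nat_mul]
        refine Real.exp_le_exp.2 ?_
        rw [norm_mul]
        calc ((2 : ℕ) : ℝ) * (‖z‖ * ‖linC v κ‖) ≤ ((2 : ℕ) : ℝ) * (‖z‖ * (A * ‖κ‖)) := by
              gcongr; exact hlin κ
          _ = (2 * (‖z‖ * A)) * ‖κ‖ := by push_cast; ring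
          _ ≤ _ := by gcongr
      have h4 : ‖z * linC v κ‖ ^ 4 ≤ ‖z‖ ^ 4 * (C ^ 4 * Real.exp (δ / 8 * ‖κ‖) ^ 4) := by
        rw [norm_mul, mul_pow, ← mul_pow C]
        gcongr
        exact hexp κ
      rw [h1, norm_mul, mul_pow]
      calc ‖expC b κ‖ ^ 2 * ‖Complex.exp (z * linC v κ) -
            ∑ m ∈ Finset.range 2, (z * linC v κ) ^ m / m.factorial‖ ^ 2
          ≤ ‖expC b κ‖ ^ 2 * (‖z * linC v κ‖ ^ 2 * Real.exp ‖z * linC v κ‖) ^ 2 := by gcongr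
        _ = ‖expC b κ‖ ^ 2 * (‖z * linC v κ‖ ^ 4 * Real.exp ‖z * linC v κ‖ ^ 2) := by ring
        _ ≤ ‖expC b κ‖ ^ 2 * (‖z‖ ^ 4 * (C ^ 4 * Real.exp (δ / 8 * ‖κ‖) ^ 4) *
              Real.exp (δ / 2 * ‖κ‖)) := by gcongr
        _ = _ := by rw [← e2 κ]; ring)).2
    rw [integral_const_mul, ← hI] at hbound
    have hI0 : 0 ≤ I := integral_nonneg fun κ => by positivity
    refine le_of_sq_le_sq (hbound.trans (le_of_eq ?_)) (by positivity)
    calc (C ^ 2 * ‖z‖ ^ 2) ^ 2 * I = (C ^ 2 * ‖z‖ ^ 2) ^ 2 * Real.sqrt I ^ 2 := by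
          rw [Real.sq_sqrt hI0]
      _ = _ := by ring
  have := hmain.hasDerivAt
  simpa using this

end Holomorphic

/-! ### Right eigen measurements: adjoints act as multiplications in the dilation -/

section Canonical

variable {n : ℕ} {H : Type*} [NormedAddCommGroup H] [InnerProductSpace ℂ H] [CompleteSpace H]
  {K : Type*} [NormedAddCommGroup K] [InnerProductSpace ℂ K] [CompleteSpace K]
  {P : QPM (Fin n → ℂ) H} {Q : QPM (Fin n → ℂ) K} {V : H →L[ℂ] K}
  {O : Set (Fin n → ℂ)} {a₀ : Fin n → ℂ} {ρ : (Fin n → ℂ) → H →L[ℂ] H}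
  {ϑ β : (Fin n → ℂ) → Fin n → ℂ} {a : Fin n → ℂ} {x : Fin n → H →ₗ.[ℂ] H}
  {χ : (Fin n → ℂ) → ℝ}

/-- Both sides are everywhere defined linear maps with equal quadratic forms, so polarization
upgrades the eigen relation to an operator identity. -/
theorem apply_op_eq (hd : P.IsDilation Q V) (hx : P.IsRightEigen x) (k : Fin n)
    {B : Set (Fin n → ℂ)} (hB : MeasurableSet B) (hb : Bornology.IsBounded B)
    (hf : BddMeas (B.indicator fun κ => κ k)) (ψ : H) :
    ∃ h : P.op B ψ ∈ (x k).domain, x k ⟨P.op B ψ, h⟩ =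
      ContinuousLinearMap.adjoint V (Q.int (B.indicator fun κ => κ k) (V ψ)) := by
  have hm : ∀ ψ, P.op B ψ ∈ (x k).domain := fun ψ => (hx k B hB hb ψ).1
  refine ⟨hm ψ, ?_⟩
  obtain ⟨L, hL⟩ : ∃ L : H →ₗ[ℂ] H, ∀ φ, L φ = x k ⟨P.op B φ, hm φ⟩ :=
    ⟨(x k).toFun ∘ₗ (P.op B : H →ₗ[ℂ] H).codRestrict (x k).domain hm, fun _ => rfl⟩
  obtain ⟨L', hL'⟩ : ∃ L' : H →ₗ[ℂ] H, ∀ φ, L' φ =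
      ContinuousLinearMap.adjoint V (Q.int (B.indicator fun κ => κ k) (V φ)) :=
    ⟨((ContinuousLinearMap.adjoint V ∘L Q.int (B.indicator fun κ => κ k) ∘L V :
      H →L[ℂ] H) : H →ₗ[ℂ] H), fun _ => rfl⟩
  have h : L = L' := by
    refine (ext_inner_map L L').1 fun φ => ?_
    rw [← inner_conj_symm, ← inner_conj_symm (L' φ)]
    congr 1
    obtain ⟨h1, h2⟩ := hx k B hB hb φ
    rw [hL, h2, hL', ContinuousLinearMap.adjoint_inner_right, Q.inner_int_self hf, hd.diag, integral_indicator hB]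
  rw [← hL, ← hL', h]

/-- By minimality it suffices to test against `Q(B) V ψ`. With `B` cut down to the ball, `x_k*`
moves over to `x_k P(B') ψ`, where the eigen relation is available. -/
theorem cut_adjoint_apply (hd : P.IsDilation Q V) (hx : P.IsRightEigen x) (k : Fin n)
    (hxd : Dense ((x k).domain : Set H)) (N : ℕ) (φ : ((x k)†).domain) :
    Q.cut N 1 (V ((x k)† φ)) = Q.cut N (coordC k) (V φ) := by
  rw [← sub_eq_zero]
  refine hd.minimal _ fun B hB ψ => ?_
  set B' := B ∩ Metric.closedBall (0 : Fin n → ℂ) N with hB'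
  have hB'm : MeasurableSet B' := hB.inter (measurableSet_ball N)
  have hB'b : Bornology.IsBounded B' := Metric.isBounded_closedBall.subset Set.inter_subset_right
  have hf : BddMeas (B'.indicator fun κ => κ k) := by
    refine ⟨(measurable_pi_apply k).indicator hB'm, N, fun κ => ?_⟩
    by_cases h : κ ∈ B'
    · rw [Set.indicator_of_mem h]
      exact (norm_le_pi_norm κ k).trans (by simpa using h.2)
    · rw [Set.indicator_of_notMem h, norm_zero]
      positivity
  obtain ⟨h1, h2⟩ := apply_op_eq hd hx k hB'm hB'b hf ψ
  have hadj : ∀ C, MeasurableSet C → ContinuousLinearMap.adjoint (Q.op C) = Q.op C := fun C hC =>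
    (Q.isPositive hC).isSelfAdjoint.adjoint_eq
  have h3 : inner ℂ (Q.op B (V ψ)) (Q.cut N 1 (V ((x k)† φ))) =
      inner ℂ (P.op B' ψ) ((x k)† φ) := by
    have e1 : Q.op B' = Q.op B ∘L Q.cut N 1 := by
      rw [QPM.cut_one, hd.proj B _ hB (measurableSet_ball N)]
    rw [hd.compress _ hB'm, ContinuousLinearMap.comp_apply, ContinuousLinearMap.comp_apply,
      ContinuousLinearMap.adjoint_inner_left, ← hadj B' hB'm, ContinuousLinearMap.adjoint_inner_left,
      e1, ← hadj B hB, ContinuousLinearMap.adjoint_inner_left, hadj B hB]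
    rfl
  have h4 : inner ℂ (P.op B' ψ) ((x k)† φ) = inner ℂ (x k ⟨P.op B' ψ, h1⟩) (φ : H) := by
    have := (LinearPMap.adjoint_isFormalAdjoint hxd) φ ⟨P.op B' ψ, h1⟩
    rw [← inner_conj_symm, ← inner_conj_symm (x k _)]
    exact congrArg conj this
  have h5 : inner ℂ (Q.op B (V ψ)) (Q.cut N (coordC k) (V φ)) =
      inner ℂ (Q.int (B'.indicator fun κ => κ k) (V ψ)) (V φ) := by
    rw [← hadj B hB, ContinuousLinearMap.adjoint_inner_left]
    have e1 : ContinuousLinearMap.adjoint (Q.int (B'.indicator fun κ => κ k)) =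
        Q.op B ∘L Q.cut N (coordC k) := by
      rw [← Q.int_conj hf]
      have e2 : Q.op B = Q.int (B.indicator fun _ => 1) := by rw [Q.int_indicator hB, one_smul]
      rw [e2]
      have e3 := hd.proj.int_mul (BddMeas.indicator_const hB 1) (cutFun_bddMeas N (coordC k))
      refine Eq.trans ?_ e3
      congr 1
      ext κ
      by_cases h1 : κ ∈ B <;> by_cases h2 : κ ∈ Metric.closedBall (0 : Fin n → ℂ) N <;>
        simp [cutFun, hB', h1, h2]
    rw [← ContinuousLinearMap.adjoint_inner_right (Q.int _), e1]
    rfl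
  rw [inner_sub_right, h3, h4, h2, h5, ContinuousLinearMap.adjoint_inner_left, sub_self]

/-- Along a solution `u` the truncations of `e^{-t b κ*} V u(t)` have derivative zero, since `x_k*`
acts as `conj κ_k`. In particular the value of the exponential does not depend on the chosen
solution. -/
theorem IsExpAdj.cut_eq (hd : P.IsDilation Q V) (hx : P.IsRightEigen x)
    (hxd : ∀ k, Dense ((x k).domain : Set H)) {b : Fin n → ℂ} {ψ φ : H} (h : IsExpAdj x b ψ φ)
    (N : ℕ) : Q.cut N 1 (V φ) = Q.cut N (expC b) (V ψ) := by
  obtain ⟨u, h0, h1, hu⟩ := h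
  set w : ℝ → K := fun t => Q.cut N (expC (-(t • b))) (V (u t)) with hw
  have hder : ∀ t ∈ Set.Icc (0 : ℝ) 1, HasDerivWithinAt w 0 (Set.Icc (0 : ℝ) 1) t := by
    intro t ht
    obtain ⟨hm, hd1⟩ := hu t ht
    have e1 : HasDerivAt (fun t : ℝ => -(t • b)) (-b) t := by
      convert! ((hasDerivAt_id t).smul_const b).neg using 1
      simp
    have e2 := (hd.proj.hasDerivAt_cut_expC N e1).hasDerivWithinAt (s := Set.Icc (0 : ℝ) 1)
    have e3 := (V.restrictScalars ℝ).hasFDerivAt.comp_hasDerivWithinAt t hd1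
    have e4 := (((ContinuousLinearMap.restrictScalarsL ℂ K K ℝ ℝ)).hasFDerivAt.comp_hasDerivWithinAt
      t e2).clm_apply e3
    refine e4.congr_deriv ?_
    change Q.cut N _ (V (u t)) + Q.cut N (expC (-(t • b))) (V _) = 0
    have e5 : ∀ y, Q.cut N (expC (-(t • b))) y = Q.cut N (expC (-(t • b))) (Q.cut N 1 y) := by
      intro y
      rw [hd.proj.cut_comp_apply, mul_one]
    have e6 : Q.cut N 1 (V (∑ k, b k • (x k)† ⟨u t, hm k⟩)) = Q.cut N (linC b) (V (u t)) := by
      rw [map_sum, map_sum, linC, Q.cut_sum, _root_.sum_apply]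
      refine Finset.sum_congr rfl fun k _ => ?_
      rw [map_smul, map_smul, cut_adjoint_apply hd hx k (hxd k), Q.cut_smul]
      rfl
    rw [e5 (V _), e6, hd.proj.cut_comp_apply]
    have e7 : linC (-b) * expC (-(t • b)) = -(expC (-(t • b)) * linC b) := by
      ext κ
      simp [linC_apply, mul_comm]
    rw [e7, Q.cut_neg, _root_.neg_apply, neg_add_cancel]
  have hconst : w 1 = w 0 := by
    refine constant_of_has_deriv_right_zero (fun t ht => (hder t ht).continuousWithinAt)
      (fun t ht => ?_) 1 (by simp)
    exact (hder t ⟨ht.1, ht.2.le⟩).mono_of_mem_nhdsWithin (Icc_mem_nhdsGE_of_mem ht)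
  simp only [hw, one_smul, zero_smul, neg_zero, expC_zero, h0, h1] at hconst
  have := congrArg (Q.cut N (expC b)) hconst
  rwa [hd.proj.cut_comp_apply, hd.proj.cut_comp_apply, expC_mul_neg, mul_one] at this

end Canonical

end

section


/-! ### Canonical systems are efficient and optimal -/

section Canonical

variable {n : ℕ} {H : Type*} [NormedAddCommGroup H] [InnerProductSpace ℂ H] [CompleteSpace H]
  {K : Type*} [NormedAddCommGroup K] [InnerProductSpace ℂ K] [CompleteSpace K]
  {P : QPM (Fin n → ℂ) H} {Q : QPM (Fin n → ℂ) K} {V : H →L[ℂ] K}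
  {O : Set (Fin n → ℂ)} {a₀ : Fin n → ℂ} {ρ : (Fin n → ℂ) → H →L[ℂ] H}
  {g : (Fin n → ℂ) → Fin n → H →ₗ.[ℂ] H} {S : (Fin n → ℂ) → Fin n → H →L[ℂ] H}
  {ϑ β : (Fin n → ℂ) → Fin n → ℂ} {a : Fin n → ℂ} {x : Fin n → H →ₗ.[ℂ] H}
  {χ : (Fin n → ℂ) → ℝ}

/-- The chain rule along lines for `1 / χ(β) = e^{-ln χ(β)}`. As `ln χ` is real, its derivative in
`β^k` is the conjugate of the one in `β̄^k`, which is `ϑ_k`. -/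
theorem isNormalizer_of_parameters (hO : IsOpen O) (hβ : DifferentiableOn ℂ β O)
    (h0 : χ (β a₀) = 1) (hpos : ∀ a ∈ O, 0 < χ (β a)) (hp : CanonicalParameters O ϑ β χ) :
    IsNormalizer O a₀ ϑ β fun a => (χ (β a))⁻¹ := by
  refine ⟨by simp [h0], fun a ha v => ?_⟩
  obtain ⟨hd, hdz⟩ := hp a ha
  have h1 := hasDerivAt_comp_line hO hβ ha v
  have hf : HasFDerivAt (fun b => (Real.log (χ b) : ℂ))
      (fderiv ℝ (fun b => (Real.log (χ b) : ℂ)) (β a)) (β (a + (0 : ℝ) • v)) := by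
    rw [zero_smul, add_zero]
    exact hd.hasFDerivAt
  have h2 := hf.comp_hasDerivAt 0 h1
  have hfd : fderiv ℝ (fun b => (Real.log (χ b) : ℂ)) (β a) (jac β a *ᵥ v) =
      linC (jac β a *ᵥ v) (ϑ a) + conj (linC (jac β a *ᵥ v) (ϑ a)) := by
    rw [fderiv_eq_sum_dz, linC_apply, map_sum, ← Finset.sum_add_distrib]
    refine Finset.sum_congr rfl fun k _ => ?_
    have h3 : dz (fun b => (Real.log (χ b) : ℂ)) k (β a) = conj (ϑ a k) := by
      rw [← hdz k]
      have := dzbar_conj (fun b => (Real.log (χ b) : ℂ)) k (β a)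
      simp only [Complex.conj_ofReal] at this
      rw [this, Complex.conj_conj]
    rw [h3, hdz k, map_mul, Complex.conj_conj]
    ring
  rw [hfd] at h2
  have h3 := h2.neg.cexp
  have hc : ContinuousAt (fun t : ℝ => a + t • v) 0 := by fun_prop
  have hexp : ∀ y : ℝ, 0 < y → Complex.exp (-(Real.log y : ℂ)) = ((y⁻¹ : ℝ) : ℂ) := fun y hy => by
    rw [← Complex.ofReal_neg, ← Complex.ofReal_exp, Real.exp_neg, Real.exp_log hy]
  have h4 : (fun t : ℝ => (((χ (β (a + t • v)))⁻¹ : ℝ) : ℂ)) =ᶠ[𝓝 0] fun t : ℝ =>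
      Complex.exp ((-((fun b => (Real.log (χ b) : ℂ)) ∘ fun t : ℝ => β (a + t • v))) t) := by
    filter_upwards [hc.eventually (p := fun b => b ∈ O) (hO.mem_nhds (by simpa using ha))] with t ht
    exact (hexp _ (hpos _ ht)).symm
  refine (h3.congr_of_eventuallyEq h4).congr_deriv ?_
  simp only [Pi.neg_apply, Function.comp, zero_smul, add_zero, hexp _ (hpos a ha)]
  ring

theorem isMul_of_isExpAdj (hd : P.IsDilation Q V) (hx : P.IsRightEigen x)
    (hxd : ∀ k, Dense ((x k).domain : Set H)) {b : Fin n → ℂ} {s A : H →L[ℂ] H}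
    (h : ∀ ψ, IsExpAdj x b (s ψ) (A ψ)) : Q.IsMul (expC b) (V ∘L s) (V ∘L A) := by
  intro N
  ext ψ
  exact (h ψ).cut_eq hd hx hxd N

/-- A canonical system provides the exponential form. -/
theorem IsCanonicalSystem.isExpForm (hO : IsOpen O) (ha₀ : a₀ ∈ O) (hρ : IsModel O ρ g S)
    (hd : P.IsDilation Q V) (h : IsCanonicalSystem O a₀ ρ ϑ β x χ P) :
    IsNormalizer O a₀ ϑ β (fun a => (χ (β a))⁻¹) ∧
      ∀ a ∈ O, 0 < (χ (β a))⁻¹ ∧ IsExpForm Q V (ρ a₀) (ρ a) (β a) (χ (β a))⁻¹ := by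
  obtain ⟨A, hA, hAρ⟩ := h.canonical
  have hmul : ∀ a ∈ O, Q.IsMul (expC (β a)) (V ∘L CFC.sqrt (ρ a₀)) (V ∘L A (β a)) := fun a ha =>
    isMul_of_isExpAdj hd h.rightEigen h.admissible.dense (hA _ ⟨a, ha, rfl⟩).1
  have hpos : ∀ a ∈ O, 0 < χ (β a) := by
    intro a ha
    have h1 : 0 ≤ χ (β a) := (hA _ ⟨a, ha, rfl⟩).2.nonneg fun e => by positivity
    refine lt_of_le_of_ne h1 fun h2 => ?_
    have h3 := tr_comp_one (hρ.density a ha)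
    -- With `χ = 0` the convention `0⁻¹ = 0` would give `ρ(a) = 0`, which has no unit trace.
    rw [hAρ a ha, ← h2] at h3
    simp [tr] at h3
  -- At `β = 0` the exponential acts as the identity in the dilation, so `A 0 = ρ₀^{1/2}` and `χ(0)`
  -- is the trace of `ρ₀`.
  have h0 : χ (β a₀) = 1 := by
    have h1 := hmul a₀ ha₀
    rw [h.coord.base, expC_zero] at h1
    have h2 := hd.proj.isMul_unique h1 (QPM.isMul_one _)
    have h3 : A 0 = CFC.sqrt (ρ a₀) := by
      have := congrArg (fun X => ContinuousLinearMap.adjoint V ∘L X) h2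
      simp only [← ContinuousLinearMap.comp_assoc, hd.isometry] at this
      simpa only [ContinuousLinearMap.one_def, ContinuousLinearMap.id_comp] using this
    have h4 := (hA _ ⟨a₀, ha₀, rfl⟩).2
    rw [h.coord.base, h3] at h4
    rw [h.coord.base]
    have h5 := (hρ.density a₀ ha₀).trace_one
    simp only [inner_self_real (hρ.density a₀ ha₀)] at h5
    have h6 := Complex.hasSum_re h5
    simp only [Complex.ofReal_re, Complex.one_re] at h6
    exact h4.unique h6
  refine ⟨isNormalizer_of_parameters hO h.coord.analytic h0 hpos h.parameters, fun a ha =>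
    ⟨inv_pos.2 (hpos a ha), fun N ζ ξ => ?_⟩⟩
  -- The truncated factor `e^{-β κ*}` undoes the exponential contained in `A (β a)`.
  have h1 : ∀ ζ : K, ContinuousLinearMap.adjoint (A (β a)) (cutVec Q V N ζ (-β a)) =
      CFC.sqrt (ρ a₀) (cutVec Q V N ζ 0) := by
    intro ζ
    refine ext_inner_right ℂ fun φ => ?_
    have h2 := congr($((hmul a ha).mul (g := expC (-β a)) hd.proj N) φ)
    rw [mul_comm (expC (-β a)), expC_mul_neg] at h2
    simp only [ContinuousLinearMap.comp_apply] at h2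
    rw [ContinuousLinearMap.adjoint_inner_left, inner_cutVec, h2, ← adjoint_sqrt,
      ContinuousLinearMap.adjoint_inner_left, inner_cutVec, expC_zero, adjoint_sqrt]
  rw [hAρ a ha, _root_.smul_apply, inner_smul_right, ContinuousLinearMap.comp_apply,
    ← ContinuousLinearMap.adjoint_inner_left, h1, h1, (hρ.density a₀ ha₀).inner_sqrt]
  push_cast
  rfl

/-- An efficient measurement from the exponential form. -/
theorem efficient_of_isExpForm (hO : IsOpen O) (ha₀ : a₀ ∈ O) (hρ : IsModel O ρ g S)
    (hd : P.IsDilation Q V) (hS : ∀ a ∈ O, IsUnit (fisher (S a))) (hϑ : ContDiffOn ℝ 1 ϑ O)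
    (hβ : DifferentiableOn ℂ β O) (hJ : ∀ a ∈ O, IsUnit (jac β a)) {c : (Fin n → ℂ) → ℝ}
    (hc : IsNormalizer O a₀ ϑ β c)
    (hE : ∀ a ∈ O, 0 < c a ∧ IsExpForm Q V (ρ a₀) (ρ a) (β a) (c a)) :
    (∀ k, ContinuousOn (fun a => fisher (S a) k k) O) ∧ IsRegularEstimate O ρ ϑ P ∧
      (∀ a ∈ O, jac β a = invErrJac P ρ ϑ a) ∧ AttainsRightBound O ρ S ϑ P := by
  have hprob := QPM.isProbabilityMeasure_law P (hρ.density a₀ ha₀)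
  have hlaw := fun a ha => law_eq_tilt hd (hρ.density a₀ ha₀) (hρ.density a ha) (hE a ha).1
    (hE a ha).2
  refine efficient_of_isScore hO hρ hd hS hϑ hβ hJ
    (fun a ha => isScore_of_isExpForm hO hρ hd hβ hc (fun a ha => (hE a ha).2) ha)
    (continuousOn_errMatrix hO hβ.continuousOn hϑ.continuousOn (μ := P.law (ρ a₀)) (fun a ha => ?_)
      fun a ha => (hlaw a ha).1)
  -- The Laplace integral is finite on `β(O)`, a neighbourhood of each of its points.
  rw [expDomain, mem_interior_iff_mem_nhds]
  refine mem_of_superset (image_mem_nhds hO hβ ha (hJ a ha)) ?_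
  rintro _ ⟨a', ha', rfl⟩
  exact (hlaw a' ha').2.2

/-- The range and the kernel of a self-adjoint operator together span a dense subspace. -/
theorem eq_top_of_isClosed {s : H →L[ℂ] H} (hs : ContinuousLinearMap.adjoint s = s)
    {W : Submodule ℂ H} (hW : IsClosed (W : Set H)) (hr : ∀ ψ, s ψ ∈ W)
    (hk : ∀ ψ, s ψ = 0 → ψ ∈ W) : W = ⊤ := by
  have : CompleteSpace W := hW.completeSpace_coe
  rw [← Submodule.orthogonal_eq_bot_iff, Submodule.eq_bot_iff]
  intro y hy
  rw [Submodule.mem_orthogonal] at hy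
  have h1 : s y = 0 := by
    rw [← inner_self_eq_zero (𝕜 := ℂ)]
    have := hy _ (hr (s y))
    rwa [← hs, ContinuousLinearMap.adjoint_inner_left, hs] at this
  exact inner_self_eq_zero.1 (hy y (hk y h1))

/-- The second moments of the operators of a canonical system. -/
theorem IsCanonicalSystem.hasCovariance (hρ : IsModel O ρ g S)
    (hd : P.IsDilation Q V) (h : IsCanonicalSystem O a₀ ρ ϑ β x χ P) (ha : a ∈ O)
    (hsc : IsScore Q V (ρ a) (S a) (jac β a) (ϑ a)) :
    HasCovariance (ρ a) x (ϑ a) (errMatrix P ρ ϑ a) := by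
  obtain ⟨A, hA, hAρ⟩ := h.canonical
  have hJ := h.coord.nondegenerate a ha
  set s := CFC.sqrt (ρ a) with hs
  set T₀ : Fin n → H →L[ℂ] H := fun k => dirOp (S a) fun l => (jac β a)⁻¹ l k with hT₀
  have hVT : ∀ k, V ∘L T₀ k = scoreRes V (S a) (jac β a) k := fun k => comp_dirOp V (S a) _
  have hT₀t : ∀ k, hsSq (T₀ k) ≠ ∞ := fun k => hsSq_dirOp_ne_top (hρ.hsSq_ne_top ha) _
  have hL := fun k => hsc.isMul hJ k
  have hmul : ∀ k, Q.IsMul (coordC k) (V ∘L s) (V ∘L (T₀ k + conj (ϑ a k) • s)) := by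
    intro k
    have h1 := (hL k).add ((QPM.isMul_one (Q := Q) (V ∘L s)).smul (conj (ϑ a k)))
    rw [← hVT k] at h1
    have e : resC (ϑ a) k + conj (ϑ a k) • (1 : C(Fin n → ℂ, ℂ)) = coordC k := by
      ext κ
      simp [resC_apply]
    rw [e] at h1
    rw [ContinuousLinearMap.comp_add, ContinuousLinearMap.comp_smul]
    exact h1
  have hsub : ∀ k, T₀ k + conj (ϑ a k) • s - conj (ϑ a k) • s = T₀ k := fun k => by abel
  refine ⟨fun k => T₀ k + conj (ϑ a k) • s, fun k => ⟨?_, ?_⟩, ?_⟩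
  · have hxd := h.admissible.dense k
    have hcl : ((x k)†).IsClosed := LinearPMap.adjoint_isClosed hxd
    set T := T₀ k + conj (ϑ a k) • s with hT
    -- `W` collects the vectors on which `x_k* ρ^{1/2} = T` holds. It is closed because the graph of
    -- `x_k*` is, so it is enough to treat the range and the kernel of `ρ^{1/2}`.
    set W : Submodule ℂ H := ((x k)†).graph.comap ((s : H →ₗ[ℂ] H).prod (T : H →ₗ[ℂ] H)) with hW
    have hWc : IsClosed (W : Set H) := by
      have : Continuous fun ψ : H => (s ψ, T ψ) := by fun_prop
      exact IsClosed.preimage this hcl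
    have hmem : ∀ ψ, ψ ∈ W ↔ (s ψ, T ψ) ∈ ((x k)†).graph := fun ψ => Iff.rfl
    have hker : ∀ ψ, s ψ = 0 → T ψ = 0 := by
      intro ψ hψ
      have h1 : V (T ψ) = 0 := by
        refine hd.proj.eq_of_cut_one fun N => ?_
        have := (hmul k).apply N ψ
        simp only [ContinuousLinearMap.comp_apply, hψ, map_zero] at this
        rw [map_zero]
        exact this
      rw [← hd.adjoint_apply (T ψ), h1, map_zero]
    have hWtop : W = ⊤ := by
      refine eq_top_of_isClosed (adjoint_sqrt (ρ a)) hWc (fun φ => ?_) fun ψ hψ => ?_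
      · rw [hmem]
        have h1 : s (s φ) = ρ a φ := congr($((hρ.density a ha).sqrt_comp) φ)
        -- `ρ(a) φ` is a multiple of the final value of a solution of the Cauchy problem, and a
        -- solution lies in the domains of all `x_k*` at every time.
        have h2 : ρ a φ ∈ ((x k)†).domain := by
          rw [hAρ a ha, _root_.smul_apply]
          refine Submodule.smul_mem _ _ ?_
          obtain ⟨u, -, hu1, hu⟩ := (hA _ ⟨a, ha, rfl⟩).1 (ContinuousLinearMap.adjoint (A (β a)) φ)
          obtain ⟨hm, -⟩ := hu 1 (by simp)
          have := hm k
          rw [hu1] at this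
          exact this
        have h3 : (x k)† ⟨ρ a φ, h2⟩ = T (s φ) := by
          have h4 : V ((x k)† ⟨ρ a φ, h2⟩) = V (T (s φ)) := by
            refine hd.proj.eq_of_cut_one fun N => ?_
            rw [cut_adjoint_apply hd h.rightEigen k hxd]
            have := (hmul k).apply N (s φ)
            simp only [ContinuousLinearMap.comp_apply, h1] at this
            exact this.symm
          rw [← hd.adjoint_apply (T (s φ)), ← h4, hd.adjoint_apply]
        rw [h1, ← h3]
        exact LinearPMap.mem_graph _ ⟨ρ a φ, h2⟩
      · rw [hmem, hψ, hker ψ hψ]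
        exact Submodule.zero_mem _
    intro ψ
    have h1 : (s ψ, T ψ) ∈ ((x k)†).graph := (hmem ψ).1 (hWtop ▸ Submodule.mem_top)
    rw [LinearPMap.mem_graph_iff] at h1
    obtain ⟨⟨y, hy⟩, h2, h3⟩ := h1
    simp only at h2
    subst h2
    exact ⟨hy, h3⟩
  · rw [isHS_iff]
    exact hsSq_add_ne_top (hT₀t k) (hsSq_smul_ne_top (hρ.density a ha).hsSq_sqrt_ne_top _)
  · ext i k
    rw [errMatrix_eq_hsIn hd hL (fun j => hsSq_scoreRes_ne_top (hρ.hsSq_ne_top ha) j),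
      Matrix.of_apply, hsub, hsub, ← hsIn_eq_hsInner, ← hVT, ← hVT, hsIn_comp_left,
      ← ContinuousLinearMap.comp_assoc, hd.isometry, ContinuousLinearMap.one_def,
      ContinuousLinearMap.id_comp]

/-- Efficient measurements have the same probability distributions. -/
theorem law_eq_of_efficient {N : QPM (Fin n → ℂ) H} (hO : IsOpen O) (hOc : IsPreconnected O)
    (ha₀ : a₀ ∈ O) (hρ : IsModel O ρ g S) (hd : P.IsDilation Q V)
    (hS : ∀ a ∈ O, IsUnit (fisher (S a))) (hϑ : ContDiffOn ℝ 1 ϑ O) (hβ : DifferentiableOn ℂ β O)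
    (hβ0 : β a₀ = 0) (hJ : ∀ a ∈ O, IsUnit (jac β a)) {c : (Fin n → ℂ) → ℝ}
    (hc : IsNormalizer O a₀ ϑ β c)
    (hE : ∀ a ∈ O, 0 < c a ∧ IsExpForm Q V (ρ a₀) (ρ a) (β a) (c a))
    (hF : ∀ k, ContinuousOn (fun a => fisher (S a) k k) O)
    (hN : IsUnbiased O ρ ϑ N) (hR : ∀ a ∈ O, IsUnit (errMatrix N ρ ϑ a))
    (hNJ : ∀ a ∈ O, jac β a = invErrJac N ρ ϑ a) (hNa : AttainsRightBound O ρ S ϑ N) :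
    ∀ a ∈ O, N.law (ρ a) = P.law (ρ a) := by
  obtain ⟨K', _, _, _, Q', V', hd'⟩ := N.exists_dilation
  have hsc : ∀ a ∈ O, IsScore Q' V' (ρ a) (S a) (jac β a) (ϑ a) := by
    intro a ha k
    rw [hNJ a ha]
    exact hN.comp_eq_of_eq hO hρ hϑ hd' hF ha (hS a ha) (hR a ha) (hNa a ha) k
  obtain ⟨c', hpos', hc', hE'⟩ := exists_expForm hO hOc ha₀ hρ hd' hϑ.continuousOn hβ hβ0 hsc
  -- Both normalizers solve the same equation, since both measurements have the same Jacobian and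
  -- the same mean values.
  have hcc := eqOn_of_isNormalizer hO hOc ha₀ hβ hϑ.continuousOn hc' hc
  have hlaw := fun a ha => law_eq_tilt hd (hρ.density a₀ ha₀) (hρ.density a ha) (hE a ha).1
    (hE a ha).2
  have hlaw' := fun a ha => law_eq_tilt hd' (hρ.density a₀ ha₀) (hρ.density a ha) (hpos' a ha)
    (hE' a ha)
  have hprob := QPM.isProbabilityMeasure_law P (hρ.density a₀ ha₀)
  have hprob' := QPM.isProbabilityMeasure_law N (hρ.density a₀ ha₀)
  have hnhds := image_mem_nhds hO hβ ha₀ (hJ a₀ ha₀)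
  -- Equal normalizers mean equal generating functions on `β(O)`, a neighbourhood of zero.
  have h0 : N.law (ρ a₀) = P.law (ρ a₀) := by
    rw [hβ0] at hnhds
    refine ext_of_genFun (mem_interior_iff_mem_nhds.2 (mem_of_superset hnhds ?_))
      (mem_interior_iff_mem_nhds.2 (mem_of_superset hnhds ?_)) (mem_of_superset hnhds ?_)
    · rintro _ ⟨a, ha, rfl⟩
      exact (hlaw' a ha).2.2
    · rintro _ ⟨a, ha, rfl⟩
      exact (hlaw a ha).2.2
    · rintro _ ⟨a, ha, rfl⟩
      have := hcc a ha
      rw [(hlaw a ha).2.1, (hlaw' a ha).2.1] at this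
      exact inv_injective this
  intro a ha
  rw [(hlaw a ha).1, (hlaw' a ha).1, h0]

/-- The measurement of a canonical system is optimal. -/
theorem IsCanonicalSystem.optimal (hO : IsOpen O) (hOc : IsPreconnected O) (ha₀ : a₀ ∈ O)
    (hρ : IsModel O ρ g S) (hS : ∀ a ∈ O, IsUnit (fisher (S a))) (hϑ : ContDiffOn ℝ 1 ϑ O)
    (h : IsCanonicalSystem O a₀ ρ ϑ β x χ P) :
    IsRegularEstimate O ρ ϑ P ∧ (∀ a ∈ O, jac β a = invErrJac P ρ ϑ a) ∧
    AttainsRightBound O ρ S ϑ P ∧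
    (∀ a ∈ O, HasCovariance (ρ a) x (ϑ a) (errMatrix P ρ ϑ a)) ∧
    (∀ N : QPM (Fin n → ℂ) H, IsUnbiased O ρ ϑ N →
      (∀ a ∈ O, (errMatrix N ρ ϑ a - errMatrix P ρ ϑ a).PosSemidef) ∧
      (AttainsRightBound O ρ S ϑ N → ∀ a ∈ O, N.law (ρ a) = P.law (ρ a))) := by
  obtain ⟨K, _, _, _, Q, V, hd⟩ := P.exists_dilation
  obtain ⟨hc, hE⟩ := h.isExpForm hO ha₀ hρ hd
  have hβ := h.coord.analytic
  have hJ := h.coord.nondegenerate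
  obtain ⟨hF, hreg, hinv, hatt⟩ := efficient_of_isExpForm hO ha₀ hρ hd hS hϑ hβ hJ hc hE
  refine ⟨hreg, hinv, hatt, fun a ha => h.hasCovariance hρ hd ha
    (isScore_of_isExpForm hO hρ hd hβ hc (fun a ha => (hE a ha).2) ha), fun N hN =>
    ⟨fun a ha => ?_, fun hNa => ?_⟩⟩
  · rw [hatt a ha]
    exact hN.posSemidef_sub hO hρ hϑ hF ha (hS a ha)
  · have hRR : ∀ a ∈ O, errMatrix N ρ ϑ a = errMatrix P ρ ϑ a := fun a ha => by
      rw [hNa a ha, hatt a ha]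
    refine law_eq_of_efficient hO hOc ha₀ hρ hd hS hϑ hβ h.coord.base hJ hc hE hF hN
      (fun a ha => ?_) (fun a ha => ?_) hNa
    · rw [hRR a ha]
      exact hreg.nondegenerate a ha
    · rw [hinv a ha, invErrJac, invErrJac, hRR a ha]

end Canonical

end

section


/-! ### The right eigen operators of a measurement -/

section Compression

variable {n : ℕ} {H : Type*} [NormedAddCommGroup H] [InnerProductSpace ℂ H] [CompleteSpace H]
  {K : Type*} [NormedAddCommGroup K] [InnerProductSpace ℂ K] [CompleteSpace K]
  {M : QPM (Fin n → ℂ) H} {Q : QPM (Fin n → ℂ) K} {V : H →L[ℂ] K}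
  (W : Submodule ℂ H) [W.HasOrthogonalProjection]

theorem adjoint_starProjection : ContinuousLinearMap.adjoint W.starProjection = W.starProjection :=
  isSelfAdjoint_starProjection W

theorem inner_starProjection (ψ φ : H) :
    inner ℂ (W.starProjection ψ) φ = inner ℂ ψ (W.starProjection φ) := by
  rw [← adjoint_starProjection, ContinuousLinearMap.adjoint_inner_left, adjoint_starProjection]

theorem starProjection_starProjection (ψ : H) :
    W.starProjection (W.starProjection ψ) = W.starProjection ψ :=
  Submodule.starProjection_eq_self_iff.2 (Submodule.starProjection_apply_mem W ψ)

/-- The measurement `M` compressed to the subspace `W`, completed by the point mass at zero. -/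
def QPM.compression (M : QPM (Fin n → ℂ) H) : QPM (Fin n → ℂ) H where
  op B := W.starProjection ∘L M.op B ∘L W.starProjection +
    (B.indicator (fun _ => (1 : ℂ)) 0) • (1 - W.starProjection)
  nonneg B hB := by
    rw [ContinuousLinearMap.nonneg_iff_isPositive]
    have h1 := (M.isPositive hB).adjoint_conj W.starProjection
    rw [adjoint_starProjection] at h1
    have h2 := ContinuousLinearMap.isPositive_adjoint_comp_self (1 - W.starProjection)
    have h3 : ContinuousLinearMap.adjoint (1 - W.starProjection) ∘L (1 - W.starProjection) =
        1 - W.starProjection := by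
      rw [map_sub, adjoint_starProjection]
      ext ψ
      have : ContinuousLinearMap.adjoint (1 : H →L[ℂ] H) = 1 := ContinuousLinearMap.adjoint_id
      simp [this, starProjection_starProjection, one_apply_eq_self]
    rw [h3] at h2
    by_cases h : (0 : Fin n → ℂ) ∈ B
    · rw [Set.indicator_of_mem h, one_smul]
      exact h1.add h2
    · rw [Set.indicator_of_notMem h, zero_smul, add_zero]
      exact h1
  op_univ := by
    rw [M.op_univ]
    ext ψ
    simp [starProjection_starProjection, one_apply_eq_self]
  hasSum f hf hd ψ := by
    have h1 := M.hasSum f hf hd (W.starProjection ψ)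
    have h2 : HasSum (fun i => (f i).indicator (fun _ => (1 : ℂ)) 0)
        ((⋃ i, f i).indicator (fun _ => (1 : ℂ)) 0) := by
      by_cases h : (0 : Fin n → ℂ) ∈ ⋃ i, f i
      · obtain ⟨i, hi⟩ := Set.mem_iUnion.1 h
        rw [Set.indicator_of_mem h]
        convert hasSum_single i (fun j hj => ?_) using 1
        · rw [Set.indicator_of_mem hi]
        · exact Set.indicator_of_notMem (fun hj' => (Set.disjoint_left.1 (hd hj)) hj' hi) _
      · rw [Set.indicator_of_notMem h]
        have : ∀ i, (f i).indicator (fun _ => (1 : ℂ)) 0 = 0 := fun i =>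
          Set.indicator_of_notMem (fun hi => h (Set.mem_iUnion.2 ⟨i, hi⟩)) _
        simp only [this]
        exact hasSum_zero
    have h3 := h1.add (h2.mul_right (inner ℂ ψ (ψ - W.starProjection ψ)))
    simpa only [_root_.add_apply, _root_.smul_apply, ContinuousLinearMap.comp_apply, inner_add_right,
      inner_smul_right, _root_.sub_apply, one_apply_eq_self, inner_starProjection] using h3

theorem QPM.inner_compression (M : QPM (Fin n → ℂ) H) (B : Set (Fin n → ℂ)) (ψ φ : H) :
    inner ℂ ψ ((M.compression W).op B φ) =
      inner ℂ (W.starProjection ψ) (M.op B (W.starProjection φ)) +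
        B.indicator (fun _ => (1 : ℂ)) 0 * inner ℂ ψ (φ - W.starProjection φ) := by
  rw [inner_starProjection, ← inner_smul_right, ← inner_add_right]
  rfl

theorem QPM.diag_compression (M : QPM (Fin n → ℂ) H) (ψ : H) :
    (M.compression W).diag ψ = M.diag (W.starProjection ψ) +
      ENNReal.ofReal (‖ψ - W.starProjection ψ‖ ^ 2) • Measure.dirac 0 := by
  have h0 : inner ℂ ψ (ψ - W.starProjection ψ) = ((‖ψ - W.starProjection ψ‖ ^ 2 : ℝ) : ℂ) := by
    have h1 : inner ℂ (W.starProjection ψ) (ψ - W.starProjection ψ) = (0 : ℂ) := by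
      rw [inner_starProjection, map_sub, starProjection_starProjection, sub_self, inner_zero_right]
    have h2 : inner ℂ (ψ - W.starProjection ψ) (ψ - W.starProjection ψ) =
        ((‖ψ - W.starProjection ψ‖ ^ 2 : ℝ) : ℂ) := by
      rw [inner_self_eq_norm_sq_to_K]
      push_cast
      rfl
    rw [← h2, inner_sub_left ψ, h1, sub_zero]
  ext B hB
  rw [QPM.diag_apply _ _ hB, Measure.add_apply, QPM.diag_apply _ _ hB, Measure.smul_apply,
    Measure.dirac_apply' _ hB, M.inner_compression W, h0, smul_eq_mul, Complex.add_re,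
    ENNReal.ofReal_add (M.re_inner_nonneg hB _)]
  · by_cases h : (0 : Fin n → ℂ) ∈ B
    · simp only [Set.indicator_of_mem h, one_mul, Complex.ofReal_re, Pi.one_apply, mul_one]
    · simp [h]
  · by_cases h : (0 : Fin n → ℂ) ∈ B
    · rw [Set.indicator_of_mem h, one_mul, Complex.ofReal_re]
      positivity
    · simp [h]

theorem adjoint_int_eval (hQ : Q.IsProj) {B : Set (Fin n → ℂ)} (hB : MeasurableSet B) {N : ℕ}
    (hN : B ⊆ Metric.closedBall 0 N) (k : Fin n) :
    BddMeas (B.indicator fun κ : Fin n → ℂ => κ k) ∧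
    ContinuousLinearMap.adjoint (Q.int (B.indicator fun κ => κ k)) = Q.op B ∘L Q.cut N (coordC k) := by
  have hf : BddMeas (B.indicator fun κ : Fin n → ℂ => κ k) := by
    refine ⟨(measurable_pi_apply k).indicator hB, N, fun κ => ?_⟩
    by_cases h : κ ∈ B
    · rw [Set.indicator_of_mem h]
      exact (norm_le_pi_norm κ k).trans (by simpa using hN h)
    · rw [Set.indicator_of_notMem h, norm_zero]
      positivity
  refine ⟨hf, ?_⟩
  rw [← Q.int_conj hf]
  have e2 : Q.op B = Q.int (B.indicator fun _ => 1) := by rw [Q.int_indicator hB, one_smul]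
  rw [e2]
  have e3 := hQ.int_mul (BddMeas.indicator_const hB 1) (cutFun_bddMeas N (coordC k))
  refine Eq.trans ?_ e3
  congr 1
  ext κ
  by_cases h1 : κ ∈ B
  · simp [cutFun, h1, hN h1]
  · simp [h1]

/-- The graph of the compression to `W` of the multiplication by `f` in the dilation space. -/
def mulGraph (Q : QPM (Fin n → ℂ) K) (V : H →L[ℂ] K) (f : C(Fin n → ℂ, ℂ)) : Submodule ℂ (H × H) where
  carrier := {p | p.2 ∈ W ∧ ∀ N, Q.cut N 1 (V p.2) = Q.cut N f (V (W.starProjection p.1))}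
  add_mem' {p q} hp hq := ⟨W.add_mem hp.1 hq.1, fun N => by
    simp only [Prod.snd_add, Prod.fst_add, map_add, hp.2 N, hq.2 N]⟩
  zero_mem' := ⟨W.zero_mem, fun N => by simp⟩
  smul_mem' c p hp := ⟨W.smul_mem c hp.1, fun N => by
    simp only [Prod.smul_snd, Prod.smul_fst, map_smul, hp.2 N]⟩

theorem mem_mulGraph {f : C(Fin n → ℂ, ℂ)} {φ η : H} : (φ, η) ∈ mulGraph W Q V f ↔
    η ∈ W ∧ ∀ N, Q.cut N 1 (V η) = Q.cut N f (V (W.starProjection φ)) := Iff.rfl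

/-- The compression to `W` of the multiplication by `f` in the dilation space, extended by zero. -/
def mulOp (Q : QPM (Fin n → ℂ) K) (V : H →L[ℂ] K) (f : C(Fin n → ℂ, ℂ)) : H →ₗ.[ℂ] H :=
  (mulGraph W Q V f).toLinearPMap

variable {W}

theorem graph_mulOp (hd : M.IsDilation Q V) (f : C(Fin n → ℂ, ℂ)) :
    (mulOp W Q V f).graph = mulGraph W Q V f := by
  refine Submodule.toLinearPMap_graph_eq _ ?_
  rintro ⟨φ, η⟩ h (rfl : φ = 0)
  have h1 : V η = 0 := hd.proj.eq_of_cut_one fun N => by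
    rw [(mem_mulGraph W).1 h |>.2 N, map_zero, map_zero, map_zero, map_zero]
  change η = 0
  rw [← hd.adjoint_apply η, h1, map_zero]

theorem exists_mulOp_eq (hd : M.IsDilation Q V) {f : C(Fin n → ℂ, ℂ)} {φ η : H}
    (h : (φ, η) ∈ mulGraph W Q V f) :
    ∃ hm : φ ∈ (mulOp W Q V f).domain, mulOp W Q V f ⟨φ, hm⟩ = η := by
  rw [← graph_mulOp hd, LinearPMap.mem_graph_iff] at h
  obtain ⟨⟨y, hy⟩, h2, h3⟩ := h
  simp only at h2
  subst h2
  exact ⟨hy, h3⟩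

theorem mulOp_mem (hd : M.IsDilation Q V) {f : C(Fin n → ℂ, ℂ)} (φ : (mulOp W Q V f).domain) :
    ((φ : H), mulOp W Q V f φ) ∈ mulGraph W Q V f := by
  rw [← graph_mulOp hd]
  exact LinearPMap.mem_graph _ φ

/-- Formal adjointness between `∫_B κ_k dM`, compressed to `W`, and the multiplication by `conj
κ_k`. The values of `mulOp` lie in `W`, so the point mass on the complement does not contribute. -/
theorem inner_compression_mulOp (hd : M.IsDilation Q V) {B : Set (Fin n → ℂ)} (hB : MeasurableSet B)
    {N : ℕ} (hN : B ⊆ Metric.closedBall 0 N) (k : Fin n) (ψ : H)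
    (φ : (mulOp W Q V (coordC k)).domain) :
    inner ℂ (W.starProjection (ContinuousLinearMap.adjoint V
      (Q.int (B.indicator fun κ => κ k) (V (W.starProjection ψ))))) (φ : H) =
    inner ℂ ((M.compression W).op B ψ) (mulOp W Q V (coordC k) φ) := by
  obtain ⟨hη, hcut⟩ := (mem_mulGraph W).1 (mulOp_mem hd φ)
  set η := mulOp W Q V (coordC k) φ
  have hηp : W.starProjection η = η := Submodule.starProjection_eq_self_iff.2 hη
  have hadj : ∀ C, MeasurableSet C → ContinuousLinearMap.adjoint (Q.op C) = Q.op C := fun C hC =>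
    (Q.isPositive hC).isSelfAdjoint.adjoint_eq
  have hBN : ∀ y, Q.op B (Q.cut N 1 y) = Q.op B y := fun y => by
    rw [QPM.cut_one, ← ContinuousLinearMap.comp_apply, hd.proj B _ hB (measurableSet_ball N),
      Set.inter_eq_left.2 hN]
  rw [inner_starProjection, ContinuousLinearMap.adjoint_inner_left,
    ← ContinuousLinearMap.adjoint_inner_right (Q.int _), (adjoint_int_eval hd.proj hB hN k).2,
    ContinuousLinearMap.comp_apply, ← hcut, hBN,
    ← inner_conj_symm ((M.compression W).op B ψ), M.inner_compression W, hηp, map_add, map_mul,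
    inner_conj_symm, inner_conj_symm]
  have h1 : inner ℂ (ψ - W.starProjection ψ) η = (0 : ℂ) := by
    rw [inner_sub_left, inner_starProjection, hηp, sub_self]
  rw [h1, mul_zero, add_zero, hd.compress B hB, ContinuousLinearMap.comp_apply,
    ContinuousLinearMap.comp_apply, ContinuousLinearMap.adjoint_inner_left,
    ← ContinuousLinearMap.adjoint_inner_right (Q.op B), hadj B hB]

/-- The compressed measurement is a right eigen measurement of the adjoint operators. -/
theorem exists_adjoint_mulOp_eq (hd : M.IsDilation Q V) {k : Fin n}
    (hdense : Dense ((mulOp W Q V (coordC k)).domain : Set H)) {B : Set (Fin n → ℂ)}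
    (hB : MeasurableSet B) {N : ℕ} (hN : B ⊆ Metric.closedBall 0 N) (ψ : H) :
    ∃ h : (M.compression W).op B ψ ∈ ((mulOp W Q V (coordC k))†).domain,
      (mulOp W Q V (coordC k))† ⟨_, h⟩ = W.starProjection (ContinuousLinearMap.adjoint V
        (Q.int (B.indicator fun κ => κ k) (V (W.starProjection ψ)))) := by
  have h1 := inner_compression_mulOp (W := W) hd hB hN k ψ
  refine ⟨LinearPMap.mem_adjoint_domain_of_exists _ ⟨_, h1⟩, ?_⟩
  exact LinearPMap.adjoint_apply_eq hdense _ h1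

theorem exists_subset_closedBall {B : Set (Fin n → ℂ)} (hb : Bornology.IsBounded B) :
    ∃ N : ℕ, B ⊆ Metric.closedBall 0 N := by
  obtain ⟨r, hr⟩ := hb.subset_closedBall 0
  obtain ⟨N, hN⟩ := exists_nat_ge r
  exact ⟨N, hr.trans (Metric.closedBall_subset_closedBall hN)⟩

/-- On `W` this is formal adjointness. On the complement the operators vanish, in agreement with a
point mass at zero, where every coordinate `κ_k` is zero. -/
theorem isRightEigen_compression (hd : M.IsDilation Q V)
    (hdense : ∀ k, Dense ((mulOp W Q V (coordC k)).domain : Set H)) :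
    (M.compression W).IsRightEigen fun k => (mulOp W Q V (coordC k))† := by
  intro k B hB hb ψ
  obtain ⟨N, hN⟩ := exists_subset_closedBall hb
  obtain ⟨h1, h2⟩ := exists_adjoint_mulOp_eq hd (hdense k) hB hN ψ
  have hf := (adjoint_int_eval hd.proj hB hN k).1
  refine ⟨h1, ?_⟩
  rw [h2, ← inner_starProjection, ContinuousLinearMap.adjoint_inner_right, Q.inner_int_self hf,
    hd.diag, ← integral_indicator hB, M.diag_compression W, integral_add_measure (hf.integrable _),
    integral_smul_measure]
  · rw [integral_dirac]
    by_cases h : (0 : Fin n → ℂ) ∈ B <;> simp [h]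
  · exact (hf.integrable _).smul_measure (by simp)

theorem tendsto_compression (hd : M.IsDilation Q V) (ψ : H) :
    Tendsto (fun N : ℕ => (M.compression W).op (Metric.closedBall 0 N) ψ) atTop (𝓝 ψ) := by
  have h1 : ∀ N : ℕ, (M.compression W).op (Metric.closedBall 0 N) ψ =
      W.starProjection (ContinuousLinearMap.adjoint V (Q.cut N 1 (V (W.starProjection ψ)))) +
        (ψ - W.starProjection ψ) := by
    intro N
    have : (M.compression W).op (Metric.closedBall 0 N) ψ =
        W.starProjection (M.op (Metric.closedBall 0 N) (W.starProjection ψ)) +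
          ((Metric.closedBall (0 : Fin n → ℂ) (N : ℝ)).indicator (fun _ => (1 : ℂ)) 0) •
            (ψ - W.starProjection ψ) := rfl
    rw [this, Set.indicator_of_mem (by simp), one_smul, hd.compress _ (measurableSet_ball N),
      QPM.cut_one]
    rfl
  simp only [h1]
  have h2 := ((W.starProjection ∘L ContinuousLinearMap.adjoint V).continuous.tendsto _).comp
    (hd.proj.tendsto_cut_one (V (W.starProjection ψ)))
  rw [ContinuousLinearMap.comp_apply, hd.adjoint_apply, starProjection_starProjection] at h2
  have h3 := h2.add_const (ψ - W.starProjection ψ)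
  rw [add_sub_cancel] at h3
  exact h3

/-- The effects of bounded sets map into the domain of the adjoint, and the effects of growing balls
converge strongly to the identity. -/
theorem dense_adjoint_mulOp (hd : M.IsDilation Q V) {k : Fin n}
    (hdense : Dense ((mulOp W Q V (coordC k)).domain : Set H)) :
    Dense (((mulOp W Q V (coordC k))†).domain : Set H) := by
  intro ψ
  refine mem_closure_of_tendsto (tendsto_compression (W := W) hd ψ) (Eventually.of_forall fun N => ?_)
  exact (exists_adjoint_mulOp_eq hd hdense (measurableSet_ball N) le_rfl ψ).1

/-- With `x_k` defined as the adjoint of `mulOp`, the operator `x_k*` is a double adjoint and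
extends `mulOp`; so `x_k*` can be computed on the orbit. -/
theorem mulOp_le_adjoint (hd : M.IsDilation Q V) {k : Fin n}
    (hdense : Dense ((mulOp W Q V (coordC k)).domain : Set H)) {φ η : H}
    (h : (φ, η) ∈ mulGraph W Q V (coordC k)) :
    ∃ hm : φ ∈ (((mulOp W Q V (coordC k))†)†).domain,
      ((mulOp W Q V (coordC k))†)† ⟨φ, hm⟩ = η := by
  obtain ⟨h1, h2⟩ := exists_mulOp_eq hd h
  have hle : mulOp W Q V (coordC k) ≤ ((mulOp W Q V (coordC k))†)† :=
    LinearPMap.IsFormalAdjoint.le_adjoint (dense_adjoint_mulOp hd hdense)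
      (LinearPMap.adjoint_isFormalAdjoint hdense)
  refine ⟨hle.1 h1, ?_⟩
  rw [← h2]
  exact (hle.2 (x := ⟨φ, h1⟩) (y := ⟨φ, hle.1 h1⟩) rfl).symm

end Compression

end

section


/-! ### The exponential orbit of the initial state -/

section Orbit

variable {n : ℕ} {H : Type*} [NormedAddCommGroup H] [InnerProductSpace ℂ H] [CompleteSpace H]
  {K : Type*} [NormedAddCommGroup K] [InnerProductSpace ℂ K] [CompleteSpace K]
  {M : QPM (Fin n → ℂ) H} {Q : QPM (Fin n → ℂ) K} {V : H →L[ℂ] K} {T : H →L[ℂ] H}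
  {W : Submodule ℂ H} {Lf : (Fin n → ℂ) → H →L[ℂ] K}

/-- The exponential form with the truncations removed, which is possible because `e^{b κ*} V T^{1/2}
= L` is a bounded operator. -/
theorem IsExpForm.inner_adjoint (hQ : Q.IsProj) {ρ : H →L[ℂ] H} {b : Fin n → ℂ} {c : ℝ}
    (hT : IsDensity T) (h : IsExpForm Q V T ρ b c) {L : H →L[ℂ] K}
    (hL : Q.IsMul (expC b) (V ∘L CFC.sqrt T) L) (ζ ξ : K) :
    inner ℂ (ContinuousLinearMap.adjoint V ζ) (ρ (ContinuousLinearMap.adjoint V ξ)) =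
      c * inner ℂ (ContinuousLinearMap.adjoint L ζ) (ContinuousLinearMap.adjoint L ξ) := by
  have h0 : ∀ N (ζ : K), cutVec Q V N ζ 0 = ContinuousLinearMap.adjoint V (Q.cut N 1 ζ) := by
    intro N ζ
    rw [cutVec, expC_zero, QPM.IsProj.adjoint_cut_one]
  have h1 : ∀ N (ζ : K), CFC.sqrt T (cutVec Q V N ζ b) =
      ContinuousLinearMap.adjoint L (Q.cut N 1 ζ) := by
    intro N ζ
    refine ext_inner_right ℂ fun ψ => ?_
    rw [ContinuousLinearMap.adjoint_inner_left, ← adjoint_sqrt, ContinuousLinearMap.adjoint_inner_left,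
      inner_cutVec, ← QPM.IsProj.adjoint_cut_one, ContinuousLinearMap.adjoint_inner_left,
      hL.apply]
    rfl
  have h2 : ∀ N, inner ℂ (ContinuousLinearMap.adjoint V (Q.cut N 1 ζ))
      (ρ (ContinuousLinearMap.adjoint V (Q.cut N 1 ξ))) =
      c * inner ℂ (ContinuousLinearMap.adjoint L (Q.cut N 1 ζ))
        (ContinuousLinearMap.adjoint L (Q.cut N 1 ξ)) := by
    intro N
    rw [← h0, ← h0, h.symm hQ, ← hT.inner_sqrt, h1, h1]
  have hlim : ∀ (Z : K →L[ℂ] H) (ζ : K), Tendsto (fun N => Z (Q.cut N 1 ζ)) atTop (𝓝 (Z ζ)) :=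
    fun Z ζ => (Z.continuous.tendsto _).comp (hQ.tendsto_cut_one ζ)
  have h3 := (hlim (ContinuousLinearMap.adjoint V) ζ).inner
    (hlim (ρ ∘L ContinuousLinearMap.adjoint V) ξ) (𝕜 := ℂ)
  have h4 := ((hlim (ContinuousLinearMap.adjoint L) ζ).inner
    (hlim (ContinuousLinearMap.adjoint L) ξ) (𝕜 := ℂ)).const_mul (c : ℂ)
  refine tendsto_nhds_unique h3 (h4.congr fun N => ?_)
  rw [← h2]
  rfl

/-- If `V* ζ = 0`, the left side of the exponential form vanishes at `ζ`, hence so does `L* ζ`.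
Equivalently, the range of `e^{b κ*} V T^{1/2}` lies in the closed range of `V`. -/
theorem IsExpForm.adjoint_eq_zero (hQ : Q.IsProj) {ρ : H →L[ℂ] H} {b : Fin n → ℂ} {c : ℝ}
    (hT : IsDensity T) (hc : 0 < c) (h : IsExpForm Q V T ρ b c) {L : H →L[ℂ] K}
    (hL : Q.IsMul (expC b) (V ∘L CFC.sqrt T) L) {ζ : K} (hζ : ContinuousLinearMap.adjoint V ζ = 0) :
    ContinuousLinearMap.adjoint L ζ = 0 := by
  have h1 := h.inner_adjoint hQ hT hL ζ ζ
  rw [hζ, inner_zero_left, eq_comm, mul_eq_zero] at h1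
  exact inner_self_eq_zero.1 (h1.resolve_left (by exact_mod_cast hc.ne'))

theorem hasDerivAt_isMul_expC (hd : M.IsDilation Q V)
    (hL : ∀ b ∈ expDomain (M.law T), Q.IsMul (expC b) (V ∘L CFC.sqrt T) (Lf b)) {b v : Fin n → ℂ}
    {z : ℂ} (hb : b + z • v ∈ expDomain (M.law T)) :
    ∃ G : H →L[ℂ] K, Q.IsMul (linC v * expC (b + z • v)) (V ∘L CFC.sqrt T) G ∧ hsSq G ≠ ∞ ∧
      HasDerivAt (fun z : ℂ => Lf (b + z • v)) G z := by
  obtain ⟨G, h1, h2, h3⟩ := exists_hasDerivAt_isMul_expC hd hL hb v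
  refine ⟨G, h1, h2, ?_⟩
  have h4 : HasDerivAt (fun w : ℂ => w - z) 1 z := (hasDerivAt_id z).sub_const z
  have h5 : HasDerivAt (fun w : ℂ => Lf (b + z • v + w • v)) G ((fun w : ℂ => w - z) z) := by
    simpa using h3
  have h6 := HasDerivAt.scomp (h := fun w : ℂ => w - z) z h5 h4
  rw [one_smul] at h6
  refine h6.congr_of_eventuallyEq (Eventually.of_forall fun w => ?_)
  simp only [Function.comp]
  congr 1
  module

/-- The vectors annihilated by `exp (κ b*)` near `b = 0` are annihilated everywhere. -/
theorem adjoint_eq_zero_of_eventually (hd : M.IsDilation Q V)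
    (hL : ∀ b ∈ expDomain (M.law T), Q.IsMul (expC b) (V ∘L CFC.sqrt T) (Lf b)) {ζ : K}
    (h0 : 0 ∈ expDomain (M.law T)) (h : ∀ᶠ b in 𝓝 0, ContinuousLinearMap.adjoint (Lf b) ζ = 0)
    {b : Fin n → ℂ} (hb : b ∈ expDomain (M.law T)) : ContinuousLinearMap.adjoint (Lf b) ζ = 0 := by
  refine ext_inner_right ℂ fun ψ => ?_
  rw [ContinuousLinearMap.adjoint_inner_left, inner_zero_left]
  -- The identity theorem is applied on the complex line through `0` and `b`; its intersection with
  -- the domain is convex, hence connected, and contains `0` and `1`.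
  set D : Set ℂ := (fun z : ℂ => z • b) ⁻¹' expDomain (M.law T) with hD
  have hcont : Continuous fun z : ℂ => z • b := by fun_prop
  have hDo : IsOpen D := isOpen_expDomain.preimage hcont
  have hDc : Convex ℝ D := by
    intro x hx y hy s t hs ht hst
    have := convex_expDomain hx hy hs ht hst
    simp only [hD, Set.mem_preimage] at this ⊢
    convert this using 1
    simp only [add_smul, smul_assoc]
  have hF : DifferentiableOn ℂ (fun z : ℂ => (inner ℂ ζ (Lf (z • b) ψ) : ℂ)) D := by
    intro z hz
    obtain ⟨G, -, -, hG⟩ := hasDerivAt_isMul_expC (b := 0) (v := b) (z := z) hd hL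
      (by rw [zero_add]; exact hz)
    simp only [zero_add] at hG
    have h1 := ((innerSL ℂ ζ) ∘L (ContinuousLinearMap.apply ℂ K ψ)).hasFDerivAt.comp_hasDerivAt z hG
    exact h1.differentiableAt.differentiableWithinAt
  have h2 := (hF.analyticOnNhd hDo).eqOn_zero_of_preconnected_of_eventuallyEq_zero
    hDc.isPreconnected (z₀ := 0) (by simpa [hD] using h0) (by
      have h3 : Tendsto (fun z : ℂ => z • b) (𝓝 0) (𝓝 0) := by
        simpa using hcont.tendsto 0
      filter_upwards [h3.eventually h] with z hz
      rw [← ContinuousLinearMap.adjoint_inner_left, hz, inner_zero_left]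
      rfl)
  have h3 := h2 (x := 1) (by simpa [hD] using hb)
  simpa using h3

/-- `Lf b = exp (b κ*) V T^{1/2}` takes its values in the image of the closed subspace `W`, which is
spanned by these values. -/
structure IsOrbit (M : QPM (Fin n → ℂ) H) (Q : QPM (Fin n → ℂ) K) (V : H →L[ℂ] K) (T : H →L[ℂ] H)
    (Lf : (Fin n → ℂ) → H →L[ℂ] K) (W : Submodule ℂ H) : Prop where
  isMul : ∀ b ∈ expDomain (M.law T), Q.IsMul (expC b) (V ∘L CFC.sqrt T) (Lf b)
  mem : ∀ b ∈ expDomain (M.law T), ∀ ψ, ContinuousLinearMap.adjoint V (Lf b ψ) ∈ W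
  map : ∀ b ∈ expDomain (M.law T), ∀ ψ, V (ContinuousLinearMap.adjoint V (Lf b ψ)) = Lf b ψ
  orthogonal : ∀ φ, (∀ b ∈ expDomain (M.law T), ∀ ψ,
    inner ℂ (ContinuousLinearMap.adjoint V (Lf b ψ)) φ = 0) → φ ∈ Wᗮ

/-- The vector `ζ = V V* L ψ - L ψ` is annihilated by `V*`, hence by `L*` (near zero by hypothesis,
elsewhere by the identity theorem), and so it is orthogonal to itself. -/
theorem exists_isOrbit (hd : M.IsDilation Q V)
    (hL : ∀ b ∈ expDomain (M.law T), Q.IsMul (expC b) (V ∘L CFC.sqrt T) (Lf b))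
    (h0 : 0 ∈ expDomain (M.law T)) (h : ∀ᶠ b in 𝓝 0, ∀ ζ, ContinuousLinearMap.adjoint V ζ = 0 →
      ContinuousLinearMap.adjoint (Lf b) ζ = 0) :
    ∃ W : Submodule ℂ H, IsClosed (W : Set H) ∧ IsOrbit M Q V T Lf W := by
  set X : Set H := {φ | ∃ b ∈ expDomain (M.law T), ∃ ψ, ContinuousLinearMap.adjoint V (Lf b ψ) = φ}
  refine ⟨(Submodule.span ℂ X).topologicalClosure, Submodule.isClosed_topologicalClosure _, hL,
    fun b hb ψ => ?_, fun b hb ψ => ?_, fun φ hφ => ?_⟩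
  · exact Submodule.le_topologicalClosure _ (Submodule.subset_span ⟨b, hb, ψ, rfl⟩)
  · set ζ : K := V (ContinuousLinearMap.adjoint V (Lf b ψ)) - Lf b ψ with hζ
    have h1 : ContinuousLinearMap.adjoint V ζ = 0 := by
      rw [hζ, map_sub, hd.adjoint_apply, sub_self]
    have h2 : ContinuousLinearMap.adjoint (Lf b) ζ = 0 :=
      adjoint_eq_zero_of_eventually hd hL h0 (h.mono fun b hb => hb ζ h1) hb
    have h3 : inner ℂ ζ ζ = (0 : ℂ) := by
      nth_rewrite 2 [hζ]
      rw [inner_sub_right, ← ContinuousLinearMap.adjoint_inner_left, h1, inner_zero_left,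
        ← ContinuousLinearMap.adjoint_inner_left, h2, inner_zero_left, sub_zero]
    exact sub_eq_zero.1 (inner_self_eq_zero.1 h3)
  · rw [Submodule.orthogonal_closure, Submodule.mem_orthogonal]
    intro u hu
    induction hu using Submodule.span_induction with
    | mem u hu =>
      obtain ⟨b, hb, ψ, rfl⟩ := hu
      exact hφ b hb ψ
    | zero => exact inner_zero_left _
    | add u v _ _ hu hv => rw [inner_add_left, hu, hv, add_zero]
    | smul c u _ hu => rw [inner_smul_left, hu, mul_zero]

variable [W.HasOrthogonalProjection]

/-- The bounded operator `V p V*`, with `p` the projection onto `W`, fixes the whole orbit and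
therefore also its derivatives. -/
theorem IsOrbit.hasDerivAt (hd : M.IsDilation Q V) (h : IsOrbit M Q V T Lf W) {b v : Fin n → ℂ}
    (hb : b ∈ expDomain (M.law T)) {G : H →L[ℂ] K}
    (hG : HasDerivAt (fun z : ℂ => Lf (b + z • v)) G 0) (ψ : H) :
    ContinuousLinearMap.adjoint V (G ψ) ∈ W ∧ V (ContinuousLinearMap.adjoint V (G ψ)) = G ψ := by
  set E : K →L[ℂ] K := V ∘L W.starProjection ∘L ContinuousLinearMap.adjoint V with hE
  have h1 : ∀ c ∈ expDomain (M.law T), E ∘L Lf c = Lf c := by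
    intro c hc
    ext φ
    simp only [hE, ContinuousLinearMap.comp_apply]
    rw [Submodule.starProjection_eq_self_iff.2 (h.mem c hc φ), h.map c hc]
  have h2 : HasDerivAt (fun z : ℂ => E ∘L Lf (b + z • v)) (E ∘L G) 0 :=
    (ContinuousLinearMap.compL ℂ H K K E).hasFDerivAt.comp_hasDerivAt 0 hG
  have hc : ContinuousAt (fun z : ℂ => b + z • v) 0 := by fun_prop
  have h3 : (fun z : ℂ => E ∘L Lf (b + z • v)) =ᶠ[𝓝 0] fun z => Lf (b + z • v) := by
    filter_upwards [hc.eventually (p := fun c => c ∈ expDomain (M.law T))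
      (isOpen_expDomain.mem_nhds (by simpa using hb))] with z hz
    exact h1 _ hz
  have h4 : E ∘L G = G := h2.unique (hG.congr_of_eventuallyEq h3)
  have h5 : V (W.starProjection (ContinuousLinearMap.adjoint V (G ψ))) = G ψ := congr($h4 ψ)
  have h6 : ContinuousLinearMap.adjoint V (G ψ) =
      W.starProjection (ContinuousLinearMap.adjoint V (G ψ)) := by
    nth_rewrite 1 [← h5]
    rw [hd.adjoint_apply]
  refine ⟨h6 ▸ Submodule.starProjection_apply_mem W _, ?_⟩
  rw [← h6] at h5
  exact h5

/-- The `b`-derivative of `e^{b κ*}` brings down the linear function, so the multiplication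
operators act on the orbit as derivatives. -/
theorem IsOrbit.mem_mulGraph (hd : M.IsDilation Q V) (h : IsOrbit M Q V T Lf W) {b v : Fin n → ℂ}
    (hb : b ∈ expDomain (M.law T)) {G : H →L[ℂ] K}
    (hG : HasDerivAt (fun z : ℂ => Lf (b + z • v)) G 0)
    (hGm : Q.IsMul (linC v * expC b) (V ∘L CFC.sqrt T) G) (ψ : H) :
    (ContinuousLinearMap.adjoint V (Lf b ψ), ContinuousLinearMap.adjoint V (G ψ)) ∈
      mulGraph W Q V (linC v) := by
  obtain ⟨h1, h2⟩ := h.hasDerivAt hd hb hG ψ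
  refine (QuantumCR.mem_mulGraph W).2 ⟨h1, fun N => ?_⟩
  rw [h2, Submodule.starProjection_eq_self_iff.2 (h.mem b hb ψ), h.map b hb, hGm.apply,
    ← hd.proj.cut_comp_apply, ← (h.isMul b hb).apply, hd.proj.cut_comp_apply, mul_one]

theorem linC_single_one (k : Fin n) : linC (Pi.single k 1) = coordC k := by
  ext κ
  rw [linC_single, one_mul, coordC_apply]

/-- The domain contains the orbit, so a vector orthogonal to it lies in the complement of `W`. That
complement also belongs to the domain, with value zero, so the vector is orthogonal to itself. -/
theorem IsOrbit.dense_mulOp (hd : M.IsDilation Q V) (h : IsOrbit M Q V T Lf W) (k : Fin n) :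
    Dense ((mulOp W Q V (coordC k)).domain : Set H) := by
  rw [Submodule.dense_iff_topologicalClosure_eq_top, Submodule.topologicalClosure_eq_top_iff,
    Submodule.eq_bot_iff]
  intro φ hφ
  rw [Submodule.mem_orthogonal] at hφ
  have h1 : φ ∈ Wᗮ := by
    refine h.orthogonal φ fun b hb ψ => hφ _ ?_
    obtain ⟨G, hG1, -, hG2⟩ := exists_hasDerivAt_isMul_expC hd h.isMul hb (Pi.single k 1)
    have := h.mem_mulGraph hd hb hG2 hG1 ψ
    rw [linC_single_one] at this
    exact (exists_mulOp_eq hd this).1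
  have h2 : W.starProjection φ = 0 := (Submodule.starProjection_apply_eq_zero_iff W).2 h1
  have h3 : (φ, (0 : H)) ∈ mulGraph W Q V (coordC k) := by
    refine (QuantumCR.mem_mulGraph W).2 ⟨W.zero_mem, fun N => ?_⟩
    rw [h2, map_zero, map_zero, map_zero]
  exact inner_self_eq_zero.1 (hφ φ (exists_mulOp_eq hd h3).1)

theorem linC_eq_sum_single (b : Fin n → ℂ) : linC b = ∑ k, b k • linC (Pi.single k 1) := by
  simp only [linC_single_one]
  rfl

/-- The solution is `t ↦ V* e^{t b κ*} V T^{1/2} ψ`. The path `t b` need not remain in `β(O)`, but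
it remains in the Laplace domain, which is convex; this is why the orbit is taken over the whole
domain. -/
theorem IsOrbit.isExpAdj (hd : M.IsDilation Q V) (h : IsOrbit M Q V T Lf W)
    (h0 : 0 ∈ expDomain (M.law T)) {b : Fin n → ℂ} (hb : b ∈ expDomain (M.law T)) (ψ : H) :
    IsExpAdj (fun k => (mulOp W Q V (coordC k))†) b (CFC.sqrt T ψ)
      (ContinuousLinearMap.adjoint V (Lf b ψ)) := by
  refine ⟨fun t => ContinuousLinearMap.adjoint V (Lf (t • b) ψ), ?_, by simp only [one_smul], ?_⟩
  · have h1 := h.isMul 0 h0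
    rw [expC_zero] at h1
    have h2 := hd.proj.isMul_unique h1 (QPM.isMul_one _)
    simp only [zero_smul]
    rw [h2, ContinuousLinearMap.comp_apply, hd.adjoint_apply]
  · intro t ht
    have htb : t • b ∈ expDomain (M.law T) := by
      have := convex_expDomain h0 hb (sub_nonneg.2 ht.2) ht.1 (by ring)
      simpa using this
    choose G hG1 hG2 hG3 using fun k => exists_hasDerivAt_isMul_expC hd h.isMul htb (Pi.single k 1)
    obtain ⟨Gb, hGb1, -, hGb⟩ := hasDerivAt_isMul_expC (b := 0) (v := b) (z := t) hd h.isMul (by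
      simpa using htb)
    simp only [zero_add] at hGb hGb1
    have e1 : ((t : ℂ)) • b = t • b := by
      ext i; simp
    rw [e1] at hGb1
    have hsum : Gb = ∑ k, b k • G k := by
      refine hd.proj.isMul_unique hGb1 ?_
      have := QPM.IsMul.sum (s := Finset.univ) fun k _ => (hG1 k).smul (b k)
      convert this using 1
      rw [linC_eq_sum_single b, Finset.sum_mul]
      refine Finset.sum_congr rfl fun k _ => ?_
      rw [smul_mul_assoc]
    have hadj : ∀ k, ∃ hm : ContinuousLinearMap.adjoint V (Lf (t • b) ψ) ∈
        (((mulOp W Q V (coordC k))†)†).domain,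
        ((mulOp W Q V (coordC k))†)† ⟨_, hm⟩ = ContinuousLinearMap.adjoint V (G k ψ) := by
      intro k
      refine mulOp_le_adjoint hd (h.dense_mulOp hd k) ?_
      have := h.mem_mulGraph hd htb (hG3 k) (hG1 k) ψ
      rwa [linC_single_one] at this
    choose hm hme using hadj
    refine ⟨hm, ?_⟩
    have e2 : ∑ k, b k • ((mulOp W Q V (coordC k))†)† ⟨_, hm k⟩ =
        ContinuousLinearMap.adjoint V (Gb ψ) := by
      rw [hsum, _root_.sum_apply, map_sum]
      refine Finset.sum_congr rfl fun k _ => ?_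
      rw [hme, _root_.smul_apply, map_smul]
    rw [e2]
    have h3 := ((ContinuousLinearMap.adjoint V) ∘L
      (ContinuousLinearMap.apply ℂ K ψ)).hasFDerivAt.comp_hasDerivAt (t : ℂ) hGb
    have h4 : HasDerivAt (fun s : ℝ => (s : ℂ)) 1 t := Complex.ofRealCLM.hasDerivAt
    have h5 := h3.scomp t h4
    rw [one_smul] at h5
    refine (h5.congr_of_eventuallyEq (Eventually.of_forall fun s => ?_)).hasDerivWithinAt
    have e3 : ((s : ℂ)) • b = s • b := by
      ext i; simp
    simp [Function.comp, e3]

theorem IsOrbit.hasSum (hd : M.IsDilation Q V) (h : IsOrbit M Q V T Lf W) {b : Fin n → ℂ}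
    (hb : b ∈ expDomain (M.law T)) :
    HasSum (fun e => ‖(ContinuousLinearMap.adjoint V ∘L Lf b) (onb H e)‖ ^ 2)
      (genFun (M.law T) b) := by
  have h1 : ∀ e, ‖(ContinuousLinearMap.adjoint V ∘L Lf b) (onb H e)‖ ^ 2 =
      (‖Lf b (onb H e)‖ₑ ^ 2).toReal := by
    intro e
    rw [ENNReal.toReal_pow, toReal_enorm, ContinuousLinearMap.comp_apply, ← hd.norm_map,
      h.map b hb]
  have hint := integrable_of_mem_expDomain hb
  have h2 := hd.hsSq_of_isMul (h.isMul b hb)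
  have h3 := (hd.norm_sq_le_of_isMul (h.isMul b hb) hint fun κ => le_rfl).1
  have h4 : genFun (M.law T) b = (hsSq (Lf b)).toReal := by
    rw [h2, ← setLIntegral_univ, lintegral_enorm_sq hint, setIntegral_univ, genFun]
  simp only [h1]
  rw [h4, hsSq, ENNReal.tsum_toReal_eq (fun e => by simp)]
  exact (ENNReal.summable_toReal h3).hasSum

theorem IsOrbit.eq_smul (hd : M.IsDilation Q V) (h : IsOrbit M Q V T Lf W) (hT : IsDensity T)
    {ρ : H →L[ℂ] H} {b : Fin n → ℂ} (hb : b ∈ expDomain (M.law T)) {c : ℝ}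
    (hE : IsExpForm Q V T ρ b c) :
    ρ = (c : ℂ) • ((ContinuousLinearMap.adjoint V ∘L Lf b) ∘L
      ContinuousLinearMap.adjoint (ContinuousLinearMap.adjoint V ∘L Lf b)) := by
  ext y
  refine ext_inner_left ℂ fun x => ?_
  have h1 := hE.inner_adjoint hd.proj hT (h.isMul b hb) (V x) (V y)
  rw [hd.adjoint_apply, hd.adjoint_apply] at h1
  rw [h1, _root_.smul_apply, inner_smul_right, ContinuousLinearMap.adjoint_comp,
    ContinuousLinearMap.adjoint_adjoint, ContinuousLinearMap.adjoint_inner_left]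
  simp only [ContinuousLinearMap.comp_apply]
  rw [ContinuousLinearMap.adjoint_inner_right]

/-- The adjoint operators are linearly independent if no linear combination of the results vanishes
almost surely. -/
theorem IsOrbit.ae_eq_zero (hd : M.IsDilation Q V) (h : IsOrbit M Q V T Lf W)
    (h0 : 0 ∈ expDomain (M.law T)) {c : Fin n → ℂ}
    (hc : ∀ (ψ : H) (hm : ∀ k, ψ ∈ ((mulOp W Q V (coordC k))†).domain),
      ∑ k, c k • (mulOp W Q V (coordC k))† ⟨ψ, hm k⟩ = 0) :
    ∀ᵐ κ ∂(M.law T), ∑ k, c k * κ k = 0 := by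
  choose G hG1 hG2 hG3 using fun k => exists_hasDerivAt_isMul_expC hd h.isMul h0 (Pi.single k 1)
  have hgr : ∀ k ψ, ∃ hm : ContinuousLinearMap.adjoint V (Lf 0 ψ) ∈ (mulOp W Q V (coordC k)).domain,
      mulOp W Q V (coordC k) ⟨_, hm⟩ = ContinuousLinearMap.adjoint V (G k ψ) := by
    intro k ψ
    have := h.mem_mulGraph hd h0 (hG3 k) (hG1 k) ψ
    rw [linC_single_one] at this
    exact exists_mulOp_eq hd this
  have h1 : ∀ ψ, ∑ k, conj (c k) • ContinuousLinearMap.adjoint V (G k ψ) = 0 := by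
    intro ψ
    set η := ∑ k, conj (c k) • ContinuousLinearMap.adjoint V (G k ψ) with hη
    -- Effects of balls applied to `η` lie in the domains of all the adjoints, where the combination
    -- vanishes by hypothesis. Moving it across to the orbit vector produces `η` on the right, and
    -- growing balls then give `η = 0`.
    have h2 : ∀ N : ℕ, inner ℂ ((M.compression W).op (Metric.closedBall 0 N) η) η = (0 : ℂ) := by
      intro N
      have hm := fun k => (exists_adjoint_mulOp_eq hd (h.dense_mulOp hd k) (measurableSet_ball N)
        le_rfl η).1
      have h3 := hc _ hm
      have h4 := congrArg (fun x => (inner ℂ x (ContinuousLinearMap.adjoint V (Lf 0 ψ)) : ℂ)) h3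
      simp only [sum_inner, inner_smul_left, inner_zero_left] at h4
      nth_rewrite 2 [hη]
      rw [inner_sum, ← h4]
      refine Finset.sum_congr rfl fun k _ => ?_
      rw [inner_smul_right]
      congr 1
      obtain ⟨hm', he⟩ := hgr k ψ
      rw [← he]
      exact ((LinearPMap.adjoint_isFormalAdjoint (h.dense_mulOp hd k)) ⟨_, hm k⟩ ⟨_, hm'⟩).symm
    have h5 := (tendsto_compression (W := W) hd η).inner (tendsto_const_nhds (x := η)) (𝕜 := ℂ)
    simp only [h2] at h5
    exact inner_self_eq_zero.1 (tendsto_nhds_unique h5 tendsto_const_nhds)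
  have h2 : ∑ k, conj (c k) • G k = 0 := by
    ext ψ
    have h3 := congrArg V (h1 ψ)
    rw [map_sum, map_zero] at h3
    rw [_root_.sum_apply, _root_.zero_apply, ← h3]
    refine Finset.sum_congr rfl fun k _ => ?_
    rw [_root_.smul_apply, map_smul, (h.hasDerivAt hd h0 (hG3 k) ψ).2]
  have h3 : Q.IsMul (linC fun k => conj (c k)) (V ∘L CFC.sqrt T) 0 := by
    rw [← h2]
    have := QPM.IsMul.sum (s := Finset.univ) fun k _ => (hG1 k).smul (conj (c k))
    convert this using 1
    rw [linC_eq_sum_single]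
    simp only [expC_zero, mul_one]
  have h4 := hd.hsSq_of_isMul h3
  have h5 : hsSq (0 : H →L[ℂ] K) = 0 := by simp [hsSq]
  rw [h5, eq_comm, lintegral_eq_zero_iff (by fun_prop)] at h4
  filter_upwards [h4] with κ hκ
  have h6 : linC (fun k => conj (c k)) κ = 0 := by simpa using hκ
  rw [linC_apply] at h6
  have h7 := congrArg conj h6
  simpa using h7

end Orbit

end

section


/-! ### Canonical systems from efficient regular measurements -/

section Efficient

variable {n : ℕ} {H : Type*} [NormedAddCommGroup H] [InnerProductSpace ℂ H] [CompleteSpace H]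
  {M : QPM (Fin n → ℂ) H} {O : Set (Fin n → ℂ)} {a₀ : Fin n → ℂ} {ρ : (Fin n → ℂ) → H →L[ℂ] H}
  {g : (Fin n → ℂ) → Fin n → H →ₗ.[ℂ] H} {S : (Fin n → ℂ) → Fin n → H →L[ℂ] H}
  {ϑ β : (Fin n → ℂ) → Fin n → ℂ} {a : Fin n → ℂ}

theorem continuousOn_jac (hO : IsOpen O) (hϑ : ContDiffOn ℝ 1 ϑ O) :
    ContinuousOn (fun a => jac ϑ a) O := by
  refine continuousOn_pi.2 fun i => continuousOn_pi.2 fun k => ?_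
  have h1 := (contDiffOn_pi.1 hϑ i).continuousOn_fderiv_of_isOpen hO le_rfl
  exact continuousOn_const.mul ((h1.clm_apply continuousOn_const).sub
    (continuousOn_const.mul (h1.clm_apply continuousOn_const)))

theorem isUnit_jac_of_eq (hR : IsUnit (errMatrix M ρ ϑ a))
    (heq : errMatrix M ρ ϑ a = rightBound S ϑ a) : IsUnit (jac ϑ a) := by
  rw [heq, rightBound, Matrix.isUnit_iff_isUnit_det, Matrix.det_mul, Matrix.det_mul] at hR
  rw [Matrix.isUnit_iff_isUnit_det]
  exact isUnit_of_mul_isUnit_left (isUnit_of_mul_isUnit_left hR)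

theorem isUnit_invErrJac (hR : IsUnit (errMatrix M ρ ϑ a)) (hD : IsUnit (jac ϑ a)) :
    IsUnit (invErrJac M ρ ϑ a) :=
  ((Matrix.isUnit_nonsing_inv_iff).2 hR).mul hD

theorem fisher_eq_of_eq (hS : IsUnit (fisher (S a))) (hR : IsUnit (errMatrix M ρ ϑ a))
    (heq : errMatrix M ρ ϑ a = rightBound S ϑ a) :
    fisher (S a) = (jac ϑ a)ᴴ * invErrJac M ρ ϑ a := by
  have hD := isUnit_jac_of_eq hR heq
  have hD' := (Matrix.isUnit_iff_isUnit_det _).1 hD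
  have hDs : IsUnit ((jac ϑ a)ᴴ).det := by
    rw [Matrix.det_conjTranspose]
    exact hD'.star
  have hS' := (Matrix.isUnit_iff_isUnit_det _).1 hS
  rw [invErrJac, heq, rightBound, Matrix.mul_inv_rev, Matrix.mul_inv_rev,
    Matrix.nonsing_inv_nonsing_inv _ hS', Matrix.mul_assoc, Matrix.mul_assoc,
    Matrix.nonsing_inv_mul _ hD', Matrix.mul_one, Matrix.mul_nonsing_inv_cancel_left _ _ hDs]

/-- Equality in the bound gives the Fisher matrix as `D† R⁻¹ D`; regularity makes `R⁻¹ D`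
continuous. -/
theorem continuousOn_fisher (hO : IsOpen O) (hϑ : ContDiffOn ℝ 1 ϑ O)
    (hS : ∀ a ∈ O, IsUnit (fisher (S a))) (hM : IsRegularEstimate O ρ ϑ M)
    (hatt : AttainsRightBound O ρ S ϑ M) (k : Fin n) :
    ContinuousOn (fun a => fisher (S a) k k) O := by
  have h1 : ContinuousOn (fun a => invErrJac M ρ ϑ a) O :=
    continuousOn_pi.2 fun i => continuousOn_pi.2 fun j => (hM.differentiable i j).continuousOn
  have h2 : ContinuousOn (fun a => (jac ϑ a)ᴴ * invErrJac M ρ ϑ a) O := by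
    rw [continuousOn_iff_continuous_domRestrict] at h1 ⊢
    have h3 := continuousOn_jac hO hϑ
    rw [continuousOn_iff_continuous_domRestrict] at h3
    exact h3.matrix_conjTranspose.matrix_mul h1
  have h3 := continuousOn_pi.1 (continuousOn_pi.1 h2 k) k
  refine h3.congr fun a ha => ?_
  simp only
  rw [fisher_eq_of_eq (hS a ha) (hM.nondegenerate a ha) (hatt a ha)]

/-- A linear relation between the results persists for their means, hence for the residuals, and so
`c` annihilates the nondegenerate matrix `R` from the left. -/
theorem eq_zero_of_ae_eq_zero [IsProbabilityMeasure (M.law (ρ a))]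
    (hfin : ∀ i, MemLp (fun l : Fin n → ℂ => l i) 2 (M.law (ρ a)))
    (hmean : ∀ i, ∫ l, l i ∂(M.law (ρ a)) = ϑ a i) (hR : IsUnit (errMatrix M ρ ϑ a))
    {c : Fin n → ℂ} (hc : ∀ᵐ κ ∂(M.law (ρ a)), ∑ k, c k * κ k = 0) : c = 0 := by
  have h1 : ∑ k, c k * ϑ a k = 0 := by
    have h2 : ∫ κ, ∑ k, c k * κ k ∂(M.law (ρ a)) = ∑ k, c k * ϑ a k := by
      rw [integral_finsetSum _ fun k _ => ((hfin k).integrable one_le_two).const_mul (c k)]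
      refine Finset.sum_congr rfl fun k _ => ?_
      rw [integral_const_mul, hmean]
    rw [← h2, integral_congr_ae hc, integral_zero]
  have h2 : c ᵥ* errMatrix M ρ ϑ a = 0 := by
    ext j
    have hint : ∀ i, Integrable (fun κ : Fin n → ℂ => (κ i - ϑ a i) * conj (κ j - ϑ a j))
        (M.law (ρ a)) := fun i => by
      have := integrable_conj_mul ((hfin j).sub (memLp_const (ϑ a j)))
        ((hfin i).sub (memLp_const (ϑ a i)))
      exact this.congr (Eventually.of_forall fun κ => mul_comm _ _)
    simp only [Matrix.vecMul, dotProduct, errMatrix, Matrix.of_apply, Pi.zero_apply]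
    simp only [← integral_const_mul]
    rw [← integral_finsetSum _ fun i _ => (hint i).const_mul (c i)]
    refine (integral_congr_ae ?_).trans (integral_zero _ _)
    filter_upwards [hc] with κ hκ
    calc ∑ i, c i * ((κ i - ϑ a i) * conj (κ j - ϑ a j))
        = (∑ i, c i * κ i - ∑ i, c i * ϑ a i) * conj (κ j - ϑ a j) := by
          rw [← Finset.sum_sub_distrib, Finset.sum_mul]
          exact Finset.sum_congr rfl fun i _ => by ring
      _ = 0 := by rw [hκ, h1, sub_zero, zero_mul]
  refine Matrix.vecMul_injective_of_isUnit hR ?_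
  simp only [h2, Matrix.zero_vecMul]

/-- An efficient regular measurement gives rise to a canonical system. -/
theorem exists_isCanonicalSystem (hO : IsOpen O) (hOc : IsPreconnected O) (ha₀ : a₀ ∈ O)
    (hρ : IsModel O ρ g S) (hS : ∀ a ∈ O, IsUnit (fisher (S a))) (hϑ : ContDiffOn ℝ 1 ϑ O)
    (hM : IsRegularEstimate O ρ ϑ M) (hβ : DifferentiableOn ℂ β O) (hβ0 : β a₀ = 0)
    (hJ : ∀ a ∈ O, jac β a = invErrJac M ρ ϑ a) (hatt : AttainsRightBound O ρ S ϑ M) :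
    ∃ (x : Fin n → H →ₗ.[ℂ] H) (χ : (Fin n → ℂ) → ℝ) (P : QPM (Fin n → ℂ) H),
      IsCanonicalSystem O a₀ ρ ϑ β x χ P := by
  obtain ⟨K, _, _, _, Q, V, hd⟩ := M.exists_dilation
  have hJu : ∀ a ∈ O, IsUnit (jac β a) := fun a ha => by
    rw [hJ a ha]
    exact isUnit_invErrJac (hM.nondegenerate a ha)
      (isUnit_jac_of_eq (hM.nondegenerate a ha) (hatt a ha))
  have hsc : ∀ a ∈ O, IsScore Q V (ρ a) (S a) (jac β a) (ϑ a) := by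
    intro a ha k
    rw [hJ a ha]
    exact hM.toIsUnbiased.comp_eq_of_eq hO hρ hϑ hd (continuousOn_fisher hO hϑ hS hM hatt) ha
      (hS a ha) (hM.nondegenerate a ha) (hatt a ha) k
  obtain ⟨c, hpos, -, hE⟩ := exists_expForm hO hOc ha₀ hρ hd hϑ.continuousOn hβ hβ0 hsc
  have hT := hρ.density a₀ ha₀
  have hprob := QPM.isProbabilityMeasure_law M hT
  have hlaw := fun a ha => law_eq_tilt hd hT (hρ.density a ha) (hpos a ha) (hE a ha)
  have hmem : ∀ a ∈ O, β a ∈ expDomain (M.law (ρ a₀)) := by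
    intro a ha
    rw [expDomain, mem_interior_iff_mem_nhds]
    refine mem_of_superset (image_mem_nhds hO hβ ha (hJu a ha)) ?_
    rintro _ ⟨a', ha', rfl⟩
    exact (hlaw a' ha').2.2
  have h0 : 0 ∈ expDomain (M.law (ρ a₀)) := hβ0 ▸ hmem a₀ ha₀
  -- Outside the domain the value of `Lf` is immaterial, and zero is used.
  have hex : ∀ b, ∃ L : H →L[ℂ] K, b ∈ expDomain (M.law (ρ a₀)) →
      Q.IsMul (expC b) (V ∘L CFC.sqrt (ρ a₀)) L := by
    intro b
    by_cases hb : b ∈ expDomain (M.law (ρ a₀))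
    · obtain ⟨L, hL, -⟩ := exists_isMul_of_integrable hd (integrable_of_mem_expDomain hb)
        (f := expC b) fun κ => le_rfl
      exact ⟨L, fun _ => hL⟩
    · exact ⟨0, fun h => absurd h hb⟩
  choose Lf hL using hex
  -- Near zero every `b` is of the form `β a`, where the exponential form is known.
  obtain ⟨W, hWc, hW⟩ := exists_isOrbit hd hL h0 (by
    have := image_mem_nhds hO hβ ha₀ (hJu a₀ ha₀)
    rw [hβ0] at this
    filter_upwards [this]
    rintro _ ⟨a, ha, rfl⟩ ζ hζ
    exact (hE a ha).adjoint_eq_zero hd.proj hT (hpos a ha) (hL _ (hmem a ha)) hζ)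
  have : CompleteSpace W := hWc.completeSpace_coe
  have hdense := fun k => hW.dense_mulOp hd k
  refine ⟨fun k => (mulOp W Q V (coordC k))†, genFun (M.law (ρ a₀)), M.compression W,
    ⟨hβ, hβ0, hJu⟩, ⟨fun k => dense_adjoint_mulOp hd (hdense k),
      fun k => LinearPMap.adjoint_isClosed (hdense k), fun c hc => ?_⟩,
    ⟨fun b => ContinuousLinearMap.adjoint V ∘L Lf b, ?_, fun a ha => ?_⟩,
    isRightEigen_compression hd hdense, fun a ha => ?_⟩
  · exact eq_zero_of_ae_eq_zero (hM.finite a₀ ha₀) (hM.mean a₀ ha₀) (hM.nondegenerate a₀ ha₀)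
      (hW.ae_eq_zero hd h0 hc)
  · rintro _ ⟨a, ha, rfl⟩
    exact ⟨fun ψ => hW.isExpAdj hd h0 (hmem a ha) ψ, hW.hasSum hd (hmem a ha)⟩
  · have h1 := hW.eq_smul hd hT (hmem a ha) (hE a ha)
    rw [(hlaw a ha).2.1] at h1
    rw [h1]
    push_cast
    rfl
  · have hg := genFun_pos (hlaw a ha).2.2
    obtain ⟨h1, h2⟩ := dzbar_log_genFun (hmem a ha) hg.ne'
    refine ⟨h1, fun k => ?_⟩
    rw [h2, ← integral_tilt (inv_nonneg.2 hg.le), ← (hlaw a ha).1, hM.mean a ha]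

/-- Both error matrices satisfy `R J = D` with the same invertible `J`, so they coincide. -/
theorem attainsRightBound_of_jac_eq (hJ : ∀ a ∈ O, IsUnit (jac β a)) {P : QPM (Fin n → ℂ) H}
    (hM : ∀ a ∈ O, IsUnit (errMatrix M ρ ϑ a)) (hP : ∀ a ∈ O, IsUnit (errMatrix P ρ ϑ a))
    (hMJ : ∀ a ∈ O, jac β a = invErrJac M ρ ϑ a) (hPJ : ∀ a ∈ O, jac β a = invErrJac P ρ ϑ a)
    (hatt : AttainsRightBound O ρ S ϑ P) : AttainsRightBound O ρ S ϑ M := by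
  intro a ha
  rw [← hatt a ha]
  have h1 : ∀ {N : QPM (Fin n → ℂ) H}, IsUnit (errMatrix N ρ ϑ a) →
      jac β a = invErrJac N ρ ϑ a → errMatrix N ρ ϑ a * jac β a = jac ϑ a := by
    intro N hN h
    rw [h, invErrJac, Matrix.mul_nonsing_inv_cancel_left _ _ ((Matrix.isUnit_iff_isUnit_det _).1 hN)]
  exact (hJ a ha).mul_right_cancel
    ((h1 (hM a ha) (hMJ a ha)).trans (h1 (hP a ha) (hPJ a ha)).symm)

/-- Canonical parameters on a simply connected domain. -/
theorem exists_canonical_parameters (hO : IsOpen O) (hs : IsSimplyConnected O)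
    (hM : IsRegularEstimate O ρ ϑ M) :
    ∃ β : (Fin n → ℂ) → Fin n → ℂ, DifferentiableOn ℂ β O ∧ β a₀ = 0 ∧
      ∀ a ∈ O, jac β a = invErrJac M ρ ϑ a := by
  choose f hf using fun j => exists_primitive_of_curl_free hO hs
    (c := fun a k => invErrJac M ρ ϑ a j k) (hM.differentiable j)
    (fun a ha i k => hM.analytic a ha j i k) (fun a ha i k => hM.curl_free a ha i j k)
  have hf' : ∀ j, ∀ a ∈ O, HasFDerivAt (fun b => f j b - f j a₀)
      (coordForm fun k => invErrJac M ρ ϑ a j k) a := fun j a ha => (hf j a ha).sub_const _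
  refine ⟨fun a j => f j a - f j a₀, fun a ha => ?_, by ext; simp, fun a ha => ?_⟩
  · exact differentiableWithinAt_pi.2 fun j => (hf' j a ha).differentiableAt.differentiableWithinAt
  · ext j k
    rw [jac, Matrix.of_apply, dz_eq_of_hasFDerivAt (hf' j a ha), coordForm_single]

end Efficient

end

end QuantumCR

end

theorem theorem2 {H : Type*} [NormedAddCommGroup H] [InnerProductSpace ℂ H] [CompleteSpace H]
    {n : ℕ} {O : Set (Fin n → ℂ)} (hO : IsOpen O) (hOc : IsPreconnected O)
    {a₀ : Fin n → ℂ} (ha₀ : a₀ ∈ O)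
    (ρ : (Fin n → ℂ) → H →L[ℂ] H)
    (g : (Fin n → ℂ) → Fin n → H →ₗ.[ℂ] H) (S : (Fin n → ℂ) → Fin n → H →L[ℂ] H)
    (hρ : IsModel O ρ g S) (hS : ∀ a ∈ O, IsUnit (fisher (S a)))
    (ϑ : (Fin n → ℂ) → Fin n → ℂ) (hϑ : ContDiffOn ℝ 1 ϑ O) :
    -- under the regularity conditions canonical parameters can be introduced
    (IsSimplyConnected O → ∀ M : QPM (Fin n → ℂ) H, IsRegularEstimate O ρ ϑ M →
      ∃ β : (Fin n → ℂ) → Fin n → ℂ, DifferentiableOn ℂ β O ∧ β a₀ = 0 ∧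
        ∀ a ∈ O, jac β a = invErrJac M ρ ϑ a) ∧
    -- the characterization of equality in the right bound
    (∀ M : QPM (Fin n → ℂ) H, IsRegularEstimate O ρ ϑ M →
      ∀ β : (Fin n → ℂ) → Fin n → ℂ, DifferentiableOn ℂ β O → β a₀ = 0 →
        (∀ a ∈ O, jac β a = invErrJac M ρ ϑ a) →
        (AttainsRightBound O ρ S ϑ M ↔
          ∃ (x : Fin n → H →ₗ.[ℂ] H) (χ : (Fin n → ℂ) → ℝ) (P : QPM (Fin n → ℂ) H),
            IsCanonicalSystem O a₀ ρ ϑ β x χ P)) ∧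
    -- the optimal estimation and the minimal error
    (∀ (β : (Fin n → ℂ) → Fin n → ℂ) (x : Fin n → H →ₗ.[ℂ] H) (χ : (Fin n → ℂ) → ℝ)
      (P : QPM (Fin n → ℂ) H), IsCanonicalSystem O a₀ ρ ϑ β x χ P →
        IsRegularEstimate O ρ ϑ P ∧ (∀ a ∈ O, jac β a = invErrJac P ρ ϑ a) ∧
        AttainsRightBound O ρ S ϑ P ∧
        (∀ a ∈ O, HasCovariance (ρ a) x (ϑ a) (errMatrix P ρ ϑ a)) ∧
        (∀ N : QPM (Fin n → ℂ) H, IsUnbiased O ρ ϑ N →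
          (∀ a ∈ O, (errMatrix N ρ ϑ a - errMatrix P ρ ϑ a).PosSemidef) ∧
          (AttainsRightBound O ρ S ϑ N → ∀ a ∈ O, N.law (ρ a) = P.law (ρ a)))) := by
  refine ⟨fun hs M hM => exists_canonical_parameters hO hs hM,
    fun M hM β hβ hβ0 hJ => ⟨exists_isCanonicalSystem hO hOc ha₀ hρ hS hϑ hM hβ hβ0 hJ, ?_⟩,
    fun β x χ P h => h.optimal hO hOc ha₀ hρ hS hϑ⟩
  -- The measurement `P` of the canonical system attains the bound, and its error matrix is that of
  -- `M` because `β` is common to both.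
  rintro ⟨x, χ, P, h⟩
  obtain ⟨hP, hPJ, hPa, -⟩ := h.optimal hO hOc ha₀ hρ hS hϑ
  exact attainsRightBound_of_jac_eq h.coord.nondegenerate hM.nondegenerate hP.nondegenerate hJ hPJ
    hPa
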